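/- **The model.** Let $\alpha_1,\dots,\alpha_6\in\mathbb C$ with $|\alpha_c|<1$ for all $c$ and $|\sum_c\alpha_c^2|<1$. Consider the formal integral over six Hermitian $N\times N$ matrices $$Z=\int\prod_{c=1}^6 dM_c\,\exp\Bigl(-\tfrac N2\sum_c \mathrm{tr}\,M_c^2-\sum_{p\ge2}N^{-2p}\sum_{a_1+\dots+a_6=p}\tilde t_{a_1\dots a_6}\prod_c \mathrm{tr}\,M_c^{a_c}\Bigr),\qquad \tilde t_{a_1\dots a_6}=-\frac{\prod_c\alpha_c^{a_c}}{\sum_c a_c}\binom{\sum_c a_c}{a_1,\dots,a_6},$$ where the last sum in the exponential is expanded in powers of the $\alpha_c$ and integrated term by term against the Gaussian weight. For colors $c_1,\dots,c_n\in\{1,\dots,6\}$, $n\ge1$, and exponents $p_j\ge 0$, the connected correlation (joint cumulant) $\langle\prod_{j=1}^n\mathrm{tr}\,M_{c_j}^{p_j}\rangle_{\rm conn}$ has, in each degree in $\alpha$, a finite expansion $\sum_{g\ge0}N^{2-n-2g}(\cdots)$. For every $g$ the series, over the total degree in $\alpha$, of the coefficients of $N^{2-n-2g}$ converges absolutely;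 its sum is denoted $\langle\prod_j\mathrm{tr}\,M_{c_j}^{p_j}\rangle^g$. **The spectral curve and the correlation forms.** The curve is the disjoint union of six components with coordinate $z$; put $x^{(c)}(z)=(1-\alpha_c^2)^{-1/2}(z+1/z)$ and $\iota(z)=1/z$ on the component of color $c$, and $D=\mathbb C\setminus\{0,1,-1\}$. On components of colors $c_1,\dots,c_n$ let $$\omega_n^g(z_1,\dots,z_n)=\sum_{p_1,\dots,p_n\ge0}\Bigl\langle\prod_j\mathrm{tr}\,M_{c_j}^{p_j}\Bigr\rangle^g\prod_j\frac{dx^{(c_j)}(z_j)}{x^{(c_j)}(z_j)^{p_j+1}}$$ for $|z_j|$ large. Unless $(g,n)=(0,2)$ and $c_1=c_2$, this continues analytically to $D^n$; so do, with respect to the remaining variables, the analogous functions in which some of the variables are replaced by traces $\mathrm{tr}\,M_c^{a}$ with fixed exponents (also for $(g,n)=(0,2)$, $c_1=c_2$). The continuation of the function with traces $\mathrm{tr}\,M_c^{a_c}$, $c\in B$, and variables $z_j$, $j\in K$, is written $\omega^g(a_B;z_K)$; it includes the factors $dx(z_j)$. For a one-form $\lambda$ in $z_1$ put $S\lambda=\lambda+\iota^*\lambda$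 and $$\mathcal O_{z_1}\lambda(z_1)=\oint_\Gamma\frac1{2i\pi}\,d_{z_1}q(x(z_1),x(z))\,\lambda(z),$$ where $\Gamma$ is the union of the circles $|z|=R$ ($R>1$ arbitrary) on the six components, and $q(x_1,x_2)=\alpha_i\alpha_j\,x_1x_2$ for $x_1,x_2$ of distinct colors $i\ne j$, $q=0$ for equal colors. **The forms $l$ and $l'$.** For $z_0$ of color $i$ and $z_1,\dots,z_n$ of any colors let $$l^g(z_0;z_1,\dots,z_n)=-dx(z_0)\sum_{\pi}\sum_{J}\sum_{a,h}a_i\,\tilde t_{a_1\dots a_6}\,x(z_0)^{a_i-1}\prod_{B\in\pi}\omega^{h_B}\bigl(a_B;z_{J^{-1}(B)}\bigr),$$ where $\pi$ runs over the set partitions of $\{1,\dots,6\}\setminus\{i\}$, $J$ over the maps $\{1,\dots,n\}\to\pi$, $a\in\mathbb N^6$ over the exponents with $a_i\ge1$, $\sum_ca_c\ge2$, and $h\in\mathbb N^{\pi}$ over the genera with $\sum_Bh_B=g+|\pi|-3-\sum_ca_c$ (a finite sum). Let $l'^g$ be the same sum without the terms in which some block $B$ satisfies $2h_B+|B|+|J^{-1}(B)|=2g+n+1$.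 **Theorem (linear loop equations).** The expansions, sums and analytic continuations above exist, and the following hold. 1. For all $g,n\ge0$ except $(g,n)=(0,0)$, and except $(g,n)=(0,1)$ with $z_0,z_1$ of the same color, for all colors and all $z_0,\dots,z_n\in D$, $$S_{z_0}\,\omega_{n+1}^g(z_0,z_1,\dots,z_n)+l^g(z_0;z_1,\dots,z_n)=0 .$$ 2. If $2g-2+(n+1)>0$, then for all colors and all $z_0,\dots,z_n\in D$ $$(S_{z_0}+\mathcal O_{z_0})\,\omega_{n+1}^g(z_0,z_1,\dots,z_n)+l'^g(z_0;z_1,\dots,z_n)=0,$$ and, for fixed $z_1,\dots,z_n\in D$, $l'^g$ is holomorphic in $z_0\in\mathbb C\setminus\{0\}$ on each component. 3. Consequently, if $2g-2+(n+1)>0$ and $z_1,\dots,z_n\in D$ are fixed, $S_{z_0}\omega_{n+1}^g$ extends holomorphically to $\mathbb C\setminus\{0\}$ on each component, in particular to neighbourhoods of $z_0=\pm1$, and it vanishes at $z_0=\pm1$. -/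

import Mathlib

open Finset MeasureTheory
open scoped BigOperators Nat

noncomputable section

namespace QuarticTensor

/-! ### The six-matrix model and its formal expectation values

The model is `∫ ∏_c dM_c exp (-(N/2) ∑_c tr M_c ^ 2 + ∑_{p ≥ 2} (N ^ (-2 p) / p) tr (∑_c α_c 𝓜_c) ^ p)`
for six Hermitian `N × N` matrices, `𝓜_c` being `M_c` acting on the `c`-th factor of a six-fold
tensor product.  It is a formal integral: everything except the Gaussian weight is expanded in
powers of the couplings `α`, and integrated term by term. -/

/-- The Hermitian matrix with real coordinates `u`: diagonal entries `u a a`, and entries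
`u a b + i u b a` above the diagonal. -/
def herm {N : ℕ} (u : Fin N → Fin N → ℝ) : Matrix (Fin N) (Fin N) ℂ :=
  Matrix.of fun a b =>
    if a = b then (u a a : ℂ)
    else if a < b then (u a b : ℂ) + Complex.I * (u b a : ℂ)
    else (u b a : ℂ) - Complex.I * (u a b : ℂ)

/-- Six `N × N` matrices, one for each color. -/
abbrev Matrices (N : ℕ) := Fin 6 → Matrix (Fin N) (Fin N) ℂ

/-- The Gaussian weight `exp (-(N/2) ∑_c tr M_c ^ 2)`. -/
def gaussWeight {N : ℕ} (M : Matrices N) : ℂ :=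
  Complex.exp (-((N : ℂ) / 2) * ∑ c, (M c ^ 2).trace)

/-- Expectation value in the Gaussian model of six independent Hermitian matrices. -/
def gaussE (N : ℕ) (F : Matrices N → ℂ) : ℂ :=
  (∫ u : Fin 6 → Fin N → Fin N → ℝ,
      F (fun c => herm (u c)) * gaussWeight (fun c => herm (u c))) /
    ∫ u : Fin 6 → Fin N → Fin N → ℝ, gaussWeight (fun c => herm (u c))

/-- The rescaled couplings
`- (∏_c α_c ^ a_c) / (∑_c a_c) * multinomial (a_1, …, a_6)`. -/
def tTilde (α : Fin 6 → ℂ) (a : Fin 6 → ℕ) : ℂ :=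
  -((∏ c, α c ^ a c) / ((∑ c, a c : ℕ) : ℂ)) * (Nat.multinomial univ a : ℂ)

/-- The part of degree `p` in `α` of the interaction, with the sign that it has in the exponential:
`(N ^ (-2 p) / p) tr (∑_c α_c 𝓜_c) ^ p = - N ^ (-2 p) ∑_{|a| = p} t̃_a ∏_c tr M_c ^ a_c`. -/
def interaction {N : ℕ} (α : Fin 6 → ℂ) (M : Matrices N) (p : ℕ) : ℂ :=
  -((N : ℂ) ^ (2 * p))⁻¹ *
    ∑ a ∈ (univ : Finset (Fin 6)).piAntidiag p, tTilde α a * ∏ c, (M c ^ a c).trace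

/-- The interaction as a formal power series; the formal variable records the degree in `α`. -/
def interactionSeries {N : ℕ} (α : Fin 6 → ℂ) (M : Matrices N) : PowerSeries ℂ :=
  PowerSeries.mk fun p => if 2 ≤ p then interaction α M p else 0

/-- The part of degree `k` in `α` of the exponential of the interaction.  (The `m`-th power of the
interaction starts in degree `2 m`, so that the sum over `m ≤ k` is the whole exponential.) -/
def boltzmann {N : ℕ} (α : Fin 6 → ℂ) (M : Matrices N) (k : ℕ) : ℂ :=
  ∑ m ∈ range (k + 1), PowerSeries.coeff k (interactionSeries α M ^ m) / (m ! : ℂ)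

/-- The formal expectation value of an observable: the coefficient of degree `k` is the part
of degree `k` in `α`. -/
def expect (N : ℕ) (α : Fin 6 → ℂ) (F : Matrices N → ℂ) : PowerSeries ℂ :=
  (PowerSeries.mk fun k => gaussE N fun M => F M * boltzmann α M k) *
    (PowerSeries.mk fun k => gaussE N fun M => boltzmann α M k)⁻¹

/-- The connected correlation (joint cumulant) of the traces `tr M_{c j} ^ {p j}`, `j ∈ ι`. -/
def cumulant (N : ℕ) (α : Fin 6 → ℂ) {ι : Type} [Fintype ι] [DecidableEq ι]
    (c : ι → Fin 6) (p : ι → ℕ) : PowerSeries ℂ :=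
  ∑ π : Finpartition (univ : Finset ι),
    ((-1 : ℂ) ^ (π.parts.card - 1) * ((π.parts.card - 1)! : ℂ)) •
      ∏ B ∈ π.parts, expect N α fun M => ∏ j ∈ B, (M (c j) ^ p j).trace

/-! ### The topological expansion -/

/-- `f N = ∑_g u_g N ^ (2 - n - 2 g)` for all `N ≥ 1`, a finite sum. -/
def IsTopExpansion (n : ℕ) (f : ℕ → ℂ) (u : ℕ →₀ ℂ) : Prop :=
  ∀ N : ℕ, 1 ≤ N → f N = u.sum fun g a => a * (N : ℂ) ^ ((2 : ℤ) - n - 2 * g)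

open Classical in
/-- The coefficient of `N ^ (2 - n - 2 g)`. -/
def topCoeff (n : ℕ) (f : ℕ → ℂ) (g : ℕ) : ℂ :=
  if h : ∃ u, IsTopExpansion n f u then h.choose g else 0

/-- The part of degree `k` in `α` of the genus `g` connected correlation of traces. -/
def wCoeff (α : Fin 6 → ℂ) (g : ℕ) {ι : Type} [Fintype ι] [DecidableEq ι]
    (c : ι → Fin 6) (p : ι → ℕ) (k : ℕ) : ℂ :=
  topCoeff (Fintype.card ι) (fun N => PowerSeries.coeff k (cumulant N α c p)) g

/-- The genus `g` connected correlation of the traces `tr M_{c j} ^ {p j}`: the coefficient of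
`N ^ (2 - n - 2 g)` in the connected correlation, where `n` is the number of traces. -/
def w (α : Fin 6 → ℂ) (g : ℕ) {ι : Type} [Fintype ι] [DecidableEq ι]
    (c : ι → Fin 6) (p : ι → ℕ) : ℂ :=
  ∑' k, wCoeff α g c p k

/-! ### The spectral curve -/

/-- The points of the spectral curve, a disjoint union of six components, in Joukowsky
coordinates: a color and a coordinate `z` on the component of that color. -/
abbrev Curve := Fin 6 × ℂ

/-- `√(1 - α_c ^ 2)`, principal branch. -/
def root (α : Fin 6 → ℂ) (c : Fin 6) : ℂ := (1 - α c ^ 2) ^ (1 / 2 : ℂ)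

/-- The covering `x^{(c)}(z) = (z + 1/z) / √(1 - α_c ^ 2)`. -/
def x (α : Fin 6 → ℂ) (P : Curve) : ℂ := (P.2 + P.2⁻¹) / root α P.1

/-- The coefficient of `dz` in `dx^{(c)}(z)`. -/
def dx (α : Fin 6 → ℂ) (P : Curve) : ℂ := (1 - (P.2 ^ 2)⁻¹) / root α P.1

/-- The `z`-plane without the origin and without the two zeros `±1` of `dx`. -/
def regular : Set ℂ := {z | z ≠ 0 ∧ z ≠ 1 ∧ z ≠ -1}

/-- `f`, a function of the coordinates `z j`, is the analytic continuation to the spectral curve of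
the coefficient of `∏ dz_j` in
`⟨∏_{k ∈ κ} tr M_{b k} ^ {a k} ∏_{j ∈ ι} tr 1 / (x (z_j) - M_{c j})⟩_connected^g ∏_{j ∈ ι} dx (z_j)`,
which is given near infinity by its expansion in powers of `1 / x (z_j)`. -/
def IsContinuation (α : Fin 6 → ℂ) (g : ℕ) {κ ι : Type} [Fintype κ] [DecidableEq κ]
    [Fintype ι] [DecidableEq ι] (b : κ → Fin 6) (a : κ → ℕ) (c : ι → Fin 6)
    (f : (ι → ℂ) → ℂ) : Prop :=
  AnalyticOnNhd ℂ f {z | ∀ j, z j ∈ regular} ∧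
    ∃ R : ℝ, ∀ z : ι → ℂ, (∀ j, R < ‖z j‖) →
      HasSum (fun p : ι → ℕ => w α g (Sum.elim b c) (Sum.elim a p) *
        ∏ j, (x α (c j, z j) ^ (p j + 1))⁻¹ * dx α (c j, z j)) (f z)

open Classical in
/-- The analytic continuation described by `IsContinuation`; it is unique on the set of all `z`
whose coordinates are regular, since that set is open and connected. -/
def mixed (α : Fin 6 → ℂ) (g : ℕ) {κ ι : Type} [Fintype κ] [DecidableEq κ]
    [Fintype ι] [DecidableEq ι] (b : κ → Fin 6) (a : κ → ℕ) (c : ι → Fin 6) :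
    (ι → ℂ) → ℂ :=
  if h : ∃ f, IsContinuation α g b a c f then h.choose else 0

/-- The global correlation form `ω_n^g` on the spectral curve, for all `(g, n)` and all colors
except two points of the same color at genus zero: the coefficient of `∏ dz_j`. -/
def omega (α : Fin 6 → ℂ) (g : ℕ) {n : ℕ} (P : Fin n → Curve) : ℂ :=
  mixed α g (κ := Empty) Empty.elim Empty.elim (fun j => (P j).1) (fun j => (P j).2)

/-! ### The operators `S` and `𝒪` on one-forms `f dz` on the spectral curve -/

/-- `S λ = λ + ι^* λ` with `ι z = 1 / z` on each component. -/
def opS (f : Curve → ℂ) (Q : Curve) : ℂ := f Q - (Q.2 ^ 2)⁻¹ * f (Q.1, Q.2⁻¹)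

/-- `q (x_1, x_2) = α_i α_j x_1 x_2` for points of distinct colors `i`, `j`, and zero for points of
the same color. -/
def q (α : Fin 6 → ℂ) (P Q : Curve) : ℂ :=
  if P.1 = Q.1 then 0 else α P.1 * α Q.1 * (x α P * x α Q)

/-- `𝒪 λ (z_1) = ∮_Γ d_{z_1} q (x (z_1), x (z)) λ (z) / (2 i π)`; the contour is, on
each component, the circle `|z| = R`, which for `R > 1` goes once around the cut of that color. -/
def opO (α : Fin 6 → ℂ) (R : ℝ) (f : Curve → ℂ) (Q : Curve) : ℂ :=
  ∑ c : Fin 6, (2 * (Real.pi : ℂ) * Complex.I)⁻¹ *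
    ∮ y in C(0, R), deriv (fun z => q α (Q.1, z) (c, y)) Q.2 * f (c, y)

/-! ### The explicit form of the linear loop equations -/

/-- A partition of the five colors other than `i`. -/
abbrev ColorPartition (i : Fin 6) := Finpartition ((univ : Finset (Fin 6)).erase i)

/-- The exponents `a_1, …, a_6` with `a_i ≥ 1` and `∑_c a_c ≥ 2`, and the genera `h_B` of the
blocks `B` of a partition of the other colors, with `∑_B h_B = g + #blocks - 3 - ∑_c a_c`.
(Since there are at most five blocks, this bounds all the `a_c` and `h_B` by `g + 2`.) -/
def loopIndex (g : ℕ) {i : Fin 6} (π : ColorPartition i) :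
    Finset ((Fin 6 → ℕ) × (π.parts → ℕ)) :=
  (Fintype.piFinset (fun _ => range (g + 3)) ×ˢ Fintype.piFinset (fun _ => range (g + 3))).filter
    fun s => 1 ≤ s.1 i ∧ 2 ≤ ∑ c, s.1 c ∧ ∑ B, s.2 B + ∑ c, s.1 c + 3 = g + π.parts.card

/-- One term: the factor of the block `B` is the connected correlation of genus `h_B` of the traces
`tr M_c ^ a_c`, `c ∈ B`, and of the resolvents at the points `P j` attributed to `B` by `J`. -/
def loopTerm (α : Fin 6 → ℂ) {n : ℕ} (Q : Curve) (P : Fin n → Curve)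
    (π : ColorPartition Q.1) (J : Fin n → π.parts) (s : (Fin 6 → ℕ) × (π.parts → ℕ)) : ℂ :=
  (s.1 Q.1 : ℂ) * tTilde α s.1 * x α Q ^ (s.1 Q.1 - 1) *
    ∏ B : π.parts,
      mixed α (s.2 B) (κ := {c : Fin 6 // c ∈ B.1}) (ι := {j : Fin n // J j = B})
        (fun c => c.1) (fun c => s.1 c.1) (fun j => (P j.1).1) (fun j => (P j.1).2)

/-- Some block carries a correlation of genus `g'` with `n'` points such that
`2 g' + n' = 2 g + n + 1`. -/
def IsTopTerm (g : ℕ) {n : ℕ} {i : Fin 6} (π : ColorPartition i)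
    (J : Fin n → π.parts) (s : (Fin 6 → ℕ) × (π.parts → ℕ)) : Prop :=
  ∃ B : π.parts,
    2 * s.2 B + (Fintype.card {j : Fin n // J j = B} + B.1.card) = 2 * g + n + 1

/-- The form `l^g (z_0; z_1, …, z_n)`, i.e. minus the sum of all the terms, times `dx (z_0)`. -/
def ell (α : Fin 6 → ℂ) (g : ℕ) {n : ℕ} (Q : Curve) (P : Fin n → Curve) : ℂ :=
  -(∑ π : ColorPartition Q.1, ∑ J : Fin n → π.parts, ∑ s ∈ loopIndex g π,
      loopTerm α Q P π J s) * dx α Q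

open Classical in
/-- The form `l'^g (z_0; z_1, …, z_n)`: the same sum without the terms that contain a correlation
with `2 g' + n' = 2 g + n + 1`. -/
def ellPrime (α : Fin 6 → ℂ) (g : ℕ) {n : ℕ} (Q : Curve) (P : Fin n → Curve) : ℂ :=
  -(∑ π : ColorPartition Q.1, ∑ J : Fin n → π.parts,
      ∑ s ∈ (loopIndex g π).filter (fun s => ¬ IsTopTerm g π J s), loopTerm α Q P π J s) *
    dx α Q

end QuarticTensor

end

open QuarticTensor

/-!
The correlations of traces are governed by the loop equations of the vector fields
`M_i ↦ M_i ^ p`, obtained from Gaussian integration by parts (`gaussInt_by_parts`,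
`schwingerDyson`). Moments and cumulants are encoded as generating functions indexed by multisets
of traces (`Egf`), for which the cumulants are the coefficients of the logarithm
(`log_apply_map`). With the normalization `freeEnergy`, `N` enters the loop equations only through
`ħ = N ^ (-2)` (`loopEq_freeEnergy`). They express each coefficient of the free energy polynomially
in terms of coefficients of smaller degree, with the degree in `α` and the exponents of the traces
counted together. Hence every coefficient is a polynomial in `N ^ (-2)` (`coeff_mem_of_loopEq`),
which is the topological expansion.

If the equations are organized by the level `2 g + n` instead, where `g` is the power of `ħ` and
`n` the number of traces, the terms of highest level are linear (`sub_mem_levelSubring`). For the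
traces of first powers, they form a linear system with the determinant `1 - ∑_c α_c ^ 2`, and for
the traces of higher powers they are multiplied by `1 - α_i ^ 2`. Since `|∑_c α_c ^ 2| < 1` and
`|α_c| < 1`, the inverses are absolutely convergent series in the couplings, and so are all the
correlations of given genus (`summable_wCoeff`). Their sums obey the same equations
(`loopEq_energy`).

For the color `i`, the loop equations of all `p` combine into one equation between Laurent series
in `1 / x` (`tailAt_quadratic`). It is quadratic in the resolvent. Twice the resolvent plus the
effective potential, which is a polynomial in `x`, completes the square: the square of
`shiftedResolvent`, plus `4 ħ` times the diagonal value of a correlation of two resolvents, is a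
polynomial in `x` (`quadratic_mem_polys`). At genus zero and without further traces,
`shiftedResolvent` is a square root `y` of
`Δ = (1 - α_i ^ 2) ^ 2 x ^ 2 - 4 (1 - α_i ^ 2)` (`IsSolution.branch_sq`). By induction on the level,
every coefficient of `shiftedResolvent` is a rational function of `x` with poles at the zeros of `Δ`
only, divided by `y` (`IsSolution.exists_shiftedResolvent_mem`): it is odd under exchange of the two
sheets of the curve `y ^ 2 = Δ`. The induction needs that diagonal values of correlations of two
resolvents have no further singularities. For this, a correlation of two resolvents is written as a
quadratic form in finitely many odd functions of one variable (`diagonal_sub_mem_polys`), which is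
possible because an odd function of bounded degree is determined by finitely many coefficients of
negative powers of `x` (`exists_basis_oddSpace`). The only diagonal value not covered by this, that
of two resolvents at genus zero, is computed explicitly (`IsSolution.branchSeries_pow_mul`).

The Joukowsky map `x = (z + 1 / z) / √(1 - α_i ^ 2)` uniformizes the curve `y ^ 2 = Δ`, the exchange
of sheets being `z ↦ 1 / z` (`IsSolution.exists_odd_function`). The dependence of a correlation on
each of its points is therefore through finitely many analytic one-forms
(`IsSolution.exists_forms`), which gives the analytic continuation (`exists_isContinuation`). Since
the resolvent plus half of the effective potential is odd, symmetrization of the resolvent gives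
minus the effective potential; its expansion over set partitions (`sum_vertexCorr_eq`) is the form
`l`, and this is the explicit linear loop equation (`opS_omega_add_ell`).

The contour integral in `𝒪` extracts the residue at infinity of `x` times a correlation form, that
is, it replaces a resolvent by the trace of a first power (`opO_omega`). The terms of `l` with a
correlation of maximal level are exactly these (`sum_topTerm`): if one block of the partition has
maximal level, counting levels leaves only the partition into singletons and bilinear couplings,
and all the other blocks carry `tr 1`. As a function of `z_0`, the forms `l` and `l'` are polynomials
in `x (z_0)` times `dx (z_0)`, hence holomorphic away from the origin, and zero where `dx` is zero.
-/

noncomputable section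

namespace QuarticTensor

/-! ### Exponential generating functions indexed by multisets -/

/-- A function `f` on multisets of labels, regarded as the formal power series in times `t_b` whose
iterated derivative `∂_{b_1} ⋯ ∂_{b_n}` at `t = 0` is `f {b_1, …, b_n}`. -/
def Egf (β R : Type*) := Multiset β → R

namespace Egf

variable {β R S : Type*}

@[ext] theorem ext {f g : Egf β R} (h : ∀ s, f s = g s) : f = g := funext h

variable [CommRing R] [CommRing S]

instance : AddCommGroup (Egf β R) := inferInstanceAs (AddCommGroup (Multiset β → R))

instance : Module R (Egf β R) := inferInstanceAs (Module R (Multiset β → R))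

@[simp] theorem add_apply (f g : Egf β R) (s) : (f + g) s = f s + g s := rfl
@[simp] theorem sub_apply (f g : Egf β R) (s) : (f - g) s = f s - g s := rfl
@[simp] theorem neg_apply (f : Egf β R) (s) : (-f) s = -f s := rfl
@[simp] theorem zero_apply (s) : (0 : Egf β R) s = 0 := rfl
@[simp] theorem smul_apply (r : R) (f : Egf β R) (s) : (r • f) s = r * f s := rfl

/-- Evaluation of a generating function at a multiset. -/
def evalHom (s : Multiset β) : Egf β R →+ R where
  toFun f := f s
  map_zero' := rfl
  map_add' _ _ := rfl

theorem sum_apply {γ : Type*} (t : Finset γ) (f : γ → Egf β R) (s) :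
    (∑ a ∈ t, f a) s = ∑ a ∈ t, f a s := map_sum (evalHom s) f t

/-- The derivative with respect to the time of label `b`. -/
def D (b : β) : Egf β R →ₗ[R] Egf β R where
  toFun f := fun s => f (b ::ₘ s)
  map_add' _ _ := rfl
  map_smul' _ _ := rfl

theorem D_apply (b : β) (f : Egf β R) (s) : D b f s = f (b ::ₘ s) := rfl

theorem D_comm (b c : β) (f : Egf β R) : D b (D c f) = D c (D b f) := by
  ext s; simp only [D_apply, Multiset.cons_swap]

instance : Mul (Egf β R) :=
  ⟨fun f g s => (s.antidiagonal.map fun x => f x.1 * g x.2).sum⟩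

instance : One (Egf β R) := ⟨fun s => if s.card = 0 then 1 else 0⟩

theorem mul_apply (f g : Egf β R) (s) :
    (f * g) s = (s.antidiagonal.map fun x => f x.1 * g x.2).sum := rfl

@[simp] theorem mul_apply_zero (f g : Egf β R) : (f * g) 0 = f 0 * g 0 := by
  simp [mul_apply]

@[simp] theorem one_apply_zero : (1 : Egf β R) 0 = 1 := rfl

@[simp] theorem one_apply_cons (b : β) (s) : (1 : Egf β R) (b ::ₘ s) = 0 := by
  change (if (b ::ₘ s).card = 0 then (1 : R) else 0) = 0
  simp

theorem one_apply (s : Multiset β) : (1 : Egf β R) s = if s.card = 0 then 1 else 0 := rfl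

@[simp] theorem D_one (b : β) : D b (1 : Egf β R) = 0 := by
  ext s; simp [D_apply]

theorem D_mul (b : β) (f g : Egf β R) : D b (f * g) = D b f * g + f * D b g := by
  ext s
  simp only [D_apply, add_apply, mul_apply, Multiset.antidiagonal_cons, Multiset.map_add,
    Multiset.sum_add, Multiset.map_map, Function.comp_def, Prod.map, id]
  rw [add_comm]

theorem mul_apply_cons (b : β) (f g : Egf β R) (s) :
    (f * g) (b ::ₘ s) = (D b f * g) s + (f * D b g) s := by
  rw [← D_apply b (f * g), D_mul, add_apply]

instance : CommRing (Egf β R) :=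
  { (inferInstance : AddCommGroup (Egf β R)), (inferInstance : Mul (Egf β R)),
    (inferInstance : One (Egf β R)) with
    left_distrib := fun f g h => by
      ext s; simp only [mul_apply, add_apply, mul_add, Multiset.sum_map_add]
    right_distrib := fun f g h => by
      ext s; simp only [mul_apply, add_apply, add_mul, Multiset.sum_map_add]
    zero_mul := fun f => by ext s; simp [mul_apply]
    mul_zero := fun f => by ext s; simp [mul_apply]
    mul_assoc := by
      have dist1 : ∀ (f g h : Egf β R) (s), ((f + g) * h) s = (f * h) s + (g * h) s := by
        intro f g h s; simp only [mul_apply, add_apply, add_mul, Multiset.sum_map_add]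
      have dist2 : ∀ (f g h : Egf β R) (s), (f * (g + h)) s = (f * g) s + (f * h) s := by
        intro f g h s; simp only [mul_apply, add_apply, mul_add, Multiset.sum_map_add]
      intro f g h
      ext s
      induction s using Multiset.induction generalizing f g h with
      | empty => simp [mul_assoc]
      | cons b s ih =>
        simp only [mul_apply_cons, D_mul, dist1, dist2, ih]
        ring
    one_mul := by
      intro f
      ext s
      induction s using Multiset.induction generalizing f with
      | empty => simp
      | cons b s ih =>
        rw [mul_apply_cons, ih, D_one]
        simp [mul_apply, D_apply]
    mul_one := by
      intro f
      ext s
      induction s using Multiset.induction generalizing f with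
      | empty => simp
      | cons b s ih =>
        rw [mul_apply_cons, ih, D_one]
        simp [mul_apply, D_apply]
    mul_comm := by
      intro f g
      ext s
      induction s using Multiset.induction generalizing f g with
      | empty => simp [mul_comm]
      | cons b s ih => rw [mul_apply_cons, mul_apply_cons, ih, ih f, add_comm] }

instance : Algebra R (Egf β R) := Algebra.ofModule
  (fun r f g => by
    ext s; simp only [mul_apply, smul_apply, ← Multiset.sum_map_mul_left, mul_assoc])
  (fun r f g => by
    ext s
    simp only [mul_apply, smul_apply, ← Multiset.sum_map_mul_left, mul_left_comm])

/-- Two generating functions agree if they have the same value and the same derivatives at zero. -/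
theorem eq_zero_of_D {E : Egf β R} (h0 : E 0 = 0) (h : ∀ b, ∃ f, D b E = f * E) : E = 0 := by
  have key : ∀ n, ∀ s : Multiset β, s.card ≤ n → E s = 0 := by
    intro n
    induction n with
    | zero =>
      intro s hs
      rw [Multiset.card_eq_zero.1 (Nat.le_zero.1 hs), h0]
    | succ n ih =>
      intro s hs
      induction s using Multiset.induction with
      | empty => exact h0
      | cons b s _ =>
        obtain ⟨f, hf⟩ := h b
        rw [← D_apply b E, hf, mul_apply]
        refine Multiset.sum_eq_zero fun y hy => ?_
        obtain ⟨x, hx, rfl⟩ := Multiset.mem_map.1 hy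
        rw [Multiset.mem_antidiagonal] at hx
        have : x.2.card ≤ n := by
          have h1 := congrArg Multiset.card hx
          simp only [Multiset.card_add, Multiset.card_cons] at h1 hs
          omega
        rw [ih _ this, mul_zero]
  ext s
  exact key _ s le_rfl

theorem D_pow (b : β) (f : Egf β R) (n : ℕ) :
    D b (f ^ (n + 1)) = (n + 1 : R) • (f ^ n * D b f) := by
  induction n with
  | zero => simp
  | succ n ih =>
    rw [pow_succ, D_mul, ih, smul_mul_assoc]
    push_cast
    rw [add_smul ((n : R) + 1) (1 : R), one_smul, pow_succ f n]
    congr 2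
    ring

theorem pow_apply_of_card_lt {f : Egf β R} (h0 : f 0 = 0) {n : ℕ} {s : Multiset β}
    (hs : s.card < n) (g : Egf β R) : (f ^ n * g) s = 0 := by
  induction s using Multiset.induction generalizing n g with
  | empty =>
    rw [mul_apply_zero]
    have : ∀ n, 0 < n → (f ^ n) 0 = 0 := by
      intro n hn
      obtain ⟨m, rfl⟩ : ∃ m, n = m + 1 := ⟨n - 1, by omega⟩
      rw [pow_succ, mul_apply_zero, h0, mul_zero]
    rw [this n (by simpa using hs), zero_mul]
  | cons b s ih =>
    rw [Multiset.card_cons] at hs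
    obtain ⟨m, rfl⟩ : ∃ m, n = m + 1 := ⟨n - 1, by omega⟩
    rw [mul_apply_cons, D_pow, ih (by omega), smul_mul_assoc, smul_apply, mul_assoc,
      ih (by omega)]
    simp

/-- Change of coefficients along a ring homomorphism. -/
def map (θ : R →+* S) : Egf β R →+* Egf β S where
  toFun f := fun s => θ (f s)
  map_zero' := by ext s; simp
  map_one' := by ext s; simp only [one_apply]; split_ifs <;> simp
  map_add' f g := by ext s; exact map_add θ _ _
  map_mul' f g := by
    ext s
    simp only [mul_apply, map_multiset_sum, Multiset.map_map, Function.comp_def, map_mul]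
    rfl

@[simp] theorem map_apply (θ : R →+* S) (f : Egf β R) (s) : map θ f s = θ (f s) := rfl

theorem D_map (θ : R →+* S) (b : β) (f : Egf β R) : D b (map θ f) = map θ (D b f) := rfl

theorem map_smul' (θ : R →+* S) (r : R) (f : Egf β R) : map θ (r • f) = θ r • map θ f := by
  ext s; simp

theorem map_injective {θ : R →+* S} (hθ : Function.Injective θ) :
    Function.Injective (map θ : Egf β R →+* Egf β S) := fun f g h => by
  ext s; exact hθ (congrFun h s)

/-- The rescaling `t_b ↦ r t_b` of all the times. -/
def rescale (r : R) : Egf β R →+* Egf β R where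
  toFun f := fun s => r ^ s.card * f s
  map_zero' := by ext s; simp
  map_one' := by
    ext s; simp only [one_apply]; split_ifs with h <;> simp [h]
  map_add' f g := by ext s; exact mul_add _ _ _
  map_mul' f g := by
    ext s
    simp only [mul_apply, ← Multiset.sum_map_mul_left]
    refine congrArg _ (Multiset.map_congr rfl fun x hx => ?_)
    rw [← Multiset.mem_antidiagonal.1 hx, Multiset.card_add, pow_add]
    ring

/-- The values of a product of generating functions at the multiset of labels `X j`, `j ∈ S`. -/
theorem mul_apply_map {ι : Type*} [DecidableEq ι] (X : ι → β) (f g : Egf β R) (S : Finset ι) :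
    (f * g) (S.val.map X) =
      ∑ T ∈ S.powerset, f (T.val.map X) * g ((S \ T).val.map X) := by
  induction S using Finset.induction generalizing f g with
  | empty => simp
  | insert j S hj ih =>
    rw [Finset.insert_val_of_notMem hj, Multiset.map_cons, mul_apply_cons, ih, ih,
      Finset.sum_powerset_insert hj, add_comm]
    congr 1
    · refine Finset.sum_congr rfl fun T hT => ?_
      have hjT : j ∉ T := fun h => hj (Finset.mem_powerset.1 hT h)
      rw [Finset.insert_sdiff_of_notMem _ hjT, Finset.insert_val_of_notMem
        (fun h => hj (Finset.mem_sdiff.1 h).1), Multiset.map_cons, D_apply]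
    · refine Finset.sum_congr rfl fun T hT => ?_
      have hjT : j ∉ T := fun h => hj (Finset.mem_powerset.1 hT h)
      rw [Finset.insert_sdiff_insert, Finset.sdiff_insert_of_notMem hj,
        Finset.insert_val_of_notMem hjT, Multiset.map_cons, D_apply]

end Egf
end QuarticTensor

namespace QuarticTensor
namespace Egf

variable {β R S : Type*}

/-- The iterated derivative with respect to the times of all the labels in a multiset. -/
def Dm (l : Multiset β) (f : Egf β R) : Egf β R := fun s => f (l + s)

theorem Dm_apply (l : Multiset β) (f : Egf β R) (s) : Dm l f s = f (l + s) := rfl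

@[simp] theorem Dm_zero (f : Egf β R) : Dm 0 f = f := by ext s; simp [Dm_apply]

variable [CommRing R] [CommRing S]

/-! ### Covariant derivatives and normalized correlators -/

/-- The covariant derivative `f ↦ Z⁻¹ h ∂_b (f Z)` for `Z = exp (F / h)`. -/
def cov (F : Egf β R) (h : R) (b : β) (f : Egf β R) : Egf β R := D b F * f + h • D b f

instance (F : Egf β R) (h : R) : LeftCommutative (cov F h) where
  left_comm b c f := by
    simp only [cov, map_add, D_mul, map_smul, D_comm b c, smul_add, mul_add, mul_smul_comm]
    ring_nf

/-- The normalized correlator `Z⁻¹ h ^ n ∂_{b_1} ⋯ ∂_{b_n} Z` for `Z = exp (F / h)`. -/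
def corr (F : Egf β R) (h : R) (l : Multiset β) : Egf β R := l.foldr (cov F h) 1

@[simp] theorem corr_zero (F : Egf β R) (h : R) : corr F h 0 = 1 := Multiset.foldr_zero _ _

theorem corr_cons (F : Egf β R) (h : R) (b : β) (l) :
    corr F h (b ::ₘ l) = cov F h b (corr F h l) := Multiset.foldr_cons _ _ _ _

theorem corr_singleton (F : Egf β R) (h : R) (b : β) : corr F h {b} = D b F := by
  rw [← Multiset.cons_zero, corr_cons, corr_zero]; simp [cov]

theorem corr_pair (F : Egf β R) (h : R) (b c : β) :
    corr F h {b, c} = D b F * D c F + h • D b (D c F) := by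
  rw [Multiset.insert_eq_cons, corr_cons, corr_singleton]; rfl

theorem map_cov (θ : R →+* S) (F : Egf β R) (h : R) (b : β) (f) :
    map θ (cov F h b f) = cov (map θ F) (θ h) b (map θ f) := by
  simp only [cov, map_add, map_mul, map_smul', D_map]

theorem map_corr (θ : R →+* S) (F : Egf β R) (h : R) (l) :
    map θ (corr F h l) = corr (map θ F) (θ h) l := by
  induction l using Multiset.induction with
  | empty => simp
  | cons b l ih => rw [corr_cons, corr_cons, map_cov, ih]

theorem Dm_cons (b : β) (l : Multiset β) (f : Egf β R) : Dm (b ::ₘ l) f = D b (Dm l f) := by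
  ext s; simp [Dm_apply, D_apply]

/-- If `m = exp (F / h)`, the iterated derivatives of `m` are its multiples by the correlators. -/
theorem corr_mul_eq {F m : Egf β R} {h : R} (hm : ∀ b, h • D b m = D b F * m) (l) :
    corr F h l * m = h ^ l.card • Dm l m := by
  induction l using Multiset.induction with
  | empty => simp
  | cons b l ih =>
    have h1 : h ^ l.card • D b (Dm l m) = D b (corr F h l * m) := by rw [ih, map_smul]
    rw [corr_cons, cov, add_mul, Multiset.card_cons, Dm_cons, pow_succ', mul_smul, h1,
      D_mul, smul_add, ← mul_smul_comm h (corr F h l), hm, smul_mul_assoc]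
    ring

/-- If derivatives with respect to `b` act trivially, the label `b` may be removed. -/
theorem cov_of_D_eq_one {F : Egf β R} {h : R} {b : β} (hb : D b F = 1) (l) :
    cov F h b (corr F h l) = corr F h l := by
  have key : D b (corr F h l) = 0 := by
    induction l using Multiset.induction with
    | empty => simp
    | cons c l ih =>
      rw [corr_cons, cov, map_add, D_mul, map_smul, D_comm b c, D_comm b c, ih, hb]
      simp
  rw [cov, hb, key, one_mul, smul_zero, add_zero]

/-! ### First-order operators -/

section shift
variable [DecidableEq β]

/-- The derivation `∑_b t_b r_b ∂_{b'}`, where `σ b = (r_b, b')`. -/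
def shift (σ : β → R × β) (f : Egf β R) : Egf β R := fun s =>
  (s.map fun b => (σ b).1 * f ((σ b).2 ::ₘ s.erase b)).sum

theorem shift_apply (σ : β → R × β) (f : Egf β R) (s) :
    shift σ f s = (s.map fun b => (σ b).1 * f ((σ b).2 ::ₘ s.erase b)).sum := rfl

@[simp] theorem shift_apply_zero (σ : β → R × β) (f : Egf β R) : shift σ f 0 = 0 := by
  simp [shift_apply]

theorem D_shift (σ : β → R × β) (b : β) (f : Egf β R) :
    D b (shift σ f) = shift σ (D b f) + (σ b).1 • D (σ b).2 f := by
  ext s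
  rw [D_apply, shift_apply, Multiset.map_cons, Multiset.sum_cons, add_apply, smul_apply, D_apply,
    Multiset.erase_cons_head, add_comm, shift_apply]
  congr 2
  refine Multiset.map_congr rfl fun c hc => ?_
  rw [Multiset.erase_cons_tail_of_mem hc, D_apply, Multiset.cons_swap]

theorem shift_smul (σ : β → R × β) (r : R) (f : Egf β R) : shift σ (r • f) = r • shift σ f := by
  ext s
  simp only [shift_apply, smul_apply, ← Multiset.sum_map_mul_left]
  exact congrArg _ (Multiset.map_congr rfl fun c _ => mul_left_comm _ _ _)

theorem shift_add (σ : β → R × β) (f g : Egf β R) :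
    shift σ (f + g) = shift σ f + shift σ g := by
  ext s
  simp only [shift_apply, add_apply, mul_add, Multiset.sum_map_add]

theorem shift_mul (σ : β → R × β) (f g : Egf β R) :
    shift σ (f * g) = shift σ f * g + f * shift σ g := by
  ext s
  induction s using Multiset.induction generalizing f g with
  | empty => simp
  | cons b s ih =>
    have h : D b (shift σ (f * g)) s = D b (shift σ f * g + f * shift σ g) s := by
      rw [D_shift, D_mul b, D_mul (σ b).2, shift_add, map_add, D_mul, D_mul, D_shift, D_shift]
      simp only [add_apply, ih, smul_apply, mul_add, add_mul, smul_mul_assoc, mul_smul_comm]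
      ring
    exact h

/-- A derivation takes `exp L` to its multiple by the derivative of `L`. -/
theorem shift_eq_mul (σ : β → R × β) {m L : Egf β R} (hm : ∀ b, D b m = D b L * m) :
    shift σ m = shift σ L * m := by
  rw [← sub_eq_zero]
  refine eq_zero_of_D (by simp) fun b => ⟨D b L, ?_⟩
  rw [map_sub, D_mul, D_shift, D_shift, hm b, shift_mul, hm (σ b).2, add_mul, smul_mul_assoc]
  ring

theorem map_shift (θ : R →+* S) (σ : β → R × β) (f : Egf β R) :
    map θ (shift σ f) = shift (fun b => (θ (σ b).1, (σ b).2)) (map θ f) := by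
  ext s
  simp only [shift_apply, map_apply, map_multiset_sum, Multiset.map_map, Function.comp_def,
    map_mul]

end shift

/-! ### The logarithm -/

section log
variable [Algebra ℚ R]

/-- The truncated series of the logarithm. -/
def logTrunc (K : ℕ) (m : Egf β R) : Egf β R :=
  ∑ k ∈ range K, algebraMap ℚ R ((-1) ^ k / (k + 1)) • (m - 1) ^ (k + 1)

/-- The logarithm of a generating function with value one at zero. -/
def log (m : Egf β R) : Egf β R := fun s => logTrunc s.card m s

theorem log_apply {m : Egf β R} (h0 : m 0 = 1) {s : Multiset β} {K : ℕ} (hK : s.card ≤ K) :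
    log m s = logTrunc K m s := by
  change logTrunc s.card m s = _
  rw [logTrunc, logTrunc, sum_apply, sum_apply]
  refine Finset.sum_subset (Finset.range_mono hK) fun k _ hk => ?_
  have := pow_apply_of_card_lt (f := m - 1) (by simp [h0]) (n := k + 1) (s := s)
    (by simpa [Nat.lt_succ_iff] using hk) 1
  rw [smul_apply, ← mul_one ((m - 1) ^ (k + 1)), this, mul_zero]

/-- The derivatives of the truncated logarithm form a geometric series in `1 - m`. -/
theorem D_logTrunc_mul (K : ℕ) (b : β) (m : Egf β R) :
    D b (logTrunc K m) * m = (1 - (1 - m) ^ K) * D b m := by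
  induction K with
  | zero => simp [logTrunc]
  | succ K ih =>
    rw [logTrunc, Finset.sum_range_succ, map_add, add_mul, ← logTrunc, ih, map_smul, D_pow,
      smul_smul, map_sub, D_one, sub_zero]
    have h1 : algebraMap ℚ R ((-1) ^ K / (K + 1)) * ((K : R) + 1) = (-1) ^ K := by
      have : ((K : R) + 1) = algebraMap ℚ R (K + 1) := by simp
      rw [this, ← map_mul, div_mul_cancel₀ _ (by positivity)]
      simp
    rw [h1]
    have h2 : ((-1) ^ K : R) • ((m - 1) ^ K * D b m) = (1 - m) ^ K * D b m := by
      rw [← neg_sub m 1, neg_pow (m - 1) K, Algebra.smul_def, map_pow, map_neg, map_one, mul_assoc]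
    rw [h2, pow_succ]
    ring

/-- The chain rule `(∂_b log m) m = ∂_b m`. -/
theorem D_log_mul {m : Egf β R} (h0 : m 0 = 1) (b : β) : D b (log m) * m = D b m := by
  ext s
  have h1 : (D b (log m) * m) s = (D b (logTrunc (s.card + 1) m) * m) s := by
    rw [mul_apply, mul_apply]
    refine congrArg _ (Multiset.map_congr rfl fun x hx => ?_)
    have := congrArg Multiset.card (Multiset.mem_antidiagonal.1 hx)
    rw [Multiset.card_add] at this
    rw [D_apply, D_apply, log_apply h0 (K := s.card + 1) (by rw [Multiset.card_cons]; omega)]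
  have h2 : ((1 - m) ^ (s.card + 1) * D b m) s = 0 :=
    pow_apply_of_card_lt (by rw [sub_apply, h0, one_apply_zero, sub_self]) (Nat.lt_succ_self _) _
  rw [h1, D_logTrunc_mul, sub_mul, one_mul, sub_apply, h2, sub_zero]

end log

/-! ### Sums over set partitions -/

/-- A sum over the partitions of `insert j S`, organized by the block containing `j`. -/
theorem sum_finpartition_insert {ι M : Type*} [DecidableEq ι] [AddCommMonoid M] {j : ι}
    {S : Finset ι} (hj : j ∉ S) (Φ : Finset (Finset ι) → M) :
    ∑ π : Finpartition (insert j S), Φ π.parts =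
      ∑ T ∈ S.powerset, ∑ π : Finpartition (S \ T), Φ (insert (insert j T) π.parts) := by
  classical
  -- the fibre over `T` consists of the partitions in which `insert j T` is a block; removing this
  -- block identifies them with the partitions of `S \ T`
  rw [← Finset.sum_fiberwise_of_maps_to (s := univ) (t := S.powerset)
    (g := fun π : Finpartition (insert j S) => (π.part j).erase j)]
  · refine Finset.sum_congr rfl fun T hT => ?_
    rw [Finset.mem_powerset] at hT
    have hjT : j ∉ T := fun h => hj (hT h)
    have hdis : Disjoint (S \ T) (insert j T) := by
      rw [Finset.disjoint_insert_right]
      exact ⟨fun h => hj (Finset.mem_sdiff.1 h).1, Finset.sdiff_disjoint⟩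
    have hsup : (S \ T) ⊔ (insert j T) = insert j S := by
      rw [Finset.sup_eq_union, Finset.union_insert, Finset.sdiff_union_of_subset hT]
    have hne : insert j T ≠ (⊥ : Finset ι) := Finset.insert_ne_empty _ _
    symm
    refine Finset.sum_bij (fun π _ => π.extend hne hdis hsup) ?_ ?_ ?_ ?_
    · intro π _
      rw [Finset.mem_filter]
      refine ⟨Finset.mem_univ _, ?_⟩
      have : (π.extend hne hdis hsup).part j = insert j T :=
        Finpartition.part_eq_of_mem _ (Finset.mem_insert_self _ _) (Finset.mem_insert_self _ _)
      rw [this, Finset.erase_insert hjT]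
    · intro π _ π' _ h
      have h' : insert (insert j T) π.parts = insert (insert j T) π'.parts :=
        congrArg Finpartition.parts h
      have key : ∀ ρ : Finpartition (S \ T), insert j T ∉ ρ.parts := fun ρ hρ =>
        hj (Finset.mem_sdiff.1 (ρ.le hρ (Finset.mem_insert_self j T))).1
      ext1
      rw [← Finset.erase_insert (key π), h', Finset.erase_insert (key π')]
    · intro π hπ
      rw [Finset.mem_filter] at hπ
      have hpart : π.part j = insert j T := by
        rw [← hπ.2, Finset.insert_erase (π.mem_part_self.2 (Finset.mem_insert_self j S))]
      have hmem : insert j T ∈ π.parts := by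
        rw [← hpart]; exact π.part_mem.2 (Finset.mem_insert_self j S)
      refine ⟨⟨π.parts.erase (insert j T), ?_, ?_, ?_⟩, Finset.mem_univ _, ?_⟩
      · exact π.supIndep.subset (Finset.erase_subset _ _)
      · ext c
        simp only [Finset.mem_sup, Finset.mem_erase, id, Finset.mem_sdiff]
        constructor
        · rintro ⟨B, ⟨hB, hBπ⟩, hc⟩
          have hcS := π.le hBπ hc
          have hcn : c ∉ insert j T := fun h' => hB (π.eq_of_mem_parts hBπ hmem hc h')
          rw [Finset.mem_insert, not_or] at hcn
          exact ⟨(Finset.mem_insert.1 hcS).resolve_left hcn.1, hcn.2⟩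
        · rintro ⟨hcS, hcT⟩
          obtain ⟨B, hB, hc⟩ := π.exists_mem (Finset.mem_insert_of_mem hcS)
          refine ⟨B, ⟨?_, hB⟩, hc⟩
          rintro rfl
          rcases Finset.mem_insert.1 hc with rfl | h'
          · exact hj hcS
          · exact hcT h'
      · exact fun h' => π.bot_notMem (Finset.mem_of_mem_erase h')
      · ext1
        exact Finset.insert_erase hmem
    · intro π _
      rfl
  · intro π _
    rw [Finset.mem_powerset]
    exact (Finset.erase_subset_erase j (π.part_subset j)).trans
      (by rw [Finset.erase_insert hj])

/-- The powers of a generating function without constant term count partitions. -/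
theorem pow_apply_map {ι : Type*} [DecidableEq ι] (X : ι → β) {f : Egf β R} (h0 : f 0 = 0)
    (S : Finset ι) (k : ℕ) :
    (f ^ k) (S.val.map X) = (k ! : R) * ∑ π : Finpartition S,
      if π.parts.card = k then ∏ B ∈ π.parts, f (B.val.map X) else 0 := by
  induction S using Finset.strongInduction generalizing k with
  | H S ih =>
    rcases S.eq_empty_or_nonempty with rfl | ⟨j, hj⟩
    · rw [← Finset.bot_eq_empty]
      have hu : (univ : Finset (Finpartition (⊥ : Finset ι))) = {default} := by
        ext π; simp [Subsingleton.elim π default]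
      rw [hu, Finset.sum_singleton]
      have hp : (default : Finpartition (⊥ : Finset ι)).parts = ∅ := by
        rw [Finpartition.default_eq_empty]; rfl
      rw [hp]
      cases k with
      | zero => simp
      | succ k =>
        have : (f ^ (k + 1)) 0 = 0 := by rw [pow_succ, mul_apply_zero, h0, mul_zero]
        simpa using this
    · have hjS : j ∉ S.erase j := Finset.notMem_erase j S
      have hS : insert j (S.erase j) = S := Finset.insert_erase hj
      have h1 := sum_finpartition_insert hjS (fun P => if P.card = k then ∏ B ∈ P,
        f (B.val.map X) else 0)
      rw [← hS, h1, Finset.insert_val_of_notMem hjS, Multiset.map_cons]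
      have hcard : ∀ T ∈ (S.erase j).powerset, ∀ π : Finpartition (S.erase j \ T),
          insert j T ∉ π.parts := fun T _ π hπ =>
        hjS (Finset.mem_sdiff.1 (π.le hπ (Finset.mem_insert_self j T))).1
      cases k with
      | zero =>
        rw [pow_zero, one_apply_cons]
        symm
        rw [Finset.sum_eq_zero, mul_zero]
        intro T hT
        refine Finset.sum_eq_zero fun π _ => ?_
        rw [if_neg]
        rw [Finset.card_insert_of_notMem (hcard T hT π)]
        omega
      | succ k =>
        rw [← D_apply (X j) (f ^ (k + 1)), D_pow, smul_apply, mul_comm (f ^ k), mul_apply_map,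
          Finset.mul_sum,
          Finset.mul_sum]
        refine Finset.sum_congr rfl fun T hT => ?_
        have hTS : S.erase j \ T ⊂ S :=
          lt_of_le_of_lt (Finset.sdiff_subset) (Finset.erase_ssubset hj)
        rw [ih _ hTS, Nat.factorial_succ, Finset.mul_sum, Finset.mul_sum, Finset.mul_sum,
          Finset.mul_sum]
        refine Finset.sum_congr rfl fun π _ => ?_
        rw [Finset.card_insert_of_notMem (hcard T hT π), Finset.prod_insert (hcard T hT π),
          Finset.insert_val_of_notMem (fun h => hjS (Finset.mem_powerset.1 hT h)),
          Multiset.map_cons, D_apply]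
        simp only [Nat.add_right_cancel_iff]
        split_ifs
        · push_cast; ring
        · simp

/-- The logarithm of a moment generating function consists of the cumulants. -/
theorem log_apply_map [Algebra ℚ R] {ι : Type*} [DecidableEq ι] (X : ι → β) {m : Egf β R}
    (h0 : m 0 = 1) {S : Finset ι} (hS : S.Nonempty) :
    log m (S.val.map X) = ∑ π : Finpartition S,
      ((-1 : R) ^ (π.parts.card - 1) * ((π.parts.card - 1)! : R)) *
        ∏ B ∈ π.parts, m (B.val.map X) := by
  have hcard : ∀ π : Finpartition S, 1 ≤ π.parts.card ∧ π.parts.card ≤ S.card := fun π =>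
    ⟨Finset.card_pos.2 (π.parts_nonempty hS.ne_empty), π.card_parts_le_card⟩
  have hc : (S.val.map X).card = S.card := by simp
  change logTrunc _ m _ = _
  rw [hc, logTrunc, sum_apply]
  simp only [smul_apply]
  simp_rw [pow_apply_map X (show (m - 1) 0 = 0 by simp [h0]), Finset.mul_sum]
  rw [Finset.sum_comm]
  refine Finset.sum_congr rfl fun π _ => ?_
  obtain ⟨h1, h2⟩ := hcard π
  obtain ⟨k, hk⟩ : ∃ k, π.parts.card = k + 1 := ⟨π.parts.card - 1, by omega⟩
  rw [Finset.sum_eq_single k]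
  · rw [if_pos hk, hk, Nat.add_sub_cancel, Nat.factorial_succ]
    have hprod : ∏ B ∈ π.parts, (m - 1) (B.val.map X) = ∏ B ∈ π.parts, m (B.val.map X) := by
      refine Finset.prod_congr rfl fun B hB => ?_
      rw [sub_apply, one_apply, if_neg, sub_zero]
      rw [Multiset.card_map]
      exact (Finset.card_pos.2 (π.nonempty_of_mem_parts hB)).ne'
    rw [hprod, ← mul_assoc]
    congr 1
    have : ((k : R) + 1) = algebraMap ℚ R (k + 1) := by simp
    push_cast
    rw [← mul_assoc, this, ← map_mul, div_mul_cancel₀ _ (by positivity)]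
    simp
  · intro l _ hl
    rw [if_neg (by omega), mul_zero, mul_zero]
  · intro hk'
    exact absurd (Finset.mem_range.2 (by omega)) hk'

/-- Correlators as sums over the partitions of the set of labels. -/
theorem corr_map_eq {ι : Type*} [DecidableEq ι] (X : ι → β) (F : Egf β R) (h : R)
    (S : Finset ι) :
    corr F h (S.val.map X) = ∑ π : Finpartition S,
      h ^ (S.card - π.parts.card) • ∏ B ∈ π.parts, Dm (B.val.map X) F := by
  -- a further label `b` either joins a set `T` of the labels in a single cumulant, or stays alone
  -- (`T = ∅`); the labels outside `T` keep their correlator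
  have step : ∀ (S : Finset ι) (b : β), cov F h b (corr F h (S.val.map X)) =
      ∑ T ∈ S.powerset, h ^ T.card • (D b (Dm (T.val.map X) F) * corr F h ((S \ T).val.map X)) := by
    intro S
    induction S using Finset.induction with
    | empty => intro b; simp [cov]
    | insert j S hj ih =>
      intro b
      rw [Finset.insert_val_of_notMem hj, Multiset.map_cons, corr_cons,
        LeftCommutative.left_comm (op := cov F h) b (X j), ih, Finset.sum_powerset_insert hj, cov,
        Finset.mul_sum, map_sum, Finset.smul_sum, ← Finset.sum_add_distrib,
        ← Finset.sum_add_distrib]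
      refine Finset.sum_congr rfl fun T hT => ?_
      have hjT : j ∉ T := fun h => hj (Finset.mem_powerset.1 hT h)
      rw [Finset.insert_sdiff_of_notMem _ hjT, Finset.insert_val_of_notMem
        (fun h => hj (Finset.mem_sdiff.1 h).1), Multiset.map_cons, Finset.insert_sdiff_insert,
        Finset.sdiff_insert_of_notMem hj, Finset.insert_val_of_notMem hjT, Multiset.map_cons,
        corr_cons, Dm_cons, Finset.card_insert_of_notMem hjT, cov, map_smul, D_mul,
        D_comm b (X j), pow_succ]
      simp only [mul_smul_comm, smul_add, mul_add, smul_smul]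
      rw [mul_comm h, mul_left_comm]
      abel
  induction S using Finset.strongInduction with
  | H S ih =>
    rcases S.eq_empty_or_nonempty with rfl | ⟨j, hj⟩
    · rw [← Finset.bot_eq_empty]
      have hu : (univ : Finset (Finpartition (⊥ : Finset ι))) = {default} := by
        ext π; simp [Subsingleton.elim π default]
      rw [hu, Finset.sum_singleton]
      have hp : (default : Finpartition (⊥ : Finset ι)).parts = ∅ := by
        rw [Finpartition.default_eq_empty]; rfl
      rw [hp]
      simp
    · have hjS : j ∉ S.erase j := Finset.notMem_erase j S
      have hS : insert j (S.erase j) = S := Finset.insert_erase hj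
      have h1 := sum_finpartition_insert hjS (fun P => h ^ (S.card - P.card) •
        ∏ B ∈ P, Dm (B.val.map X) F)
      rw [hS] at h1
      rw [h1, ← hS, Finset.insert_val_of_notMem hjS, Multiset.map_cons, corr_cons, step, hS]
      refine Finset.sum_congr rfl fun T hT => ?_
      have hTS : S.erase j \ T ⊂ S :=
        lt_of_le_of_lt (Finset.sdiff_subset) (Finset.erase_ssubset hj)
      rw [ih _ hTS, Finset.mul_sum, Finset.smul_sum]
      refine Finset.sum_congr rfl fun π _ => ?_
      have hn : insert j T ∉ π.parts := fun hπ =>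
        hjS (Finset.mem_sdiff.1 (π.le hπ (Finset.mem_insert_self j T))).1
      rw [Finset.card_insert_of_notMem hn, Finset.prod_insert hn, Finset.insert_val_of_notMem
        (fun h => hjS (Finset.mem_powerset.1 hT h)), Multiset.map_cons, Dm_cons, mul_smul_comm,
        smul_smul, ← pow_add]
      congr 2
      have h2 := π.card_parts_le_card
      have h3 := Finset.card_sdiff_add_card_eq_card (Finset.mem_powerset.1 hT)
      have h4 := Finset.card_erase_add_one hj
      omega

end Egf
end QuarticTensor

namespace QuarticTensor

/-! ### Gaussian integration by parts -/

section gaussian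

variable {N : ℕ}

theorem herm_apply (u : Fin N → Fin N → ℝ) (a b : Fin N) :
    herm u a b = if a = b then (u a a : ℂ)
      else if a < b then (u a b : ℂ) + Complex.I * (u b a : ℂ)
      else (u b a : ℂ) - Complex.I * (u a b : ℂ) := rfl

/-- The real coordinates of six Hermitian matrices. -/
abbrev Coords (N : ℕ) := Fin 6 → Fin N → Fin N → ℝ

instance : (volume : Measure (Coords N)).IsAddHaarMeasure := by
  have h0 := isAddHaarMeasure_volume_pi (Fin N)
  have h1 : (volume : Measure (Fin N → Fin N → ℝ)).IsAddHaarMeasure :=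
    Measure.pi.isAddHaarMeasure fun _ : Fin N => (volume : Measure (Fin N → ℝ))
  exact Measure.pi.isAddHaarMeasure fun _ : Fin 6 => (volume : Measure (Fin N → Fin N → ℝ))

/-- The entries of the six matrices, as linear functions of the real coordinates. -/
def entries (N : ℕ) : Coords N →ₗ[ℝ] (Fin 6 × Fin N × Fin N → ℂ) where
  toFun u := fun e => herm (u e.1) e.2.1 e.2.2
  map_add' u v := by
    ext e
    simp only [herm_apply, Pi.add_apply]
    split_ifs <;> push_cast <;> ring
  map_smul' r u := by
    ext e
    simp only [herm_apply, Pi.smul_apply, smul_eq_mul, RingHom.id_apply, Complex.real_smul]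
    split_ifs <;> push_cast <;> ring

theorem entries_apply (u : Coords N) (e) : entries N u e = herm (u e.1) e.2.1 e.2.2 := rfl

/-- Polynomials in the entries of the six matrices. -/
abbrev EntryPoly (N : ℕ) := MvPolynomial (Fin 6 × Fin N × Fin N) ℂ

/-- The value of a polynomial in the entries at a point of the integration domain. -/
def polyVal (P : EntryPoly N) (u : Coords N) : ℂ := MvPolynomial.eval (entries N u) P

/-- The polynomial `∑_c tr M_c ^ 2`. -/
def actionPoly (N : ℕ) : EntryPoly N :=
  ∑ e : Fin 6 × Fin N × Fin N, MvPolynomial.X e * MvPolynomial.X (e.1, e.2.2, e.2.1)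

theorem gaussWeight_eq (u : Coords N) :
    gaussWeight (fun c => herm (u c)) =
      Complex.exp (-((N : ℂ) / 2) * polyVal (actionPoly N) u) := by
  rw [gaussWeight, polyVal, actionPoly, map_sum, Fintype.sum_prod_type]
  simp only [Fintype.sum_prod_type, map_mul, MvPolynomial.eval_X, entries_apply, Matrix.trace,
    Matrix.diag, pow_two, Matrix.mul_apply]

theorem herm_conj (u : Fin N → Fin N → ℝ) (a b : Fin N) :
    herm u b a = (starRingEnd ℂ) (herm u a b) := by
  simp only [herm_apply]
  rcases lt_trichotomy a b with h | h | h
  · rw [if_neg h.ne', if_neg h.not_gt, if_neg h.ne, if_pos h]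
    simp [sub_eq_add_neg]
  · subst h; simp
  · rw [if_neg h.ne, if_pos h, if_neg h.ne', if_neg h.not_gt]
    simp

theorem exists_entries_eq (H : Fin 6 × Fin N × Fin N → ℂ)
    (hH : ∀ c a b, H (c, b, a) = (starRingEnd ℂ) (H (c, a, b))) : ∃ u, entries N u = H := by
  refine ⟨fun c a b => if a ≤ b then (H (c, a, b)).re else (H (c, b, a)).im, ?_⟩
  ext ⟨c, a, b⟩
  simp only [entries_apply, herm_apply]
  rcases lt_trichotomy a b with h | h | h
  · rw [if_neg h.ne, if_pos h, if_pos h.le, if_neg h.not_ge, mul_comm, Complex.re_add_im]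
  · subst h
    rw [if_pos rfl, if_pos le_rfl]
    exact Complex.conj_eq_iff_re.1 (hH c a a).symm
  · rw [if_neg h.ne', if_neg h.not_gt, if_pos h.le, if_neg h.not_ge, hH c b a]
    apply Complex.ext <;> simp

theorem abs_le_norm_entry (u : Coords N) (c a b) : |u c a b| ≤ ‖entries N u (c, a, b)‖ := by
  simp only [entries_apply, herm_apply]
  rcases lt_trichotomy a b with h | h | h
  · rw [if_neg h.ne, if_pos h]
    refine le_trans (le_of_eq ?_) (Complex.abs_re_le_norm _)
    simp
  · subst h; simp
  · rw [if_neg h.ne', if_neg h.not_gt]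
    refine le_trans (le_of_eq ?_) (Complex.abs_im_le_norm _)
    simp

theorem norm_entry_le (u : Coords N) (e) : ‖entries N u e‖ ≤ 2 * ‖u‖ := by
  have hu : ∀ c a b, ‖(u c a b : ℂ)‖ ≤ ‖u‖ := fun c a b => by
    rw [Complex.norm_real]
    exact (norm_le_pi_norm (u c a) b).trans ((norm_le_pi_norm (u c) a).trans (norm_le_pi_norm u c))
  simp only [entries_apply, herm_apply]
  split_ifs with h1 h2
  · exact (hu _ _ _).trans (by linarith [norm_nonneg u])
  · refine (norm_add_le _ _).trans ?_
    rw [norm_mul, Complex.norm_I, one_mul]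
    linarith [hu e.1 e.2.1 e.2.2, hu e.1 e.2.2 e.2.1]
  · refine (norm_sub_le _ _).trans ?_
    rw [norm_mul, Complex.norm_I, one_mul]
    linarith [hu e.1 e.2.1 e.2.2, hu e.1 e.2.2 e.2.1]

theorem polyVal_action (u : Coords N) :
    polyVal (actionPoly N) u = ((∑ e, ‖entries N u e‖ ^ 2 : ℝ) : ℂ) := by
  rw [polyVal, actionPoly, map_sum]
  push_cast
  refine Finset.sum_congr rfl fun e _ => ?_
  rw [map_mul, MvPolynomial.eval_X, MvPolynomial.eval_X, entries_apply, entries_apply]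
  dsimp only
  rw [herm_conj (u e.1) e.2.1 e.2.2, Complex.mul_conj']

/-- Each real coordinate is bounded by the norm of a matrix entry, and `∑_c tr M_c ^ 2` is the sum
of the squares of these norms. -/
theorem sq_norm_le_action (u : Coords N) : ‖u‖ ^ 2 ≤ ∑ e, ‖entries N u e‖ ^ 2 := by
  set A := ∑ e, ‖entries N u e‖ ^ 2
  have hA : 0 ≤ A := Finset.sum_nonneg fun e _ => by positivity
  have h : ‖u‖ ≤ Real.sqrt A := by
    refine (pi_norm_le_iff_of_nonneg (Real.sqrt_nonneg _)).2 fun c =>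
      (pi_norm_le_iff_of_nonneg (Real.sqrt_nonneg _)).2 fun a =>
        (pi_norm_le_iff_of_nonneg (Real.sqrt_nonneg _)).2 fun b => ?_
    refine Real.le_sqrt_of_sq_le ?_
    have h1 : ‖u c a b‖ ^ 2 ≤ ‖entries N u (c, a, b)‖ ^ 2 := by
      have := abs_le_norm_entry u c a b
      rw [Real.norm_eq_abs]
      gcongr
    exact h1.trans (Finset.single_le_sum (f := fun e => ‖entries N u e‖ ^ 2)
      (fun e _ => by positivity) (Finset.mem_univ _))
  calc ‖u‖ ^ 2 ≤ Real.sqrt A ^ 2 := by gcongr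
    _ = A := Real.sq_sqrt hA

/-- Polynomials in the entries grow polynomially in the coordinates. -/
theorem polyVal_growth (P : EntryPoly N) :
    ∃ (C : ℝ) (d : ℕ), ∀ u, ‖polyVal P u‖ ≤ C * (1 + ‖u‖) ^ d := by
  induction P using MvPolynomial.induction_on with
  | C a => exact ⟨‖a‖, 0, fun u => by simp [polyVal]⟩
  | add p q hp hq =>
    obtain ⟨C, d, h⟩ := hp
    obtain ⟨C', d', h'⟩ := hq
    refine ⟨|C| + |C'|, d + d', fun u => ?_⟩
    have h1 : (1 : ℝ) ≤ 1 + ‖u‖ := by linarith [norm_nonneg u]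
    have e1 := pow_le_pow_right₀ h1 (Nat.le_add_right d d')
    have e2 := pow_le_pow_right₀ h1 (Nat.le_add_left d' d)
    have p1 : 0 ≤ (1 + ‖u‖) ^ d := by positivity
    have p2 : 0 ≤ (1 + ‖u‖) ^ d' := by positivity
    have : polyVal (p + q) u = polyVal p u + polyVal q u := by simp [polyVal]
    rw [this, add_mul]
    refine (norm_add_le _ _).trans (add_le_add ((h u).trans ?_) ((h' u).trans ?_))
    · exact mul_le_mul (le_abs_self _) e1 p1 (abs_nonneg _)
    · exact mul_le_mul (le_abs_self _) e2 p2 (abs_nonneg _)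
  | mul_X p e hp =>
    obtain ⟨C, d, h⟩ := hp
    refine ⟨|C| * 2, d + 1, fun u => ?_⟩
    have : polyVal (p * MvPolynomial.X e) u = polyVal p u * entries N u e := by simp [polyVal]
    rw [this, norm_mul, pow_succ]
    have p1 : 0 ≤ (1 + ‖u‖) ^ d := by positivity
    calc ‖polyVal p u‖ * ‖entries N u e‖
        ≤ (|C| * (1 + ‖u‖) ^ d) * (2 * (1 + ‖u‖)) := by
          refine mul_le_mul ((h u).trans (mul_le_mul_of_nonneg_right (le_abs_self C) p1))
            ((norm_entry_le u e).trans (by linarith)) (norm_nonneg _) (by positivity)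
      _ = _ := by ring

theorem continuous_polyVal (P : EntryPoly N) : Continuous (polyVal P) := by
  have : Continuous (entries N) := LinearMap.continuous_of_finiteDimensional _
  exact (MvPolynomial.continuous_eval P).comp this

/-- The Gaussian weight as a function of the real coordinates. -/
def weight (u : Coords N) : ℂ := Complex.exp (-((N : ℂ) / 2) * polyVal (actionPoly N) u)

theorem continuous_weight : Continuous (weight (N := N)) :=
  Complex.continuous_exp.comp (continuous_const.mul (continuous_polyVal _))

theorem weight_eq_ofReal (u : Coords N) :
    weight u = ((Real.exp (-((N : ℝ) / 2) * ∑ e, ‖entries N u e‖ ^ 2) : ℝ) : ℂ) := by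
  rw [weight, polyVal_action]; push_cast; rfl

theorem norm_weight_le (hN : 1 ≤ N) (u : Coords N) : ‖weight u‖ ≤ Real.exp (-(‖u‖ ^ 2 / 2)) := by
  rw [weight_eq_ofReal, Complex.norm_real, Real.norm_eq_abs, Real.abs_exp]
  apply Real.exp_le_exp.2
  have h := sq_norm_le_action u
  have h1 : (1 : ℝ) ≤ N := by exact_mod_cast hN
  nlinarith [sq_nonneg ‖u‖]

/-- The Gaussian weight decays faster than any polynomial grows: the product is at most a constant
times `(1 + ‖u‖) ^ (-r)`, where `r` exceeds the dimension. -/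
theorem integrable_polyVal_weight (hN : 1 ≤ N) (P : EntryPoly N) :
    Integrable fun u => polyVal P u * weight u := by
  obtain ⟨C, d, hC⟩ := polyVal_growth P
  set r := Module.finrank ℝ (Coords N) + 1
  have hint : Integrable fun u : Coords N => (1 + ‖u‖) ^ (-(r : ℝ)) :=
    integrable_one_add_norm (by simp [r])
  refine (hint.const_mul (|C| * ((d + r)! * Real.exp (3 / 2)))).mono'
    ((continuous_polyVal P).mul continuous_weight).aestronglyMeasurable
    (Filter.Eventually.of_forall fun u => ?_)
  set t := ‖u‖
  have ht : 0 ≤ t := norm_nonneg u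
  have h1 : (0 : ℝ) < 1 + t := by linarith
  rw [norm_mul, Real.rpow_neg h1.le, Real.rpow_natCast]
  have h2 : (1 + t) ^ (d + r) ≤ (d + r)! * Real.exp (1 + t) := by
    have := Real.pow_div_factorial_le_exp (1 + t) h1.le (d + r)
    rwa [div_le_iff₀ (by positivity), mul_comm] at this
  -- `1 + t - t ^ 2 / 2 ≤ 3 / 2`
  have h3 : Real.exp (1 + t) * Real.exp (-(t ^ 2 / 2)) ≤ Real.exp (3 / 2) := by
    rw [← Real.exp_add]
    exact Real.exp_le_exp.2 (by nlinarith [sq_nonneg (t - 1)])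
  have h4 : (1 + t) ^ d * Real.exp (-(t ^ 2 / 2)) ≤
      ((d + r)! * Real.exp (3 / 2)) * ((1 + t) ^ r)⁻¹ := by
    rw [← div_eq_mul_inv, le_div_iff₀ (by positivity)]
    calc (1 + t) ^ d * Real.exp (-(t ^ 2 / 2)) * (1 + t) ^ r
        = (1 + t) ^ (d + r) * Real.exp (-(t ^ 2 / 2)) := by ring
      _ ≤ ((d + r)! * Real.exp (1 + t)) * Real.exp (-(t ^ 2 / 2)) := by gcongr
      _ = (d + r)! * (Real.exp (1 + t) * Real.exp (-(t ^ 2 / 2))) := by ring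
      _ ≤ _ := by gcongr
  calc ‖polyVal P u‖ * ‖weight u‖
      ≤ (|C| * (1 + t) ^ d) * Real.exp (-(t ^ 2 / 2)) := by
        refine mul_le_mul ((hC u).trans (mul_le_mul_of_nonneg_right (le_abs_self C)
          (by positivity))) (norm_weight_le hN u) (norm_nonneg _) (by positivity)
    _ = |C| * ((1 + t) ^ d * Real.exp (-(t ^ 2 / 2))) := by ring
    _ ≤ |C| * (((d + r)! * Real.exp (3 / 2)) * ((1 + t) ^ r)⁻¹) := by gcongr
    _ = _ := by ring

theorem hasLineDerivAt_polyVal (P : EntryPoly N) (u v : Coords N) :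
    HasLineDerivAt ℝ (polyVal P)
      (∑ e, polyVal (MvPolynomial.pderiv e P) u * entries N v e) u v := by
  have hz : u + (0 : ℝ) • v = u := by ext; simp
  unfold HasLineDerivAt
  induction P using MvPolynomial.induction_on with
  | C a =>
    simp only [polyVal, MvPolynomial.eval_C, MvPolynomial.pderiv_C, map_zero, zero_mul,
      Finset.sum_const_zero]
    exact hasDerivAt_const _ _
  | add p q hp hq =>
    have := hp.add hq
    convert this using 1
    · ext t; simp [polyVal]
    · rw [← Finset.sum_add_distrib]
      exact Finset.sum_congr rfl fun e _ => by simp [polyVal, add_mul]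
  | mul_X p e hp =>
    have h1 : HasDerivAt (fun t : ℝ => entries N (u + t • v) e) (entries N v e) 0 := by
      have : (fun t : ℝ => entries N (u + t • v) e) =
          fun t : ℝ => entries N u e + (t : ℂ) * entries N v e := by
        ext t; simp
      rw [this]
      have h2 : HasDerivAt (fun t : ℝ => (t : ℂ)) 1 0 := Complex.ofRealCLM.hasDerivAt
      simpa using (h2.mul_const (entries N v e)).const_add (entries N u e)
    have hf : (fun t : ℝ => polyVal (p * MvPolynomial.X e) (u + t • v)) =
        (fun t : ℝ => polyVal p (u + t • v)) * fun t => entries N (u + t • v) e := by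
      ext t; simp [polyVal]
    rw [hf]
    refine (hp.mul h1).congr_deriv ?_
    · rw [hz, Finset.sum_mul]
      have h2 : ∀ e', polyVal (MvPolynomial.pderiv e' (p * MvPolynomial.X e)) u * entries N v e' =
          polyVal (MvPolynomial.pderiv e' p) u * entries N v e' * entries N u e +
            (if e' = e then polyVal p u * entries N v e else 0) := by
        intro e'
        rw [Derivation.leibniz, MvPolynomial.pderiv_X]
        by_cases h : e' = e
        · subst h
          simp [polyVal]; ring
        · rw [if_neg h, Pi.single_eq_of_ne (Ne.symm h)]
          simp [polyVal]; ring
      rw [Finset.sum_congr rfl fun e' _ => h2 e', Finset.sum_add_distrib]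
      simp

theorem pderiv_action (e : Fin 6 × Fin N × Fin N) :
    MvPolynomial.pderiv e (actionPoly N) = 2 * MvPolynomial.X (e.1, e.2.2, e.2.1) := by
  obtain ⟨c, a, b⟩ := e
  rw [actionPoly, map_sum]
  have : ∀ e : Fin 6 × Fin N × Fin N, MvPolynomial.pderiv (c, a, b)
      (MvPolynomial.X e * MvPolynomial.X (e.1, e.2.2, e.2.1) : EntryPoly N) =
      (if e = (c, b, a) then MvPolynomial.X e else 0) +
        (if e = (c, a, b) then MvPolynomial.X (e.1, e.2.2, e.2.1) else 0) := by
    intro e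
    obtain ⟨c', a', b'⟩ := e
    rw [Derivation.leibniz, MvPolynomial.pderiv_X, MvPolynomial.pderiv_X]
    simp only [smul_eq_mul, Pi.single_apply, Prod.mk.injEq, mul_ite, mul_one, mul_zero]
    congr 1
    · congr 1; apply propext; tauto
  rw [Finset.sum_congr rfl fun e _ => this e, Finset.sum_add_distrib]
  simp [two_mul]

theorem hasLineDerivAt_weight (u v : Coords N) :
    HasLineDerivAt ℝ weight
      (-(N : ℂ) * (∑ e, entries N u (e.1, e.2.2, e.2.1) * entries N v e) * weight u) u v := by
  have hz : u + (0 : ℝ) • v = u := by ext; simp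
  have h := hasLineDerivAt_polyVal (actionPoly N) u v
  unfold HasLineDerivAt at h ⊢
  have h2 := (h.const_mul (-((N : ℂ) / 2))).cexp
  refine h2.congr_deriv ?_
  simp only [pderiv_action]
  rw [hz, mul_comm, weight]
  congr 1
  have : ∀ e : Fin 6 × Fin N × Fin N,
      polyVal (2 * MvPolynomial.X (e.1, e.2.2, e.2.1)) u * entries N v e =
        2 * (entries N u (e.1, e.2.2, e.2.1) * entries N v e) := by
    intro e; simp [polyVal]; ring
  rw [Finset.sum_congr rfl fun e _ => this e, ← Finset.mul_sum]
  ring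

/-- The Gaussian integral of a polynomial in the entries. -/
def gaussInt (P : EntryPoly N) : ℂ := ∫ u, polyVal P u * weight u

theorem gaussInt_add (hN : 1 ≤ N) (P Q : EntryPoly N) :
    gaussInt (P + Q) = gaussInt P + gaussInt Q := by
  rw [gaussInt, gaussInt, gaussInt, ← integral_add (integrable_polyVal_weight hN P)
    (integrable_polyVal_weight hN Q)]
  simp only [polyVal, map_add, add_mul]

theorem gaussInt_C_mul (a : ℂ) (P : EntryPoly N) :
    gaussInt (MvPolynomial.C a * P) = a * gaussInt P := by
  rw [gaussInt, gaussInt, ← integral_const_mul]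
  simp only [polyVal, map_mul, MvPolynomial.eval_C, mul_assoc]

theorem gaussInt_sum (hN : 1 ≤ N) {γ : Type*} (t : Finset γ) (P : γ → EntryPoly N) :
    gaussInt (∑ a ∈ t, P a) = ∑ a ∈ t, gaussInt (P a) := by
  classical
  induction t using Finset.induction with
  | empty => simp [gaussInt, polyVal]
  | insert a t ha ih => rw [Finset.sum_insert ha, Finset.sum_insert ha, gaussInt_add hN, ih]

/-- Integration by parts along a direction in the space of Hermitian matrices. -/
theorem gaussInt_by_parts_dir (hN : 1 ≤ N) (P : EntryPoly N) (v : Coords N) :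
    ∑ e, ((N : ℂ) * gaussInt (P * MvPolynomial.X (e.1, e.2.2, e.2.1)) -
      gaussInt (MvPolynomial.pderiv e P)) * entries N v e = 0 := by
  have h1 : ∀ u, ContinuousLinearMap.mul ℝ ℂ (polyVal P u)
      (-(N : ℂ) * (∑ e, entries N u (e.1, e.2.2, e.2.1) * entries N v e) * weight u) =
      polyVal (∑ e, MvPolynomial.C (-(N : ℂ) * entries N v e) *
        (P * MvPolynomial.X (e.1, e.2.2, e.2.1))) u * weight u := by
    intro u
    simp only [ContinuousLinearMap.mul_apply', polyVal, map_sum, map_mul, MvPolynomial.eval_C,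
      MvPolynomial.eval_X]
    rw [← mul_assoc]
    congr 1
    rw [Finset.mul_sum, Finset.mul_sum]
    exact Finset.sum_congr rfl fun e _ => by ring
  have h2 : ∀ u, ContinuousLinearMap.mul ℝ ℂ
      (∑ e, polyVal (MvPolynomial.pderiv e P) u * entries N v e) (weight u) =
      polyVal (∑ e, MvPolynomial.C (entries N v e) * MvPolynomial.pderiv e P) u * weight u := by
    intro u
    rw [ContinuousLinearMap.mul_apply']
    simp only [polyVal, map_sum, map_mul, MvPolynomial.eval_C]
    congr 1
    exact Finset.sum_congr rfl fun e _ => by ring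
  have key := integral_bilinear_hasLineDerivAt_right_eq_neg_left_of_integrable (μ := volume)
    (B := ContinuousLinearMap.mul ℝ ℂ) (f := polyVal P) (g := weight) (v := v)
    (f' := fun u => ∑ e, polyVal (MvPolynomial.pderiv e P) u * entries N v e)
    (g' := fun u => -(N : ℂ) * (∑ e, entries N u (e.1, e.2.2, e.2.1) * entries N v e) * weight u)
    (by simp only [h2]; exact integrable_polyVal_weight hN _)
    (by simp only [h1]; exact integrable_polyVal_weight hN _)
    (by exact integrable_polyVal_weight hN _)
    (fun u _ => hasLineDerivAt_polyVal P u v) (fun u _ => hasLineDerivAt_weight u v)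
  simp only [h1, h2] at key
  change gaussInt _ = - gaussInt _ at key
  rw [gaussInt_sum hN, gaussInt_sum hN] at key
  simp only [gaussInt_C_mul] at key
  rw [eq_neg_iff_add_eq_zero, ← Finset.sum_add_distrib] at key
  rw [← neg_eq_zero, ← key, ← Finset.sum_neg_distrib]
  exact Finset.sum_congr rfl fun e _ => by ring

/-- The Schwinger–Dyson equation of a single matrix entry: since the Hermitian matrices span all
matrices over `ℂ`, the directions of integration by parts may be complexified. -/
theorem gaussInt_by_parts (hN : 1 ≤ N) (P : EntryPoly N) (c : Fin 6) (a b : Fin N) :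
    (N : ℂ) * gaussInt (P * MvPolynomial.X (c, a, b)) =
      gaussInt (MvPolynomial.pderiv (c, b, a) P) := by
  set K : Fin 6 × Fin N × Fin N → ℂ := fun e =>
    (N : ℂ) * gaussInt (P * MvPolynomial.X (e.1, e.2.2, e.2.1)) -
      gaussInt (MvPolynomial.pderiv e P) with hK
  have herm_zero : ∀ H : Fin 6 × Fin N × Fin N → ℂ,
      (∀ c a b, H (c, b, a) = (starRingEnd ℂ) (H (c, a, b))) → ∑ e, K e * H e = 0 := by
    intro H hH
    obtain ⟨u, rfl⟩ := exists_entries_eq H hH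
    exact gaussInt_by_parts_dir hN P u
  set δ : Fin 6 × Fin N × Fin N → Fin 6 × Fin N × Fin N → ℂ := fun e e' => if e' = e then 1 else 0
  have hδ : ∀ a b c' a' b', δ (c, a, b) (c', b', a') = δ (c, b, a) (c', a', b') := by
    intro a b c' a' b'
    simp only [δ, Prod.mk.injEq]
    congr 1; apply propext; tauto
  have hreal : ∀ e e', (starRingEnd ℂ) (δ e e') = δ e e' := by
    intro e e'; simp only [δ]; split_ifs <;> simp
  -- with `δ` the matrix unit at `(b, a)`, both `δ + δᵀ` and `i (δ - δᵀ)` are Hermitian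
  have h1 := herm_zero (fun e' => δ (c, b, a) e' + δ (c, a, b) e') fun c' a' b' => by
    rw [map_add, hreal, hreal, hδ a b, hδ b a, add_comm]
  have h2 := herm_zero (fun e' => Complex.I * (δ (c, b, a) e' - δ (c, a, b) e')) fun c' a' b' => by
    rw [map_mul, map_sub, hreal, hreal, hδ a b, hδ b a, Complex.conj_I]; ring
  have h3 : ∑ e, K e * δ (c, b, a) e = 0 := by
    have e1 : ∑ e, K e * (δ (c, b, a) e + δ (c, a, b) e) =
        ∑ e, K e * δ (c, b, a) e + ∑ e, K e * δ (c, a, b) e := by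
      rw [← Finset.sum_add_distrib]; exact Finset.sum_congr rfl fun e _ => by ring
    have e2 : ∑ e, K e * (Complex.I * (δ (c, b, a) e - δ (c, a, b) e)) =
        Complex.I * (∑ e, K e * δ (c, b, a) e - ∑ e, K e * δ (c, a, b) e) := by
      rw [← Finset.sum_sub_distrib, Finset.mul_sum]
      exact Finset.sum_congr rfl fun e _ => by ring
    rw [e1] at h1
    rw [e2] at h2
    have h4 := (mul_eq_zero.1 h2).resolve_left Complex.I_ne_zero
    linear_combination (h1 + h4) / 2
  simp only [δ, mul_ite, mul_one, mul_zero, Finset.sum_ite_eq', Finset.mem_univ, if_true] at h3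
  exact sub_eq_zero.1 h3

theorem gaussInt_one_ne_zero (hN : 1 ≤ N) : gaussInt (1 : EntryPoly N) ≠ 0 := by
  have hW : (fun u : Coords N => polyVal (1 : EntryPoly N) u * weight u) = fun u =>
      ((Real.exp (-((N : ℝ) / 2) * ∑ e, ‖entries N u e‖ ^ 2) : ℝ) : ℂ) := by
    ext u; rw [weight_eq_ofReal]; simp [polyVal]
  have hint := integrable_polyVal_weight hN (1 : EntryPoly N)
  rw [hW] at hint
  have hI : gaussInt (1 : EntryPoly N) = ((∫ u : Coords N,
      Real.exp (-((N : ℝ) / 2) * ∑ e, ‖entries N u e‖ ^ 2) : ℝ) : ℂ) := by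
    rw [gaussInt, hW]
    exact integral_ofReal
  rw [hI]
  have hr : Integrable fun u : Coords N =>
      Real.exp (-((N : ℝ) / 2) * ∑ e, ‖entries N u e‖ ^ 2) := by
    exact hint.re
  exact_mod_cast (integral_exp_pos hr).ne'

/-- Expectation value of a polynomial in the entries. -/
theorem gaussE_eq (F : Matrices N → ℂ) (P : EntryPoly N)
    (hF : ∀ u : Coords N, F (fun c => herm (u c)) = polyVal P u) :
    gaussE N F = gaussInt P / gaussInt (1 : EntryPoly N) := by
  rw [gaussE, gaussInt, gaussInt]
  simp only [hF, gaussWeight_eq]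
  simp only [polyVal, map_one, one_mul]
  rfl

end gaussian
end QuarticTensor

namespace QuarticTensor

/-! ### Schwinger–Dyson equations for products of traces -/

section traces

variable {N : ℕ}

/-- The generic matrix of color `c`. -/
def genMat (N : ℕ) (c : Fin 6) : Matrix (Fin N) (Fin N) (EntryPoly N) :=
  Matrix.of fun a b => MvPolynomial.X (c, a, b)

theorem genMat_apply (c : Fin 6) (a b : Fin N) : genMat N c a b = MvPolynomial.X (c, a, b) := rfl

/-- The trace `tr M_c ^ p`, for the label `(c, p)`, as a polynomial in the entries. -/
def trPoly (N : ℕ) (b : Fin 6 × ℕ) : EntryPoly N := (genMat N b.1 ^ b.2).trace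

theorem polyVal_trPoly (b : Fin 6 × ℕ) (u : Coords N) :
    polyVal (trPoly N b) u = (herm (u b.1) ^ b.2).trace := by
  have h1 : (MvPolynomial.eval (entries N u)).mapMatrix (genMat N b.1) = herm (u b.1) := by
    ext a c
    simp [genMat_apply, entries_apply]
  rw [← h1, ← map_pow, polyVal, trPoly]
  simp [Matrix.trace, map_sum]

/-- The noncommutative Leibniz rule for powers of a matrix. -/
theorem derivation_pow_apply (d : Derivation ℂ (EntryPoly N) (EntryPoly N))
    (M : Matrix (Fin N) (Fin N) (EntryPoly N)) (p : ℕ) :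
    (M ^ p).map d = ∑ k ∈ range p, M ^ k * M.map d * M ^ (p - 1 - k) := by
  have hmul : ∀ A B : Matrix (Fin N) (Fin N) (EntryPoly N),
      (A * B).map d = A.map d * B + A * B.map d := by
    intro A B
    ext1 a b
    simp only [Matrix.map_apply, Matrix.mul_apply, Matrix.add_apply, map_sum, Derivation.leibniz,
      smul_eq_mul, ← Finset.sum_add_distrib]
    exact Finset.sum_congr rfl fun c _ => by ring
  induction p with
  | zero =>
    ext1 a b
    rw [pow_zero, Matrix.map_apply, Matrix.one_apply]
    split_ifs <;> simp
  | succ p ih =>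
    rw [pow_succ, hmul, ih, Finset.sum_range_succ, Finset.sum_mul]
    refine congrArg₂ (· + ·) ?_ ?_
    · refine Finset.sum_congr rfl fun k hk => ?_
      have hk' := Finset.mem_range.1 hk
      rw [Matrix.mul_assoc, ← pow_succ]
      congr 2
      omega
    · simp

/-- The vector field `M_i ↦ M_i ^ p` on the space of matrices, as a derivation. -/
def matField (N : ℕ) (i : Fin 6) (p : ℕ) : Derivation ℂ (EntryPoly N) (EntryPoly N) :=
  ∑ e : Fin N × Fin N, (genMat N i ^ p) e.1 e.2 • MvPolynomial.pderiv (i, e.1, e.2)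

theorem matField_apply (i : Fin 6) (p : ℕ) (P : EntryPoly N) :
    matField N i p P =
      ∑ e : Fin N × Fin N, (genMat N i ^ p) e.1 e.2 * MvPolynomial.pderiv (i, e.1, e.2) P := by
  have := map_sum (Derivation.coeFnAddMonoidHom (R := ℂ) (A := EntryPoly N) (M := EntryPoly N))
    (fun e : Fin N × Fin N => (genMat N i ^ p) e.1 e.2 • MvPolynomial.pderiv (i, e.1, e.2))
    Finset.univ
  have h2 := congrFun this P
  rw [Finset.sum_apply] at h2
  exact h2

theorem matField_trPoly (i : Fin 6) (p : ℕ) (b : Fin 6 × ℕ) :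
    matField N i p (trPoly N b) =
      (if b.1 = i then (b.2 : EntryPoly N) else 0) * trPoly N (i, b.2 + p - 1) := by
  obtain ⟨c, q⟩ := b
  have h1 : (genMat N c).map (matField N i p) = if c = i then genMat N i ^ p else 0 := by
    ext1 a b
    rw [Matrix.map_apply, genMat_apply, matField_apply]
    simp only [MvPolynomial.pderiv_X, Pi.single_apply, mul_ite, mul_one, mul_zero, Prod.mk.injEq]
    by_cases hc : c = i
    · subst hc
      rw [if_pos rfl, Finset.sum_eq_single (a, b)]
      · simp
      · rintro ⟨a', b'⟩ _ hne
        rw [if_neg]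
        rintro ⟨_, h1, h2⟩
        exact hne (by rw [h1, h2])
      · simp
    · rw [if_neg hc]
      simp [hc]
  have h2 : matField N i p (trPoly N (c, q)) = ((genMat N c ^ q).map (matField N i p)).trace := by
    rw [trPoly, Matrix.trace, map_sum]; rfl
  rw [h2, derivation_pow_apply, h1]
  dsimp only
  by_cases hc : c = i
  · subst hc
    rw [if_pos rfl, if_pos rfl]
    have : ∀ k ∈ range q, genMat N c ^ k * genMat N c ^ p * genMat N c ^ (q - 1 - k) =
        genMat N c ^ (q + p - 1) := by
      intro k hk
      have := Finset.mem_range.1 hk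
      rw [← pow_add, ← pow_add]
      congr 1
      omega
    rw [Finset.sum_congr rfl this, Finset.sum_const, Finset.card_range, Matrix.trace_smul, trPoly,
      nsmul_eq_mul]
  · rw [if_neg hc, if_neg hc]
    simp

/-- The divergence of the vector field `M_i ↦ M_i ^ p`. -/
theorem sum_pderiv_pow (i : Fin 6) (p : ℕ) :
    ∑ e : Fin N × Fin N, MvPolynomial.pderiv (i, e.1, e.2) ((genMat N i ^ p) e.1 e.2) =
      ∑ k ∈ range p, trPoly N (i, k) * trPoly N (i, p - 1 - k) := by
  have h1 : ∀ e : Fin N × Fin N,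
      (genMat N i).map (MvPolynomial.pderiv (R := ℂ) (i, e.1, e.2)) = Matrix.single e.1 e.2 1 := by
    intro e
    ext1 a b
    rw [Matrix.map_apply, genMat_apply, MvPolynomial.pderiv_X, Pi.single_apply, Matrix.single_apply]
    simp only [Prod.mk.injEq, true_and]
    congr 1; apply propext; constructor <;> (rintro ⟨h, h'⟩; exact ⟨h.symm, h'.symm⟩)
  have h2 : ∀ e : Fin N × Fin N, MvPolynomial.pderiv (i, e.1, e.2) ((genMat N i ^ p) e.1 e.2) =
      ∑ k ∈ range p, (genMat N i ^ k) e.1 e.1 * (genMat N i ^ (p - 1 - k)) e.2 e.2 := by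
    intro e
    have h3 := congrFun (congrFun (derivation_pow_apply (MvPolynomial.pderiv (i, e.1, e.2))
      (genMat N i) p) e.1) e.2
    rw [Matrix.map_apply] at h3
    rw [h3, Matrix.sum_apply]
    refine Finset.sum_congr rfl fun k _ => ?_
    rw [h1]
    simp [Matrix.mul_apply, Matrix.single_apply, Finset.sum_ite_eq, ite_and]
  rw [Finset.sum_congr rfl fun e _ => h2 e, Finset.sum_comm]
  refine Finset.sum_congr rfl fun k _ => ?_
  rw [Fintype.sum_prod_type, trPoly, trPoly, Matrix.trace, Matrix.trace, Finset.sum_mul_sum]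
  rfl

/-- The normalized Gaussian expectation value, as a linear functional. -/
def gaussLin (hN : 1 ≤ N) : EntryPoly N →ₗ[ℂ] ℂ where
  toFun P := gaussInt P / gaussInt (1 : EntryPoly N)
  map_add' P Q := by rw [gaussInt_add hN, add_div]
  map_smul' a P := by
    rw [MvPolynomial.smul_eq_C_mul, gaussInt_C_mul, RingHom.id_apply, smul_eq_mul, mul_div_assoc]

theorem gaussLin_one (hN : 1 ≤ N) : gaussLin hN 1 = 1 := div_self (gaussInt_one_ne_zero hN)

/-- The Schwinger–Dyson equation of the vector field `M_i ↦ M_i ^ p`. -/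
theorem schwingerDyson (hN : 1 ≤ N) (i : Fin 6) (p : ℕ) (G : EntryPoly N) :
    (N : ℂ) * gaussLin hN (trPoly N (i, p + 1) * G) =
      gaussLin hN ((∑ k ∈ range p, trPoly N (i, k) * trPoly N (i, p - 1 - k)) * G +
        matField N i p G) := by
  have h1 : trPoly N (i, p + 1) * G = ∑ e : Fin N × Fin N,
      ((genMat N i ^ p) e.1 e.2 * G) * MvPolynomial.X (i, e.2, e.1) := by
    rw [trPoly, pow_succ, Matrix.trace, Fintype.sum_prod_type, Finset.sum_mul]
    refine Finset.sum_congr rfl fun a _ => ?_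
    rw [Matrix.diag, Matrix.mul_apply, Finset.sum_mul]
    exact Finset.sum_congr rfl fun b _ => by rw [genMat_apply]; ring
  have h2 : (∑ k ∈ range p, trPoly N (i, k) * trPoly N (i, p - 1 - k)) * G + matField N i p G =
      ∑ e : Fin N × Fin N, MvPolynomial.pderiv (i, e.1, e.2) ((genMat N i ^ p) e.1 e.2 * G) := by
    rw [← sum_pderiv_pow, matField_apply, Finset.sum_mul, ← Finset.sum_add_distrib]
    refine Finset.sum_congr rfl fun e _ => ?_
    rw [Derivation.leibniz, smul_eq_mul, smul_eq_mul]
    ring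
  rw [h1, h2, map_sum, map_sum, Finset.mul_sum]
  refine Finset.sum_congr rfl fun e _ => ?_
  have := gaussInt_by_parts hN ((genMat N i ^ p) e.1 e.2 * G) i e.2 e.1
  change (N : ℂ) * (gaussInt _ / _) = gaussInt _ / _
  rw [← this, mul_div_assoc]

end traces

/-! ### The interaction and its exponential -/

/-- The coefficient of `x ^ {b_i} ∏_{c ≠ i} tr M_c ^ {b_c}` in the derivative with respect to the
`i`-th matrix of the interaction; in the notation of `tTilde`, it is `- a_i t̃_a` with
`a = b + e_i`. -/
def vert (α : Fin 6 → ℂ) (i : Fin 6) (b : Fin 6 → ℕ) : ℂ :=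
  α i * (∏ c, α c ^ b c) * (Nat.multinomial univ b : ℂ)

/-- The factor `a_i` turns the multinomial coefficient of `a`, divided by `∑_c a_c`, into that of
`b = a - e_i`. -/
theorem tTilde_add_single (α : Fin 6 → ℂ) (i : Fin 6) (b : Fin 6 → ℕ) :
    -(tTilde α (b + Pi.single i 1)) * (((b + Pi.single i 1 : Fin 6 → ℕ) i : ℕ) : ℂ) =
      vert α i b := by
  have hs : ∑ c, (b + Pi.single i 1 : Fin 6 → ℕ) c = ∑ c, b c + 1 := by
    simp [Finset.sum_add_distrib]
  have hp : ∏ c, α c ^ (b + Pi.single i 1 : Fin 6 → ℕ) c = α i * ∏ c, α c ^ b c := by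
    simp only [Pi.add_apply, pow_add, Finset.prod_mul_distrib, Pi.single_apply, pow_ite, pow_one,
      pow_zero]
    rw [Finset.prod_ite_eq' univ i]; simp [mul_comm]
  have hf : ∏ c, ((b + Pi.single i 1 : Fin 6 → ℕ) c)! = (b i + 1) * ∏ c, (b c)! := by
    rw [← Finset.mul_prod_erase univ _ (Finset.mem_univ i),
      ← Finset.mul_prod_erase univ (fun c => (b c)!) (Finset.mem_univ i), ← mul_assoc]
    congr 1
    · simp [Nat.factorial_succ]
    · refine Finset.prod_congr rfl fun c hc => ?_
      have := Finset.ne_of_mem_erase hc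
      simp [this]
  have m1 := Nat.multinomial_spec univ (b + Pi.single i 1)
  have m2 := Nat.multinomial_spec univ b
  rw [hs, hf, Nat.factorial_succ, ← m2] at m1
  have hpos : 0 < ∏ c, (b c)! := Finset.prod_pos fun c _ => Nat.factorial_pos _
  have m3 : (b i + 1) * Nat.multinomial univ (b + Pi.single i 1) =
      (∑ c, b c + 1) * Nat.multinomial univ b := by
    apply Nat.eq_of_mul_eq_mul_left hpos
    linarith
  have m4 : ((b i : ℂ) + 1) * (Nat.multinomial univ (b + Pi.single i 1) : ℂ) =
      ((∑ c, b c : ℕ) + 1 : ℂ) * (Nat.multinomial univ b : ℂ) := by exact_mod_cast m3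
  have hne : (((∑ c, b c : ℕ) : ℂ) + 1) ≠ 0 := Nat.cast_add_one_ne_zero _
  rw [tTilde, vert, hs, hp]
  have hbi : (((b + Pi.single i 1 : Fin 6 → ℕ) i : ℕ) : ℂ) = (b i : ℂ) + 1 := by simp
  rw [hbi]
  push_cast at m4 hne ⊢
  field_simp
  linear_combination (α i * ∏ c, α c ^ b c) * m4

/-- The sum over exponents with `a_i ≥ 1`, written in terms of `b = a - e_i`. -/
theorem sum_tTilde_eq {M : Type*} [AddCommGroup M] [Module ℂ M] (α : Fin 6 → ℂ) (i : Fin 6)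
    (j : ℕ) (Φ : (Fin 6 → ℕ) → M) :
    ∑ a ∈ (univ : Finset (Fin 6)).piAntidiag (j + 1), (-(tTilde α a) * (a i : ℂ)) • Φ a =
      ∑ b ∈ (univ : Finset (Fin 6)).piAntidiag j, vert α i b • Φ (b + Pi.single i 1) := by
  symm
  refine Finset.sum_of_injOn (fun b => b + Pi.single i 1) ?_ ?_ ?_ ?_
  · intro b _ b' _ h
    exact add_right_cancel h
  · intro b hb
    simp only [Finset.mem_coe, Finset.mem_piAntidiag] at hb ⊢
    simp [Finset.sum_add_distrib, hb.1]
  · intro a ha hna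
    have : a i = 0 := by
      by_contra h
      apply hna
      refine ⟨a - Pi.single i 1, ?_, ?_⟩
      · simp only [Finset.mem_coe, Finset.mem_piAntidiag] at ha ⊢
        refine ⟨?_, fun c _ => Finset.mem_univ c⟩
        have h2 := ha.1
        rw [← Finset.add_sum_erase univ _ (Finset.mem_univ i)] at h2 ⊢
        have h3 : ∑ c ∈ univ.erase i, (a - Pi.single i 1 : Fin 6 → ℕ) c = ∑ c ∈ univ.erase i,
            a c := by
          refine Finset.sum_congr rfl fun c hc => ?_
          simp [Finset.ne_of_mem_erase hc]
        rw [h3]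
        simp only [Pi.sub_apply, Pi.single_eq_same]
        omega
      · ext c
        by_cases hc : c = i
        · subst hc; simp; omega
        · simp [hc]
    rw [this]; simp
  · intro b _
    rw [← tTilde_add_single]

section interaction

variable (N : ℕ) (α : Fin 6 → ℂ)

/-- The interaction of degree `p` as a polynomial in the matrix entries. -/
def interPoly (p : ℕ) : EntryPoly N :=
  MvPolynomial.C (-((N : ℂ) ^ (2 * p))⁻¹) *
    ∑ a ∈ (univ : Finset (Fin 6)).piAntidiag p,
      MvPolynomial.C (tTilde α a) * ∏ c, trPoly N (c, a c)

/-- The interaction as a power series with polynomial coefficients. -/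
def interPolySeries : PowerSeries (EntryPoly N) :=
  PowerSeries.mk fun p => if 2 ≤ p then interPoly N α p else 0

/-- The part of degree `k` of the exponential of the interaction, as a polynomial. -/
def boltzPoly (k : ℕ) : EntryPoly N :=
  ∑ m ∈ range (k + 1), MvPolynomial.C ((m ! : ℂ)⁻¹) *
    PowerSeries.coeff k (interPolySeries N α ^ m)

theorem polyVal_boltzPoly (k : ℕ) (u : Coords N) :
    polyVal (boltzPoly N α k) u = boltzmann α (fun c => herm (u c)) k := by
  have h1 : PowerSeries.map (MvPolynomial.eval (entries N u)) (interPolySeries N α) =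
      interactionSeries α (fun c => herm (u c)) := by
    ext p
    rw [PowerSeries.coeff_map, interPolySeries, interactionSeries, PowerSeries.coeff_mk,
      PowerSeries.coeff_mk]
    split_ifs
    · rw [interPoly, interaction, map_mul, MvPolynomial.eval_C, map_sum]
      congr 1
      refine Finset.sum_congr rfl fun a _ => ?_
      rw [map_mul, MvPolynomial.eval_C, map_prod]
      congr 1
      exact Finset.prod_congr rfl fun c _ => polyVal_trPoly (c, a c) u
    · simp
  rw [polyVal, boltzPoly, boltzmann, map_sum]
  refine Finset.sum_congr rfl fun m _ => ?_
  rw [map_mul, MvPolynomial.eval_C, ← h1, ← map_pow, PowerSeries.coeff_map, div_eq_mul_inv,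
    mul_comm]

theorem coeff_interPolySeries_pow {m l : ℕ} (h : l < m) :
    PowerSeries.coeff l (interPolySeries N α ^ m) = 0 := by
  have h1 : PowerSeries.X ∣ interPolySeries N α := by
    rw [PowerSeries.X_dvd_iff, ← PowerSeries.coeff_zero_eq_constantCoeff_apply, interPolySeries,
      PowerSeries.coeff_mk]
    simp
  exact PowerSeries.X_pow_dvd_iff.1 (pow_dvd_pow_of_dvd h1 m) l h

theorem boltzPoly_eq {k M : ℕ} (h : k + 1 ≤ M) :
    boltzPoly N α k = ∑ m ∈ range M, MvPolynomial.C ((m ! : ℂ)⁻¹) *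
      PowerSeries.coeff k (interPolySeries N α ^ m) := by
  refine Finset.sum_subset (Finset.range_mono h) fun m _ hm => ?_
  rw [coeff_interPolySeries_pow N α (by simpa [Nat.lt_succ_iff] using hm), mul_zero]

variable {N α}

theorem derivation_coeff_pow (d : Derivation ℂ (EntryPoly N) (EntryPoly N))
    (f : PowerSeries (EntryPoly N)) (m k : ℕ) :
    d (PowerSeries.coeff k (f ^ (m + 1))) = (m + 1 : EntryPoly N) *
      ∑ y ∈ antidiagonal k, d (PowerSeries.coeff y.1 f) * PowerSeries.coeff y.2 (f ^ m) := by
  let dh : PowerSeries (EntryPoly N) → PowerSeries (EntryPoly N) := fun g =>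
    PowerSeries.mk fun k => d (PowerSeries.coeff k g)
  have hmul : ∀ g g', dh (g * g') = dh g * g' + g * dh g' := by
    intro g g'
    ext1 k
    simp only [dh, PowerSeries.coeff_mk, PowerSeries.coeff_mul, map_add, map_sum,
      Derivation.leibniz, smul_eq_mul, ← Finset.sum_add_distrib]
    exact Finset.sum_congr rfl fun y _ => by ring
  have hpow : ∀ m : ℕ, dh (f ^ (m + 1)) = (m + 1 : PowerSeries (EntryPoly N)) * (dh f * f ^ m) := by
    intro m
    induction m with
    | zero => simp
    | succ m ih => rw [pow_succ, hmul, ih]; push_cast; ring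
  have := congrArg (PowerSeries.coeff k) (hpow m)
  have hC : (m + 1 : PowerSeries (EntryPoly N)) = PowerSeries.C (m + 1 : EntryPoly N) := by simp
  rw [hC, PowerSeries.coeff_C_mul, PowerSeries.coeff_mul] at this
  simpa [dh] using this

/-- A derivation acts on the exponential of the interaction by multiplication. -/
theorem derivation_boltzPoly (d : Derivation ℂ (EntryPoly N) (EntryPoly N)) (k : ℕ) :
    d (boltzPoly N α k) = ∑ y ∈ antidiagonal k,
      d (PowerSeries.coeff y.1 (interPolySeries N α)) * boltzPoly N α y.2 := by
  have hCd : ∀ (a : ℂ) (P : EntryPoly N), d (MvPolynomial.C a * P) = MvPolynomial.C a * d P := by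
    intro a P
    rw [← MvPolynomial.smul_eq_C_mul, Derivation.map_smul, MvPolynomial.smul_eq_C_mul]
  rw [boltzPoly_eq N α (M := k + 1 + 1) (by omega), map_sum, Finset.sum_range_succ']
  simp only [hCd, derivation_coeff_pow]
  have h0 : d (PowerSeries.coeff k (interPolySeries N α ^ 0)) = 0 := by
    rw [pow_zero, PowerSeries.coeff_one]; split_ifs <;> simp
  rw [h0, mul_zero, add_zero]
  have h2 : ∀ y ∈ antidiagonal k,
      d (PowerSeries.coeff y.1 (interPolySeries N α)) * boltzPoly N α y.2 =
      ∑ m ∈ range (k + 1), MvPolynomial.C ((m ! : ℂ)⁻¹) *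
        (d (PowerSeries.coeff y.1 (interPolySeries N α)) *
          PowerSeries.coeff y.2 (interPolySeries N α ^ m)) := by
    intro y hy
    have := Finset.HasAntidiagonal.mem_antidiagonal.1 hy
    rw [boltzPoly_eq N α (M := k + 1) (by omega), Finset.mul_sum]
    exact Finset.sum_congr rfl fun m _ => by ring
  rw [Finset.sum_congr rfl h2, Finset.sum_comm]
  refine Finset.sum_congr rfl fun m _ => ?_
  rw [← mul_assoc, ← Finset.mul_sum]
  congr 1
  have : (m + 1 : EntryPoly N) = MvPolynomial.C (m + 1 : ℂ) := by simp
  rw [this, ← map_mul, Nat.factorial_succ]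
  congr 1
  push_cast
  have h1 : ((m : ℂ) + 1) ≠ 0 := by exact_mod_cast Nat.succ_ne_zero m
  field_simp

/-- The labels of the traces `tr M_c ^ {b_c}`, `c ≠ i`. -/
def rest (i : Fin 6) (b : Fin 6 → ℕ) : Multiset (Fin 6 × ℕ) :=
  (univ.erase i).val.map fun c => (c, b c)

/-- The product of the traces with labels in a multiset. -/
def trProd (N : ℕ) : Egf (Fin 6 × ℕ) (EntryPoly N) := fun s => (s.map (trPoly N)).prod

theorem trProd_cons (b s) : trProd N (b ::ₘ s) = trPoly N b * trProd N s := by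
  simp [trProd]

theorem trProd_add (s t) : trProd N (s + t) = trProd N s * trProd N t := by
  simp [trProd]

theorem trProd_rest (i : Fin 6) (b : Fin 6 → ℕ) :
    trProd N (rest i b) = ∏ c ∈ univ.erase i, trPoly N (c, b c) := by
  rw [trProd, rest, Multiset.map_map]; rfl

/-- The derivative of the interaction along `M_i ↦ M_i ^ p`: one of the factors `M_i` of each vertex
is replaced by `M_i ^ p`. -/
theorem matField_interPoly (i : Fin 6) (p j : ℕ) :
    matField N i p (interPoly N α (j + 1)) = MvPolynomial.C (((N : ℂ) ^ (2 * (j + 1)))⁻¹) *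
      ∑ b ∈ (univ : Finset (Fin 6)).piAntidiag j,
        MvPolynomial.C (vert α i b) * trProd N ((i, b i + p) ::ₘ rest i b) := by
  have hCd : ∀ (a : ℂ) (P : EntryPoly N), matField N i p (MvPolynomial.C a * P) =
      MvPolynomial.C a * matField N i p P := by
    intro a P
    rw [← MvPolynomial.smul_eq_C_mul, Derivation.map_smul, MvPolynomial.smul_eq_C_mul]
  have hprod : ∀ a : Fin 6 → ℕ, matField N i p (∏ c, trPoly N (c, a c)) =
      (a i : EntryPoly N) *
        (trPoly N (i, a i + p - 1) * ∏ c ∈ univ.erase i, trPoly N (c, a c)) := by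
    intro a
    have hzero : ∀ S : Finset (Fin 6), i ∉ S →
        matField N i p (∏ c ∈ S, trPoly N (c, a c)) = 0 := by
      intro S
      induction S using Finset.induction with
      | empty => intro _; simp
      | insert c S hc ih =>
        intro h
        rw [Finset.mem_insert, not_or] at h
        rw [Finset.prod_insert hc, Derivation.leibniz, ih h.2, matField_trPoly,
          if_neg (Ne.symm h.1)]
        simp
    rw [← Finset.mul_prod_erase univ _ (Finset.mem_univ i), Derivation.leibniz,
      hzero _ (Finset.notMem_erase i univ), matField_trPoly, if_pos rfl]
    simp only [smul_eq_mul]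
    ring
  have key := sum_tTilde_eq α i j (fun a => trPoly N (i, a i + p - 1) *
    ∏ c ∈ univ.erase i, trPoly N (c, a c))
  rw [interPoly, hCd, map_sum, map_neg, neg_mul, ← mul_neg, ← Finset.sum_neg_distrib]
  congr 1
  have h1 : ∀ a ∈ (univ : Finset (Fin 6)).piAntidiag (j + 1),
      -(matField N i p (MvPolynomial.C (tTilde α a) * ∏ c, trPoly N (c, a c))) =
      (-(tTilde α a) * (a i : ℂ)) • (trPoly N (i, a i + p - 1) *
        ∏ c ∈ univ.erase i, trPoly N (c, a c)) := by
    intro a _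
    rw [hCd, hprod, MvPolynomial.smul_eq_C_mul, map_mul, map_neg, map_natCast]
    ring
  rw [Finset.sum_congr rfl h1, key]
  refine Finset.sum_congr rfl fun b _ => ?_
  rw [MvPolynomial.smul_eq_C_mul, trProd_cons, trProd_rest]
  have h2 : (b + Pi.single i 1 : Fin 6 → ℕ) i + p - 1 = b i + p := by
    simp only [Pi.add_apply, Pi.single_eq_same]; omega
  rw [h2]
  congr 2
  refine Finset.prod_congr rfl fun c hc => ?_
  simp [Finset.ne_of_mem_erase hc]

/-- The first-order operator of the loop equations: `∂_{(j, q)} ↦ q ∂_{(i, q + p - 1)}` for `j = i`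
and zero for the other colors. -/
def virShift (R : Type*) [CommRing R] (i : Fin 6) (p : ℕ) (b : Fin 6 × ℕ) : R × (Fin 6 × ℕ) :=
  (if b.1 = i then (b.2 : R) else 0, (i, b.2 + p - 1))

theorem matField_trProd (i : Fin 6) (p : ℕ) (s : Multiset (Fin 6 × ℕ)) :
    matField N i p (trProd N s) =
      Egf.shift (virShift (EntryPoly N) i p) (trProd N) s := by
  induction s using Multiset.induction with
  | empty =>
    rw [Egf.shift_apply_zero]
    simp [trProd]
  | cons b s ih =>
    have hD : ∀ b, Egf.D b (trProd N) =
        trPoly N b • (trProd N) := by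
      intro b; ext1 s; exact trProd_cons b s
    have h1 := congrFun (Egf.D_shift (virShift (EntryPoly N) i p) b
      (trProd N)) s
    rw [Egf.D_apply] at h1
    rw [h1, hD, hD, Egf.shift_smul, Egf.add_apply, Egf.smul_apply, Egf.smul_apply, Egf.smul_apply,
      ← ih, trProd_cons, Derivation.leibniz, matField_trPoly]
    simp only [smul_eq_mul, virShift]
    ring

end interaction
end QuarticTensor

namespace QuarticTensor

/-! ### The loop equations at finite `N` -/

namespace Egf
variable {β R S : Type*} [CommRing R] [CommRing S]

/-- Divisibility of all coefficients by `d` can be cancelled by a factor with value `1` at zero: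
such a factor is invertible. -/
theorem dvd_of_dvd_mul {f m : Egf β R} {d : R} (h0 : m 0 = 1) (h : ∀ s, d ∣ (f * m) s) (s) :
    d ∣ f s := by
  have h1 : (f * (1 - (1 - m) ^ (s.card + 1))) s = f s := by
    have h2 : ((1 - m) ^ (s.card + 1) * f) s = 0 :=
      pow_apply_of_card_lt (by rw [sub_apply, h0, one_apply_zero, sub_self]) (Nat.lt_succ_self _) _
    rw [mul_sub, mul_one, sub_apply, mul_comm f, h2, sub_zero]
  rw [← h1, ← mul_neg_geom_sum, sub_sub_cancel, ← mul_assoc, mul_apply]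
  refine Multiset.dvd_sum fun y hy => ?_
  obtain ⟨x, _, rfl⟩ := Multiset.mem_map.1 hy
  exact (h _).mul_right _

theorem rescale_apply (r : R) (f : Egf β R) (s) : rescale r f s = r ^ s.card * f s := rfl

theorem rescale_log [Algebra ℚ R] (r : R) (m : Egf β R) (s) :
    log (rescale r m) s = r ^ s.card * log m s := by
  change logTrunc _ _ s = _ * logTrunc _ _ s
  rw [← rescale_apply r]
  refine congrFun ?_ s
  rw [logTrunc, logTrunc, map_sum]
  refine Finset.sum_congr rfl fun k _ => ?_
  have h1 : ∀ (a : R) (f : Egf β R), rescale r (a • f) = a • rescale r f := by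
    intro a f; ext t; simp only [rescale_apply, smul_apply]; ring
  rw [h1, map_pow, map_sub, map_one]

theorem shift_rescale [DecidableEq β] (σ : β → R × β) (r : R) (f : Egf β R) :
    shift σ (rescale r f) = rescale r (shift σ f) := by
  ext s
  rw [rescale_apply, shift_apply, shift_apply, ← Multiset.sum_map_mul_left]
  refine congrArg _ (Multiset.map_congr rfl fun b hb => ?_)
  rw [rescale_apply, Multiset.card_cons, Multiset.card_erase_add_one hb]
  ring

end Egf

open Egf

/-- The loop equation of the vector field `M_i ↦ M_i ^ p` in terms of the normalized free energy
`F`, where `h` stands for `N ^ (-2)` and `u` for the formal variable that records the degree in `α`.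
The interaction is truncated at degree `K + 1`. -/
def loopEq {R : Type*} [CommRing R] [Algebra ℂ R] (α : Fin 6 → ℂ) (F : Egf (Fin 6 × ℕ) R)
    (h u : R) (i : Fin 6) (p K : ℕ) : Egf (Fin 6 × ℕ) R :=
  ∑ k ∈ range p, corr F h {(i, k), (i, p - 1 - k)} - D (i, p + 1) F + shift (virShift R i p) F +
    ∑ j ∈ range K, ∑ b ∈ (univ : Finset (Fin 6)).piAntidiag (j + 1),
      (algebraMap ℂ R (vert α i b) * u ^ (j + 2) * h ^ j) • corr F h ((i, b i + p) ::ₘ rest i b)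

theorem map_loopEq {R S : Type*} [CommRing R] [CommRing S] [Algebra ℂ R] [Algebra ℂ S]
    (θ : R →+* S) (hθ : ∀ a, θ (algebraMap ℂ R a) = algebraMap ℂ S a) (α : Fin 6 → ℂ)
    (F : Egf (Fin 6 × ℕ) R) (h u : R) (i : Fin 6) (p K : ℕ) :
    Egf.map θ (loopEq α F h u i p K) = loopEq α (Egf.map θ F) (θ h) (θ u) i p K := by
  have hs : (fun b => (θ (virShift R i p b).1, (virShift R i p b).2)) = virShift S i p := by
    ext1 b
    simp only [virShift]
    split_ifs <;> simp
  simp only [loopEq, map_add, map_sub, map_sum, map_corr, map_shift, map_smul', map_mul, map_pow,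
    hθ, D_map, hs]

section finiteN

variable {N : ℕ} (hN : 1 ≤ N) (α : Fin 6 → ℂ)

/-- The unnormalized moments of products of traces. -/
def moments : Egf (Fin 6 × ℕ) (PowerSeries ℂ) := fun s =>
  PowerSeries.mk fun k => gaussLin hN (trProd N s * boltzPoly N α k)

theorem coeff_moments (s k) :
    PowerSeries.coeff k (moments hN α s) = gaussLin hN (trProd N s * boltzPoly N α k) :=
  PowerSeries.coeff_mk _ _

/-- The loop equations for the moments. Vertices of degree `K + 2` and more in `α` do not contribute
to the coefficients of degree less than `K + 2`. -/
theorem moments_loopEq (i : Fin 6) (p K : ℕ) (s) {k : ℕ} (hk : k < K + 2) :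
    PowerSeries.coeff k (PowerSeries.C (N : ℂ) * moments hN α ((i, p + 1) ::ₘ s)) =
    PowerSeries.coeff k (∑ l ∈ range p, moments hN α ((i, l) ::ₘ (i, p - 1 - l) ::ₘ s) +
      shift (virShift _ i p) (moments hN α) s +
      ∑ j ∈ range K, ∑ b ∈ (univ : Finset (Fin 6)).piAntidiag (j + 1),
        PowerSeries.C (vert α i b * ((N : ℂ) ^ (2 * (j + 2)))⁻¹) * (PowerSeries.X ^ (j + 2) *
          moments hN α ((i, b i + p) ::ₘ rest i b + s))) := by
  rw [PowerSeries.coeff_C_mul, coeff_moments, trProd_cons, mul_assoc, schwingerDyson,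
    Derivation.leibniz, smul_eq_mul, smul_eq_mul, map_add, map_add, map_add, map_add,
    add_assoc]
  refine congrArg₂ (· + ·) ?_ ?_
  · rw [Finset.sum_mul, map_sum, map_sum]
    refine Finset.sum_congr rfl fun l _ => ?_
    rw [coeff_moments, trProd_cons, trProd_cons]
    ring_nf
  · rw [add_comm]
    refine congrArg₂ (· + ·) ?_ ?_
    · rw [mul_comm, matField_trProd, shift_apply, shift_apply, ← Multiset.sum_map_mul_right,
        map_multiset_sum, map_multiset_sum, Multiset.map_map, Multiset.map_map]
      refine congrArg _ (Multiset.map_congr rfl fun b _ => ?_)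
      simp only [Function.comp_def, virShift]
      split_ifs
      · have h1 : ((b.2 : EntryPoly N)) = MvPolynomial.C (b.2 : ℂ) := by simp
        have h2 : ((b.2 : PowerSeries ℂ)) = PowerSeries.C (b.2 : ℂ) := by simp
        rw [h1, h2, PowerSeries.coeff_C_mul, coeff_moments, mul_assoc,
          ← MvPolynomial.smul_eq_C_mul, map_smul, smul_eq_mul]
      · simp
    · rw [derivation_boltzPoly, Finset.mul_sum, map_sum,
        Finset.Nat.sum_antidiagonal_eq_sum_range_succ
          (fun a b => gaussLin hN (trProd N s * (matField N i p
            (PowerSeries.coeff a (interPolySeries N α)) * boltzPoly N α b)))]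
      set g : ℕ → ℂ := fun j => if j ≤ k then gaussLin hN (trProd N s * (matField N i p
            (PowerSeries.coeff j (interPolySeries N α)) * boltzPoly N α (k - j))) else 0 with hg
      have e1 : ∑ j ∈ range (k + 1), gaussLin hN (trProd N s * (matField N i p
            (PowerSeries.coeff j (interPolySeries N α)) * boltzPoly N α (k - j))) =
          ∑ j ∈ range (K + 2), g j := by
        rw [← Finset.sum_subset (Finset.range_mono (show k + 1 ≤ K + 2 by omega))]
        · refine Finset.sum_congr rfl fun j hj => ?_
          rw [hg]; dsimp only
          rw [if_pos (by have := Finset.mem_range.1 hj; omega)]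
        · intro j _ hj
          rw [hg]; dsimp only
          rw [if_neg (by rw [Finset.mem_range] at hj; omega)]
      have g0 : g 0 = 0 := by
        rw [hg]; simp [interPolySeries]
      have g1 : g 1 = 0 := by
        rw [hg]; simp [interPolySeries]
      rw [Nat.succ_eq_add_one, e1, Finset.sum_range_succ', Finset.sum_range_succ', g0, g1, add_zero,
        add_zero, map_sum]
      refine Finset.sum_congr rfl fun j _ => ?_
      rw [map_sum, hg]
      dsimp only
      by_cases hjk : j + 1 + 1 ≤ k
      · rw [if_pos hjk, interPolySeries, PowerSeries.coeff_mk, if_pos (by omega),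
          matField_interPoly, ← mul_assoc, mul_left_comm, mul_assoc,
          ← MvPolynomial.smul_eq_C_mul, map_smul, Finset.mul_sum, Finset.sum_mul, map_sum,
          Finset.smul_sum]
        refine Finset.sum_congr rfl fun b _ => ?_
        rw [PowerSeries.coeff_C_mul, PowerSeries.coeff_X_pow_mul', if_pos (by omega),
          coeff_moments, trProd_add, smul_eq_mul]
        have e2 : trProd N s * (MvPolynomial.C (vert α i b) *
            trProd N ((i, b i + p) ::ₘ rest i b)) *
            boltzPoly N α (k - (j + 1 + 1)) = vert α i b • (trProd N ((i, b i + p) ::ₘ rest i b) *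
            trProd N s * boltzPoly N α (k - (j + 2))) := by
          rw [MvPolynomial.smul_eq_C_mul]; ring
        rw [e2, map_smul, smul_eq_mul]
        ring
      · rw [if_neg hjk]
        symm
        refine Finset.sum_eq_zero fun b _ => ?_
        rw [PowerSeries.coeff_C_mul, PowerSeries.coeff_X_pow_mul', if_neg (by omega), mul_zero]

theorem moments_zero_mul_inv : moments hN α 0 * (moments hN α 0)⁻¹ = 1 := by
  refine PowerSeries.mul_inv_cancel _ ?_
  have h1 : trProd N 0 = 1 := by simp [trProd]
  have h2 : boltzPoly N α 0 = 1 := by simp [boltzPoly]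
  rw [← PowerSeries.coeff_zero_eq_constantCoeff_apply, coeff_moments, h1, h2, mul_one,
    gaussLin_one]
  exact one_ne_zero

/-- The moments normalized to be `1` for the empty product. -/
def normMoments : Egf (Fin 6 × ℕ) (PowerSeries ℂ) := (moments hN α 0)⁻¹ • moments hN α

theorem normMoments_zero : normMoments hN α 0 = 1 := by
  rw [normMoments, Egf.smul_apply, mul_comm, moments_zero_mul_inv]

theorem gaussE_mul_boltzmann (G : Matrices N → ℂ) (P : EntryPoly N)
    (hG : ∀ u : Coords N, G (fun c => herm (u c)) = polyVal P u) (k : ℕ) :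
    gaussE N (fun M => G M * boltzmann α M k) = gaussLin hN (P * boltzPoly N α k) := by
  have h := gaussE_eq (fun M => G M * boltzmann α M k) (P * boltzPoly N α k) fun u => by
    rw [hG, ← polyVal_boltzPoly, polyVal, polyVal, polyVal, map_mul]
  rw [h]
  rfl

theorem expect_eq (s : Multiset (Fin 6 × ℕ)) (F : Matrices N → ℂ)
    (hF : ∀ M, F M = (s.map fun b => (M b.1 ^ b.2).trace).prod) :
    expect N α F = normMoments hN α s := by
  have h1 : (PowerSeries.mk fun k => gaussE N fun M => boltzmann α M k) = moments hN α 0 := by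
    refine PowerSeries.ext fun k => ?_
    have := gaussE_mul_boltzmann hN α (fun _ => 1) (trProd N 0)
      (fun u => by simp [polyVal, trProd]) k
    simp only [one_mul] at this
    rw [coeff_moments, PowerSeries.coeff_mk, this]
  have h2 : (PowerSeries.mk fun k => gaussE N fun M => F M * boltzmann α M k) =
      moments hN α s := by
    refine PowerSeries.ext fun k => ?_
    rw [coeff_moments, PowerSeries.coeff_mk]
    refine gaussE_mul_boltzmann hN α F (trProd N s) (fun u => ?_) k
    rw [hF, polyVal, trProd, map_multiset_prod, Multiset.map_map]
    simp only [Function.comp_def]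
    exact congrArg _ (Multiset.map_congr rfl fun b _ => (polyVal_trPoly b u).symm)
  rw [expect, normMoments, Egf.smul_apply, mul_comm, h1, h2]

/-- The free energy, normalized so that the cumulant of the traces with labels `s` is
`N ^ (2 - card s)` times its value at `s`. -/
def freeEnergy : Egf (Fin 6 × ℕ) (PowerSeries ℂ) :=
  PowerSeries.C (((N : ℂ) ^ 2)⁻¹) • log (rescale (PowerSeries.C (N : ℂ)) (normMoments hN α))

/-- The moment generating function is the exponential of the free energy divided by `h = N ^ (-2)`.
-/
theorem freeEnergy_spec (b : Fin 6 × ℕ) :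
    PowerSeries.C (((N : ℂ) ^ 2)⁻¹) • D b (rescale (PowerSeries.C (N : ℂ)) (normMoments hN α)) =
      D b (freeEnergy hN α) * rescale (PowerSeries.C (N : ℂ)) (normMoments hN α) := by
  have h0 : rescale (PowerSeries.C (N : ℂ)) (normMoments hN α) 0 = 1 := by
    rw [rescale_apply, normMoments_zero]; simp
  rw [freeEnergy, map_smul, smul_mul_assoc, D_log_mul h0]

theorem card_rest (i : Fin 6) (b : Fin 6 → ℕ) : (rest i b).card = 5 := by
  rw [rest, Multiset.card_map]; simp

/-- The loop equations for the free energy, from those for the moments upon division by the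
generating function of the moments. The powers of `N` combine into powers of `N ^ (-2)`: a vertex
carries six traces, hence a factor `N ^ 6`, of which three pairs are absorbed. -/
theorem loopEq_freeEnergy (i : Fin 6) (p K : ℕ) (s) {k : ℕ} (hk : k < K + 2) :
    PowerSeries.coeff k (loopEq α (freeEnergy hN α) (PowerSeries.C (((N : ℂ) ^ 2)⁻¹)) PowerSeries.X
      i p K s) = 0 := by
  set H : PowerSeries ℂ := PowerSeries.C (((N : ℂ) ^ 2)⁻¹) with hH
  set ν : PowerSeries ℂ := PowerSeries.C (N : ℂ) with hν
  set μ := normMoments hN α with hμ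
  set m := rescale ν μ with hm
  have hNne : (N : ℂ) ≠ 0 := by exact_mod_cast (by omega : N ≠ 0)
  have hHν : H * ν ^ 2 = 1 := by
    rw [hH, hν, ← map_pow, ← map_mul, inv_mul_cancel₀ (pow_ne_zero 2 hNne), map_one]
  have h0 : m 0 = 1 := by rw [hm, rescale_apply, hμ, normMoments_zero]; simp
  have hF : ∀ b, H • D b m = D b (freeEnergy hN α) * m := freeEnergy_spec hN α
  have hshift : ∀ σ : Fin 6 × ℕ → PowerSeries ℂ × (Fin 6 × ℕ),
      shift σ (freeEnergy hN α) * m = H • shift σ m := by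
    intro σ
    rw [freeEnergy, shift_smul, smul_mul_assoc,
      shift_eq_mul σ (L := log m) fun b => (D_log_mul h0 b).symm]
  have hdvd : ∀ s, PowerSeries.X ^ (K + 2) ∣
      (loopEq α (freeEnergy hN α) H PowerSeries.X i p K * m) s := by
    intro s
    have e1 : (loopEq α (freeEnergy hN α) H PowerSeries.X i p K * m) s =
        H * ν ^ s.card * (moments hN α 0)⁻¹ *
          ((∑ l ∈ range p, moments hN α ((i, l) ::ₘ (i, p - 1 - l) ::ₘ s) +
          shift (virShift _ i p) (moments hN α) s +
          ∑ j ∈ range K, ∑ b ∈ (univ : Finset (Fin 6)).piAntidiag (j + 1),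
            PowerSeries.C (vert α i b * ((N : ℂ) ^ (2 * (j + 2)))⁻¹) * (PowerSeries.X ^ (j + 2) *
              moments hN α ((i, b i + p) ::ₘ rest i b + s))) -
          ν * moments hN α ((i, p + 1) ::ₘ s)) := by
      rw [loopEq, add_mul, add_mul, sub_mul, hshift, ← hF, Finset.sum_mul, Finset.sum_mul]
      simp only [Finset.sum_mul, smul_mul_assoc, corr_mul_eq hF]
      simp only [Egf.add_apply, Egf.sub_apply, Egf.sum_apply,
        Egf.smul_apply, Dm_apply, D_apply, hm, rescale_apply, shift_rescale, Multiset.card_add,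
        Multiset.card_cons, card_rest, hμ, normMoments, Multiset.insert_eq_cons,
        Multiset.card_singleton, Multiset.cons_add, Multiset.singleton_add, shift_smul]
      rw [mul_sub, mul_add, mul_add, Finset.mul_sum, Finset.mul_sum]
      have t1 : ∀ l, H ^ (1 + 1) * (ν ^ (s.card + 1 + 1) * ((moments hN α 0)⁻¹ *
          moments hN α ((i, l) ::ₘ (i, p - 1 - l) ::ₘ s))) =
          H * ν ^ s.card * (moments hN α 0)⁻¹ *
            moments hN α ((i, l) ::ₘ (i, p - 1 - l) ::ₘ s) := by
        intro l
        linear_combination H * ν ^ s.card * (moments hN α 0)⁻¹ *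
            moments hN α ((i, l) ::ₘ (i, p - 1 - l) ::ₘ s) * hHν
      have t2 : ∀ j (b : Fin 6 → ℕ), algebraMap ℂ (PowerSeries ℂ) (vert α i b) *
          PowerSeries.X ^ (j + 2) * H ^ j * (H ^ (5 + 1) * (ν ^ (5 + s.card + 1) *
            ((moments hN α 0)⁻¹ * moments hN α ((i, b i + p) ::ₘ (rest i b + s))))) =
          H * ν ^ s.card * (moments hN α 0)⁻¹ * (PowerSeries.C (vert α i b *
            ((N : ℂ) ^ (2 * (j + 2)))⁻¹) * (PowerSeries.X ^ (j + 2) *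
              moments hN α ((i, b i + p) ::ₘ (rest i b + s)))) := by
        intro j b
        have e2 : PowerSeries.C (vert α i b * ((N : ℂ) ^ (2 * (j + 2)))⁻¹) =
            algebraMap ℂ (PowerSeries ℂ) (vert α i b) * H ^ (j + 2) := by
          rw [map_mul, hH, ← map_pow, inv_pow, ← pow_mul]; rfl
        rw [e2]
        -- three of the factors `H = N ^ (-2)` cancel against the six factors `N` of the traces
        have e3 : H ^ (j + 6) * ν ^ (s.card + 6) = H ^ (j + 3) * ν ^ s.card := by
          calc H ^ (j + 6) * ν ^ (s.card + 6) =
              H ^ (j + 3) * ν ^ s.card * (H * ν ^ 2) ^ 3 := by ring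
            _ = _ := by rw [hHν]; ring
        linear_combination algebraMap ℂ (PowerSeries ℂ) (vert α i b) * PowerSeries.X ^ (j + 2) *
          (moments hN α 0)⁻¹ * moments hN α ((i, b i + p) ::ₘ (rest i b + s)) * e3
      simp only [t1, t2, Finset.mul_sum]
      ring
    rw [e1]
    refine Dvd.dvd.mul_left (PowerSeries.X_pow_dvd_iff.2 fun k hk => ?_) _
    rw [map_sub, moments_loopEq hN α i p K s hk, sub_self]
  exact PowerSeries.X_pow_dvd_iff.1 (dvd_of_dvd_mul h0 hdvd s) k hk

/-- Insertion of `tr 1 = N` is trivial. -/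
theorem D_zero_freeEnergy (c : Fin 6) : D (c, 0) (freeEnergy hN α) = 1 := by
  have hNne : (N : ℂ) ≠ 0 := by exact_mod_cast (by omega : N ≠ 0)
  set m := rescale (PowerSeries.C (N : ℂ)) (normMoments hN α) with hm
  have h0 : m 0 = 1 := by rw [hm, rescale_apply, normMoments_zero]; simp
  have h1 : PowerSeries.C (((N : ℂ) ^ 2)⁻¹) • D (c, 0) m = m := by
    ext1 s
    have h2 : moments hN α ((c, 0) ::ₘ s) = PowerSeries.C (N : ℂ) * moments hN α s := by
      refine PowerSeries.ext fun k => ?_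
      rw [PowerSeries.coeff_C_mul, coeff_moments, coeff_moments, trProd_cons]
      have : trPoly N (c, 0) = MvPolynomial.C (N : ℂ) := by simp [trPoly]
      rw [this, mul_assoc, ← MvPolynomial.smul_eq_C_mul, map_smul, smul_eq_mul]
    rw [Egf.smul_apply, D_apply, hm, rescale_apply, rescale_apply, normMoments, Egf.smul_apply,
      Egf.smul_apply,
      h2, Multiset.card_cons]
    have h3 : PowerSeries.C (((N : ℂ) ^ 2)⁻¹) * PowerSeries.C (N : ℂ) ^ 2 = 1 := by
      rw [← map_pow, ← map_mul, inv_mul_cancel₀ (pow_ne_zero 2 hNne), map_one]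
    linear_combination (PowerSeries.C (N : ℂ)) ^ s.card * ((moments hN α 0)⁻¹ * moments hN α s) * h3
  have h2 : (D (c, 0) (freeEnergy hN α) - 1) * m = 0 := by
    rw [sub_mul, ← freeEnergy_spec, one_mul, h1, sub_self]
  rw [← sub_eq_zero]
  ext1 s
  refine zero_dvd_iff.1 (dvd_of_dvd_mul h0 (fun s => ?_) s)
  rw [h2, Egf.zero_apply]

theorem cumulant_eq {ι : Type} [Fintype ι] [DecidableEq ι] [Nonempty ι] (c : ι → Fin 6)
    (p : ι → ℕ) (k : ℕ) :
    PowerSeries.coeff k (cumulant N α c p) = (N : ℂ) ^ ((2 : ℤ) - Fintype.card ι) *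
      PowerSeries.coeff k (freeEnergy hN α (univ.val.map fun j => (c j, p j))) := by
  have hNne : (N : ℂ) ≠ 0 := by exact_mod_cast (by omega : N ≠ 0)
  have h1 : cumulant N α c p = log (normMoments hN α) (univ.val.map fun j => (c j, p j)) := by
    rw [log_apply_map _ (normMoments_zero hN α) Finset.univ_nonempty, cumulant]
    refine Finset.sum_congr rfl fun π _ => ?_
    have e1 : ∏ B ∈ π.parts, expect N α (fun M => ∏ j ∈ B, (M (c j) ^ p j).trace) =
        ∏ B ∈ π.parts, normMoments hN α (B.val.map fun j => (c j, p j)) := by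
      refine Finset.prod_congr rfl fun B _ => expect_eq hN α _ _ fun M => ?_
      rw [Multiset.map_map]; rfl
    rw [e1, PowerSeries.smul_eq_C_mul]
    congr 1
    simp
  have hcard : (univ.val.map fun j => (c j, p j)).card = Fintype.card ι := by simp
  rw [freeEnergy, Egf.smul_apply, PowerSeries.coeff_C_mul, rescale_log, h1, hcard, ← map_pow,
    PowerSeries.coeff_C_mul, zpow_sub₀ hNne, zpow_natCast]
  have : (N : ℂ) ^ (2 : ℤ) = (N : ℂ) ^ 2 := by norm_cast
  rw [this]
  field_simp

end finiteN
end QuarticTensor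

namespace QuarticTensor

/-! ### The topological expansion -/

namespace Egf
variable {β A : Type*} [CommRing A]

/-- The generating functions whose coefficients of level at most `L` lie in the subring `B`; the
level of the coefficient of `X ^ k` of `f s` is `a * k + ω s`. -/
def levelSubring (B : Subring A) (a : ℕ) (ω : Multiset β →+ ℕ) (L : ℕ) :
    Subring (Egf β (PowerSeries A)) where
  carrier := {f | ∀ k s, a * k + ω s ≤ L → PowerSeries.coeff k (f s) ∈ B}
  mul_mem' {f g} hf hg k s h := by
    rw [mul_apply, map_multiset_sum, Multiset.map_map]
    refine multiset_sum_mem _ fun y hy => ?_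
    obtain ⟨x, hx, rfl⟩ := Multiset.mem_map.1 hy
    have hs : ω x.1 + ω x.2 = ω s := by
      rw [← map_add, Multiset.mem_antidiagonal.1 hx]
    simp only [Function.comp_apply, PowerSeries.coeff_mul]
    refine sum_mem fun y hy => ?_
    have hk : y.1 + y.2 = k := Finset.HasAntidiagonal.mem_antidiagonal.1 hy
    have h1 : a * y.1 + a * y.2 = a * k := by rw [← mul_add, hk]
    exact mul_mem (hf _ _ (by omega)) (hg _ _ (by omega))
  one_mem' k s _ := by
    rw [one_apply]
    split_ifs
    · rw [PowerSeries.coeff_one]; split_ifs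
      · exact one_mem _
      · exact zero_mem _
    · rw [map_zero]; exact zero_mem _
  add_mem' {f g} hf hg k s h := by rw [add_apply, map_add]; exact add_mem (hf k s h) (hg k s h)
  zero_mem' k s _ := by rw [zero_apply, map_zero]; exact zero_mem _
  neg_mem' {f} hf k s h := by rw [neg_apply, map_neg]; exact neg_mem (hf k s h)

variable {B : Subring A} {a : ℕ} {ω : Multiset β →+ ℕ} {L : ℕ}

theorem levelSubring_anti {L L' : ℕ} (h : L ≤ L') :
    levelSubring B a ω L' ≤ levelSubring B a ω L := fun _ hf k s hs => hf k s (hs.trans h)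

theorem D_mem_levelSubring {f : Egf β (PowerSeries A)} {b : β}
    (hf : f ∈ levelSubring B a ω (L + ω {b})) : D b f ∈ levelSubring B a ω L := by
  intro k s hs
  rw [D_apply]
  refine hf k _ ?_
  rw [← Multiset.singleton_add, map_add]; omega

theorem C_smul_mem_levelSubring {f : Egf β (PowerSeries A)} {r : A} (hr : r ∈ B)
    (hf : f ∈ levelSubring B a ω L) : PowerSeries.C r • f ∈ levelSubring B a ω L := by
  intro k s hs
  rw [smul_apply, PowerSeries.coeff_C_mul]
  exact mul_mem hr (hf k s hs)

theorem X_smul_mem_levelSubring {f : Egf β (PowerSeries A)}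
    (hf : f ∈ levelSubring B a ω L) :
    (PowerSeries.X : PowerSeries A) • f ∈ levelSubring B a ω (L + a) := by
  intro k s hs
  rw [smul_apply]
  cases k with
  | zero => rw [PowerSeries.coeff_zero_X_mul]; exact zero_mem _
  | succ k =>
    rw [PowerSeries.coeff_succ_X_mul]
    exact hf k s (by rw [mul_add] at hs; omega)

theorem corr_C_mem_levelSubring {F : Egf β (PowerSeries A)} {h : A} (hh : h ∈ B) (l : Multiset β)
    {L : ℕ} (hF : F ∈ levelSubring B a ω (L + ω l)) :
    corr F (PowerSeries.C h) l ∈ levelSubring B a ω L := by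
  induction l using Multiset.induction generalizing L with
  | empty => rw [corr_zero]; exact one_mem _
  | cons b l ih =>
    rw [corr_cons, cov]
    rw [← Multiset.singleton_add, map_add] at hF
    refine add_mem (mul_mem (D_mem_levelSubring (levelSubring_anti (by omega) hF))
      (ih (levelSubring_anti (by omega) hF))) (C_smul_mem_levelSubring hh (D_mem_levelSubring
      (ih (by convert hF using 2; ring))))

end Egf

open Egf

/-- The total exponent of the traces with the given labels. -/
def totalDegree : Multiset (Fin 6 × ℕ) →+ ℕ where
  toFun s := (s.map Prod.snd).sum
  map_zero' := by simp
  map_add' s t := by simp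

theorem totalDegree_apply (s : Multiset (Fin 6 × ℕ)) : totalDegree s = (s.map Prod.snd).sum := rfl

theorem totalDegree_cons (b : Fin 6 × ℕ) (s) : totalDegree (b ::ₘ s) = b.2 + totalDegree s := by
  simp [totalDegree_apply]

theorem totalDegree_cons_rest (i : Fin 6) (b : Fin 6 → ℕ) (p : ℕ) :
    totalDegree ((i, b i + p) ::ₘ rest i b) = ∑ c, b c + p := by
  rw [totalDegree_cons, ← Finset.add_sum_erase univ b (Finset.mem_univ i), totalDegree_apply, rest,
    Multiset.map_map]
  change _ + ∑ c ∈ univ.erase i, b c = _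
  ring

/-- The loop equations propagate membership in a subring: all coefficients of a solution are
polynomial expressions in the coefficients of the equations. -/
theorem coeff_mem_of_loopEq {A : Type*} [CommRing A] [Algebra ℂ A] (B : Subring A)
    (hB : ∀ a, algebraMap ℂ A a ∈ B) {h : A} (hh : h ∈ B) (α : Fin 6 → ℂ)
    {F : Egf (Fin 6 × ℕ) (PowerSeries A)} (F0 : F 0 = 0) (hD : ∀ c, D (c, 0) F = 1)
    (hloop : ∀ i p K s k, k < K + 2 →
      PowerSeries.coeff k (loopEq α F (PowerSeries.C h) PowerSeries.X i p K s) = 0) (k s) :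
    PowerSeries.coeff k (F s) ∈ B := by
  -- induction on the degree in `X` plus the total exponent of the traces: the linear term
  -- `∂_{(i, p + 1)} F` of the loop equation has larger level than all the others
  suffices H : ∀ L, F ∈ levelSubring B 1 totalDegree L from H _ _ _ le_rfl
  intro L
  induction L with
  | zero =>
    intro k s hs
    induction s using Multiset.induction with
    | empty => rw [F0, map_zero]; exact zero_mem _
    | cons b t _ =>
      obtain ⟨i, q⟩ := b
      rw [totalDegree_cons] at hs
      -- at level zero, all the exponents are zero
      obtain rfl : q = 0 := by simp only at hs; omega
      rw [← D_apply (i, 0) F, hD]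
      exact one_mem (levelSubring B 1 totalDegree (1 * k + totalDegree t)) k t le_rfl
  | succ L ih =>
    intro k s hs
    induction s using Multiset.induction with
    | empty => rw [F0, map_zero]; exact zero_mem _
    | cons b t _ =>
      obtain ⟨i, q⟩ := b
      rw [totalDegree_cons] at hs
      -- a trace with exponent zero is removed, one with exponent `p + 1` is expressed by the loop
      -- equation
      rcases q with _ | p
      · rw [← D_apply (i, 0) F, hD]
        exact one_mem (levelSubring B 1 totalDegree (1 * k + totalDegree t)) k t le_rfl
      have key := hloop i p k t k (by omega)
      rw [loopEq, Egf.add_apply, Egf.add_apply, Egf.sub_apply, map_add, map_add, map_sub, D_apply]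
        at key
      have e : PowerSeries.coeff k (F ((i, p + 1) ::ₘ t)) =
          PowerSeries.coeff k ((∑ k ∈ range p, corr F (PowerSeries.C h)
            {(i, k), (i, p - 1 - k)}) t) +
          PowerSeries.coeff k (shift (virShift _ i p) F t) +
          PowerSeries.coeff k ((∑ j ∈ range k, ∑ b ∈ (univ : Finset (Fin 6)).piAntidiag (j + 1),
            (algebraMap ℂ (PowerSeries A) (vert α i b) * PowerSeries.X ^ (j + 2) *
            (PowerSeries.C h) ^ j) • corr F (PowerSeries.C h) ((i, b i + p) ::ₘ rest i b)) t) := by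
        linear_combination -key
      rw [e]
      simp only at hs
      refine add_mem (add_mem ?_ ?_) ?_
      · rw [Egf.sum_apply, map_sum]
        refine sum_mem fun l hl => ?_
        have hl := Finset.mem_range.1 hl
        refine corr_C_mem_levelSubring (L := 1 * k + totalDegree t) hh _ ?_ k t le_rfl
        refine levelSubring_anti ?_ ih
        rw [Multiset.insert_eq_cons, totalDegree_cons, totalDegree_apply {_},
          Multiset.map_singleton,
          Multiset.sum_singleton]
        simp only
        omega
      · rw [shift_apply, map_multiset_sum, Multiset.map_map]
        refine multiset_sum_mem _ fun y hy => ?_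
        obtain ⟨x, hx, rfl⟩ := Multiset.mem_map.1 hy
        have hx' : totalDegree t = x.2 + totalDegree (t.erase x) := by
          rw [← totalDegree_cons, Multiset.cons_erase hx]
        simp only [Function.comp_apply, virShift]
        split_ifs
        · have e2 : ((x.2 : ℕ) : PowerSeries A) = PowerSeries.C (x.2 : A) := by simp
          rw [e2, PowerSeries.coeff_C_mul]
          rcases Nat.eq_zero_or_pos x.2 with h0 | h0
          · rw [h0]; simp
          · refine mul_mem (natCast_mem _ _) (ih _ _ ?_)
            rw [totalDegree_cons]
            simp only
            omega
        · simp
      · rw [Egf.sum_apply, map_sum]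
        refine sum_mem fun j _ => ?_
        rw [Egf.sum_apply, map_sum]
        refine sum_mem fun b hb => ?_
        have hb' : ∑ c, b c = j + 1 := (Finset.mem_piAntidiag.1 hb).1
        have e3 : ∀ G, algebraMap ℂ (PowerSeries A) (vert α i b) * PowerSeries.X ^ (j + 2) *
            (PowerSeries.C h) ^ j * G = PowerSeries.C (algebraMap ℂ A (vert α i b) * h ^ j) *
              (PowerSeries.X ^ (j + 2) * G) := by
          intro G
          rw [map_mul, map_pow, PowerSeries.algebraMap_apply]
          ring
        rw [Egf.smul_apply, e3, PowerSeries.coeff_C_mul, PowerSeries.coeff_X_pow_mul']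
        refine mul_mem (mul_mem (hB _) (pow_mem hh _)) ?_
        split_ifs with hjk
        · refine corr_C_mem_levelSubring (L := 1 * (k - (j + 2)) + totalDegree t) hh _ ?_ _ t le_rfl
          refine levelSubring_anti ?_ ih
          rw [totalDegree_cons_rest, hb']
          omega
        · exact zero_mem _

/-- The inverse of the square of `N + 1`. -/
def invSq (N : ℕ) : ℂ := (((N + 1 : ℕ) : ℂ) ^ 2)⁻¹

theorem invSq_injective : Function.Injective invSq := by
  intro M N h
  have h1 : ((M + 1 : ℕ) : ℂ) ^ 2 = ((N + 1 : ℕ) : ℂ) ^ 2 := inv_injective h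
  have h2 : (M + 1) ^ 2 = (N + 1) ^ 2 := by exact_mod_cast h1
  have := Nat.pow_left_injective (n := 2) (by norm_num) h2
  omega

theorem polynomial_eq_of_eval_invSq {P Q : Polynomial ℂ}
    (h : ∀ N, P.eval (invSq N) = Q.eval (invSq N)) : P = Q :=
  Polynomial.eq_of_infinite_eval_eq _ _
    ((Set.infinite_range_of_injective invSq_injective).mono (by rintro _ ⟨N, rfl⟩; exact h N))

/-- Evaluation of polynomials at all `N ^ (-2)`. -/
def evalInvSq : Polynomial ℂ →+* (ℕ → ℂ) := (Polynomial.aeval invSq).toRingHom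

theorem evalInvSq_apply (P : Polynomial ℂ) (N : ℕ) : evalInvSq P N = P.eval (invSq N) := by
  have h1 : (Pi.evalAlgHom ℂ (fun _ : ℕ => ℂ) N) (Polynomial.aeval invSq P) =
      Polynomial.aeval (invSq N) P := by
    rw [← Polynomial.aeval_algHom_apply]; rfl
  rw [Polynomial.coe_aeval_eq_eval] at h1
  exact h1

theorem evalInvSq_injective : Function.Injective evalInvSq := fun P Q h =>
  polynomial_eq_of_eval_invSq fun N => by rw [← evalInvSq_apply, h, evalInvSq_apply]

theorem powerSeries_map_injective {A B : Type*} [CommRing A] [CommRing B] {θ : A →+* B}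
    (hθ : Function.Injective θ) : Function.Injective (PowerSeries.map θ) := by
  intro f g h
  refine PowerSeries.ext fun k => hθ ?_
  rw [← PowerSeries.coeff_map, h, PowerSeries.coeff_map]

/-- The free energies of all `N` at once, the value at `N` being that of `(N + 1) × (N + 1)`
matrices. -/
def freeEnergies (α : Fin 6 → ℂ) : Egf (Fin 6 × ℕ) (PowerSeries (ℕ → ℂ)) := fun s =>
  PowerSeries.mk fun k N => PowerSeries.coeff k (freeEnergy (Nat.succ_pos N) α s)

theorem map_freeEnergies (α : Fin 6 → ℂ) (N : ℕ) :
    Egf.map (PowerSeries.map (Pi.evalRingHom (fun _ => ℂ) N)) (freeEnergies α) =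
      freeEnergy (Nat.succ_pos N) α := by
  ext1 s
  refine PowerSeries.ext fun k => ?_
  rw [map_apply, PowerSeries.coeff_map, freeEnergies, PowerSeries.coeff_mk]
  rfl

theorem freeEnergy_zero {N : ℕ} (hN : 1 ≤ N) (α : Fin 6 → ℂ) : freeEnergy hN α 0 = 0 := by
  rw [freeEnergy, Egf.smul_apply, log_apply (K := 0)]
  · simp [logTrunc]
  · rw [rescale_apply, normMoments_zero]; simp
  · simp

theorem freeEnergies_ext {f g : Egf (Fin 6 × ℕ) (PowerSeries (ℕ → ℂ))}
    (h : ∀ N, Egf.map (PowerSeries.map (Pi.evalRingHom (fun _ => ℂ) N)) f =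
      Egf.map (PowerSeries.map (Pi.evalRingHom (fun _ => ℂ) N)) g) : f = g := by
  ext1 s
  refine PowerSeries.ext fun k => funext fun N => ?_
  have := congrArg (PowerSeries.coeff k) (congrFun (h N) s)
  rwa [map_apply, map_apply, PowerSeries.coeff_map, PowerSeries.coeff_map] at this

theorem map_loopEq_powerSeries {A B : Type*} [CommRing A] [CommRing B] [Algebra ℂ A] [Algebra ℂ B]
    (θ : A →ₐ[ℂ] B) (α : Fin 6 → ℂ) (F : Egf (Fin 6 × ℕ) (PowerSeries A))
    (h u : PowerSeries A) (i : Fin 6) (p K : ℕ) :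
    Egf.map (PowerSeries.map (θ : A →+* B)) (loopEq α F h u i p K) =
      loopEq α (Egf.map (PowerSeries.map (θ : A →+* B)) F) (PowerSeries.map (θ : A →+* B) h)
        (PowerSeries.map (θ : A →+* B) u) i p K :=
  map_loopEq _ (fun a => by
    rw [PowerSeries.algebraMap_apply, PowerSeries.map_C, PowerSeries.algebraMap_apply]
    congr 1
    exact θ.commutes a) _ _ _ _ _ _ _

theorem loopEq_freeEnergies (α : Fin 6 → ℂ) (i : Fin 6) (p K : ℕ) (s) {k : ℕ} (hk : k < K + 2) :
    PowerSeries.coeff k (loopEq α (freeEnergies α) (PowerSeries.C invSq) PowerSeries.X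
      i p K s) = 0 := by
  funext N
  have h1 := map_loopEq_powerSeries (Pi.evalAlgHom ℂ (fun _ : ℕ => ℂ) N) α (freeEnergies α)
    (PowerSeries.C invSq) PowerSeries.X i p K
  rw [PowerSeries.map_C, PowerSeries.map_X] at h1
  have h2 := congrArg (PowerSeries.coeff k) (congrFun h1 s)
  rw [map_apply, PowerSeries.coeff_map] at h2
  refine Eq.trans h2 ?_
  have h3 : Egf.map (PowerSeries.map ((Pi.evalAlgHom ℂ (fun _ : ℕ => ℂ) N : _ →ₐ[ℂ] ℂ) :
      (ℕ → ℂ) →+* ℂ)) (freeEnergies α) = freeEnergy (Nat.succ_pos N) α := map_freeEnergies α N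
  rw [h3]
  exact loopEq_freeEnergy (Nat.succ_pos N) α i p K s hk

theorem D_zero_freeEnergies (α : Fin 6 → ℂ) (c : Fin 6) : D (c, 0) (freeEnergies α) = 1 :=
  freeEnergies_ext fun N => by rw [← D_map, map_freeEnergies, D_zero_freeEnergy, map_one]

/-- The coefficients of the free energies of all `N`, as functions of `N`, form polynomials in
`N ^ (-2)`. -/
theorem freeEnergies_mem (α : Fin 6 → ℂ) (k s) :
    PowerSeries.coeff k (freeEnergies α s) ∈ evalInvSq.range := by
  refine coeff_mem_of_loopEq evalInvSq.range (h := invSq) (fun a => ⟨Polynomial.C a, ?_⟩)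
    ⟨Polynomial.X, ?_⟩ α ?_ (D_zero_freeEnergies α)
    (fun i p K s k hk => loopEq_freeEnergies α i p K s hk) k s
  · funext N; rw [evalInvSq_apply]; simp
  · funext N; rw [evalInvSq_apply]; simp
  · refine PowerSeries.ext fun k => funext fun N => ?_
    rw [freeEnergies, PowerSeries.coeff_mk, freeEnergy_zero]; simp

/-- The polynomial in `N ^ (-2)` that is the coefficient of degree `k` in `α` of the free energy. -/
def genusPoly (α : Fin 6 → ℂ) (k : ℕ) (s : Multiset (Fin 6 × ℕ)) : Polynomial ℂ :=
  (freeEnergies_mem α k s).choose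

theorem evalInvSq_genusPoly (α : Fin 6 → ℂ) (k s) :
    evalInvSq (genusPoly α k s) = PowerSeries.coeff k (freeEnergies α s) :=
  (freeEnergies_mem α k s).choose_spec

theorem eval_genusPoly (α : Fin 6 → ℂ) (k s) {N : ℕ} (hN : 1 ≤ N) :
    (genusPoly α k s).eval (((N : ℂ) ^ 2)⁻¹) = PowerSeries.coeff k (freeEnergy hN α s) := by
  obtain ⟨N, rfl⟩ : ∃ M, N = M + 1 := ⟨N - 1, by omega⟩
  have := congrFun (evalInvSq_genusPoly α k s) N
  rw [evalInvSq_apply, freeEnergies, PowerSeries.coeff_mk] at this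
  exact this

section cumulants

variable {ι : Type} [Fintype ι] [DecidableEq ι] [Nonempty ι]

/-- The topological expansion is unique, since a polynomial is determined by its values at all
`N ^ (-2)`. -/
theorem isTopExpansion_iff {n : ℕ} {f : ℕ → ℂ} {P : Polynomial ℂ}
    (hf : ∀ N : ℕ, 1 ≤ N → f N = (N : ℂ) ^ ((2 : ℤ) - n) * P.eval (((N : ℂ) ^ 2)⁻¹)) {u : ℕ →₀ ℂ} :
    IsTopExpansion n f u ↔ u = P.toFinsupp.coeff := by
  have key : ∀ (v : ℕ →₀ ℂ) (Q : Polynomial ℂ), v = Q.toFinsupp.coeff → ∀ N : ℕ, 1 ≤ N →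
      v.sum (fun g a => a * (N : ℂ) ^ ((2 : ℤ) - n - 2 * g)) =
        (N : ℂ) ^ ((2 : ℤ) - n) * Q.eval (((N : ℂ) ^ 2)⁻¹) := by
    intro v Q hv N hN
    have hNne : (N : ℂ) ≠ 0 := by exact_mod_cast (by omega : N ≠ 0)
    subst hv
    rw [Polynomial.eval_eq_sum, Polynomial.sum, Finset.mul_sum]
    refine Finset.sum_congr rfl fun g _ => ?_
    change Q.coeff g * (N : ℂ) ^ ((2 : ℤ) - n - 2 * g) = _
    rw [zpow_sub₀ hNne _ (2 * (g : ℤ)), zpow_mul, zpow_natCast]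
    have : (N : ℂ) ^ (2 : ℤ) = (N : ℂ) ^ 2 := by norm_cast
    rw [this, inv_pow]
    ring
  constructor
  · intro h
    have hv : u = (Polynomial.ofFinsupp (.ofCoeff u)).toFinsupp.coeff := rfl
    have : Polynomial.ofFinsupp (.ofCoeff u) = P := by
      refine polynomial_eq_of_eval_invSq fun N => ?_
      have h1 := h (N + 1) (by omega)
      rw [hf _ (by omega), key u _ hv _ (by omega)] at h1
      have hNne : ((N + 1 : ℕ) : ℂ) ≠ 0 := by exact_mod_cast (by omega : N + 1 ≠ 0)
      exact (mul_left_cancel₀ (zpow_ne_zero _ hNne) h1).symm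
    rw [hv, this]
  · rintro rfl N hN
    rw [hf N hN, key _ P rfl N hN]

theorem coeff_cumulant (α : Fin 6 → ℂ) (c : ι → Fin 6) (p : ι → ℕ) (k N : ℕ) (hN : 1 ≤ N) :
    PowerSeries.coeff k (cumulant N α c p) = (N : ℂ) ^ ((2 : ℤ) - Fintype.card ι) *
      (genusPoly α k (univ.val.map fun j => (c j, p j))).eval (((N : ℂ) ^ 2)⁻¹) := by
  rw [cumulant_eq hN, eval_genusPoly α k _ hN]

theorem exists_isTopExpansion (α : Fin 6 → ℂ) (c : ι → Fin 6) (p : ι → ℕ) (k : ℕ) :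
    ∃ u, IsTopExpansion (Fintype.card ι) (fun N => PowerSeries.coeff k (cumulant N α c p)) u :=
  ⟨_, (isTopExpansion_iff (coeff_cumulant α c p k)).2 rfl⟩

theorem wCoeff_eq (α : Fin 6 → ℂ) (g : ℕ) (c : ι → Fin 6) (p : ι → ℕ) (k : ℕ) :
    wCoeff α g c p k = (genusPoly α k (univ.val.map fun j => (c j, p j))).coeff g := by
  have h := exists_isTopExpansion α c p k
  rw [wCoeff, topCoeff, dif_pos h, (isTopExpansion_iff (coeff_cumulant α c p k)).1 h.choose_spec]
  rfl

end cumulants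

/-- Exchange of the two variables of a double power series. -/
def swapVars {A : Type*} [CommRing A] : PowerSeries (PowerSeries A) →+* PowerSeries (PowerSeries A)
    where
  toFun f := PowerSeries.mk fun g => PowerSeries.mk fun k =>
    PowerSeries.coeff g (PowerSeries.coeff k f)
  map_one' := by
    refine PowerSeries.ext fun g => PowerSeries.ext fun k => ?_
    simp only [PowerSeries.coeff_mk, PowerSeries.coeff_one]
    split_ifs <;> simp_all
  map_zero' := by
    refine PowerSeries.ext fun g => PowerSeries.ext fun k => ?_
    simp
  map_add' f₁ f₂ := by
    refine PowerSeries.ext fun g => PowerSeries.ext fun k => ?_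
    simp
  map_mul' f₁ f₂ := by
    refine PowerSeries.ext fun g => PowerSeries.ext fun k => ?_
    simp only [PowerSeries.coeff_mk, PowerSeries.coeff_mul, map_sum]
    exact Finset.sum_comm

theorem coeff_coeff_swapVars {A : Type*} [CommRing A] (f : PowerSeries (PowerSeries A)) (g k) :
    PowerSeries.coeff k (PowerSeries.coeff g (swapVars f)) =
      PowerSeries.coeff g (PowerSeries.coeff k f) := by
  change PowerSeries.coeff k (PowerSeries.coeff g (PowerSeries.mk fun g => PowerSeries.mk fun k =>
    PowerSeries.coeff g (PowerSeries.coeff k f))) = _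
  rw [PowerSeries.coeff_mk, PowerSeries.coeff_mk]

/-- The free energy as a power series in `ħ = N ^ (-2)`, whose coefficients are power series in the
variable that records the degree in `α`. -/
def formalFreeEnergy (α : Fin 6 → ℂ) : Egf (Fin 6 × ℕ) (PowerSeries (PowerSeries ℂ)) := fun s =>
  PowerSeries.mk fun g => PowerSeries.mk fun k => (genusPoly α k s).coeff g

theorem coeff_coeff_formalFreeEnergy (α : Fin 6 → ℂ) (s g k) :
    PowerSeries.coeff k (PowerSeries.coeff g (formalFreeEnergy α s)) =
      (genusPoly α k s).coeff g := by
  rw [formalFreeEnergy, PowerSeries.coeff_mk, PowerSeries.coeff_mk]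

/-- The free energy with polynomial coefficients. -/
def polyFreeEnergy (α : Fin 6 → ℂ) : Egf (Fin 6 × ℕ) (PowerSeries (Polynomial ℂ)) := fun s =>
  PowerSeries.mk fun k => genusPoly α k s

theorem map_polyFreeEnergy (α : Fin 6 → ℂ) :
    Egf.map (PowerSeries.map evalInvSq) (polyFreeEnergy α) = freeEnergies α := by
  ext1 s
  refine PowerSeries.ext fun k => ?_
  rw [map_apply, PowerSeries.coeff_map, polyFreeEnergy, PowerSeries.coeff_mk, evalInvSq_genusPoly]

/-- From power series with polynomial coefficients to power series with power series
coefficients, the variables being exchanged. -/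
def swapPoly : PowerSeries (Polynomial ℂ) →+* PowerSeries (PowerSeries ℂ) :=
  swapVars.comp (PowerSeries.map Polynomial.coeToPowerSeries.ringHom)

theorem coeff_coeff_swapPoly (f : PowerSeries (Polynomial ℂ)) (g k) :
    PowerSeries.coeff k (PowerSeries.coeff g (swapPoly f)) = (PowerSeries.coeff k f).coeff g := by
  rw [swapPoly, RingHom.comp_apply, coeff_coeff_swapVars, PowerSeries.coeff_map]
  simp

theorem map_swapPoly (α : Fin 6 → ℂ) :
    Egf.map swapPoly (polyFreeEnergy α) = formalFreeEnergy α := by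
  ext1 s
  refine PowerSeries.ext fun g => PowerSeries.ext fun k => ?_
  rw [map_apply, coeff_coeff_swapPoly, coeff_coeff_formalFreeEnergy, polyFreeEnergy,
    PowerSeries.coeff_mk]

theorem D_zero_formalFreeEnergy (α : Fin 6 → ℂ) (c : Fin 6) :
    D (c, 0) (formalFreeEnergy α) = 1 := by
  have h : D (c, 0) (polyFreeEnergy α) = 1 := by
    refine map_injective (powerSeries_map_injective evalInvSq_injective) ?_
    rw [← D_map, map_polyFreeEnergy, D_zero_freeEnergies, map_one]
  rw [← map_swapPoly, D_map, h, map_one]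

theorem formalFreeEnergy_zero (α : Fin 6 → ℂ) : formalFreeEnergy α 0 = 0 := by
  refine PowerSeries.ext fun g => PowerSeries.ext fun k => ?_
  have : genusPoly α k 0 = 0 := by
    refine evalInvSq_injective ?_
    rw [evalInvSq_genusPoly, map_zero]
    funext N
    rw [freeEnergies, PowerSeries.coeff_mk, freeEnergy_zero]; simp
  rw [coeff_coeff_formalFreeEnergy, this]; simp

/-- Terms of the interaction with more than `g` additional powers of `ħ` do not contribute to
genus `g`. -/
theorem coeff_loopEq_eq {A : Type*} [CommRing A] [Algebra ℂ A] (α : Fin 6 → ℂ)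
    (F : Egf (Fin 6 × ℕ) (PowerSeries A)) (u : PowerSeries A) (i : Fin 6) (p : ℕ) {g K K' : ℕ}
    (hK : g < K) (hKK : K ≤ K') (s) :
    PowerSeries.coeff g (loopEq α F PowerSeries.X u i p K' s) =
      PowerSeries.coeff g (loopEq α F PowerSeries.X u i p K s) := by
  induction K', hKK using Nat.le_induction with
  | base => rfl
  | succ n hn ih =>
    have e : loopEq α F PowerSeries.X u i p (n + 1) = loopEq α F PowerSeries.X u i p n +
        ∑ b ∈ (univ : Finset (Fin 6)).piAntidiag (n + 1),
          (algebraMap ℂ (PowerSeries A) (vert α i b) * u ^ (n + 2) * PowerSeries.X ^ n) •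
            corr F PowerSeries.X ((i, b i + p) ::ₘ rest i b) := by
      rw [loopEq, Finset.sum_range_succ, ← add_assoc]; rfl
    rw [← ih, e, Egf.add_apply, map_add, Egf.sum_apply, map_sum, Finset.sum_eq_zero, add_zero]
    intro b _
    rw [Egf.smul_apply, mul_right_comm, PowerSeries.coeff_mul_X_pow', if_neg (by omega)]

/-- The loop equations order by order in `ħ = N ^ (-2)`: they hold at all `N`, hence as identities
between polynomials in `N ^ (-2)`, and the order of the two expansions may be exchanged. -/
theorem loopEq_formalFreeEnergy (α : Fin 6 → ℂ) (i : Fin 6) (p : ℕ) {g K : ℕ} (hK : g < K) (s) :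
    PowerSeries.coeff g (loopEq α (formalFreeEnergy α) PowerSeries.X
      (PowerSeries.C PowerSeries.X) i p K s) = 0 := by
  refine PowerSeries.ext fun k => ?_
  rw [← coeff_loopEq_eq α _ _ i p hK (le_max_left K k)]
  have h1 : PowerSeries.coeff k (loopEq α (polyFreeEnergy α) (PowerSeries.C Polynomial.X)
      PowerSeries.X i p (max K k) s) = 0 := by
    refine evalInvSq_injective ?_
    let θ : Polynomial ℂ →ₐ[ℂ] (ℕ → ℂ) := Polynomial.aeval invSq
    have h2 := map_loopEq_powerSeries θ α (polyFreeEnergy α) (PowerSeries.C Polynomial.X)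
      PowerSeries.X i p (max K k)
    have h3 : Egf.map (PowerSeries.map (θ : Polynomial ℂ →+* (ℕ → ℂ))) (polyFreeEnergy α) =
      freeEnergies α := map_polyFreeEnergy α
    have h4 : (θ : Polynomial ℂ →+* (ℕ → ℂ)) Polynomial.X = invSq := Polynomial.aeval_X _
    rw [h3, PowerSeries.map_C, PowerSeries.map_X, h4] at h2
    have h5 := congrArg (PowerSeries.coeff k) (congrFun h2 s)
    rw [map_apply, PowerSeries.coeff_map] at h5
    refine Eq.trans h5 ?_
    rw [map_zero]
    exact loopEq_freeEnergies α i p _ s (by omega)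
  -- the exchange of variables maps the variable of degree in `α` to a constant, and `N ^ (-2)` to
  -- the formal variable `ħ`
  have h2 := map_loopEq swapPoly (fun a => ?_) α (polyFreeEnergy α) (PowerSeries.C Polynomial.X)
      PowerSeries.X i p (max K k)
  · have hX : swapPoly PowerSeries.X = PowerSeries.C PowerSeries.X := by
      refine PowerSeries.ext fun g => PowerSeries.ext fun k => ?_
      rw [coeff_coeff_swapPoly, PowerSeries.coeff_X, PowerSeries.coeff_C]
      split_ifs <;> simp_all [PowerSeries.coeff_X, Polynomial.coeff_one]
    have hC : swapPoly (PowerSeries.C Polynomial.X) = PowerSeries.X := by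
      refine PowerSeries.ext fun g => PowerSeries.ext fun k => ?_
      rw [coeff_coeff_swapPoly, PowerSeries.coeff_X, PowerSeries.coeff_C]
      clear h1 hX h2
      split_ifs <;> simp_all [PowerSeries.coeff_one, Polynomial.coeff_X, eq_comm]
    rw [map_swapPoly, hX, hC] at h2
    rw [← h2, map_apply, coeff_coeff_swapPoly, h1]
    simp
  · refine PowerSeries.ext fun g => PowerSeries.ext fun k => ?_
    rw [coeff_coeff_swapPoly]
    rw [PowerSeries.algebraMap_apply, PowerSeries.coeff_C, PowerSeries.algebraMap_apply,
      PowerSeries.coeff_C]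
    split_ifs <;> simp_all [PowerSeries.coeff_C, Polynomial.coeff_C]

/-- Labels of traces `tr 1` may be removed from correlators. -/
theorem corr_add_zeroLabels {R : Type*} [CommRing R] {F : Egf (Fin 6 × ℕ) R} {h : R}
    (hD : ∀ c, D (c, 0) F = 1) (l : Multiset (Fin 6 × ℕ)) (t : Multiset (Fin 6)) :
    corr F h (l + t.map fun c => (c, 0)) = corr F h l := by
  induction t using Multiset.induction with
  | empty => simp
  | cons c t ih =>
    rw [Multiset.map_cons, Multiset.add_cons, corr_cons, cov_of_D_eq_one (hD c), ih]

theorem vert_single (α : Fin 6 → ℂ) (i c : Fin 6) : vert α i (Pi.single c 1) = α i * α c := by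
  have h1 : ∏ e, α e ^ (Pi.single c 1 : Fin 6 → ℕ) e = α c := by
    rw [Finset.prod_eq_single c] <;> simp +contextual
  have h2 : Nat.multinomial univ (Pi.single c 1 : Fin 6 → ℕ) = 1 := by
    rw [Nat.multinomial, Finset.sum_pi_single' c 1 univ, Finset.prod_eq_one]
    · simp
    · intro e _
      by_cases h : e = c
      · subst h; simp
      · rw [Pi.single_eq_of_ne h]; rfl
  rw [vert, h1, h2]
  simp

theorem sum_piAntidiag_one {M : Type*} [AddCommMonoid M] (f : (Fin 6 → ℕ) → M) :
    ∑ b ∈ (univ : Finset (Fin 6)).piAntidiag 1, f b = ∑ c, f (Pi.single c 1) := by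
  symm
  refine Finset.sum_bij (fun c _ => Pi.single c 1) ?_ ?_ ?_ fun _ _ => rfl
  · intro c _
    rw [Finset.mem_piAntidiag]
    exact ⟨(Finset.sum_pi_single' c 1 univ).trans (by simp), by simp⟩
  · intro c _ d _ h
    by_contra hne
    have h1 := congrFun h c
    simp only [Pi.single_eq_same, Pi.single_eq_of_ne hne] at h1
    omega
  · intro b hb
    have h : ∑ c, b c = 1 := (Finset.mem_piAntidiag.1 hb).1
    obtain ⟨c, hc⟩ : ∃ c, b c ≠ 0 := by
      by_contra! h0
      simp [h0] at h
    have h2 := Finset.add_sum_erase univ b (Finset.mem_univ c)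
    rw [h] at h2
    have h3 : ∑ e ∈ univ.erase c, b e = 0 := by omega
    rw [Finset.sum_eq_zero_iff] at h3
    refine ⟨c, mem_univ c, funext fun e => ?_⟩
    by_cases he : e = c
    · subst he; rw [Pi.single_eq_same]; omega
    · rw [Pi.single_eq_of_ne he, h3 e (by simp [he])]

/-- A vertex of degree two, of the colors `i` and `c`: the other traces are `tr 1`. For `c = i` only
one trace is left. -/
theorem corr_rest_single {R : Type*} [CommRing R] {F : Egf (Fin 6 × ℕ) R} {h : R}
    (hD : ∀ c, D (c, 0) F = 1) (i c : Fin 6) (p : ℕ) :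
    corr F h ((i, (Pi.single c 1 : Fin 6 → ℕ) i + p) ::ₘ rest i (Pi.single c 1)) =
      if c = i then D (i, p + 1) F else corr F h {(i, p), (c, 1)} := by
  split_ifs with hc
  · subst hc
    have h1 : rest c (Pi.single c 1) = (univ.erase c).val.map fun e => (e, 0) :=
      Multiset.map_congr rfl fun e he => by
        have he' : e ∈ univ.erase c := he
        rw [Pi.single_eq_of_ne (Finset.ne_of_mem_erase he')]
    rw [h1, ← Multiset.singleton_add, corr_add_zeroLabels hD, corr_singleton, Pi.single_eq_same,
      add_comm]
  · have hm : c ∈ univ.erase i := by simp [hc]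
    have h1 : rest i (Pi.single c 1) =
        (c, 1) ::ₘ ((univ.erase i).erase c).val.map fun e => (e, 0) := by
      rw [rest]
      conv_lhs => rw [← Finset.insert_erase hm]
      rw [Finset.insert_val_of_notMem (Finset.notMem_erase _ _), Multiset.map_cons,
        Pi.single_eq_same]
      refine congrArg _ (Multiset.map_congr rfl fun e he => ?_)
      have he' : e ∈ (univ.erase i).erase c := he
      rw [Pi.single_eq_of_ne (Finset.ne_of_mem_erase he')]
    have h2 : (i, (Pi.single c 1 : Fin 6 → ℕ) i + p) = (i, p) := by
      rw [Pi.single_eq_of_ne (Ne.symm hc), zero_add]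
    rw [h1, h2, Multiset.insert_eq_cons, ← corr_add_zeroLabels hD ((i, p) ::ₘ {(c, 1)}),
      Multiset.cons_add, Multiset.singleton_add]

/-- The interaction terms with at least one explicit power of `ħ`. -/
def higherVertices {R : Type*} [CommRing R] [Algebra ℂ R] (α : Fin 6 → ℂ)
    (F : Egf (Fin 6 × ℕ) R) (h u : R) (i : Fin 6) (p K : ℕ) : Egf (Fin 6 × ℕ) R :=
  ∑ j ∈ range K, ∑ b ∈ (univ : Finset (Fin 6)).piAntidiag (j + 2),
    (algebraMap ℂ R (vert α i b) * u ^ (j + 3) * h ^ j) • corr F h ((i, b i + p) ::ₘ rest i b)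

/-- The loop equation with the quadratic vertices made explicit. -/
theorem loopEq_succ {R : Type*} [CommRing R] [Algebra ℂ R] (α : Fin 6 → ℂ)
    {F : Egf (Fin 6 × ℕ) R} (hD : ∀ c, D (c, 0) F = 1) (h u : R) (i : Fin 6) (p K : ℕ) :
    loopEq α F h u i p (K + 1) = ∑ k ∈ range p, (D (i, k) F * D (i, p - 1 - k) F +
        h • D (i, k) (D (i, p - 1 - k) F)) - D (i, p + 1) F + shift (virShift R i p) F +
      ((algebraMap ℂ R (α i * α i) * u ^ 2) • D (i, p + 1) F +
      ∑ c ∈ univ.erase i, (algebraMap ℂ R (α i * α c) * u ^ 2) •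
        (D (i, p) F * D (c, 1) F + h • D (i, p) (D (c, 1) F))) +
      h • higherVertices α F h u i p K := by
  have h1 : ∑ b ∈ (univ : Finset (Fin 6)).piAntidiag (0 + 1),
      (algebraMap ℂ R (vert α i b) * u ^ (0 + 2) * h ^ 0) • corr F h ((i, b i + p) ::ₘ rest i b) =
      (algebraMap ℂ R (α i * α i) * u ^ 2) • D (i, p + 1) F +
      ∑ c ∈ univ.erase i, (algebraMap ℂ R (α i * α c) * u ^ 2) •
        (D (i, p) F * D (c, 1) F + h • D (i, p) (D (c, 1) F)) := by
    rw [zero_add, zero_add, sum_piAntidiag_one, ← Finset.add_sum_erase _ _ (mem_univ i)]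
    simp only [vert_single, corr_rest_single hD, if_true, pow_zero, mul_one]
    refine congrArg₂ (· + ·) rfl (Finset.sum_congr rfl fun c hc => ?_)
    rw [if_neg (Finset.ne_of_mem_erase hc), corr_pair]
  rw [loopEq, Finset.sum_range_succ', h1, add_comm (∑ j ∈ range K, _), ← add_assoc, higherVertices,
    Finset.smul_sum]
  refine congrArg₂ (· + ·) (congrArg₂ (· + ·) (congrArg₂ (· + ·) (congrArg₂ (· - ·) ?_ rfl) rfl)
    rfl) ?_
  · exact Finset.sum_congr rfl fun k _ => corr_pair _ _ _ _
  · refine Finset.sum_congr rfl fun j _ => ?_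
    rw [Finset.smul_sum]
    refine Finset.sum_congr rfl fun b _ => ?_
    rw [smul_smul]
    congr 1
    ring

end QuarticTensor

namespace QuarticTensor

/-! ### Absolute convergence in the couplings -/

/-- The power series that converge absolutely at `r`. -/
def convergentAt (r : ℂ) : Subalgebra ℂ (PowerSeries ℂ) where
  carrier := {f | Summable fun n => ‖PowerSeries.coeff n f * r ^ n‖}
  mul_mem' {f g} hf hg := by
    have h := summable_norm_sum_mul_antidiagonal_of_summable_norm hf hg
    refine h.congr fun n => ?_
    rw [PowerSeries.coeff_mul, Finset.sum_mul]
    refine congrArg _ (Finset.sum_congr rfl fun x hx => ?_)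
    rw [← Finset.HasAntidiagonal.mem_antidiagonal.1 hx, pow_add]
    ring
  add_mem' {f g} hf hg := by
    refine Summable.of_nonneg_of_le (fun _ => norm_nonneg _) (fun n => ?_) (hf.add hg)
    rw [map_add, add_mul]
    exact norm_add_le _ _
  algebraMap_mem' a := by
    refine summable_of_ne_finset_zero (s := {0}) fun n hn => ?_
    rw [PowerSeries.algebraMap_apply, PowerSeries.coeff_C, if_neg (by simpa using hn)]
    simp

theorem mem_convergentAt {r : ℂ} {f : PowerSeries ℂ} :
    f ∈ convergentAt r ↔ Summable fun n => ‖PowerSeries.coeff n f * r ^ n‖ := Iff.rfl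

theorem mem_convergentAt_of_finite {r : ℂ} {f : PowerSeries ℂ} (K : ℕ)
    (h : ∀ n, K ≤ n → PowerSeries.coeff n f = 0) : f ∈ convergentAt r := by
  refine summable_of_ne_finset_zero (s := range K) fun n hn => ?_
  rw [h n (by simpa using hn)]
  simp

theorem X_mem_convergentAt (r : ℂ) : (PowerSeries.X : PowerSeries ℂ) ∈ convergentAt r :=
  mem_convergentAt_of_finite 2 fun n hn => by rw [PowerSeries.coeff_X, if_neg (by omega)]

/-- The value of a power series at a point of absolute convergence. -/
def evalAt (r : ℂ) : convergentAt r →ₐ[ℂ] ℂ :=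
  AlgHom.ofLinearMap
    { toFun := fun f => ∑' n, PowerSeries.coeff n f.1 * r ^ n
      map_add' := fun f g => by
        rw [← Summable.tsum_add f.2.of_norm g.2.of_norm]
        refine tsum_congr fun n => ?_
        rw [Subalgebra.coe_add, map_add, add_mul]
      map_smul' := fun a f => by
        rw [RingHom.id_apply, smul_eq_mul, ← tsum_mul_left]
        refine tsum_congr fun n => ?_
        rw [Subalgebra.coe_smul, map_smul, smul_eq_mul, mul_assoc] }
    (by
      change ∑' n, PowerSeries.coeff n (1 : PowerSeries ℂ) * r ^ n = 1
      rw [tsum_eq_single 0]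
      · simp
      · intro n hn
        rw [PowerSeries.coeff_one, if_neg hn, zero_mul])
    (fun f g => by
      change ∑' n, PowerSeries.coeff n (f.1 * g.1) * r ^ n =
        (∑' n, PowerSeries.coeff n f.1 * r ^ n) * ∑' n, PowerSeries.coeff n g.1 * r ^ n
      rw [tsum_mul_tsum_eq_tsum_sum_antidiagonal_of_summable_norm f.2 g.2]
      refine tsum_congr fun n => ?_
      rw [PowerSeries.coeff_mul, Finset.sum_mul]
      refine Finset.sum_congr rfl fun x hx => ?_
      rw [← Finset.HasAntidiagonal.mem_antidiagonal.1 hx, pow_add]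
      ring)

theorem evalAt_apply {r : ℂ} (f : convergentAt r) :
    evalAt r f = ∑' n, PowerSeries.coeff n f.1 * r ^ n := rfl

theorem hasSum_evalAt {r : ℂ} (f : convergentAt r) :
    HasSum (fun n => PowerSeries.coeff n f.1 * r ^ n) (evalAt r f) := f.2.of_norm.hasSum

/-- Multiplication by a geometric series preserves absolute convergence. -/
theorem mem_convergentAt_of_one_sub_mul {r a : ℂ} (ha : ‖a * r‖ < 1) {f : PowerSeries ℂ}
    (hf : (1 - PowerSeries.C a * PowerSeries.X) * f ∈ convergentAt r) : f ∈ convergentAt r := by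
  have h1 : (PowerSeries.mk fun n => a ^ n) * (1 - PowerSeries.C a * PowerSeries.X) = 1 := by
    refine PowerSeries.ext fun n => ?_
    rw [mul_sub, mul_one, map_sub, ← mul_assoc]
    cases n with
    | zero => simp
    | succ n =>
      rw [PowerSeries.coeff_succ_mul_X, mul_comm, PowerSeries.coeff_C_mul, PowerSeries.coeff_mk,
        PowerSeries.coeff_mk, PowerSeries.coeff_one, if_neg (by omega)]
      ring
  have h2 : (PowerSeries.mk fun n => a ^ n) ∈ convergentAt r := by
    refine (summable_geometric_of_lt_one (norm_nonneg _) ha).congr fun n => ?_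
    rw [PowerSeries.coeff_mk, ← mul_pow, norm_pow]
  have := mul_mem h2 hf
  rwa [← mul_assoc, h1, one_mul] at this

theorem mem_convergentAt_of_one_sub_sq_mul {S : ℂ} (hS : ‖S‖ < 1) {f : PowerSeries ℂ}
    (hf : (1 - PowerSeries.C S * PowerSeries.X ^ 2) * f ∈ convergentAt 1) : f ∈ convergentAt 1 := by
  obtain ⟨t, ht⟩ := IsAlgClosed.exists_pow_nat_eq S (n := 2) (by norm_num)
  have h1 : ‖t‖ < 1 := by
    rw [← ht, norm_pow] at hS
    by_contra! h
    nlinarith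
  refine mem_convergentAt_of_one_sub_mul (a := t) (by simpa using h1)
    (mem_convergentAt_of_one_sub_mul (a := -t) (by simpa using h1) ?_)
  convert hf using 1
  rw [← ht, map_pow, map_neg]
  ring

namespace Egf
variable {β A : Type*} [CommRing A] {B : Subring A} {a : ℕ} {ω : Multiset β →+ ℕ} {L : ℕ}

theorem X_smul_mem_levelSubring' {f : Egf β (PowerSeries A)}
    (hf : ∀ L', L = L' + a → f ∈ levelSubring B a ω L') :
    (PowerSeries.X : PowerSeries A) • f ∈ levelSubring B a ω L := by
  by_cases h : a ≤ L
  · obtain ⟨L', rfl⟩ := Nat.exists_eq_add_of_le' h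
    exact X_smul_mem_levelSubring (hf L' rfl)
  · intro k s hs
    rw [smul_apply]
    cases k with
    | zero => rw [PowerSeries.coeff_zero_X_mul]; exact zero_mem _
    | succ k => rw [mul_add] at hs; omega

theorem X_pow_smul_mem_levelSubring {f : Egf β (PowerSeries A)}
    (hf : f ∈ levelSubring B a ω L) (n : ℕ) :
    (PowerSeries.X ^ n : PowerSeries A) • f ∈ levelSubring B a ω L := by
  induction n with
  | zero => rwa [pow_zero, one_smul]
  | succ n ih =>
    rw [pow_succ', mul_smul]
    exact X_smul_mem_levelSubring' fun L' h => levelSubring_anti (by omega) ih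

theorem corr_X_mem_levelSubring {F : Egf β (PowerSeries A)} {L : ℕ}
    (hF : F ∈ levelSubring B 2 Multiset.cardHom (L + 1)) (l : Multiset β) :
    corr F PowerSeries.X l ∈ levelSubring B 2 Multiset.cardHom L := by
  induction l using Multiset.induction with
  | empty => rw [corr_zero]; exact one_mem _
  | cons b l ih =>
    rw [corr_cons, cov]
    refine add_mem (mul_mem (D_mem_levelSubring ?_) ih)
      (X_smul_mem_levelSubring' fun L' h => D_mem_levelSubring (levelSubring_anti ?_ ih))
    · simpa using hF
    · simp; omega

end Egf

open Egf

section

variable {A : Type*} [CommRing A] [Algebra ℂ A]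

/-- One step in the recursive solution of the loop equations in powers of `ħ`: everything except the
linear terms involves smaller levels. -/
theorem sub_mem_levelSubring {B : Subalgebra ℂ A} {r : A} (hr : r ∈ B) (α : Fin 6 → ℂ)
    {F : Egf (Fin 6 × ℕ) (PowerSeries A)} (hD : ∀ c, D (c, 0) F = 1)
    (hloop : ∀ i p g K s, g < K →
      PowerSeries.coeff g (loopEq α F PowerSeries.X (PowerSeries.C r) i p K s) = 0) {L : ℕ}
    (hF : F ∈ levelSubring B.toSubring 2 Multiset.cardHom L) (i : Fin 6) (p : ℕ)
    (hp : ∀ k < p, D (i, k) F ∈ levelSubring B.toSubring 2 Multiset.cardHom L) :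
    D (i, p + 1) F - ((algebraMap ℂ (PowerSeries A) (α i * α i) * PowerSeries.C r ^ 2) •
      D (i, p + 1) F + ∑ c ∈ univ.erase i, (algebraMap ℂ (PowerSeries A) (α i * α c) *
        PowerSeries.C r ^ 2) • (D (i, p) F * D (c, 1) F)) ∈
      levelSubring B.toSubring 2 Multiset.cardHom L := by
  have halg : ∀ a : ℂ, algebraMap ℂ (PowerSeries A) a = PowerSeries.C (algebraMap ℂ A a) := fun a =>
    PowerSeries.algebraMap_apply
  have hDD : ∀ b c, (PowerSeries.X : PowerSeries A) • D b (D c F) ∈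
      levelSubring B.toSubring 2 Multiset.cardHom L := fun b c =>
    X_smul_mem_levelSubring' fun L' h => D_mem_levelSubring (D_mem_levelSubring
      (by simpa [h] using hF))
  have hsmul : ∀ (a : ℂ) (n : ℕ) (f : Egf (Fin 6 × ℕ) (PowerSeries A)),
      f ∈ levelSubring B.toSubring 2 Multiset.cardHom L →
      (algebraMap ℂ (PowerSeries A) a * PowerSeries.C r ^ n) • f ∈
        levelSubring B.toSubring 2 Multiset.cardHom L := by
    intro a n f hf
    rw [halg, ← map_pow, ← map_mul]
    exact C_smul_mem_levelSubring (mul_mem (B.algebraMap_mem a) (pow_mem hr n)) hf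
  -- the remaining terms: products with smaller exponents, terms with fewer labels, and terms with
  -- an additional `ħ`, which makes up for two labels
  have key : ∀ K, loopEq α F PowerSeries.X (PowerSeries.C r) i p (K + 1) +
      (D (i, p + 1) F - ((algebraMap ℂ (PowerSeries A) (α i * α i) * PowerSeries.C r ^ 2) •
      D (i, p + 1) F + ∑ c ∈ univ.erase i, (algebraMap ℂ (PowerSeries A) (α i * α c) *
        PowerSeries.C r ^ 2) • (D (i, p) F * D (c, 1) F))) ∈
      levelSubring B.toSubring 2 Multiset.cardHom L := by
    intro K
    have e : loopEq α F PowerSeries.X (PowerSeries.C r) i p (K + 1) +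
      (D (i, p + 1) F - ((algebraMap ℂ (PowerSeries A) (α i * α i) * PowerSeries.C r ^ 2) •
      D (i, p + 1) F + ∑ c ∈ univ.erase i, (algebraMap ℂ (PowerSeries A) (α i * α c) *
        PowerSeries.C r ^ 2) • (D (i, p) F * D (c, 1) F))) =
      ∑ k ∈ range p, (D (i, k) F * D (i, p - 1 - k) F +
        (PowerSeries.X : PowerSeries A) • D (i, k) (D (i, p - 1 - k) F)) +
      shift (virShift _ i p) F +
      ∑ c ∈ univ.erase i, (algebraMap ℂ (PowerSeries A) (α i * α c) * PowerSeries.C r ^ 2) •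
        ((PowerSeries.X : PowerSeries A) • D (i, p) (D (c, 1) F)) +
      (PowerSeries.X : PowerSeries A) •
        higherVertices α F PowerSeries.X (PowerSeries.C r) i p K := by
      rw [loopEq_succ α hD]
      simp only [smul_add, Finset.sum_add_distrib]
      abel
    rw [e]
    refine add_mem (add_mem (add_mem (sum_mem fun k hk => add_mem (mul_mem (hp _ ?_) (hp _ ?_))
      (hDD _ _)) ?_) (sum_mem fun c _ => hsmul _ _ _ (hDD _ _)))
      (X_smul_mem_levelSubring' fun L' h => sum_mem fun j _ => sum_mem fun b _ => ?_)
    · exact Finset.mem_range.1 hk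
    · have := Finset.mem_range.1 hk; omega
    · intro k s hs
      rw [shift_apply, map_multiset_sum, Multiset.map_map]
      refine multiset_sum_mem _ fun y hy => ?_
      obtain ⟨x, hx, rfl⟩ := Multiset.mem_map.1 hy
      simp only [Function.comp_apply, virShift]
      split_ifs
      · have e2 : ((x.2 : ℕ) : PowerSeries A) = PowerSeries.C (x.2 : A) := by simp
        rw [e2, PowerSeries.coeff_C_mul]
        refine mul_mem (natCast_mem _ _) (hF _ _ ?_)
        simpa [Multiset.card_erase_add_one hx] using hs
      · simp
    · have e3 : (algebraMap ℂ (PowerSeries A) (vert α i b) * PowerSeries.C r ^ (j + 3) *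
          PowerSeries.X ^ j) • corr F PowerSeries.X ((i, b i + p) ::ₘ rest i b) =
          (algebraMap ℂ (PowerSeries A) (vert α i b) * PowerSeries.C r ^ (j + 3)) •
            (PowerSeries.X ^ j : PowerSeries A) •
              corr F PowerSeries.X ((i, b i + p) ::ₘ rest i b) := mul_smul _ _ _
      rw [e3, halg, ← map_pow, ← map_mul]
      exact C_smul_mem_levelSubring (mul_mem (B.algebraMap_mem _) (pow_mem hr _))
        (X_pow_smul_mem_levelSubring (corr_X_mem_levelSubring
          (levelSubring_anti (by omega) hF) _) _)
  intro k s hs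
  have h1 := key k k s hs
  rwa [Egf.add_apply, map_add, hloop i p k (k + 1) s (by omega), zero_add] at h1

end

variable {α : Fin 6 → ℂ}

/-- The recursion of `sub_mem_levelSubring` stays within the absolutely convergent series: the
linear terms are inverted by the geometric series of `∑_c α_c ^ 2` for the traces of first powers,
and of `α_i ^ 2` for the others. -/
theorem D_mem_of_mem (hα : ∀ c, ‖α c‖ < 1) (hα2 : ‖∑ c, α c ^ 2‖ < 1) {L : ℕ}
    (hF : formalFreeEnergy α ∈
      levelSubring (convergentAt 1).toSubring 2 Multiset.cardHom L) (i : Fin 6) (q : ℕ) :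
    D (i, q) (formalFreeEnergy α) ∈
      levelSubring (convergentAt 1).toSubring 2 Multiset.cardHom L := by
  have hstep := sub_mem_levelSubring (X_mem_convergentAt 1) α (D_zero_formalFreeEnergy α)
    (fun i p g K s h => loopEq_formalFreeEnergy α i p h s) hF
  have h0 : ∀ c, D (c, 0) (formalFreeEnergy α) ∈
      levelSubring (convergentAt 1).toSubring 2 Multiset.cardHom L := fun c => by
    rw [D_zero_formalFreeEnergy]; exact one_mem _
  have hcoeff : ∀ (a : ℂ) (f : Egf (Fin 6 × ℕ) (PowerSeries (PowerSeries ℂ))) k s,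
      PowerSeries.coeff k (((algebraMap ℂ (PowerSeries (PowerSeries ℂ)) a *
        PowerSeries.C PowerSeries.X ^ 2) • f) s) =
      PowerSeries.C a * PowerSeries.X ^ 2 * PowerSeries.coeff k (f s) := by
    intro a f k s
    rw [Egf.smul_apply, PowerSeries.algebraMap_apply, PowerSeries.algebraMap_apply, ← map_pow,
      ← map_mul, PowerSeries.coeff_C_mul]
    rfl
  -- the traces of first powers obey a linear system with a matrix of rank one
  have h1 : ∀ c, D (c, 1) (formalFreeEnergy α) ∈
      levelSubring (convergentAt 1).toSubring 2 Multiset.cardHom L := by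
    intro e k s hs
    set y : Fin 6 → PowerSeries ℂ := fun c =>
      PowerSeries.coeff k (D (c, 1) (formalFreeEnergy α) s) with hy
    -- `y c = α c Y` up to convergent series, and therefore `Y = (∑_c α_c ^ 2) Y` up to convergent
    -- series
    set Y := ∑ c, PowerSeries.C (α c) * y c with hY
    have hr : ∀ c, y c - PowerSeries.C (α c) * PowerSeries.X ^ 2 * Y ∈ convergentAt 1 := by
      intro c
      have h2 := hstep c 0 (fun k hk => absurd hk (Nat.not_lt_zero _)) k s hs
      simp only [D_zero_formalFreeEnergy, one_mul, zero_add] at h2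
      rw [Egf.sub_apply, Egf.add_apply, Egf.sum_apply, map_sub, map_add, map_sum, hcoeff] at h2
      simp only [hcoeff] at h2
      have h3 := Finset.add_sum_erase univ (fun e => PowerSeries.C (α e) * y e) (mem_univ c)
      have h4 : y c - PowerSeries.C (α c) * PowerSeries.X ^ 2 * Y =
          y c - (PowerSeries.C (α c * α c) * PowerSeries.X ^ 2 * y c + ∑ e ∈ univ.erase c,
            PowerSeries.C (α c * α e) * PowerSeries.X ^ 2 * y e) := by
        rw [hY, ← h3, mul_add, Finset.mul_sum, map_mul]
        congr 1
        refine congrArg₂ (· + ·) (by ring) (Finset.sum_congr rfl fun e _ => ?_)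
        rw [map_mul]; ring
      rw [h4]
      exact h2
    have hYm : Y ∈ convergentAt 1 := by
      refine mem_convergentAt_of_one_sub_sq_mul hα2 ?_
      have h5 : (1 - PowerSeries.C (∑ c, α c ^ 2) * PowerSeries.X ^ 2) * Y =
          ∑ c, PowerSeries.C (α c) * (y c - PowerSeries.C (α c) * PowerSeries.X ^ 2 * Y) := by
        simp only [mul_sub, Finset.sum_sub_distrib, ← hY, map_sum, map_pow, sub_mul, one_mul,
          Finset.sum_mul]
        congr 1
        exact Finset.sum_congr rfl fun c _ => by ring
      rw [h5]
      exact sum_mem fun c _ => mul_mem ((convergentAt 1).algebraMap_mem (α c)) (hr c)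
    have h6 : y e = (y e - PowerSeries.C (α e) * PowerSeries.X ^ 2 * Y) +
        PowerSeries.C (α e) * PowerSeries.X ^ 2 * Y := by ring
    change y e ∈ convergentAt 1
    rw [h6]
    exact add_mem (hr e) (mul_mem (mul_mem ((convergentAt 1).algebraMap_mem (α e))
      (pow_mem (X_mem_convergentAt 1) 2)) hYm)
  induction q using Nat.strong_induction_on with
  | _ q ih =>
    -- for higher powers, only the term with `α_i ^ 2` has the same level and exponent
    rcases q with _ | p
    · exact h0 i
    intro k s hs
    have h2 := hstep i p (fun k hk => ih k (by omega)) k s hs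
    have h3 : ∑ c ∈ univ.erase i, (algebraMap ℂ (PowerSeries (PowerSeries ℂ)) (α i * α c) *
        PowerSeries.C PowerSeries.X ^ 2) • (D (i, p) (formalFreeEnergy α) *
          D (c, 1) (formalFreeEnergy α)) ∈
        levelSubring (convergentAt 1).toSubring 2 Multiset.cardHom L := by
      refine sum_mem fun c _ => ?_
      rw [PowerSeries.algebraMap_apply, ← map_pow, ← map_mul]
      exact C_smul_mem_levelSubring (mul_mem (Subalgebra.algebraMap_mem _ _)
        (pow_mem (X_mem_convergentAt 1) 2)) (mul_mem (ih p (by omega)) (h1 c))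
    have h4 := add_mem h2 (h3 k s hs)
    rw [Egf.sub_apply, Egf.add_apply, map_sub, map_add, hcoeff, ← sub_sub, sub_add_cancel] at h4
    refine mem_convergentAt_of_one_sub_sq_mul (S := α i * α i) ?_ ?_
    · rw [norm_mul]
      have := hα i
      have := norm_nonneg (α i)
      nlinarith
    · rw [sub_mul, one_mul]
      exact h4

/-- All correlations of given genus converge absolutely; induction on the level `2 g + n`, where `n`
is the number of traces. -/
theorem coeff_formalFreeEnergy_mem (hα : ∀ c, ‖α c‖ < 1) (hα2 : ‖∑ c, α c ^ 2‖ < 1) (g s) :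
    PowerSeries.coeff g (formalFreeEnergy α s) ∈ convergentAt 1 := by
  suffices H : ∀ L, formalFreeEnergy α ∈
    levelSubring (convergentAt 1).toSubring 2 Multiset.cardHom L from H _ g s le_rfl
  intro L
  have h0 : ∀ k, PowerSeries.coeff k (formalFreeEnergy α 0) ∈ (convergentAt 1).toSubring := by
    intro k; rw [formalFreeEnergy_zero, map_zero]; exact zero_mem _
  induction L with
  | zero =>
    intro k s hs
    have : s = 0 := by
      rw [← Multiset.card_eq_zero]; simp at hs; simp [hs]
    subst this
    exact h0 k
  | succ L ih =>
    intro k s hs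
    induction s using Multiset.induction with
    | empty => exact h0 k
    | cons b t _ =>
      refine D_mem_of_mem hα hα2 ih b.1 b.2 k t ?_
      simp at hs ⊢
      omega

theorem summable_wCoeff (hα : ∀ c, ‖α c‖ < 1) (hα2 : ‖∑ c, α c ^ 2‖ < 1) (g : ℕ)
    {ι : Type} [Fintype ι] [DecidableEq ι] [Nonempty ι] (c : ι → Fin 6) (p : ι → ℕ) :
    Summable (wCoeff α g c p) := by
  have h := coeff_formalFreeEnergy_mem hα hα2 g (univ.val.map fun j => (c j, p j))
  refine (mem_convergentAt.1 h).of_norm.congr fun k => ?_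
  rw [wCoeff_eq, coeff_coeff_formalFreeEnergy, one_pow, mul_one]

/-- The free energy at the given couplings, as a power series in `ħ`. -/
def energy (α : Fin 6 → ℂ) : Egf (Fin 6 × ℕ) (PowerSeries ℂ) := fun s =>
  PowerSeries.mk fun g => ∑' k, (genusPoly α k s).coeff g

theorem w_eq (g : ℕ) {ι : Type} [Fintype ι] [DecidableEq ι] [Nonempty ι] (c : ι → Fin 6)
    (p : ι → ℕ) :
    w α g c p = PowerSeries.coeff g (energy α (univ.val.map fun j => (c j, p j))) := by
  rw [w, energy, PowerSeries.coeff_mk]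
  exact tsum_congr fun k => wCoeff_eq α g c p k

/-- The free energy with coefficients in the algebra of absolutely convergent power series. -/
def convergentFreeEnergy (hα : ∀ c, ‖α c‖ < 1) (hα2 : ‖∑ c, α c ^ 2‖ < 1) :
    Egf (Fin 6 × ℕ) (PowerSeries (convergentAt 1)) := fun s =>
  PowerSeries.mk fun g => ⟨_, coeff_formalFreeEnergy_mem hα hα2 g s⟩

theorem map_val_convergentFreeEnergy (hα : ∀ c, ‖α c‖ < 1) (hα2 : ‖∑ c, α c ^ 2‖ < 1) :
    Egf.map (PowerSeries.map ((convergentAt 1).val : convergentAt 1 →+* PowerSeries ℂ))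
      (convergentFreeEnergy hα hα2) = formalFreeEnergy α := by
  ext1 s
  refine PowerSeries.ext fun g => ?_
  rw [map_apply, PowerSeries.coeff_map, convergentFreeEnergy, PowerSeries.coeff_mk]
  rfl

theorem map_evalAt_convergentFreeEnergy (hα : ∀ c, ‖α c‖ < 1) (hα2 : ‖∑ c, α c ^ 2‖ < 1) :
    Egf.map (PowerSeries.map (evalAt 1 : convergentAt 1 →+* ℂ))
      (convergentFreeEnergy hα hα2) = energy α := by
  ext1 s
  refine PowerSeries.ext fun g => ?_
  rw [map_apply, PowerSeries.coeff_map, convergentFreeEnergy, PowerSeries.coeff_mk, energy,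
    PowerSeries.coeff_mk]
  refine (evalAt_apply _).trans (tsum_congr fun k => ?_)
  rw [one_pow, mul_one, coeff_coeff_formalFreeEnergy]

theorem convergentAt_val_injective : Function.Injective
    (PowerSeries.map ((convergentAt 1).val : convergentAt 1 →+* PowerSeries ℂ)) :=
  powerSeries_map_injective Subtype.val_injective

theorem D_zero_energy (hα : ∀ c, ‖α c‖ < 1) (hα2 : ‖∑ c, α c ^ 2‖ < 1) (c : Fin 6) :
    D (c, 0) (energy α) = 1 := by
  have h : D (c, 0) (convergentFreeEnergy hα hα2) = 1 := by
    refine map_injective convergentAt_val_injective ?_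
    rw [← D_map, map_val_convergentFreeEnergy, D_zero_formalFreeEnergy, map_one]
  rw [← map_evalAt_convergentFreeEnergy hα hα2, D_map, h, map_one]

/-- The loop equations at the actual couplings: evaluation at `1` of the variable that records the
degree in `α` is a homomorphism on absolutely convergent series. -/
theorem loopEq_energy (hα : ∀ c, ‖α c‖ < 1) (hα2 : ‖∑ c, α c ^ 2‖ < 1) (i : Fin 6) (p : ℕ)
    {g K : ℕ} (hK : g < K) (s) :
    PowerSeries.coeff g (loopEq α (energy α) PowerSeries.X 1 i p K s) = 0 := by
  set x : convergentAt 1 := ⟨PowerSeries.X, X_mem_convergentAt 1⟩ with hx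
  have h1 : PowerSeries.coeff g (loopEq α (convergentFreeEnergy hα hα2) PowerSeries.X
      (PowerSeries.C x) i p K s) = 0 := by
    have h2 := map_loopEq_powerSeries (convergentAt 1).val α (convergentFreeEnergy hα hα2)
      PowerSeries.X (PowerSeries.C x) i p K
    rw [map_val_convergentFreeEnergy, PowerSeries.map_X, PowerSeries.map_C] at h2
    have h5 := congrArg (PowerSeries.coeff g) (congrFun h2 s)
    rw [map_apply, PowerSeries.coeff_map] at h5
    refine Subtype.val_injective (Eq.trans h5 ?_)
    exact loopEq_formalFreeEnergy α i p hK s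
  have h2 := map_loopEq_powerSeries (evalAt 1) α (convergentFreeEnergy hα hα2)
    PowerSeries.X (PowerSeries.C x) i p K
  have hx1 : (evalAt 1 : convergentAt 1 →+* ℂ) x = 1 := by
    refine (evalAt_apply x).trans ?_
    rw [tsum_eq_single 1]
    · simp [hx]
    · intro n hn
      rw [hx, PowerSeries.coeff_X, if_neg hn, zero_mul]
  rw [map_evalAt_convergentFreeEnergy, PowerSeries.map_X, PowerSeries.map_C, hx1, map_one] at h2
  rw [← h2, map_apply, PowerSeries.coeff_map, h1, map_zero]

end QuarticTensor

namespace QuarticTensor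

/-! ### Laurent series at infinity -/

/-- Laurent series in `1 / x`, for a formal variable `x`. -/
def LaurentInf := HahnSeries ℤ ℂ

namespace LaurentInf

instance : Field LaurentInf := inferInstanceAs (Field (HahnSeries ℤ ℂ))

instance : Algebra ℂ LaurentInf := (HahnSeries.C : ℂ →+* HahnSeries ℤ ℂ).toAlgebra

/-- The coefficient of `x ^ (-n)`. -/
def coeff (n : ℤ) : LaurentInf →ₗ[ℂ] ℂ where
  toFun f := HahnSeries.coeff f n
  map_add' _ _ := rfl
  map_smul' a f := by
    have h := congrArg (fun g => HahnSeries.coeff g n)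
      (HahnSeries.C_mul_eq_smul (Γ := ℤ) (r := a) (x := (show HahnSeries ℤ ℂ from f)))
    exact h

@[ext] theorem ext {f g : LaurentInf} (h : ∀ n, coeff n f = coeff n g) : f = g :=
  HahnSeries.ext (funext h)

/-- The monomial `x ^ (-n)`. -/
def monomial (n : ℤ) : LaurentInf := HahnSeries.single n (1 : ℂ)

theorem coeff_monomial (n m : ℤ) : coeff n (monomial m) = if n = m then 1 else 0 := by
  split_ifs with h
  · rw [h]; exact HahnSeries.coeff_single_same m (1 : ℂ)
  · exact HahnSeries.coeff_single_of_ne h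

theorem monomial_mul_monomial (m n : ℤ) : monomial m * monomial n = monomial (m + n) := by
  refine (HahnSeries.single_mul_single (Γ := ℤ) (R := ℂ)).trans ?_
  rw [one_mul]; rfl

theorem coeff_monomial_mul (m n : ℤ) (f : LaurentInf) :
    coeff (m + n) (monomial m * f) = coeff n f := by
  refine Eq.trans (b := (1 : ℂ) * coeff n f) ?_ (one_mul _)
  rw [add_comm m n]
  exact HahnSeries.coeff_single_mul_add (Γ := ℤ) (R := ℂ) (b := m) (a := n) (r := 1)
    (x := (show HahnSeries ℤ ℂ from f))

/-- Power series in `1 / x`. -/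
def ofPowerSeries : PowerSeries ℂ →ₐ[ℂ] LaurentInf :=
  { (HahnSeries.ofPowerSeries ℤ ℂ : PowerSeries ℂ →+* HahnSeries ℤ ℂ) with
    commutes' := fun a => HahnSeries.ofPowerSeries_C a }

theorem coeff_ofPowerSeries (f : PowerSeries ℂ) (n : ℕ) :
    coeff n (ofPowerSeries f) = PowerSeries.coeff n f :=
  LaurentSeries.coeff_coe_powerSeries f n

theorem coeff_ofPowerSeries_of_neg (f : PowerSeries ℂ) {n : ℤ} (hn : n < 0) :
    coeff n (ofPowerSeries f) = 0 :=
  (PowerSeries.coeff_coe f n).trans (if_pos hn)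

/-- The variable `x`, the inverse of the local parameter at infinity. -/
def var : LaurentInf := monomial (-1)

/-- The coefficients of `x ^ (- n - 1)`, `n ≥ 0`. -/
def tail : LaurentInf →ₗ[ℂ] (ℕ → ℂ) := LinearMap.pi fun n => coeff (n + 1)

theorem tail_apply (f : LaurentInf) (n : ℕ) : tail f n = coeff (n + 1) f := rfl

/-- The series `∑ a_n x ^ (- n - 1)`. -/
def ofTail : (ℕ → ℂ) →ₗ[ℂ] LaurentInf :=
  ofPowerSeries.toLinearMap ∘ₗ
    { toFun := fun a => PowerSeries.X * PowerSeries.mk a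
      map_add' := fun a b => by rw [← mul_add]; rfl
      map_smul' := fun r a => by rw [RingHom.id_apply, ← mul_smul_comm]; rfl }

theorem ofTail_apply (a : ℕ → ℂ) :
    ofTail a = ofPowerSeries (PowerSeries.X * PowerSeries.mk a) := rfl

theorem tail_ofPowerSeries (f : PowerSeries ℂ) (n : ℕ) :
    tail (ofPowerSeries f) n = PowerSeries.coeff (n + 1) f := by
  rw [tail_apply]
  exact_mod_cast coeff_ofPowerSeries f (n + 1)

@[simp] theorem tail_ofTail (a : ℕ → ℂ) : tail (ofTail a) = a := by
  funext n
  rw [ofTail_apply, tail_ofPowerSeries, PowerSeries.coeff_succ_X_mul, PowerSeries.coeff_mk]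

theorem coeff_ofTail_of_nonpos (a : ℕ → ℂ) {n : ℤ} (hn : n ≤ 0) : coeff n (ofTail a) = 0 := by
  rw [ofTail_apply]
  rcases hn.lt_or_eq with h | rfl
  · exact coeff_ofPowerSeries_of_neg _ h
  · have := coeff_ofPowerSeries (PowerSeries.X * PowerSeries.mk a) 0
    simpa using this

/-- The polynomials in `x`. -/
def polys : Subalgebra ℂ LaurentInf where
  carrier := {f | ∀ n : ℤ, 0 < n → coeff n f = 0}
  mul_mem' {f g} hf hg n hn := by
    refine HahnSeries.coeff_mul.trans ?_
    refine Finset.sum_eq_zero fun y hy => ?_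
    have h1 : y.1 + y.2 = n := (Finset.mem_antidiagonal.1 hy).2.2
    rcases lt_or_ge 0 y.1 with h | h
    · exact mul_eq_zero_of_left (hf _ h) _
    · exact mul_eq_zero_of_right _ (hg y.2 (by omega))
  add_mem' {f g} hf hg n hn := by rw [map_add, hf n hn, hg n hn, add_zero]
  algebraMap_mem' a n hn := by
    exact HahnSeries.coeff_single_of_ne hn.ne'

theorem mem_polys_iff {f : LaurentInf} : f ∈ polys ↔ tail f = 0 := by
  constructor
  · intro h
    funext n
    exact h _ (by omega)
  · intro h n hn
    obtain ⟨k, rfl⟩ : ∃ k : ℕ, n = k + 1 := ⟨(n - 1).toNat, by omega⟩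
    exact congrFun h k

theorem var_mem_polys : var ∈ polys := fun n hn => by
  rw [var, coeff_monomial, if_neg (by omega)]

theorem sub_ofTail_mem_polys (f : LaurentInf) : f - ofTail (tail f) ∈ polys := by
  rw [mem_polys_iff, map_sub, tail_ofTail, sub_self]

theorem var_pow (k : ℕ) : var ^ k = monomial (-(k : ℤ)) := by
  induction k with
  | zero => rfl
  | succ k ih =>
    rw [pow_succ, ih, var, monomial_mul_monomial]
    congr 1
    push_cast; ring

theorem coeff_aeval_var (P : Polynomial ℂ) (k : ℕ) :
    coeff (-(k : ℤ)) (Polynomial.aeval var P) = P.coeff k := by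
  rw [Polynomial.aeval_eq_sum_range, map_sum]
  simp only [var_pow, map_smul, coeff_monomial, neg_inj, Nat.cast_inj,
    smul_eq_mul, mul_ite, mul_one, mul_zero, Finset.sum_ite_eq, Finset.mem_range]
  split_ifs with h
  · rfl
  · exact (Polynomial.coeff_eq_zero_of_natDegree_lt (by omega)).symm

theorem aeval_var_mem_polys (P : Polynomial ℂ) : Polynomial.aeval var P ∈ polys := by
  rw [Polynomial.aeval_eq_sum_range]
  exact sum_mem fun k _ => polys.smul_mem (pow_mem var_mem_polys k) _

theorem aeval_var_injective : Function.Injective (Polynomial.aeval (R := ℂ) var) := by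
  intro P Q h
  ext k
  rw [← coeff_aeval_var, h, coeff_aeval_var]

theorem ext_of_coeff_neg {f g : LaurentInf} (h : tail f = tail g)
    (h' : ∀ k : ℕ, coeff (-(k : ℤ)) f = coeff (-(k : ℤ)) g) : f = g := by
  ext n
  rcases lt_or_ge 0 n with hn | hn
  · obtain ⟨k, rfl⟩ : ∃ k : ℕ, n = k + 1 := ⟨(n - 1).toNat, by omega⟩
    exact congrFun h k
  · obtain ⟨k, rfl⟩ : ∃ k : ℕ, n = -(k : ℤ) := ⟨(-n).toNat, by omega⟩
    exact h' k

theorem exists_aeval_eq {f : LaurentInf} (hf : f ∈ polys) {d : ℕ}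
    (hd : ∀ k : ℕ, d < k → coeff (-(k : ℤ)) f = 0) :
    ∃ P : Polynomial ℂ, P.natDegree ≤ d ∧ Polynomial.aeval var P = f := by
  refine ⟨∑ k ∈ range (d + 1), Polynomial.monomial k (coeff (-(k : ℤ)) f), ?_, ?_⟩
  · refine Polynomial.natDegree_sum_le_of_forall_le _ _ fun k hk => ?_
    exact (Polynomial.natDegree_monomial_le _).trans (by simpa [Nat.lt_succ_iff] using hk)
  · refine ext_of_coeff_neg ?_ fun k => ?_
    · rw [mem_polys_iff.1 hf, mem_polys_iff.1 (aeval_var_mem_polys _)]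
    · rw [coeff_aeval_var, Polynomial.finsetSum_coeff]
      simp only [Polynomial.coeff_monomial, Finset.sum_ite_eq', Finset.mem_range]
      split_ifs with h
      · rfl
      · exact (hd k (by omega)).symm

theorem exists_coeff_neg_eq_zero (f : LaurentInf) :
    ∃ d : ℕ, ∀ k : ℕ, d < k → coeff (-(k : ℤ)) f = 0 := by
  refine ⟨(-HahnSeries.order (f : HahnSeries ℤ ℂ)).toNat, fun k hk =>
    HahnSeries.coeff_eq_zero_of_lt_order (x := (f : HahnSeries ℤ ℂ)) ?_⟩
  omega

theorem exists_aeval_eq' {f : LaurentInf} (hf : f ∈ polys) :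
    ∃ P : Polynomial ℂ, Polynomial.aeval var P = f := by
  obtain ⟨d, hd⟩ := exists_coeff_neg_eq_zero f
  obtain ⟨P, _, h⟩ := exists_aeval_eq hf hd
  exact ⟨P, h⟩

theorem tail_ofTail_mul_ofTail (a b : ℕ → ℂ) (p : ℕ) :
    tail (ofTail a * ofTail b) p = ∑ k ∈ range p, a k * b (p - 1 - k) := by
  have h1 : PowerSeries.X * PowerSeries.mk a * (PowerSeries.X * PowerSeries.mk b) =
      PowerSeries.X * (PowerSeries.X * (PowerSeries.mk a * PowerSeries.mk b)) := by ring
  rw [ofTail_apply, ofTail_apply, ← map_mul, tail_ofPowerSeries, h1, PowerSeries.coeff_succ_X_mul]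
  cases p with
  | zero => simp
  | succ p =>
    rw [PowerSeries.coeff_succ_X_mul, PowerSeries.coeff_mul,
      Finset.Nat.sum_antidiagonal_eq_sum_range_succ (fun i j =>
        PowerSeries.coeff i (PowerSeries.mk a) * PowerSeries.coeff j (PowerSeries.mk b))]
    simp

theorem tail_var_mul (f : LaurentInf) (p : ℕ) : tail (var * f) p = tail f (p + 1) := by
  rw [tail_apply, tail_apply, var]
  have : ((p : ℤ) + 1) = -1 + (((p + 1 : ℕ) : ℤ) + 1) := by push_cast; ring
  rw [this, coeff_monomial_mul]

theorem tail_var_pow_mul (r : ℕ) (f : LaurentInf) (p : ℕ) :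
    tail (var ^ r * f) p = tail f (p + r) := by
  induction r generalizing p with
  | zero => simp
  | succ r ih => rw [pow_succ', mul_assoc, tail_var_mul, ih, add_right_comm]; rfl

theorem tail_aeval_mul (P : Polynomial ℂ) {R : ℕ} (hR : P.natDegree < R) (f : LaurentInf) (p : ℕ) :
    tail (Polynomial.aeval var P * f) p = ∑ r ∈ range R, P.coeff r * tail f (p + r) := by
  rw [Polynomial.aeval_eq_sum_range' hR, Finset.sum_mul, map_sum, Finset.sum_apply]
  refine Finset.sum_congr rfl fun r _ => ?_
  rw [smul_mul_assoc, map_smul, Pi.smul_apply, tail_var_pow_mul, smul_eq_mul]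

/-- If the Laurent series `∑_p ϕ (p, q) x ^ (- p - 1)` are, up to the polynomial
`(1 / 2) ∑_t y_t (q) x ^ r_t`, linear combinations of series `e_l` with the coefficients
`ϕ (l, q)`, where `ϕ` is symmetric, then the restriction to the diagonal of the corresponding
series in two variables is, up to polynomials, a quadratic form in the `e_l`. -/
theorem diagonal_sub_mem_polys {T : Type*} (I : Finset T) (r : T → ℕ) (y : T → ℕ → ℂ)
    {ϕ : ℕ → ℕ → ℂ} (hϕ : ∀ p q, ϕ p q = ϕ q p) (n : ℕ) (e : ℕ → LaurentInf)
    (h : ∀ q, ofTail (fun p => ϕ p q) + (1 / 2 : ℂ) • ∑ t ∈ I, y t q • var ^ r t =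
      ∑ l ∈ range n, ϕ l q • e l) :
    ofTail (fun p => ∑ k ∈ range p, ϕ k (p - 1 - k) + ∑ t ∈ I, y t (r t + p)) -
      ∑ l ∈ range n, ∑ m ∈ range n, ϕ l m • (e l * e m) ∈ polys := by
  choose P hP using fun l => exists_aeval_eq' (sub_ofTail_mem_polys (e l))
  set ε : ℕ → ℕ → ℂ := fun l => tail (e l) with hε
  have he : ∀ l, e l = ofTail (ε l) + Polynomial.aeval var (P l) := fun l => by
    rw [hP]; ring
  have hpoly : ∀ q, tail ((1 / 2 : ℂ) • ∑ t ∈ I, y t q • var ^ r t) = 0 := fun q =>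
    mem_polys_iff.1 (polys.smul_mem (sum_mem fun t _ =>
      polys.smul_mem (pow_mem var_mem_polys _) _) _)
  have h1 : ∀ p q, ϕ p q = ∑ l ∈ range n, ϕ l q * ε l p := by
    intro p q
    have := congrFun (congrArg tail (h q)) p
    rw [map_add, hpoly, add_zero, tail_ofTail, map_sum, Finset.sum_apply] at this
    simpa only [map_smul, Pi.smul_apply, smul_eq_mul] using this
  -- by symmetry, `ϕ` is a quadratic form in the coefficients of the `e l`
  have h2 : ∀ p q, ϕ p q = ∑ l ∈ range n, ∑ m ∈ range n, ϕ l m * (ε l p * ε m q) := by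
    intro p q
    rw [h1]
    refine Finset.sum_congr rfl fun l _ => ?_
    rw [hϕ l q, h1 q l, Finset.sum_mul]
    refine Finset.sum_congr rfl fun m _ => ?_
    rw [hϕ m l]; ring
  have h3 : ∀ q, (1 / 2 : ℂ) • ∑ t ∈ I, y t q • Polynomial.X ^ r t =
      ∑ l ∈ range n, ϕ l q • P l := by
    intro q
    refine aeval_var_injective ?_
    have h4 : ofTail (fun p => ϕ p q) = ∑ l ∈ range n, ϕ l q • ofTail (ε l) := by
      simp only [← map_smul, ← map_sum]
      congr 1
      funext p
      rw [h1, Finset.sum_apply]; rfl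
    have h5 := h q
    have h5' : ∑ l ∈ range n, ϕ l q • e l = ∑ l ∈ range n, ϕ l q • ofTail (ε l) +
        ∑ l ∈ range n, ϕ l q • Polynomial.aeval var (P l) := by
      rw [← Finset.sum_add_distrib]
      exact Finset.sum_congr rfl fun l _ => by rw [← smul_add, ← he]
    rw [h4, h5'] at h5
    have h5'' := add_left_cancel h5
    rw [map_smul, map_sum, map_sum]
    simp only [map_smul, map_pow, Polynomial.aeval_X]
    exact h5''
  obtain ⟨R, hR1, hR2⟩ : ∃ R, (∀ t ∈ I, r t < R) ∧ ∀ l ∈ range n, (P l).natDegree < R := by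
    refine ⟨I.sup r + (range n).sup (fun l => (P l).natDegree) + 1, fun t ht => ?_, fun l hl => ?_⟩
    · have := Finset.le_sup (f := r) ht; omega
    · have := Finset.le_sup (f := fun l => (P l).natDegree) hl
      omega
  rw [mem_polys_iff]
  funext p
  -- the coefficient of `X ^ r'` of the identity `h3` at `q = p + r'`, summed over `r'`
  have h6 : ∑ t ∈ I, y t (r t + p) =
      2 * ∑ l ∈ range n, ∑ r' ∈ range R, (P l).coeff r' * ϕ l (p + r') := by
    have h7 : ∀ r', (1 / 2 : ℂ) * ∑ t ∈ I, (if r' = r t then y t (p + r') else 0) =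
        ∑ l ∈ range n, ϕ l (p + r') * (P l).coeff r' := by
      intro r'
      have := congrArg (fun Q => Polynomial.coeff Q r') (h3 (p + r'))
      simpa [Polynomial.finsetSum_coeff, Polynomial.coeff_X_pow] using this
    have h8 : ∑ t ∈ I, y t (r t + p) =
        ∑ r' ∈ range R, ∑ t ∈ I, (if r' = r t then y t (p + r') else 0) := by
      rw [Finset.sum_comm]
      refine Finset.sum_congr rfl fun t ht => ?_
      rw [Finset.sum_eq_single (r t)]
      · rw [if_pos rfl, add_comm]
      · intro r' _ hr; rw [if_neg hr]
      · intro h; exact absurd (Finset.mem_range.2 (hR1 t ht)) h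
    rw [h8, Finset.sum_comm (s := range n), Finset.mul_sum]
    refine Finset.sum_congr rfl fun r' _ => ?_
    have := h7 r'
    simp only [mul_comm (ϕ _ _)] at this
    rw [← this]; ring
  -- the products of a tail and a polynomial reproduce the terms with `y`, and the product of two
  -- polynomials does not contribute
  have h9 : ∀ l m, tail (e l * e m) p = ∑ k ∈ range p, ε l k * ε m (p - 1 - k) +
      tail (Polynomial.aeval var (P l) * ofTail (ε m)) p +
      tail (Polynomial.aeval var (P m) * ofTail (ε l)) p := by
    intro l m
    have h10 : tail (Polynomial.aeval var (P l) * Polynomial.aeval var (P m)) = 0 :=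
      mem_polys_iff.1 (mul_mem (aeval_var_mem_polys _) (aeval_var_mem_polys _))
    have h11 : e l * e m = ofTail (ε l) * ofTail (ε m) +
        Polynomial.aeval var (P l) * ofTail (ε m) + Polynomial.aeval var (P m) * ofTail (ε l) +
        Polynomial.aeval var (P l) * Polynomial.aeval var (P m) := by
      rw [he l, he m]; ring
    rw [h11, map_add, map_add, map_add, h10, add_zero]
    simp only [Pi.add_apply, tail_ofTail_mul_ofTail]
  have h12 : ∑ l ∈ range n, ∑ m ∈ range n, ϕ l m *
      tail (Polynomial.aeval var (P l) * ofTail (ε m)) p =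
      ∑ l ∈ range n, ∑ r' ∈ range R, (P l).coeff r' * ϕ l (p + r') := by
    refine Finset.sum_congr rfl fun l hl => ?_
    simp only [tail_aeval_mul _ (hR2 l hl), tail_ofTail, Finset.mul_sum]
    rw [Finset.sum_comm]
    refine Finset.sum_congr rfl fun r' _ => ?_
    rw [hϕ l, h1 (p + r') l, Finset.mul_sum]
    refine Finset.sum_congr rfl fun m _ => ?_
    rw [hϕ m l]; ring
  have h13 : ∑ l ∈ range n, ∑ m ∈ range n, ϕ l m *
      tail (Polynomial.aeval var (P m) * ofTail (ε l)) p =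
      ∑ l ∈ range n, ∑ m ∈ range n, ϕ l m *
      tail (Polynomial.aeval var (P l) * ofTail (ε m)) p := by
    rw [Finset.sum_comm]
    exact Finset.sum_congr rfl fun l _ => Finset.sum_congr rfl fun m _ => by rw [hϕ m l]
  have h14 : ∑ k ∈ range p, ϕ k (p - 1 - k) = ∑ l ∈ range n, ∑ m ∈ range n, ϕ l m *
      ∑ k ∈ range p, ε l k * ε m (p - 1 - k) := by
    rw [Finset.sum_congr rfl fun k _ => h2 k (p - 1 - k), Finset.sum_comm]
    refine Finset.sum_congr rfl fun l _ => ?_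
    rw [Finset.sum_comm]
    exact Finset.sum_congr rfl fun m _ => (Finset.mul_sum _ _ _).symm
  rw [map_sub, tail_ofTail, map_sum]
  simp only [map_sum, map_smul, Pi.sub_apply, Finset.sum_apply, Pi.smul_apply, smul_eq_mul,
    Pi.zero_apply]
  rw [h14, h6, ← h12]
  simp only [h9, mul_add, Finset.sum_add_distrib]
  rw [h13]
  ring

/-- In a finite-dimensional space of Laurent series on which the negative powers of `x` separate,
finitely many of them separate. -/
theorem exists_finite_tail (V : Submodule ℂ LaurentInf) [FiniteDimensional ℂ V]
    (hV : ∀ f ∈ V, tail f = 0 → f = 0) :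
    ∃ (n : ℕ) (e : ℕ → LaurentInf), (∀ r, e r ∈ V) ∧
      ∀ f ∈ V, f = ∑ r ∈ range n, tail f r • e r := by
  let T : ∀ n : ℕ, V →ₗ[ℂ] (Fin n → ℂ) := fun n =>
    (LinearMap.funLeft ℂ ℂ (fun r : Fin n => (r : ℕ))).comp (tail.comp V.subtype)
  have hT : ∀ n v r, T n v r = tail v.1 r := fun _ _ _ => rfl
  let W : ℕ →o (Submodule ℂ V)ᵒᵈ := ⟨fun n => LinearMap.ker (T n), by
    intro m n hmn v hv
    rw [LinearMap.mem_ker] at hv ⊢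
    funext r
    exact congrFun hv ⟨r, by omega⟩⟩
  -- the subspaces on which the first `n` coefficients vanish decrease, and their intersection is
  -- zero
  obtain ⟨n, hn⟩ := IsArtinian.monotone_stabilizes W
  have hker : LinearMap.ker (T n) = ⊥ := by
    rw [eq_bot_iff]
    intro v hv
    rw [Submodule.mem_bot]
    refine Subtype.ext (hV v.1 v.2 (funext fun p => ?_))
    have h1 : v ∈ LinearMap.ker (T (max n (p + 1))) := by
      have := hn (max n (p + 1)) (le_max_left _ _)
      change LinearMap.ker (T n) = LinearMap.ker (T (max n (p + 1))) at this
      rwa [← this]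
    exact congrFun (LinearMap.mem_ker.1 h1) ⟨p, by omega⟩
  obtain ⟨G, hG⟩ := LinearMap.exists_leftInverse_of_injective (T n) hker
  refine ⟨n, fun r => if h : r < n then (G (Pi.single ⟨r, h⟩ 1)).1 else 0, fun r => ?_,
    fun f hf => ?_⟩
  · dsimp only
    split_ifs
    · exact Subtype.mem _
    · exact zero_mem _
  · have h1 : G (T n ⟨f, hf⟩) = ⟨f, hf⟩ := LinearMap.congr_fun hG _
    have h2 : T n ⟨f, hf⟩ = ∑ r : Fin n, tail f r • (Pi.single r 1 : Fin n → ℂ) := by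
      funext r
      rw [hT, Finset.sum_apply]
      simp [Pi.single_apply]
    rw [h2, map_sum] at h1
    have h3 := congrArg Subtype.val h1
    rw [AddSubmonoidClass.coe_finsetSum] at h3
    rw [Finset.sum_range]
    refine h3.symm.trans (Finset.sum_congr rfl fun r _ => ?_)
    dsimp only
    rw [map_smul, dif_pos r.2]
    rfl

end LaurentInf
end QuarticTensor

namespace QuarticTensor

/-! ### The quadratic loop equation -/

namespace Egf

variable {β R : Type*} [CommRing R]

/-- The generating function with values `t b` at singletons. -/
def linear (t : β → R) : Egf β R := fun s => if s.card = 1 then (s.map t).sum else 0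

theorem D_linear (t : β → R) (b : β) : D b (linear t) = t b • 1 := by
  ext s
  rw [D_apply, linear, smul_apply, one_apply, Multiset.card_cons]
  by_cases h : s.card = 0
  · rw [Multiset.card_eq_zero] at h
    subst h
    simp
  · rw [if_neg (by omega), if_neg h, mul_zero]

theorem linear_mul [DecidableEq β] (t : β → R) (f : Egf β R) (s : Multiset β) :
    (linear t * f) s = (s.map fun b => t b * f (s.erase b)).sum := by
  induction s using Multiset.induction generalizing f with
  | empty => simp [linear]
  | cons b s ih =>
    rw [mul_apply_cons, D_linear, smul_mul_assoc, one_mul, smul_apply, ih, Multiset.map_cons,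
      Multiset.sum_cons, Multiset.erase_cons_head]
    refine congrArg _ (congrArg _ (Multiset.map_congr rfl fun c hc => ?_))
    rw [D_apply, Multiset.erase_cons_tail_of_mem hc]

end Egf

open Egf LaurentInf

section tails

variable {β : Type*}

/-- The coefficient of `x ^ (- p - 1)`. -/
def tailAt (p : ℕ) : Egf β (PowerSeries LaurentInf) →+ Egf β (PowerSeries ℂ) where
  toFun f := fun s => PowerSeries.mk fun g => tail (PowerSeries.coeff g (f s)) p
  map_zero' := by
    ext1 s
    refine PowerSeries.ext fun g => ?_
    simp
  map_add' f₁ f₂ := by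
    ext1 s
    refine PowerSeries.ext fun g => ?_
    refine Eq.trans ?_ (map_add (PowerSeries.coeff g) _ _).symm
    rw [PowerSeries.coeff_mk, PowerSeries.coeff_mk, PowerSeries.coeff_mk, Egf.add_apply, map_add,
      map_add]
    rfl

theorem coeff_tailAt (p : ℕ) (f : Egf β (PowerSeries LaurentInf)) (g s) :
    PowerSeries.coeff g (tailAt p f s) = tail (PowerSeries.coeff g (f s)) p := by
  change PowerSeries.coeff g (PowerSeries.mk fun g => tail (PowerSeries.coeff g (f s)) p) = _
  rw [PowerSeries.coeff_mk]

/-- The generating function of the series `∑_p a_p x ^ (- p - 1)`. -/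
def resolvent (a : ℕ → Egf β (PowerSeries ℂ)) : Egf β (PowerSeries LaurentInf) := fun s =>
  PowerSeries.mk fun g => ofTail fun p => PowerSeries.coeff g (a p s)

theorem coeff_resolvent (a : ℕ → Egf β (PowerSeries ℂ)) (g s) :
    PowerSeries.coeff g (resolvent a s) = ofTail fun p => PowerSeries.coeff g (a p s) :=
  PowerSeries.coeff_mk _ _

theorem tailAt_resolvent (p : ℕ) (a : ℕ → Egf β (PowerSeries ℂ)) :
    tailAt p (resolvent a) = a p := by
  ext1 s
  refine PowerSeries.ext fun g => ?_
  rw [coeff_tailAt, coeff_resolvent, tail_ofTail]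

theorem sum_multiset_sum {γ M : Type*} [AddCommMonoid M] (t : Finset γ) {δ : Type*}
    (m : Multiset δ) (f : γ → δ → M) :
    ∑ k ∈ t, (m.map (f k)).sum = (m.map fun x => ∑ k ∈ t, f k x).sum :=
  Multiset.sum_map_sum_map _ _

theorem tailAt_resolvent_mul (p : ℕ) (a b : ℕ → Egf β (PowerSeries ℂ)) :
    tailAt p (resolvent a * resolvent b) = ∑ k ∈ range p, a k * b (p - 1 - k) := by
  ext1 s
  refine PowerSeries.ext fun g => ?_
  rw [coeff_tailAt, mul_apply, map_multiset_sum, map_multiset_sum, Egf.sum_apply]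
  have h : ∀ m : Multiset (ℕ → ℂ), m.sum p = (m.map fun f => f p).sum := fun m =>
    map_multiset_sum (Pi.evalAddMonoidHom (fun _ : ℕ => ℂ) p) m
  rw [h]
  simp only [mul_apply, map_sum, map_multiset_sum, Multiset.map_map, Function.comp_def,
    PowerSeries.coeff_mul]
  rw [sum_multiset_sum]
  refine congrArg _ (Multiset.map_congr rfl fun x _ => ?_)
  rw [Finset.sum_apply, Finset.sum_comm]
  refine Finset.sum_congr rfl fun y _ => ?_
  rw [coeff_resolvent, coeff_resolvent, tail_ofTail_mul_ofTail]

theorem tailAt_C_smul (p : ℕ) (c : ℂ) (f : Egf β (PowerSeries LaurentInf)) :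
    tailAt p (PowerSeries.C (algebraMap ℂ LaurentInf c) • f) = PowerSeries.C c • tailAt p f := by
  ext1 s
  refine PowerSeries.ext fun g => ?_
  rw [coeff_tailAt, Egf.smul_apply, Egf.smul_apply, PowerSeries.coeff_C_mul,
    PowerSeries.coeff_C_mul, coeff_tailAt, ← Algebra.smul_def, map_smul]
  rfl

theorem tailAt_var_pow_smul (p r : ℕ) (f : Egf β (PowerSeries LaurentInf)) :
    tailAt p (PowerSeries.C (var ^ r) • f) = tailAt (p + r) f := by
  ext1 s
  refine PowerSeries.ext fun g => ?_
  rw [coeff_tailAt, Egf.smul_apply, PowerSeries.coeff_C_mul, coeff_tailAt, tail_var_pow_mul]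

theorem tailAt_X_pow_smul (p j : ℕ) (f : Egf β (PowerSeries LaurentInf)) :
    tailAt p ((PowerSeries.X ^ j : PowerSeries LaurentInf) • f) =
      (PowerSeries.X ^ j : PowerSeries ℂ) • tailAt p f := by
  ext1 s
  refine PowerSeries.ext fun g => ?_
  rw [coeff_tailAt, Egf.smul_apply, Egf.smul_apply, PowerSeries.coeff_X_pow_mul',
    PowerSeries.coeff_X_pow_mul']
  split_ifs
  · rw [coeff_tailAt]
  · simp

/-- Generating functions with constant coefficients. -/
def constants : Egf β (PowerSeries ℂ) →+* Egf β (PowerSeries LaurentInf) :=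
  Egf.map (PowerSeries.map (algebraMap ℂ LaurentInf))

theorem coeff_constants (f : Egf β (PowerSeries ℂ)) (g s) :
    PowerSeries.coeff g (constants f s) = algebraMap ℂ LaurentInf (PowerSeries.coeff g (f s)) := by
  rw [constants, map_apply, PowerSeries.coeff_map]

theorem tailAt_constants_mul (p : ℕ) (Y : Egf β (PowerSeries ℂ))
    (f : Egf β (PowerSeries LaurentInf)) :
    tailAt p (constants Y * f) = Y * tailAt p f := by
  ext1 s
  refine PowerSeries.ext fun g => ?_
  have h : ∀ m : Multiset (ℕ → ℂ), m.sum p = (m.map fun f => f p).sum := fun m =>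
    map_multiset_sum (Pi.evalAddMonoidHom (fun _ : ℕ => ℂ) p) m
  rw [coeff_tailAt, mul_apply, mul_apply, map_multiset_sum, map_multiset_sum, map_multiset_sum, h]
  simp only [Multiset.map_map, Function.comp_def, PowerSeries.coeff_mul, map_sum]
  refine congrArg _ (Multiset.map_congr rfl fun x _ => ?_)
  rw [Finset.sum_apply]
  refine Finset.sum_congr rfl fun y _ => ?_
  rw [coeff_constants, ← Algebra.smul_def, map_smul, coeff_tailAt]
  rfl

/-- The generating functions all of whose coefficients are polynomials in `x`. -/
def polySubring (β : Type*) : Subring (Egf β (PowerSeries LaurentInf)) :=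
  levelSubring polys.toSubring 0 0 0

theorem mem_polySubring {f : Egf β (PowerSeries LaurentInf)} :
    f ∈ polySubring β ↔ ∀ g s, PowerSeries.coeff g (f s) ∈ polys :=
  ⟨fun h g s => h g s (by simp), fun h g s _ => h g s⟩

theorem constants_mem_polySubring (f : Egf β (PowerSeries ℂ)) : constants f ∈ polySubring β :=
  mem_polySubring.2 fun g s => by rw [coeff_constants]; exact polys.algebraMap_mem _

end tails

section loop

variable (α : Fin 6 → ℂ) (F : Egf (Fin 6 × ℕ) (PowerSeries ℂ)) (i : Fin 6) (K : ℕ)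

/-- The generating function of the correlations with one resolvent of color `i`. -/
def oneResolvent : Egf (Fin 6 × ℕ) (PowerSeries LaurentInf) := resolvent fun p => D (i, p) F

/-- The effective potential of the color `i`: the derivative of the interaction in `tr M_i`, with
the traces of the other colors replaced by their correlations. -/
def potential : Egf (Fin 6 × ℕ) (PowerSeries LaurentInf) :=
  ∑ j ∈ range K, ∑ b ∈ (univ : Finset (Fin 6)).piAntidiag (j + 1),
    (PowerSeries.C (algebraMap ℂ LaurentInf (vert α i b)) * (PowerSeries.C (var ^ b i) *
      PowerSeries.X ^ j)) • constants (corr F PowerSeries.X (rest i b))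

/-- The derivatives `p x ^ (p - 1)` of the sources `x ^ p` of the traces of color `i`. -/
def source : Egf (Fin 6 × ℕ) (PowerSeries LaurentInf) :=
  linear fun b => if b.1 = i then
    PowerSeries.C (algebraMap ℂ LaurentInf b.2) * PowerSeries.C (var ^ (b.2 - 1)) else 0

/-- The polynomial part of `shiftedResolvent`. -/
def polyTerms : Egf (Fin 6 × ℕ) (PowerSeries LaurentInf) :=
  potential α F i K + source i - PowerSeries.C (var ^ 1) • 1

/-- Twice the resolvent, shifted by polynomials in such a way that the square is completed in the
loop equations. -/
def shiftedResolvent : Egf (Fin 6 × ℕ) (PowerSeries LaurentInf) :=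
  2 * oneResolvent F i + polyTerms α F i K

/-- The terms with a double derivative in the loop equations. -/
def secondOrder : Egf (Fin 6 × ℕ) (PowerSeries LaurentInf) := resolvent fun p =>
  ∑ k ∈ range p, D (i, k) (D (i, p - 1 - k) F) +
    ∑ j ∈ range K, ∑ b ∈ (univ : Finset (Fin 6)).piAntidiag (j + 1),
      (PowerSeries.C (vert α i b) * PowerSeries.X ^ j) •
        D (i, b i + p) (corr F PowerSeries.X (rest i b))

theorem smul_mem_polySubring {r : PowerSeries LaurentInf} (hr : ∀ g, PowerSeries.coeff g r ∈ polys)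
    {f : Egf (Fin 6 × ℕ) (PowerSeries LaurentInf)} (hf : f ∈ polySubring _) :
    r • f ∈ polySubring (Fin 6 × ℕ) := by
  rw [mem_polySubring] at hf ⊢
  intro g s
  rw [Egf.smul_apply, PowerSeries.coeff_mul]
  exact sum_mem fun y _ => mul_mem (hr _) (hf _ _)

theorem coeff_C_mem_polys {f : LaurentInf} (hf : f ∈ polys) (g : ℕ) :
    PowerSeries.coeff g (PowerSeries.C f) ∈ polys := by
  rw [PowerSeries.coeff_C]
  split_ifs
  · exact hf
  · exact zero_mem _

theorem potential_mem_polySubring : potential α F i K ∈ polySubring _ := by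
  refine sum_mem fun j _ => sum_mem fun b _ =>
    smul_mem_polySubring (fun g => ?_) (constants_mem_polySubring _)
  rw [PowerSeries.coeff_C_mul, PowerSeries.coeff_C_mul, PowerSeries.coeff_X_pow]
  refine mul_mem (polys.algebraMap_mem _) (mul_mem (pow_mem var_mem_polys _) ?_)
  split_ifs
  · exact one_mem _
  · exact zero_mem _

theorem source_mem_polySubring : source i ∈ polySubring _ := by
  rw [mem_polySubring]
  intro g s
  rw [source, linear]
  split_ifs
  · rw [map_multiset_sum, Multiset.map_map]
    refine multiset_sum_mem _ fun y hy => ?_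
    obtain ⟨b, _, rfl⟩ := Multiset.mem_map.1 hy
    simp only [Function.comp_apply]
    split_ifs
    · rw [← map_mul]
      exact coeff_C_mem_polys (mul_mem (polys.algebraMap_mem _) (pow_mem var_mem_polys _)) g
    · rw [map_zero]; exact zero_mem _
  · rw [map_zero]; exact zero_mem _

theorem polyTerms_mem_polySubring : polyTerms α F i K ∈ polySubring _ :=
  sub_mem (add_mem (potential_mem_polySubring α F i K) (source_mem_polySubring i))
    (smul_mem_polySubring (coeff_C_mem_polys (pow_mem var_mem_polys _)) (one_mem _))

theorem tailAt_potential_mul (p : ℕ) :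
    tailAt p (potential α F i K * oneResolvent F i) =
      ∑ j ∈ range K, ∑ b ∈ (univ : Finset (Fin 6)).piAntidiag (j + 1),
        (PowerSeries.C (vert α i b) * PowerSeries.X ^ j) •
          (corr F PowerSeries.X (rest i b) * D (i, b i + p) F) := by
  rw [potential, Finset.sum_mul, map_sum]
  refine Finset.sum_congr rfl fun j _ => ?_
  rw [Finset.sum_mul, map_sum]
  refine Finset.sum_congr rfl fun b _ => ?_
  rw [smul_mul_assoc, mul_smul, tailAt_C_smul, mul_smul, tailAt_var_pow_smul, tailAt_X_pow_smul,
    tailAt_constants_mul, oneResolvent, tailAt_resolvent, ← mul_smul, add_comm p]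

theorem tailAt_source_mul (p : ℕ) :
    tailAt p (source i * oneResolvent F i) = shift (virShift _ i p) F := by
  ext1 s
  refine PowerSeries.ext fun g => ?_
  have h : ∀ m : Multiset (ℕ → ℂ), m.sum p = (m.map fun f => f p).sum := fun m =>
    map_multiset_sum (Pi.evalAddMonoidHom (fun _ : ℕ => ℂ) p) m
  rw [coeff_tailAt, source, linear_mul, shift_apply, map_multiset_sum, map_multiset_sum,
    map_multiset_sum, h]
  simp only [Multiset.map_map, Function.comp_def]
  refine congrArg _ (Multiset.map_congr rfl fun b _ => ?_)
  simp only [virShift]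
  split_ifs
  · have e2 : ((b.2 : ℕ) : PowerSeries ℂ) = PowerSeries.C (b.2 : ℂ) := by simp
    rw [e2, mul_assoc, PowerSeries.coeff_C_mul, PowerSeries.coeff_C_mul, PowerSeries.coeff_C_mul,
      ← Algebra.smul_def, map_smul, Pi.smul_apply, tail_var_pow_mul, oneResolvent, coeff_resolvent,
      tail_ofTail, D_apply, smul_eq_mul]
    rcases Nat.eq_zero_or_pos b.2 with h0 | h0
    · rw [h0]; simp
    · have : p + (b.2 - 1) = b.2 + p - 1 := by omega
      rw [this]
  · simp

/-- The loop equations of all the vector fields `M_i ↦ M_i ^ p` in a single equation. -/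
theorem tailAt_quadratic (p : ℕ) :
    tailAt p (oneResolvent F i * oneResolvent F i + polyTerms α F i K * oneResolvent F i +
      (PowerSeries.X : PowerSeries LaurentInf) • secondOrder α F i K) =
      loopEq α F PowerSeries.X 1 i p K := by
  have hX : ∀ f : Egf (Fin 6 × ℕ) (PowerSeries LaurentInf),
      tailAt p ((PowerSeries.X : PowerSeries LaurentInf) • f) =
        (PowerSeries.X : PowerSeries ℂ) • tailAt p f := fun f => by
    simpa using tailAt_X_pow_smul p 1 f
  rw [map_add, map_add, hX, secondOrder, tailAt_resolvent, polyTerms, sub_mul, add_mul, map_sub,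
    map_add, tailAt_potential_mul, tailAt_source_mul, smul_mul_assoc, one_mul, tailAt_var_pow_smul,
    oneResolvent, tailAt_resolvent, tailAt_resolvent_mul, loopEq]
  have h1 : ∀ k, corr F PowerSeries.X {(i, k), (i, p - 1 - k)} =
      D (i, k) F * D (i, p - 1 - k) F +
        (PowerSeries.X : PowerSeries ℂ) • D (i, k) (D (i, p - 1 - k) F) := fun k =>
    corr_pair _ _ _ _
  have h2 : ∀ (j : ℕ) (b : Fin 6 → ℕ), (algebraMap ℂ (PowerSeries ℂ) (vert α i b) * 1 ^ (j + 2) *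
      PowerSeries.X ^ j) • corr F PowerSeries.X ((i, b i + p) ::ₘ rest i b) =
      (PowerSeries.C (vert α i b) * PowerSeries.X ^ j) •
          (corr F PowerSeries.X (rest i b) * D (i, b i + p) F) +
      (PowerSeries.X : PowerSeries ℂ) • ((PowerSeries.C (vert α i b) * PowerSeries.X ^ j) •
        D (i, b i + p) (corr F PowerSeries.X (rest i b))) := by
    intro j b
    rw [corr_cons, cov, one_pow, mul_one, smul_add, mul_comm (D _ F), smul_comm PowerSeries.X]
    rfl
  simp only [h1, h2, Finset.sum_add_distrib, smul_add, Finset.smul_sum]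
  abel

/-- Completion of the square: the coefficients of negative powers of `x` in `tailAt_quadratic`
vanish by the loop equations, and the square of `polyTerms` is a polynomial. -/
theorem quadratic_mem_polys {F : Egf (Fin 6 × ℕ) (PowerSeries ℂ)} {g : ℕ}
    (hloop : ∀ p s, PowerSeries.coeff g (loopEq α F PowerSeries.X 1 i p K s) = 0) (s) :
    PowerSeries.coeff g ((shiftedResolvent α F i K * shiftedResolvent α F i K) s) +
      4 • PowerSeries.coeff g (((PowerSeries.X : PowerSeries LaurentInf) •
        secondOrder α F i K) s) ∈ polys := by
  set Q := oneResolvent F i * oneResolvent F i + polyTerms α F i K * oneResolvent F i +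
      (PowerSeries.X : PowerSeries LaurentInf) • secondOrder α F i K with hQ
  have h1 : shiftedResolvent α F i K * shiftedResolvent α F i K +
      4 • (PowerSeries.X : PowerSeries LaurentInf) • secondOrder α F i K =
      4 • Q + polyTerms α F i K * polyTerms α F i K := by
    rw [shiftedResolvent, hQ, nsmul_eq_mul, nsmul_eq_mul]; push_cast; ring
  have h2 : PowerSeries.coeff g (Q s) ∈ polys := by
    rw [mem_polys_iff]
    funext p
    rw [← coeff_tailAt, tailAt_quadratic, hloop]
    rfl
  have h3 : ∀ f : Egf (Fin 6 × ℕ) (PowerSeries LaurentInf),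
      PowerSeries.coeff g ((4 • f) s) = 4 • PowerSeries.coeff g (f s) := fun f => by
    rw [← map_nsmul]
    exact congrArg _ (map_nsmul (Egf.evalHom s) 4 f)
  have h4 := congrArg (fun f : Egf (Fin 6 × ℕ) (PowerSeries LaurentInf) =>
    PowerSeries.coeff g (f s)) h1
  simp only [Egf.add_apply, map_add, h3] at h4
  rw [h4]
  refine add_mem (nsmul_mem h2 4) (mem_polySubring.1 (mul_mem ?_ ?_) g s) <;>
  exact polyTerms_mem_polySubring α F i K

end loop
end QuarticTensor

namespace QuarticTensor

/-! ### Laurent series with a square root singularity -/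

namespace LaurentInf

/-- The Laurent series `f` such that `Δ ^ m * y * f` is a polynomial in `x`; here `y` is a square
root of the polynomial `Δ = y ^ 2`. -/
def oddSpace (y : LaurentInf) (m : ℕ) : Submodule ℂ LaurentInf where
  carrier := {f | (y ^ 2) ^ m * y * f ∈ polys}
  add_mem' {f g} hf hg := by
    change _ * (f + g) ∈ polys
    rw [mul_add]; exact add_mem hf hg
  zero_mem' := by
    change _ * (0 : LaurentInf) ∈ polys
    rw [mul_zero]; exact zero_mem _
  smul_mem' a f hf := by
    change _ * (a • f) ∈ polys
    rw [mul_smul_comm]; exact polys.smul_mem hf a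

theorem mem_oddSpace {y f : LaurentInf} {m : ℕ} :
    f ∈ oddSpace y m ↔ (y ^ 2) ^ m * y * f ∈ polys := Iff.rfl

variable {y : LaurentInf}

theorem oddSpace_mono (hy : y ^ 2 ∈ polys) {m m' : ℕ} (h : m ≤ m') :
    oddSpace y m ≤ oddSpace y m' := by
  intro f hf
  obtain ⟨k, rfl⟩ := Nat.exists_eq_add_of_le' h
  rw [mem_oddSpace, pow_add, mul_assoc, mul_assoc, ← mul_assoc _ y f]
  exact mul_mem (pow_mem hy k) hf

theorem mul_mem_polys_of_mem_oddSpace {m : ℕ} {f g : LaurentInf} (hf : f ∈ oddSpace y m)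
    (hg : g ∈ oddSpace y m) : (y ^ 2) ^ (2 * m + 1) * (f * g) ∈ polys := by
  have := mul_mem (mem_oddSpace.1 hf) (mem_oddSpace.1 hg)
  convert this using 1
  ring

theorem coeff_neg_mul_eq_zero {f g : LaurentInf} {d d' : ℕ}
    (hf : ∀ k : ℕ, d < k → coeff (-(k : ℤ)) f = 0) (hg : ∀ k : ℕ, d' < k → coeff (-(k : ℤ)) g = 0)
    {k : ℕ} (hk : d + d' < k) : coeff (-(k : ℤ)) (f * g) = 0 := by
  refine HahnSeries.coeff_mul.trans (Finset.sum_eq_zero fun z hz => ?_)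
  have h1 : z.1 + z.2 = -(k : ℤ) := (Finset.mem_antidiagonal.1 hz).2.2
  rcases lt_or_ge z.1 (-(d : ℤ)) with h | h
  · obtain ⟨l, hl⟩ : ∃ l : ℕ, z.1 = -(l : ℤ) := ⟨(-z.1).toNat, by omega⟩
    refine mul_eq_zero_of_left ?_ _
    rw [hl]
    exact hf l (by omega)
  · obtain ⟨l, hl⟩ : ∃ l : ℕ, z.2 = -(l : ℤ) := ⟨(-z.2).toNat, by omega⟩
    refine mul_eq_zero_of_right _ ?_
    rw [hl]
    exact hg l (by omega)

/-- A Laurent series whose product with a square root of `a x ^ 2 - b`, `a, b ≠ 0`, and with powers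
of `a x ^ 2 - b` is a polynomial is not itself a polynomial, since the roots of `a x ^ 2 - b` are
simple. -/
theorem eq_zero_of_mem_oddSpace {a b : ℂ} (ha : a ≠ 0) (hb : b ≠ 0)
    (hy : y ^ 2 = Polynomial.aeval var (Polynomial.C a * Polynomial.X ^ 2 - Polynomial.C b))
    {m : ℕ} {f : LaurentInf} (hf : f ∈ oddSpace y m) (hp : f ∈ polys) : f = 0 := by
  obtain ⟨P, hP⟩ := exists_aeval_eq' hf
  obtain ⟨Q, rfl⟩ := exists_aeval_eq' hp
  set Δ : Polynomial ℂ := Polynomial.C a * Polynomial.X ^ 2 - Polynomial.C b with hΔ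
  -- the multiplicity of a simple root `ξ` of `Δ` is even on the left, and odd on the right unless
  -- `Q = 0`
  have h1 : P ^ 2 = Δ ^ (2 * m + 1) * Q ^ 2 := by
    refine aeval_var_injective ?_
    rw [map_pow, hP, map_mul, map_pow, map_pow, ← hy]
    ring
  obtain ⟨ξ, hξ⟩ := IsAlgClosed.exists_pow_nat_eq (b / a) (n := 2) (by norm_num)
  have hξ0 : ξ ≠ 0 := by
    intro h
    rw [h, zero_pow two_ne_zero] at hξ
    exact div_ne_zero hb ha hξ.symm
  have hΔ2 : Δ = (Polynomial.X - Polynomial.C ξ) * (Polynomial.C a *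
      (Polynomial.X + Polynomial.C ξ)) := by
    have hb' : b = a * ξ ^ 2 := by rw [hξ]; field_simp
    rw [hΔ, hb', map_mul, map_pow]
    ring
  have hroot : ¬ (Polynomial.X - Polynomial.C ξ) ∣ (Polynomial.C a *
      (Polynomial.X + Polynomial.C ξ)) := by
    rw [Polynomial.dvd_iff_isRoot, Polynomial.IsRoot.def]
    simp only [Polynomial.eval_mul, Polynomial.eval_C, Polynomial.eval_add, Polynomial.eval_X]
    rw [← two_mul]
    exact mul_ne_zero ha (mul_ne_zero two_ne_zero hξ0)
  have hprime : Prime (Polynomial.X - Polynomial.C ξ) := Polynomial.prime_X_sub_C ξ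
  have hΔm : emultiplicity (Polynomial.X - Polynomial.C ξ) Δ = 1 := by
    rw [hΔ2, emultiplicity_mul hprime, emultiplicity_eq_zero.2 hroot, add_zero]
    have := (FiniteMultiplicity.of_prime_left hprime hprime.ne_zero).emultiplicity_self
    exact this
  have h2 := congrArg (emultiplicity (Polynomial.X - Polynomial.C ξ)) h1
  rw [emultiplicity_pow hprime, emultiplicity_mul hprime, emultiplicity_pow hprime,
    emultiplicity_pow hprime, hΔm] at h2
  by_contra hne
  have hQ : Q ≠ 0 := by rintro rfl; exact hne (map_zero _)
  have hQf := FiniteMultiplicity.of_prime_left hprime hQ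
  have hP0 : P ≠ 0 := by
    rintro rfl
    have hΔ0 : Δ ≠ 0 := by
      intro h0
      rw [h0, emultiplicity_zero] at hΔm
      exact absurd hΔm (by simp)
    have := mul_ne_zero (pow_ne_zero (2 * m + 1) hΔ0) (pow_ne_zero 2 hQ)
    rw [← h1] at this
    exact this (by simp)
  have hPf := FiniteMultiplicity.of_prime_left hprime hP0
  rw [hQf.emultiplicity_eq_multiplicity, hPf.emultiplicity_eq_multiplicity] at h2
  have h3 : 2 * multiplicity (Polynomial.X - Polynomial.C ξ) P =
      (2 * m + 1) * 1 + 2 * multiplicity (Polynomial.X - Polynomial.C ξ) Q := by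
    exact_mod_cast h2
  omega

/-- The elements of `oddSpace y m` of bounded degree in `x` depend linearly on finitely many of
their coefficients of negative powers of `x`. -/
theorem exists_basis_oddSpace {a b : ℂ} (ha : a ≠ 0) (hb : b ≠ 0)
    (hy : y ^ 2 = Polynomial.aeval var (Polynomial.C a * Polynomial.X ^ 2 - Polynomial.C b))
    (m d : ℕ) :
    ∃ (n : ℕ) (e : ℕ → LaurentInf), (∀ r, e r ∈ oddSpace y m) ∧
      ∀ f ∈ oddSpace y m, (∀ k : ℕ, d < k → coeff (-(k : ℤ)) f = 0) →
        f = ∑ r ∈ range n, tail f r • e r := by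
  have hy0 : y ≠ 0 := by
    rintro rfl
    have h1 : Polynomial.C a * Polynomial.X ^ 2 - Polynomial.C b = 0 := by
      refine aeval_var_injective ?_
      rw [← hy, map_zero]; simp
    have := congrArg (fun P => Polynomial.coeff P 0) h1
    simp at this
    exact hb this
  have hz0 : (y ^ 2) ^ m * y ≠ 0 := mul_ne_zero (pow_ne_zero _ (pow_ne_zero _ hy0)) hy0
  obtain ⟨d', hd'⟩ := exists_coeff_neg_eq_zero ((y ^ 2) ^ m * y)
  let B : Submodule ℂ LaurentInf :=
    { carrier := {f | ∀ k : ℕ, d < k → coeff (-(k : ℤ)) f = 0}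
      add_mem' := fun {f g} hf hg k hk => by rw [map_add, hf k hk, hg k hk, add_zero]
      zero_mem' := fun k _ => map_zero _
      smul_mem' := fun c f hf k hk => by rw [map_smul, hf k hk, smul_zero] }
  let V := oddSpace y m ⊓ B
  -- an element of `oddSpace` of bounded degree is a polynomial of bounded degree divided by
  -- `(y ^ 2) ^ m * y`
  have hV : V ≤ Submodule.span ℂ ((fun k : ℕ => ((y ^ 2) ^ m * y)⁻¹ * var ^ k) ''
      Set.Iio (d' + d + 1)) := by
    rintro f ⟨hf1, hf2⟩
    obtain ⟨P, hP, h⟩ := exists_aeval_eq hf1 (d := d' + d) fun k hk =>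
      coeff_neg_mul_eq_zero hd' hf2 hk
    have h2 : f = ((y ^ 2) ^ m * y)⁻¹ * Polynomial.aeval var P := by
      rw [h, inv_mul_cancel_left₀ hz0]
    rw [h2, Polynomial.aeval_eq_sum_range' (Nat.lt_succ_of_le hP), Finset.mul_sum]
    refine sum_mem fun k hk => ?_
    rw [mul_smul_comm]
    exact Submodule.smul_mem _ _ (Submodule.subset_span
      (Set.mem_image_of_mem _ (by simpa using hk)))
  have : FiniteDimensional ℂ (Submodule.span ℂ ((fun k : ℕ => ((y ^ 2) ^ m * y)⁻¹ * var ^ k) ''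
      Set.Iio (d' + d + 1))) := FiniteDimensional.span_of_finite ℂ ((Set.finite_Iio _).image _)
  have : FiniteDimensional ℂ V := Submodule.finiteDimensional_of_le hV
  obtain ⟨n, e, he, h⟩ := exists_finite_tail V fun f hf h0 =>
    eq_zero_of_mem_oddSpace ha hb hy hf.1 (mem_polys_iff.2 h0)
  exact ⟨n, e, fun r => (he r).1, fun f hf hf' => h f ⟨hf, hf'⟩⟩

end LaurentInf
end QuarticTensor

namespace QuarticTensor

/-! ### Genus zero -/

open Egf

/-- The properties of the free energy from which everything else follows. -/
structure IsSolution (α : Fin 6 → ℂ) (F : Egf (Fin 6 × ℕ) (PowerSeries ℂ)) : Prop where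
  D_zero : ∀ c, D (c, 0) F = 1
  loop : ∀ i p g K s, g < K → PowerSeries.coeff g (loopEq α F PowerSeries.X 1 i p K s) = 0

/-- The part of order zero in `ħ`. -/
def genusZero (F : Egf (Fin 6 × ℕ) (PowerSeries ℂ)) : Egf (Fin 6 × ℕ) ℂ :=
  Egf.map PowerSeries.constantCoeff F

theorem genusZero_apply (F : Egf (Fin 6 × ℕ) (PowerSeries ℂ)) (s) :
    genusZero F s = PowerSeries.coeff 0 (F s) := by
  rw [genusZero, map_apply, PowerSeries.coeff_zero_eq_constantCoeff_apply]

variable {α : Fin 6 → ℂ} {F : Egf (Fin 6 × ℕ) (PowerSeries ℂ)}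

theorem IsSolution.genusZero_D_zero (hF : IsSolution α F) (c : Fin 6) :
    D (c, 0) (genusZero F) = 1 := by
  rw [genusZero, D_map, hF.D_zero, map_one]

/-- The loop equations at genus zero; only the quadratic vertices contribute. -/
theorem IsSolution.genusZero_loop (hF : IsSolution α F) (i : Fin 6) (p : ℕ) :
    ∑ k ∈ range p, D (i, k) (genusZero F) * D (i, p - 1 - k) (genusZero F) -
      (1 - α i ^ 2) • D (i, p + 1) (genusZero F) + shift (virShift ℂ i p) (genusZero F) +
      ∑ c ∈ univ.erase i, (α i * α c) • (D (i, p) (genusZero F) * D (c, 1) (genusZero F)) = 0 := by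
  have h1 := map_loopEq PowerSeries.constantCoeff (fun a => by
    rw [PowerSeries.algebraMap_apply, PowerSeries.constantCoeff_C]) α F PowerSeries.X 1 i p 1
  have h2 : Egf.map PowerSeries.constantCoeff (loopEq α F PowerSeries.X 1 i p 1) = 0 := by
    ext1 s
    rw [map_apply, ← PowerSeries.coeff_zero_eq_constantCoeff_apply, hF.loop i p 0 1 s one_pos]
    rfl
  rw [h2, PowerSeries.constantCoeff_X, map_one] at h1
  change 0 = loopEq α (genusZero F) 0 1 i p (0 + 1) at h1
  rw [loopEq_succ α hF.genusZero_D_zero] at h1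
  simp only [zero_smul, add_zero, one_pow, mul_one, Algebra.algebraMap_self, RingHom.id_apply] at h1
  rw [h1, sub_smul, one_smul, pow_two]
  abel

theorem mul_singleton {β R : Type*} [CommRing R] (f g : Egf β R) (b : β) :
    (f * g) {b} = f {b} * g 0 + f 0 * g {b} := by
  have := mul_apply_cons b f g 0
  rw [Multiset.cons_zero, Egf.mul_apply_zero, Egf.mul_apply_zero] at this
  exact this

/-- The genus zero one-point functions of the traces of first powers solve a homogeneous linear
system with a matrix of rank one, whose determinant is `1 - ∑_c α_c ^ 2`. -/
theorem IsSolution.genusZero_one (hF : IsSolution α F) (hα : ∑ c, α c ^ 2 ≠ 1) (c : Fin 6) :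
    genusZero F {(c, 1)} = 0 := by
  set y : Fin 6 → ℂ := fun c => genusZero F {(c, 1)} with hy
  set Y := ∑ c, α c * y c with hY
  have h1 : ∀ c, y c = α c * Y := by
    intro i
    have := congrFun (hF.genusZero_loop i 0) 0
    have h3 := Finset.add_sum_erase univ (fun e => α e * y e) (mem_univ i)
    have hD0 : D (i, 0) (genusZero F) 0 = 1 := by rw [hF.genusZero_D_zero]; rfl
    rw [Finset.range_zero, Finset.sum_empty, Egf.add_apply, Egf.add_apply, Egf.sub_apply,
      shift_apply_zero, Egf.sum_apply, Egf.smul_apply] at this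
    simp only [Egf.smul_apply, Egf.mul_apply_zero, hD0, one_mul, D_apply, zero_add, Egf.zero_apply,
      Multiset.cons_zero, mul_assoc] at this
    rw [← Finset.mul_sum] at this
    rw [hY, ← h3]
    change 0 - (1 - α i ^ 2) * y i + 0 + α i * ∑ c ∈ univ.erase i, α c * y c = 0 at this
    linear_combination -this
  have h2 : (1 - ∑ c, α c ^ 2) * Y = 0 := by
    have : Y = ∑ c, α c * (α c * Y) := by
      conv_lhs => rw [hY]
      exact Finset.sum_congr rfl fun c _ => by rw [← h1]
    rw [sub_mul, one_mul, Finset.sum_mul]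
    rw [sub_eq_zero]
    conv_lhs => rw [this]
    exact Finset.sum_congr rfl fun c _ => by ring
  have h3 : Y = 0 := (mul_eq_zero.1 h2).resolve_left (sub_ne_zero.2 (Ne.symm hα))
  change y c = 0
  rw [h1, h3, mul_zero]

/-- The moments of the genus zero resolvent, as a power series. -/
def onePoint (F : Egf (Fin 6 × ℕ) (PowerSeries ℂ)) (i : Fin 6) : PowerSeries ℂ :=
  PowerSeries.mk fun p => genusZero F {(i, p)}

/-- The genus zero correlations of a resolvent and a trace. -/
def twoPoint (F : Egf (Fin 6 × ℕ) (PowerSeries ℂ)) (i : Fin 6) (b : Fin 6 × ℕ) : PowerSeries ℂ :=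
  PowerSeries.mk fun p => genusZero F {(i, p), b}

theorem sum_range_eq_coeff_mul (a b : PowerSeries ℂ) (p : ℕ) :
    ∑ k ∈ range p, PowerSeries.coeff k a * PowerSeries.coeff (p - 1 - k) b =
      PowerSeries.coeff p (PowerSeries.X * (a * b)) := by
  cases p with
  | zero => simp
  | succ p =>
    rw [PowerSeries.coeff_succ_X_mul, PowerSeries.coeff_mul,
      Finset.Nat.sum_antidiagonal_eq_sum_range_succ (fun i j =>
        PowerSeries.coeff i a * PowerSeries.coeff j b)]
    simp

theorem IsSolution.onePoint_zero (hF : IsSolution α F) (i : Fin 6) :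
    PowerSeries.coeff 0 (onePoint F i) = 1 := by
  have : D (i, 0) (genusZero F) 0 = 1 := by rw [hF.genusZero_D_zero]; rfl
  rw [onePoint, PowerSeries.coeff_mk]
  exact this

theorem coeff_onePoint (i : Fin 6) (p : ℕ) :
    PowerSeries.coeff p (onePoint F i) = D (i, p) (genusZero F) 0 := by
  rw [onePoint, PowerSeries.coeff_mk]; rfl

theorem coeff_twoPoint (i : Fin 6) (b : Fin 6 × ℕ) (p : ℕ) :
    PowerSeries.coeff p (twoPoint F i b) = D (i, p) (genusZero F) {b} := by
  rw [twoPoint, PowerSeries.coeff_mk]; rfl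

/-- The algebraic equation for the genus zero resolvent, that of the semicircle law with variance
`(1 - α_i ^ 2)⁻¹`. -/
theorem IsSolution.onePoint_eq (hF : IsSolution α F) (hα : ∑ c, α c ^ 2 ≠ 1) (i : Fin 6) :
    PowerSeries.X ^ 2 * onePoint F i ^ 2 =
      PowerSeries.C (1 - α i ^ 2) * (onePoint F i - 1) := by
  refine PowerSeries.ext fun p => ?_
  rw [PowerSeries.coeff_C_mul]
  cases p with
  | zero => rw [map_sub, hF.onePoint_zero]; simp
  | succ p =>
    have h1 : PowerSeries.X ^ 2 * onePoint F i ^ 2 =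
        PowerSeries.X * (PowerSeries.X * (onePoint F i * onePoint F i)) := by ring
    rw [h1, PowerSeries.coeff_succ_X_mul, ← sum_range_eq_coeff_mul, map_sub, PowerSeries.coeff_one,
      if_neg (by omega), sub_zero]
    have := congrFun (hF.genusZero_loop i p) 0
    rw [Egf.add_apply, Egf.add_apply, Egf.sub_apply, shift_apply_zero, Egf.sum_apply, Egf.sum_apply,
      Egf.smul_apply, Finset.sum_eq_zero (s := univ.erase i)] at this
    · simp only [Egf.mul_apply_zero, ← coeff_onePoint, Egf.zero_apply, add_zero] at this
      linear_combination this
    · intro c _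
      rw [Egf.smul_apply, Egf.mul_apply_zero, D_apply (c, 1), Multiset.cons_zero,
        hF.genusZero_one hα, mul_zero, mul_zero]

/-- The square root singularity of the genus zero resolvent, multiplied by `1 / x`. -/
def branchSeries (α : Fin 6 → ℂ) (F : Egf (Fin 6 × ℕ) (PowerSeries ℂ)) (i : Fin 6) :
    PowerSeries ℂ :=
  2 * PowerSeries.X ^ 2 * onePoint F i - PowerSeries.C (1 - α i ^ 2)

theorem IsSolution.branchSeries_sq (hF : IsSolution α F) (hα : ∑ c, α c ^ 2 ≠ 1) (i : Fin 6) :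
    branchSeries α F i ^ 2 = PowerSeries.C (1 - α i ^ 2) ^ 2 -
      4 * PowerSeries.C (1 - α i ^ 2) * PowerSeries.X ^ 2 := by
  rw [branchSeries]
  linear_combination (4 * PowerSeries.X ^ 2) * hF.onePoint_eq hα i

/-- The coupling of the color `i` to the first powers of the other colors. -/
def linearCoupling (α : Fin 6 → ℂ) (F : Egf (Fin 6 × ℕ) (PowerSeries ℂ)) (i : Fin 6)
    (b : Fin 6 × ℕ) : ℂ :=
  ∑ c ∈ univ.erase i, α i * α c * genusZero F {(c, 1), b}

/-- The genus zero loop equation, differentiated with respect to one time. -/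
theorem IsSolution.coeff_twoPoint_eq (hF : IsSolution α F) (hα : ∑ c, α c ^ 2 ≠ 1) (i : Fin 6)
    (b : Fin 6 × ℕ) (p : ℕ) :
    2 * PowerSeries.coeff p (PowerSeries.X * (onePoint F i * twoPoint F i b)) -
      (1 - α i ^ 2) * PowerSeries.coeff (p + 1) (twoPoint F i b) +
      (if b.1 = i then (b.2 : ℂ) * PowerSeries.coeff (b.2 + p - 1) (onePoint F i) else 0) +
      PowerSeries.coeff p (onePoint F i) * linearCoupling α F i b = 0 := by
  have := congrFun (hF.genusZero_loop i p) {b}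
  rw [Egf.add_apply, Egf.add_apply, Egf.sub_apply, Egf.sum_apply, Egf.sum_apply,
    Egf.smul_apply, shift_apply] at this
  simp only [mul_singleton, Multiset.map_singleton, Multiset.sum_singleton, Egf.zero_apply,
    Egf.smul_apply, D_apply (_, 1), Multiset.cons_zero, hF.genusZero_one hα, mul_zero, zero_add,
    ← coeff_onePoint, ← coeff_twoPoint, Finset.sum_add_distrib] at this
  have h1 : ∑ k ∈ range p, PowerSeries.coeff k (twoPoint F i b) *
      PowerSeries.coeff (p - 1 - k) (onePoint F i) =
      PowerSeries.coeff p (PowerSeries.X * (onePoint F i * twoPoint F i b)) := by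
    rw [sum_range_eq_coeff_mul, mul_comm (twoPoint F i b)]
  rw [h1, sum_range_eq_coeff_mul] at this
  have h2 : (virShift ℂ i p b).1 * genusZero F ((virShift ℂ i p b).2 ::ₘ Multiset.erase {b} b) =
      if b.1 = i then (b.2 : ℂ) * PowerSeries.coeff (b.2 + p - 1) (onePoint F i) else 0 := by
    rw [virShift, Multiset.erase_singleton, Multiset.cons_zero]
    split_ifs
    · rw [coeff_onePoint]; rfl
    · rw [zero_mul]
  have h3 : ∑ c ∈ univ.erase i, α i * α c * (PowerSeries.coeff p (onePoint F i) *
      genusZero F ((c, 1) ::ₘ {b})) =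
      PowerSeries.coeff p (onePoint F i) * linearCoupling α F i b := by
    rw [linearCoupling, Finset.mul_sum]
    exact Finset.sum_congr rfl fun c _ => by rw [Multiset.insert_eq_cons]; ring
  rw [h2, h3] at this
  linear_combination this

theorem IsSolution.twoPoint_zero (hF : IsSolution α F) (i : Fin 6) (b : Fin 6 × ℕ) :
    PowerSeries.coeff 0 (twoPoint F i b) = 0 := by
  rw [coeff_twoPoint, hF.genusZero_D_zero, one_apply, if_neg (by simp)]

theorem IsSolution.branchSeries_mul_twoPoint (hF : IsSolution α F) (hα : ∑ c, α c ^ 2 ≠ 1)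
    {i c : Fin 6} (hc : c ≠ i) (q : ℕ) :
    branchSeries α F i * twoPoint F i (c, q) =
      -PowerSeries.C (linearCoupling α F i (c, q)) * PowerSeries.X * onePoint F i := by
  have h : branchSeries α F i * twoPoint F i (c, q) +
      PowerSeries.C (linearCoupling α F i (c, q)) * (PowerSeries.X * onePoint F i) =
      PowerSeries.X * (PowerSeries.C 2 * (PowerSeries.X * (onePoint F i * twoPoint F i (c, q))) +
        PowerSeries.C (linearCoupling α F i (c, q)) * onePoint F i) -
      PowerSeries.C (1 - α i ^ 2) * twoPoint F i (c, q) := by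
    rw [branchSeries, show (PowerSeries.C 2 : PowerSeries ℂ) = 2 from map_ofNat _ 2]; ring
  have h2 : branchSeries α F i * twoPoint F i (c, q) +
      PowerSeries.C (linearCoupling α F i (c, q)) * (PowerSeries.X * onePoint F i) = 0 := by
    rw [h]
    refine PowerSeries.ext fun p => ?_
    cases p with
    | zero => rw [map_sub, PowerSeries.coeff_C_mul, hF.twoPoint_zero]; simp
    | succ p =>
      rw [map_sub, PowerSeries.coeff_succ_X_mul, map_add, PowerSeries.coeff_C_mul,
        PowerSeries.coeff_C_mul, PowerSeries.coeff_C_mul, map_zero]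
      have := hF.coeff_twoPoint_eq hα i (c, q) p
      rw [if_neg hc] at this
      linear_combination this
  linear_combination h2

/-- The restriction to the diagonal of the genus zero correlation of two resolvents. -/
def diagonalTwoPoint (F : Egf (Fin 6 × ℕ) (PowerSeries ℂ)) (i : Fin 6) : PowerSeries ℂ :=
  PowerSeries.mk fun n => ∑ k ∈ range (n + 1), genusZero F {(i, k), (i, n - k)}

/-- The genus zero correlation of the resolvent and the effective potential. -/
def potentialTwoPoint (α : Fin 6 → ℂ) (F : Egf (Fin 6 × ℕ) (PowerSeries ℂ)) (i : Fin 6) :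
    PowerSeries ℂ :=
  ∑ c ∈ univ.erase i, PowerSeries.C (α i * α c) * twoPoint F i (c, 1)

theorem coeff_potentialTwoPoint (i : Fin 6) (p : ℕ) :
    PowerSeries.coeff p (potentialTwoPoint α F i) = linearCoupling α F i (i, p) := by
  rw [potentialTwoPoint, map_sum, linearCoupling]
  refine Finset.sum_congr rfl fun c _ => ?_
  rw [PowerSeries.coeff_C_mul, twoPoint, PowerSeries.coeff_mk, Multiset.pair_comm]

theorem IsSolution.branchSeries_mul_potentialTwoPoint (hF : IsSolution α F)
    (hα : ∑ c, α c ^ 2 ≠ 1) (i : Fin 6) :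
    branchSeries α F i * potentialTwoPoint α F i = -PowerSeries.C (∑ c ∈ univ.erase i,
      α i * α c * linearCoupling α F i (c, 1)) * PowerSeries.X * onePoint F i := by
  rw [potentialTwoPoint, Finset.mul_sum, map_sum, ← Finset.sum_neg_distrib, Finset.sum_mul,
    Finset.sum_mul]
  refine Finset.sum_congr rfl fun c hc => ?_
  rw [mul_left_comm, hF.branchSeries_mul_twoPoint hα (Finset.ne_of_mem_erase hc),
    show PowerSeries.C (α i * α c * linearCoupling α F i (c, 1)) = PowerSeries.C (α i * α c) *
    PowerSeries.C (linearCoupling α F i (c, 1)) from map_mul _ _ _]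
  ring

theorem coeff_diagonalTwoPoint (i : Fin 6) (n : ℕ) :
    PowerSeries.coeff n (diagonalTwoPoint F i) =
      ∑ q ∈ range (n + 1), PowerSeries.coeff (n - q) (twoPoint F i (i, q)) := by
  rw [diagonalTwoPoint, PowerSeries.coeff_mk]
  refine Finset.sum_congr rfl fun q _ => ?_
  rw [twoPoint, PowerSeries.coeff_mk, Multiset.pair_comm]

theorem sum_coeff_mul_twoPoint (f : PowerSeries ℂ) (i : Fin 6) (n : ℕ) :
    ∑ q ∈ range (n + 1), PowerSeries.coeff (n - q) (f * twoPoint F i (i, q)) =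
      PowerSeries.coeff n (f * diagonalTwoPoint F i) := by
  have h1 : ∀ q ∈ range (n + 1), PowerSeries.coeff (n - q) (f * twoPoint F i (i, q)) =
      PowerSeries.coeff n (f * (PowerSeries.X ^ q * twoPoint F i (i, q))) := by
    intro q hq
    rw [mul_left_comm, PowerSeries.coeff_X_pow_mul',
      if_pos (Nat.lt_succ_iff.1 (Finset.mem_range.1 hq))]
  rw [Finset.sum_congr rfl h1, ← map_sum, ← Finset.mul_sum, ← sub_eq_zero, ← map_sub, ← mul_sub]
  refine PowerSeries.X_pow_dvd_iff.1 (Dvd.dvd.mul_left (PowerSeries.X_pow_dvd_iff.2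
    fun m hm => ?_) f) n (Nat.lt_succ_self n)
  rw [map_sub, coeff_diagonalTwoPoint, map_sum, sub_eq_zero]
  symm
  rw [← Finset.sum_subset (Finset.range_mono (show m + 1 ≤ n + 1 by omega))]
  · refine Finset.sum_congr rfl fun q hq => ?_
    rw [PowerSeries.coeff_X_pow_mul', if_pos (Nat.lt_succ_iff.1 (Finset.mem_range.1 hq))]
  · intro q _ hq
    rw [PowerSeries.coeff_X_pow_mul', if_neg (by rw [Finset.mem_range] at hq; omega)]

open PowerSeries in
/-- The genus zero loop equations for the correlations of two resolvents of the color `i`,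
restricted to the diagonal. The terms `q tr M_i ^ (q + p - 1)` sum up to a second derivative of the
resolvent. -/
theorem IsSolution.branchSeries_mul_diagonal (hF : IsSolution α F) (hα : ∑ c, α c ^ 2 ≠ 1)
    (i : Fin 6) :
    4 * (branchSeries α F i * diagonalTwoPoint F i) =
      -(X ^ 2 * d⁄dX ℂ (d⁄dX ℂ (branchSeries α F i))) -
        4 * (X * onePoint F i * potentialTwoPoint α F i) := by
  set v := onePoint F i with hv
  set d := diagonalTwoPoint F i with hd
  set A := potentialTwoPoint α F i with hA
  have hd0 : ∀ n, coeff (n + 1) d =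
      ∑ q ∈ range (n + 1), coeff (n - q + 1) (twoPoint F i (i, q)) := by
    intro n
    rw [hd, coeff_diagonalTwoPoint, Finset.sum_range_succ, Nat.sub_self, hF.twoPoint_zero, add_zero]
    refine Finset.sum_congr rfl fun q hq => ?_
    have := Finset.mem_range.1 hq
    congr 2
    omega
  have h : C 8 * (X * (X * v * d)) - C (4 * (1 - α i ^ 2)) * d +
      X ^ 2 * d⁄dX ℂ (d⁄dX ℂ (branchSeries α F i)) + C 4 * (X * (v * A)) = 0 := by
    refine PowerSeries.ext fun n => ?_
    cases n with
    | zero =>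
      have : coeff 0 d = 0 := by
        rw [hd, coeff_diagonalTwoPoint]
        simp only [zero_add, Finset.range_one, Finset.sum_singleton, Nat.sub_zero]
        exact hF.twoPoint_zero i _
      rw [map_add, map_add, map_sub, coeff_C_mul, coeff_C_mul, coeff_C_mul, this]
      simp
    | succ n =>
      rw [map_add, map_add, map_sub, coeff_C_mul, coeff_C_mul, coeff_C_mul, coeff_succ_X_mul,
        coeff_succ_X_mul, hd0, ← sum_coeff_mul_twoPoint, map_zero]
      have e1 : coeff n (v * A) = ∑ q ∈ range (n + 1),
          coeff (n - q) v * linearCoupling α F i (i, q) := by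
        rw [mul_comm, coeff_mul, Finset.Nat.sum_antidiagonal_eq_sum_range_succ (fun i j =>
          coeff i A * coeff j v)]
        refine Finset.sum_congr rfl fun q _ => ?_
        rw [hA, coeff_potentialTwoPoint, mul_comm]
      have e2 : coeff (n + 1) (X ^ 2 * d⁄dX ℂ (d⁄dX ℂ (branchSeries α F i))) =
          4 * ∑ q ∈ range (n + 1), (q : ℂ) * coeff (q + (n - q) - 1) v := by
        have e3 : ∑ q ∈ range (n + 1), (q : ℂ) * coeff (q + (n - q) - 1) v =
            (∑ q ∈ range (n + 1), (q : ℂ)) * coeff (n - 1) v := by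
          rw [Finset.sum_mul]
          refine Finset.sum_congr rfl fun q hq => ?_
          have := Finset.mem_range.1 hq
          rw [show q + (n - q) - 1 = n - 1 by omega]
        have e4 : ∀ n : ℕ, 2 * ∑ q ∈ range (n + 1), (q : ℂ) = n * (n + 1) := by
          intro n
          induction n with
          | zero => simp
          | succ n ih => rw [Finset.sum_range_succ, mul_add, ih]; push_cast; ring
        rw [e3, coeff_X_pow_mul']
        cases n with
        | zero => simp
        | succ m =>
          have e5 : coeff (m + 1 + 1) (branchSeries α F i) = 2 * coeff m v := by
            have : branchSeries α F i = C 2 * (X ^ 2 * v) - C (1 - α i ^ 2) := by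
              rw [branchSeries, show (C 2 : PowerSeries ℂ) = 2 from map_ofNat _ 2]; ring
            rw [this, map_sub, coeff_C_mul, coeff_X_pow_mul', if_pos (by omega), coeff_C,
              if_neg (by omega), sub_zero]
            rfl
          rw [if_pos (by omega), show m + 1 + 1 - 2 = m by omega, coeff_derivative,
            coeff_derivative, e5]
          have := e4 (m + 1)
          push_cast at this ⊢
          linear_combination (-2 * coeff m v) * this
      rw [e1, e2]
      -- four times the loop equations with exponents `n - q` and `q`, whose sum over `q` is to be
      -- shown
      have e6 : ∀ q ∈ range (n + 1), 8 * coeff (n - q) (X * v * twoPoint F i (i, q)) -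
          4 * (1 - α i ^ 2) * coeff (n - q + 1) (twoPoint F i (i, q)) +
          4 * ((q : ℂ) * coeff (q + (n - q) - 1) v) +
          4 * (coeff (n - q) v * linearCoupling α F i (i, q)) = 0 := by
        intro q _
        have := hF.coeff_twoPoint_eq hα i (i, q) (n - q)
        rw [if_pos rfl, ← mul_assoc X] at this
        linear_combination 4 * this
      rw [← Finset.sum_eq_zero e6]
      simp only [Finset.sum_add_distrib, Finset.sum_sub_distrib, Finset.mul_sum]
  rw [map_mul] at h
  simp only [show (C 8 : PowerSeries ℂ) = 8 from map_ofNat _ 8,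
    show (C 4 : PowerSeries ℂ) = 4 from map_ofNat _ 4] at h
  have hQ : branchSeries α F i = 2 * X ^ 2 * v - C (1 - α i ^ 2) := rfl
  linear_combination h + 4 * d * hQ

theorem ofNat_ne_zero' (n : ℕ) [n.AtLeastTwo] : (OfNat.ofNat n : PowerSeries ℂ) ≠ 0 := by
  rw [← map_ofNat (PowerSeries.C (R := ℂ)) n]
  intro h
  have := congrArg PowerSeries.constantCoeff h
  rw [PowerSeries.constantCoeff_C, map_zero] at this
  exact OfNat.ofNat_ne_zero n this

open PowerSeries in
/-- The correlation of two resolvents of the color `i` at coinciding points, at genus zero, together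
with the part of the effective potential that accompanies it in the loop equations, is a rational
function of `x`, with poles at the branch points only. -/
theorem IsSolution.branchSeries_pow_mul (hF : IsSolution α F) (hα : ∑ c, α c ^ 2 ≠ 1)
    (i : Fin 6) :
    branchSeries α F i ^ 4 * (X * diagonalTwoPoint F i + potentialTwoPoint α F i) =
      C (1 - α i ^ 2) ^ 3 * X ^ 3 + C (∑ c ∈ univ.erase i, α i * α c *
        linearCoupling α F i (c, 1)) * C (1 - α i ^ 2) * X * branchSeries α F i ^ 2 := by
  set Q := branchSeries α F i with hQ
  set v := onePoint F i with hv
  set A := potentialTwoPoint α F i with hA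
  set u : PowerSeries ℂ := C (∑ c ∈ univ.erase i, α i * α c * linearCoupling α F i (c, 1)) with hu
  set r : PowerSeries ℂ := C (1 - α i ^ 2) with hr
  set Q₁ := d⁄dX ℂ Q
  set Q₂ := d⁄dX ℂ Q₁ with hQ₂
  have ha : 4 * (Q * diagonalTwoPoint F i) = -(X ^ 2 * Q₂) - 4 * (X * v * A) :=
    hF.branchSeries_mul_diagonal hα i
  have hb : Q * A = -u * X * v := hF.branchSeries_mul_potentialTwoPoint hα i
  have hc : Q ^ 2 = r ^ 2 - 4 * r * X ^ 2 := hF.branchSeries_sq hα i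
  have he : X ^ 2 * v ^ 2 = r * (v - 1) := hF.onePoint_eq hα i
  have hQv : Q = 2 * X ^ 2 * v - r := rfl
  have hr' : d⁄dX ℂ r = 0 := derivative_C
  have h4' : d⁄dX ℂ (4 : PowerSeries ℂ) = 0 := by
    rw [show (4 : PowerSeries ℂ) = C 4 from (map_ofNat _ 4).symm]; exact derivative_C
  -- the first and second derivatives of `hc`
  have hd1 : Q * Q₁ = -4 * r * X := by
    have := congrArg (d⁄dX ℂ) hc
    rw [map_sub, Derivation.leibniz_pow, Derivation.leibniz_pow, Derivation.leibniz,
      Derivation.leibniz_pow, Derivation.leibniz, hr', h4', derivative_X] at this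
    simp only [smul_zero, smul_eq_mul, mul_one, mul_zero, add_zero, zero_sub] at this
    have h2 : (2 : PowerSeries ℂ) ≠ 0 := ofNat_ne_zero' 2
    refine mul_left_cancel₀ h2 ?_
    have e : d⁄dX ℂ Q = Q₁ := rfl
    rw [e] at this
    simp only [nsmul_eq_mul] at this
    push_cast at this
    linear_combination this
  have hd2 : Q₁ ^ 2 + Q * Q₂ = -4 * r := by
    have := congrArg (d⁄dX ℂ) hd1
    rw [Derivation.leibniz, Derivation.leibniz, Derivation.leibniz, map_neg, hr', h4',
      derivative_X] at this
    simp only [smul_eq_mul, neg_zero, mul_zero, add_zero, mul_one] at this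
    have e : d⁄dX ℂ Q = Q₁ := rfl
    rw [e, ← hQ₂] at this
    linear_combination this
  have hd3 : Q ^ 3 * Q₂ = -4 * r ^ 3 := by
    linear_combination Q ^ 2 * hd2 - (Q * Q₁ - 4 * r * X) * hd1 - 4 * r * hc
  have h4 : (4 : PowerSeries ℂ) ≠ 0 := ofNat_ne_zero' 4
  refine mul_left_cancel₀ h4 ?_
  linear_combination (Q ^ 3 * X) * ha + (4 * Q ^ 3 - 4 * X ^ 2 * v * Q ^ 2) * hb - X ^ 3 * hd3 -
    4 * u * X * Q ^ 2 * he - 4 * u * X * Q ^ 2 * v * hQv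

end QuarticTensor

namespace QuarticTensor

/-! ### The resolvents as functions on a hyperelliptic curve -/

open Egf LaurentInf

variable {α : Fin 6 → ℂ} {F : Egf (Fin 6 × ℕ) (PowerSeries ℂ)}

theorem LaurentInf.var_mul_ofPowerSeries_X_mul (f : PowerSeries ℂ) :
    var * ofPowerSeries (PowerSeries.X * f) = ofPowerSeries f := by
  ext n
  have h : n = -1 + (n + 1) := by ring
  conv_lhs => rw [h, var, coeff_monomial_mul]
  rcases lt_or_ge n 0 with hn | hn
  · rw [coeff_ofPowerSeries_of_neg f hn]
    rcases lt_or_ge (n + 1) 0 with h1 | h1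
    · exact coeff_ofPowerSeries_of_neg _ h1
    · rw [show n + 1 = ((0 : ℕ) : ℤ) by omega, coeff_ofPowerSeries]
      simp
  · obtain ⟨k, rfl⟩ := Int.eq_ofNat_of_zero_le hn
    rw [coeff_ofPowerSeries, show (k : ℤ) + 1 = ((k + 1 : ℕ) : ℤ) by push_cast; ring,
      coeff_ofPowerSeries, PowerSeries.coeff_succ_X_mul]

theorem LaurentInf.var_pow_mul_ofPowerSeries (r : ℕ) (f : PowerSeries ℂ) :
    var ^ r * ofPowerSeries (PowerSeries.X ^ r * f) = ofPowerSeries f := by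
  induction r generalizing f with
  | zero => simp
  | succ r ih =>
    rw [pow_succ, mul_assoc, pow_succ', mul_assoc, var_mul_ofPowerSeries_X_mul, ih]

theorem LaurentInf.ofPowerSeries_C (a : ℂ) :
    ofPowerSeries (PowerSeries.C a) = algebraMap ℂ LaurentInf a := ofPowerSeries.commutes a

/-- The square root singularity of the genus zero resolvent of the color `i`, with the polynomial
behaviour at infinity. -/
def branch (α : Fin 6 → ℂ) (F : Egf (Fin 6 × ℕ) (PowerSeries ℂ)) (i : Fin 6) : LaurentInf :=
  var * ofPowerSeries (branchSeries α F i)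

theorem branch_eq (i : Fin 6) :
    branch α F i = 2 * ofPowerSeries (PowerSeries.X * onePoint F i) -
    algebraMap ℂ _ (1 - α i ^ 2) * var := by
  have : branchSeries α F i = PowerSeries.X * (PowerSeries.C 2 * (PowerSeries.X * onePoint F i)) -
      PowerSeries.C (1 - α i ^ 2) := by
    rw [branchSeries, show (PowerSeries.C 2 : PowerSeries ℂ) = 2 from map_ofNat _ 2]; ring
  rw [branch, this, map_sub, mul_sub, var_mul_ofPowerSeries_X_mul, map_mul, ofPowerSeries_C,
    ofPowerSeries_C, map_ofNat, mul_comm var]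

/-- The spectral curve of the color `i`: `branch` is the square root of a quadratic polynomial in
`x`. -/
theorem IsSolution.branch_sq (hF : IsSolution α F) (hα : ∑ c, α c ^ 2 ≠ 1) (i : Fin 6) :
    branch α F i ^ 2 = Polynomial.aeval var (Polynomial.C ((1 - α i ^ 2) ^ 2) * Polynomial.X ^ 2 -
      Polynomial.C (4 * (1 - α i ^ 2))) := by
  have h1 : branchSeries α F i ^ 2 = PowerSeries.C ((1 - α i ^ 2) ^ 2) -
      PowerSeries.X ^ 2 * PowerSeries.C (4 * (1 - α i ^ 2)) := by
    rw [hF.branchSeries_sq hα, map_pow, map_mul,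
      show (PowerSeries.C 4 : PowerSeries ℂ) = 4 from map_ofNat _ 4]
    ring
  rw [branch, mul_pow, ← map_pow, h1, map_sub, mul_sub, var_pow_mul_ofPowerSeries, ofPowerSeries_C,
    ofPowerSeries_C, map_sub, map_mul (Polynomial.aeval var), Polynomial.aeval_C,
    Polynomial.aeval_C, map_pow (Polynomial.aeval var), Polynomial.aeval_X, mul_comm]

theorem IsSolution.branch_sq_mem_polys (hF : IsSolution α F) (hα : ∑ c, α c ^ 2 ≠ 1) (i : Fin 6) :
    branch α F i ^ 2 ∈ polys := by
  rw [hF.branch_sq hα]; exact aeval_var_mem_polys _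

/-- The labels of the terms of the effective potential. -/
def vertices (K : ℕ) : Finset (Σ _ : ℕ, Fin 6 → ℕ) :=
  (range K).sigma fun j => (univ : Finset (Fin 6)).piAntidiag (j + 1)

/-- The coefficients of the effective potential, as a polynomial in `x`. -/
def vertexCorr (α : Fin 6 → ℂ) (F : Egf (Fin 6 × ℕ) (PowerSeries ℂ)) (i : Fin 6)
    (t : Σ _ : ℕ, Fin 6 → ℕ) : Egf (Fin 6 × ℕ) (PowerSeries ℂ) :=
  (PowerSeries.C (vert α i t.2) * PowerSeries.X ^ t.1) • corr F PowerSeries.X (rest i t.2)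

theorem coeff_potential (i : Fin 6) (K g : ℕ) (s) :
    PowerSeries.coeff g (potential α F i K s) =
      ∑ t ∈ vertices K, PowerSeries.coeff g (vertexCorr α F i t s) • var ^ t.2 i := by
  rw [potential, Finset.sum_sigma', Egf.sum_apply, map_sum]
  refine Finset.sum_congr rfl fun t _ => ?_
  rw [vertexCorr, Egf.smul_apply, Egf.smul_apply, mul_assoc, mul_assoc, mul_assoc,
    PowerSeries.coeff_C_mul, PowerSeries.coeff_C_mul, PowerSeries.coeff_C_mul,
    PowerSeries.coeff_X_pow_mul', PowerSeries.coeff_X_pow_mul', Algebra.smul_def, map_mul]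
  split_ifs
  · rw [coeff_constants]; ring
  · simp

theorem mem_vertices_le {K : ℕ} {t : Σ _ : ℕ, Fin 6 → ℕ} (ht : t ∈ vertices K) (i : Fin 6) :
    t.2 i ≤ K := by
  rw [vertices, Finset.mem_sigma, Finset.mem_range, Finset.mem_piAntidiag] at ht
  have := Finset.single_le_sum (f := t.2) (fun _ _ => Nat.zero_le _) (mem_univ i)
  rw [ht.2.1] at this
  omega

theorem coeff_neg_potential (i : Fin 6) (K g : ℕ) (s) {k : ℕ} (hk : K < k) :
    LaurentInf.coeff (-(k : ℤ)) (PowerSeries.coeff g (potential α F i K s)) = 0 := by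
  rw [coeff_potential, map_sum]
  refine Finset.sum_eq_zero fun t ht => ?_
  have := mem_vertices_le ht i
  rw [map_smul, var_pow, coeff_monomial, if_neg (by omega), smul_zero]

theorem coeff_source_eq_zero {i : Fin 6} {g : ℕ} {s : Multiset (Fin 6 × ℕ)}
    (h : ¬ (g = 0 ∧ ∃ q, s = {(i, q)})) : PowerSeries.coeff g (source i s) = 0 := by
  rw [source, linear]
  split_ifs with hs
  · obtain ⟨b, rfl⟩ := Multiset.card_eq_one.1 hs
    rw [Multiset.map_singleton, Multiset.sum_singleton]
    split_ifs with hb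
    · rw [← map_mul, PowerSeries.coeff_C, if_neg]
      rintro rfl
      exact h ⟨rfl, b.2, by rw [← hb]⟩
    · exact map_zero _
  · exact map_zero _

/-- Away from the sources, `shiftedResolvent` is the sum of the resolvent and the potential. -/
theorem coeff_shiftedResolvent {i : Fin 6} {K g : ℕ} {s : Multiset (Fin 6 × ℕ)}
    (h : ¬ (g = 0 ∧ ∃ q, s = {(i, q)})) (h0 : ¬ (g = 0 ∧ s = 0)) :
    PowerSeries.coeff g (shiftedResolvent α F i K s) =
      (2 : ℂ) • ofTail (fun p => PowerSeries.coeff g (F ((i, p) ::ₘ s))) +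
        PowerSeries.coeff g (potential α F i K s) := by
  have h1 : PowerSeries.coeff g ((PowerSeries.C (var ^ 1) • (1 : Egf (Fin 6 × ℕ)
      (PowerSeries LaurentInf))) s) = 0 := by
    rw [Egf.smul_apply, PowerSeries.coeff_C_mul, one_apply]
    split_ifs with hs
    · rw [PowerSeries.coeff_one, if_neg (fun hg => h0 ⟨hg, Multiset.card_eq_zero.1 hs⟩), mul_zero]
    · rw [map_zero, mul_zero]
  rw [shiftedResolvent, polyTerms, Egf.add_apply, Egf.sub_apply, Egf.add_apply, map_add, map_sub,
    map_add, h1, coeff_source_eq_zero h, sub_zero, add_zero, two_mul, Egf.add_apply, map_add,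
    oneResolvent, coeff_resolvent, two_smul]
  rfl

theorem IsSolution.corr_rest_single_apply (hF : IsSolution α F) (i c : Fin 6) (s) :
    corr F PowerSeries.X (rest i (Pi.single c 1)) s =
      if c = i then (1 : Egf (Fin 6 × ℕ) (PowerSeries ℂ)) s else F ((c, 1) ::ₘ s) := by
  have h1 := corr_rest_single (h := PowerSeries.X) hF.D_zero i c 0
  have h2 : ∀ l, corr F PowerSeries.X ((i, 0) ::ₘ l) = corr F PowerSeries.X l := fun l => by
    rw [corr_cons, cov_of_D_eq_one (hF.D_zero i)]
  split_ifs with hc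
  · subst hc
    have h3 : rest c (Pi.single c 1) = (0 : Multiset (Fin 6 × ℕ)) +
        (univ.erase c).val.map fun e => (e, 0) := by
      rw [zero_add]
      refine Multiset.map_congr rfl fun e he => ?_
      have he' : e ∈ univ.erase c := he
      rw [Pi.single_eq_of_ne (Finset.ne_of_mem_erase he')]
    rw [h3, corr_add_zeroLabels hF.D_zero, corr_zero]
  · rw [if_neg hc, Pi.single_eq_of_ne (Ne.symm hc), add_zero, h2] at h1
    rw [h1, Multiset.insert_eq_cons, h2, corr_singleton]
    rfl

theorem sum_vertices_coeff_zero {M : Type*} [AddCommMonoid M] {K : ℕ} (hK : 0 < K)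
    (f : (Σ _ : ℕ, Fin 6 → ℕ) → M) (hf : ∀ t, 0 < t.1 → f t = 0) :
    ∑ t ∈ vertices K, f t = ∑ c, f ⟨0, Pi.single c 1⟩ := by
  rw [vertices, Finset.sum_sigma, Finset.sum_eq_single 0]
  · exact sum_piAntidiag_one fun b => f ⟨0, b⟩
  · intro j _ hj
    exact Finset.sum_eq_zero fun b _ => hf _ (Nat.pos_of_ne_zero hj)
  · intro h; exact absurd (Finset.mem_range.2 hK) h

theorem coeff_zero_vertexCorr {i : Fin 6} {t : Σ _ : ℕ, Fin 6 → ℕ} (ht : 0 < t.1) (s) :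
    PowerSeries.coeff 0 (vertexCorr α F i t s) = 0 := by
  rw [vertexCorr, Egf.smul_apply, mul_assoc, PowerSeries.coeff_C_mul, PowerSeries.coeff_X_pow_mul',
    if_neg (by omega), mul_zero]

theorem IsSolution.coeff_zero_vertexCorr_single (hF : IsSolution α F) (i c : Fin 6) (s) :
    PowerSeries.coeff 0 (vertexCorr α F i ⟨0, Pi.single c 1⟩ s) = α i * α c *
      if c = i then (if s = 0 then 1 else 0) else genusZero F ((c, 1) ::ₘ s) := by
  rw [vertexCorr, Egf.smul_apply, pow_zero, mul_one, PowerSeries.coeff_C_mul, vert_single,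
    hF.corr_rest_single_apply, genusZero_apply]
  congr 1
  split_ifs with h1 h2
  · rw [one_apply, if_pos (Multiset.card_eq_zero.2 h2), PowerSeries.coeff_one, if_pos rfl]
  · rw [one_apply, if_neg (mt Multiset.card_eq_zero.1 h2), map_zero]
  · rfl

/-- The leading coefficient of `shiftedResolvent`: at genus zero the effective potential contributes
`α_i ^ 2 x` only, since the traces of first powers have zero expectation. -/
theorem IsSolution.coeff_zero_shiftedResolvent (hF : IsSolution α F) (hα : ∑ c, α c ^ 2 ≠ 1)
    (i : Fin 6) {K : ℕ} (hK : 0 < K) :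
    PowerSeries.coeff 0 (shiftedResolvent α F i K 0) = branch α F i := by
  have h1 : PowerSeries.coeff 0 (potential α F i K 0) = (α i ^ 2) • var := by
    rw [coeff_potential, sum_vertices_coeff_zero hK _ fun t ht => by
      rw [coeff_zero_vertexCorr ht, zero_smul], Finset.sum_eq_single i]
    · rw [hF.coeff_zero_vertexCorr_single, if_pos rfl, if_pos rfl, mul_one, pow_two]
      simp
    · intro c _ hc
      rw [hF.coeff_zero_vertexCorr_single, if_neg hc, Multiset.cons_zero, hF.genusZero_one hα,
        mul_zero, zero_smul]
    · intro h; exact absurd (mem_univ i) h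
  have h2 : PowerSeries.coeff 0 (oneResolvent F i 0) =
      ofPowerSeries (PowerSeries.X * onePoint F i) := by
    rw [oneResolvent, coeff_resolvent, ofTail_apply, onePoint]
    congr 3
    funext p
    rw [genusZero_apply]
    rfl
  rw [shiftedResolvent, polyTerms, Egf.add_apply, Egf.sub_apply, Egf.add_apply, map_add, map_sub,
    map_add, coeff_source_eq_zero (by
      rintro ⟨-, q, hq⟩; exact Multiset.singleton_ne_zero _ hq.symm),
    Egf.smul_apply, PowerSeries.coeff_C_mul, one_apply, if_pos Multiset.card_zero,
      PowerSeries.coeff_one,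
    if_pos rfl, h1, two_mul, Egf.add_apply, map_add, h2, branch_eq, map_sub, map_one,
      Algebra.smul_def]
  ring

end QuarticTensor

namespace QuarticTensor

/-! ### Recursive solution of the loop equations -/

open Egf LaurentInf

variable {α : Fin 6 → ℂ} {F : Egf (Fin 6 × ℕ) (PowerSeries ℂ)}

theorem coeff_secondOrder (i : Fin 6) (K g : ℕ) (s) :
    PowerSeries.coeff g (secondOrder α F i K s) = ofTail fun p =>
      ∑ k ∈ range p, PowerSeries.coeff g (F ((i, k) ::ₘ (i, p - 1 - k) ::ₘ s)) +
        ∑ t ∈ vertices K, PowerSeries.coeff g (vertexCorr α F i t ((i, t.2 i + p) ::ₘ s)) := by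
  rw [secondOrder, coeff_resolvent]
  congr 1
  funext p
  rw [Finset.sum_sigma', Egf.add_apply, Egf.sum_apply, Egf.sum_apply, map_add, map_sum, map_sum]
  refine congrArg₂ (· + ·) (Finset.sum_congr rfl fun k _ => ?_) rfl
  rw [D_apply (i, k), D_apply (i, p - 1 - k), Multiset.cons_swap]

theorem coeff_neg_shiftedResolvent {i : Fin 6} {K g : ℕ} {s : Multiset (Fin 6 × ℕ)}
    (h : ¬ (g = 0 ∧ ∃ q, s = {(i, q)})) (h0 : ¬ (g = 0 ∧ s = 0)) {k : ℕ} (hk : K < k) :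
    LaurentInf.coeff (-(k : ℤ)) (PowerSeries.coeff g (shiftedResolvent α F i K s)) = 0 := by
  rw [coeff_shiftedResolvent h h0, map_add, map_smul, coeff_ofTail_of_nonpos _ (by omega),
    coeff_neg_potential i K g s hk, smul_zero, add_zero]

theorem tail_shiftedResolvent (i : Fin 6) (K g : ℕ) (s : Multiset (Fin 6 × ℕ)) (r : ℕ) :
    tail (PowerSeries.coeff g (shiftedResolvent α F i K s)) r =
      2 * PowerSeries.coeff g (F ((i, r) ::ₘ s)) := by
  have h1 : tail (PowerSeries.coeff g (polyTerms α F i K s)) = 0 :=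
    mem_polys_iff.1 (mem_polySubring.1 (polyTerms_mem_polySubring α F i K) g s)
  rw [shiftedResolvent, Egf.add_apply, map_add, map_add, h1, add_zero, two_mul, Egf.add_apply,
    map_add, map_add, oneResolvent, coeff_resolvent, tail_ofTail, two_mul]
  rfl

/-- If finitely many coefficients determine the correlation of a resolvent, they do so linearly. -/
theorem resolvent_eq_sum {i : Fin 6} {K g : ℕ} {s : Multiset (Fin 6 × ℕ)}
    (h : ¬ (g = 0 ∧ ∃ q, s = {(i, q)})) (h0 : ¬ (g = 0 ∧ s = 0)) {V : Submodule ℂ LaurentInf}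
    {n : ℕ} {e : ℕ → LaurentInf} (hspan : ∀ f ∈ V, (∀ k : ℕ, K < k →
      LaurentInf.coeff (-(k : ℤ)) f = 0) → f = ∑ r ∈ range n, tail f r • e r)
    (hs : PowerSeries.coeff g (shiftedResolvent α F i K s) ∈ V) :
    ofTail (fun p => PowerSeries.coeff g (F ((i, p) ::ₘ s))) +
      (1 / 2 : ℂ) • PowerSeries.coeff g (potential α F i K s) =
      ∑ l ∈ range n, PowerSeries.coeff g (F ((i, l) ::ₘ s)) • e l := by
  have := hspan _ hs fun k hk => coeff_neg_shiftedResolvent h h0 hk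
  simp only [tail_shiftedResolvent, mul_smul] at this
  rw [coeff_shiftedResolvent h h0, ← Finset.smul_sum] at this
  have h2 := congrArg (fun f => (1 / 2 : ℂ) • f) this
  simp only [smul_add, smul_smul] at h2
  norm_num at h2 ⊢
  exact h2

/-- The second order terms of the loop equations, the restriction to the diagonal of correlations
of two resolvents of lower order. -/
theorem pow_mul_secondOrder_mem {i : Fin 6} {K g : ℕ} {s : Multiset (Fin 6 × ℕ)} {y : LaurentInf}
    {a b : ℂ} (ha : a ≠ 0) (hb : b ≠ 0)
    (hy : y ^ 2 = Polynomial.aeval var (Polynomial.C a * Polynomial.X ^ 2 - Polynomial.C b))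
    {m : ℕ} (hO : ∀ q, PowerSeries.coeff g (shiftedResolvent α F i K ((i, q) ::ₘ s)) ∈
      oddSpace y m) (hgs : ¬ (g = 0 ∧ s = 0)) :
    (y ^ 2) ^ (2 * m + 1) * PowerSeries.coeff g (secondOrder α F i K s) ∈ polys := by
  have hs : ∀ q, ¬ (g = 0 ∧ ∃ r, (i, q) ::ₘ s = {(i, r)}) := by
    rintro q ⟨hg, r, hr⟩
    refine hgs ⟨hg, ?_⟩
    have := congrArg Multiset.card hr
    rw [Multiset.card_cons, Multiset.card_singleton] at this
    exact Multiset.card_eq_zero.1 (by omega)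
  have h0 : ∀ q, ¬ (g = 0 ∧ (i, q) ::ₘ s = 0) := fun q h => Multiset.cons_ne_zero h.2
  obtain ⟨n, e, he, hspan⟩ := exists_basis_oddSpace ha hb hy m K
  have h1 : ∀ q, ofTail (fun p => PowerSeries.coeff g (F ((i, p) ::ₘ (i, q) ::ₘ s))) +
      (1 / 2 : ℂ) • ∑ t ∈ vertices K,
        PowerSeries.coeff g (vertexCorr α F i t ((i, q) ::ₘ s)) • var ^ t.2 i =
      ∑ l ∈ range n, PowerSeries.coeff g (F ((i, l) ::ₘ (i, q) ::ₘ s)) • e l := by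
    intro q
    rw [← coeff_potential]
    exact resolvent_eq_sum (hs q) (h0 q) hspan (hO q)
  have h2 := diagonal_sub_mem_polys (vertices K) (fun t => t.2 i)
    (fun t q => PowerSeries.coeff g (vertexCorr α F i t ((i, q) ::ₘ s)))
    (ϕ := fun p q => PowerSeries.coeff g (F ((i, p) ::ₘ (i, q) ::ₘ s)))
    (fun p q => by rw [Multiset.cons_swap]) n e h1
  have h3 : y ^ 2 ∈ polys := by rw [hy]; exact aeval_var_mem_polys _
  have h4 := mul_mem (pow_mem h3 (2 * m + 1)) h2
  rw [← coeff_secondOrder, mul_sub] at h4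
  have h5 : (y ^ 2) ^ (2 * m + 1) * ∑ l ∈ range n, ∑ k ∈ range n,
      PowerSeries.coeff g (F ((i, l) ::ₘ (i, k) ::ₘ s)) • (e l * e k) ∈ polys := by
    simp only [Finset.mul_sum, mul_smul_comm]
    exact sum_mem fun l _ => sum_mem fun k _ =>
      polys.smul_mem (mul_mem_polys_of_mem_oddSpace (he l) (he k)) _
  have h6 := add_mem h4 h5
  rwa [sub_add_cancel] at h6

/-- The second order terms in the loop equation for the resolvent at genus one. -/
theorem IsSolution.branch_pow_mul_secondOrder_mem (hF : IsSolution α F) (hα : ∑ c, α c ^ 2 ≠ 1)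
    (i : Fin 6) {K : ℕ} (hK : 0 < K) :
    (branch α F i ^ 2) ^ 2 * PowerSeries.coeff 0 (secondOrder α F i K 0) ∈ polys := by
  have h1 : PowerSeries.coeff 0 (secondOrder α F i K 0) = ofPowerSeries (PowerSeries.X *
      (PowerSeries.X * diagonalTwoPoint F i + potentialTwoPoint α F i)) := by
    rw [coeff_secondOrder, ofTail_apply]
    congr 2
    refine PowerSeries.ext fun p => ?_
    rw [PowerSeries.coeff_mk, map_add]
    congr 1
    · cases p with
      | zero => simp
      | succ n =>
        rw [PowerSeries.coeff_succ_X_mul, diagonalTwoPoint, PowerSeries.coeff_mk]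
        refine Finset.sum_congr rfl fun k _ => ?_
        rw [genusZero_apply]
        rfl
    · rw [coeff_potentialTwoPoint, linearCoupling, sum_vertices_coeff_zero hK _ fun t ht =>
        coeff_zero_vertexCorr ht _, ← Finset.add_sum_erase _ _ (mem_univ i),
        hF.coeff_zero_vertexCorr_single, if_pos rfl, if_neg (Multiset.cons_ne_zero), mul_zero,
        zero_add]
      refine Finset.sum_congr rfl fun c hc => ?_
      have hci := Finset.ne_of_mem_erase hc
      rw [hF.coeff_zero_vertexCorr_single, if_neg hci]
      dsimp only
      rw [Pi.single_eq_of_ne (Ne.symm hci), zero_add]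
      rfl
  set u := ∑ c ∈ univ.erase i, α i * α c * linearCoupling α F i (c, 1) with hu
  have h2 : branchSeries α F i ^ 4 * (PowerSeries.X *
      (PowerSeries.X * diagonalTwoPoint F i + potentialTwoPoint α F i)) =
      PowerSeries.X ^ 4 * PowerSeries.C ((1 - α i ^ 2) ^ 3) + PowerSeries.X ^ 2 *
        (PowerSeries.C (u * (1 - α i ^ 2)) * branchSeries α F i ^ 2) := by
    rw [mul_left_comm, hF.branchSeries_pow_mul hα, map_pow, map_mul]
    ring
  have h3 : (branch α F i ^ 2) ^ 2 * PowerSeries.coeff 0 (secondOrder α F i K 0) =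
      algebraMap ℂ _ ((1 - α i ^ 2) ^ 3) + algebraMap ℂ _ (u * (1 - α i ^ 2)) *
        branch α F i ^ 2 := by
    have h4 : var ^ 4 * ofPowerSeries (PowerSeries.X ^ 2 *
        (PowerSeries.C (u * (1 - α i ^ 2)) * branchSeries α F i ^ 2)) =
        var ^ 2 * ofPowerSeries (PowerSeries.C (u * (1 - α i ^ 2)) * branchSeries α F i ^ 2) := by
      rw [show 4 = 2 + 2 by norm_num, pow_add, mul_assoc, var_pow_mul_ofPowerSeries]
    rw [h1, branch, ← pow_mul, mul_pow, mul_assoc, ← map_pow, ← map_mul, h2, map_add, mul_add,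
      var_pow_mul_ofPowerSeries, h4, ofPowerSeries_C, map_mul, ofPowerSeries_C,
      map_pow ofPowerSeries]
    ring
  rw [h3]
  exact add_mem (polys.algebraMap_mem _)
    (mul_mem (polys.algebraMap_mem _) (hF.branch_sq_mem_polys hα i))

theorem coeff_X_smul_succ {A : Type*} [CommRing A] {β : Type*} (f : Egf β (PowerSeries A)) (g s) :
    PowerSeries.coeff (g + 1) (((PowerSeries.X : PowerSeries A) • f) s) =
      PowerSeries.coeff g (f s) := by
  rw [Egf.smul_apply, PowerSeries.coeff_succ_X_mul]

theorem coeff_X_smul_zero {A : Type*} [CommRing A] {β : Type*} (f : Egf β (PowerSeries A)) (s) :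
    PowerSeries.coeff 0 (((PowerSeries.X : PowerSeries A) • f) s) = 0 := by
  rw [Egf.smul_apply, PowerSeries.coeff_zero_X_mul]

/-- The coefficients of a square, apart from those that contain the leading coefficient. -/
theorem coeff_sq_mem {β : Type*} {f : Egf β (PowerSeries LaurentInf)} {V : Submodule ℂ LaurentInf}
    {B : AddSubmonoid LaurentInf} (hVB : ∀ a ∈ V, ∀ b ∈ V, a * b ∈ B)
    (h0 : PowerSeries.coeff 0 (f 0) = 0) {L : ℕ}
    {g : ℕ} (hf : ∀ k s, k ≤ g → 2 * k + s.card ≤ L → PowerSeries.coeff k (f s) ∈ V)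
    {s : Multiset β} (hL : 2 * g + s.card ≤ L + 1) : PowerSeries.coeff g ((f * f) s) ∈ B := by
  rw [mul_apply, map_multiset_sum, Multiset.map_map]
  refine multiset_sum_mem _ fun b hb => ?_
  obtain ⟨x, hx, rfl⟩ := Multiset.mem_map.1 hb
  have hx' := congrArg Multiset.card (Multiset.mem_antidiagonal.1 hx)
  rw [Multiset.card_add] at hx'
  rw [Function.comp_apply, PowerSeries.coeff_mul]
  refine sum_mem fun y hy => ?_
  have hy' := Finset.HasAntidiagonal.mem_antidiagonal.1 hy
  by_cases h1 : y.1 = 0 ∧ x.1 = 0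
  · rw [h1.1, h1.2, h0, zero_mul]; exact B.zero_mem
  by_cases h2 : y.2 = 0 ∧ x.2 = 0
  · rw [h2.1, h2.2, h0, mul_zero]; exact B.zero_mem
  rw [← Multiset.card_eq_zero] at h1 h2
  exact hVB _ (hf _ _ (by omega) (by omega)) _ (hf _ _ (by omega) (by omega))

/-- The correlations of the resolvent and arbitrary traces, shifted by polynomials, are odd
functions on the hyperelliptic curve, with poles at the branch points only. -/
theorem IsSolution.exists_shiftedResolvent_mem (hF : IsSolution α F) (hα : ∑ c, α c ^ 2 ≠ 1)
    (i : Fin 6) (hi : α i ^ 2 ≠ 1) (K L : ℕ) :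
    ∃ m, 1 ≤ m ∧ ∀ g s, g < K → 2 * g + s.card ≤ L →
      PowerSeries.coeff g (shiftedResolvent α F i K s) ∈ oddSpace (branch α F i) m := by
  have hρ : 1 - α i ^ 2 ≠ 0 := sub_ne_zero.2 (Ne.symm hi)
  set y := branch α F i with hy
  have hy2 : y ^ 2 ∈ polys := hF.branch_sq_mem_polys hα i
  rcases Nat.eq_zero_or_pos K with rfl | hK
  · exact ⟨1, le_rfl, fun g s hg => absurd hg (Nat.not_lt_zero _)⟩
  induction L with
  | zero =>
    refine ⟨1, le_rfl, fun g s _ h => ?_⟩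
    obtain rfl : g = 0 := by omega
    obtain rfl : s = 0 := Multiset.card_eq_zero.1 (by omega)
    rw [hF.coeff_zero_shiftedResolvent hα i hK, mem_oddSpace, mul_assoc, ← pow_two]
    exact mul_mem (pow_mem hy2 _) hy2
  | succ L ih =>
    obtain ⟨m, hm, h⟩ := ih
    refine ⟨2 * m + 1, by omega, fun g s hg hL => ?_⟩
    rcases Nat.lt_or_ge L (2 * g + s.card) with hL' | hL'
    swap
    · exact oddSpace_mono hy2 (by omega) (h g s hg hL')
    have hgs : ¬ (g = 0 ∧ s = 0) := by
      rintro ⟨rfl, rfl⟩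
      rw [Multiset.card_zero] at hL'
      omega
    set O := shiftedResolvent α F i K with hO
    set O' : Egf (Fin 6 × ℕ) (PowerSeries LaurentInf) := O - PowerSeries.C y • 1 with hO'
    -- subtracting the leading coefficient `y` from `O` splits off the linear part of the square:
    -- `O ^ 2 = 2 y O - y ^ 2 + (O - y) ^ 2`
    have hO's : ∀ g' s', ¬ (g' = 0 ∧ s' = 0) →
        PowerSeries.coeff g' (O' s') = PowerSeries.coeff g' (O s') := by
      intro g' s' h'
      rw [hO', Egf.sub_apply, map_sub, Egf.smul_apply, PowerSeries.coeff_C_mul, one_apply]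
      split_ifs with hs
      · rw [PowerSeries.coeff_one, if_neg fun hg => h' ⟨hg, Multiset.card_eq_zero.1 hs⟩, mul_zero,
          sub_zero]
      · rw [map_zero, mul_zero, sub_zero]
    have hO'0 : PowerSeries.coeff 0 (O' 0) = 0 := by
      rw [hO', Egf.sub_apply, map_sub, Egf.smul_apply, PowerSeries.coeff_C_mul, one_apply,
        if_pos Multiset.card_zero, PowerSeries.coeff_one, if_pos rfl,
        hF.coeff_zero_shiftedResolvent hα i hK, mul_one, sub_self]
    -- the products of two coefficients of lower order
    let B : AddSubmonoid LaurentInf :=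
      { carrier := {f | (y ^ 2) ^ (2 * m + 1) * f ∈ polys}
        add_mem' := fun {a b} ha hb => by
          change _ * (a + b) ∈ polys
          rw [mul_add]; exact add_mem ha hb
        zero_mem' := by
          change _ * (0 : LaurentInf) ∈ polys
          rw [mul_zero]; exact zero_mem _ }
    have hB : ∀ f, f ∈ B ↔ (y ^ 2) ^ (2 * m + 1) * f ∈ polys := fun _ => Iff.rfl
    have hpolysB : ∀ f ∈ polys, f ∈ B := fun f hf => (hB f).2 (mul_mem (pow_mem hy2 _) hf)
    have hnegB : ∀ f ∈ B, -f ∈ B := fun f hf => (hB _).2 (by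
      rw [mul_neg]; exact neg_mem ((hB f).1 hf))
    have hsq : PowerSeries.coeff g ((O' * O') s) ∈ B := by
      refine coeff_sq_mem (V := oddSpace y m)
        (fun a ha b hb => (hB _).2 (mul_mem_polys_of_mem_oddSpace ha hb)) hO'0 (L := L)
        (fun k s' hk hks => ?_) hL
      by_cases h0 : k = 0 ∧ s' = 0
      · rw [h0.1, h0.2, hO'0]; exact zero_mem _
      · rw [hO's k s' h0]; exact h k s' (by omega) hks
    have hsec : PowerSeries.coeff g (((PowerSeries.X : PowerSeries LaurentInf) •
        secondOrder α F i K) s) ∈ B := by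
      cases g with
      | zero => rw [coeff_X_smul_zero]; exact B.zero_mem
      | succ g =>
        rw [coeff_X_smul_succ, hB]
        -- at genus one without labels, the diagonal value of two resolvents at genus zero enters
        by_cases h0 : g = 0 ∧ s = 0
        · obtain ⟨rfl, rfl⟩ := h0
          obtain ⟨k, hk⟩ := Nat.exists_eq_add_of_le (show 2 ≤ 2 * m + 1 by omega)
          rw [hk, pow_add, mul_right_comm]
          exact mul_mem (hF.branch_pow_mul_secondOrder_mem hα i hK) (pow_mem hy2 k)
        · refine pow_mul_secondOrder_mem (pow_ne_zero 2 hρ) (mul_ne_zero (by norm_num) hρ)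
            (hF.branch_sq hα i) (fun q => h g _ (by omega) ?_) h0
          rw [Multiset.card_cons]
          omega
    have hquad := quadratic_mem_polys α i K (fun p s => hF.loop i p g K s hg) s
    have hOO : PowerSeries.coeff g ((O * O) s) =
        2 * y * PowerSeries.coeff g (O s) + PowerSeries.coeff g ((O' * O') s) := by
      have h1 : O * O = PowerSeries.C (2 * y) • O' + PowerSeries.C (y ^ 2) • 1 + O' * O' := by
        have h2 : O = O' + PowerSeries.C y • 1 := by rw [hO', sub_add_cancel]
        have h3 : ∀ (a : PowerSeries LaurentInf)
            (f : Egf (Fin 6 × ℕ) (PowerSeries LaurentInf)), a • f = (a • 1) * f := fun a f => by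
          rw [smul_mul_assoc, one_mul]
        rw [h2, h3 _ O', map_mul, map_pow, map_ofNat, pow_two, mul_smul, mul_smul,
          h3 _ (PowerSeries.C y • 1), h3 (PowerSeries.C y) (PowerSeries.C y • 1)]
        have h4 : ((2 : PowerSeries LaurentInf) • (1 : Egf (Fin 6 × ℕ) (PowerSeries LaurentInf))) =
            2 := by
          rw [ofNat_smul_eq_nsmul]; simp
        rw [h4]
        ring
      rw [h1, Egf.add_apply, Egf.add_apply, map_add, map_add, Egf.smul_apply, Egf.smul_apply,
        PowerSeries.coeff_C_mul, PowerSeries.coeff_C_mul, hO's g s hgs, one_apply]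
      split_ifs with hs
      · rw [PowerSeries.coeff_one, if_neg fun hg => hgs ⟨hg, Multiset.card_eq_zero.1 hs⟩, mul_zero,
          add_zero]
      · rw [map_zero, mul_zero, add_zero]
    rw [hOO] at hquad
    -- hence `2 y O` is in `B`, which means that `O` is in `oddSpace y (2 * m + 1)`
    have hfin : 2 * y * PowerSeries.coeff g (O s) ∈ B := by
      have := add_mem (add_mem (hpolysB _ hquad) (hnegB _ (nsmul_mem hsec 4))) (hnegB _ hsq)
      convert this using 1
      abel
    have h2 := polys.smul_mem ((hB _).1 hfin) (1 / 2 : ℂ)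
    rw [mem_oddSpace]
    convert h2 using 1
    rw [Algebra.smul_def]
    have h3 : algebraMap ℂ LaurentInf (1 / 2) * 2 = 1 := by
      rw [show (2 : LaurentInf) = algebraMap ℂ LaurentInf 2 from (map_ofNat _ 2).symm, ← map_mul]
      norm_num
    linear_combination (-(y ^ 2) ^ (2 * m + 1) * y * PowerSeries.coeff g (O s)) * h3

/-- The correlations of given genus of a resolvent of the color `i` and of a bounded number of
traces are linear combinations of finitely many functions on the hyperelliptic curve; the
coefficients are correlations in which the resolvent is replaced by a trace. -/
theorem IsSolution.exists_decomposition (hF : IsSolution α F) (hα : ∑ c, α c ^ 2 ≠ 1)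
    (i : Fin 6) (hi : α i ^ 2 ≠ 1) (g N : ℕ) :
    ∃ (m n : ℕ) (e : ℕ → LaurentInf), (∀ r, e r ∈ oddSpace (branch α F i) m) ∧
      ∀ s, s.card ≤ N → ¬ (g = 0 ∧ ∃ q, s = {(i, q)}) → ¬ (g = 0 ∧ s = 0) →
        ofTail (fun p => PowerSeries.coeff g (F ((i, p) ::ₘ s))) +
          (1 / 2 : ℂ) • PowerSeries.coeff g (potential α F i (g + 1) s) =
          ∑ r ∈ range n, PowerSeries.coeff g (F ((i, r) ::ₘ s)) • e r := by
  have hρ : 1 - α i ^ 2 ≠ 0 := sub_ne_zero.2 (Ne.symm hi)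
  obtain ⟨m, _, h⟩ := hF.exists_shiftedResolvent_mem hα i hi (g + 1) (2 * g + N)
  obtain ⟨n, e, he, hspan⟩ := exists_basis_oddSpace (pow_ne_zero 2 hρ)
    (mul_ne_zero (by norm_num) hρ) (hF.branch_sq hα i) m (g + 1)
  exact ⟨m, n, e, he, fun s hs h1 h2 => resolvent_eq_sum h1 h2 hspan
    (h g s (Nat.lt_succ_self g) (by omega))⟩

end QuarticTensor

namespace QuarticTensor

/-! ### Convergence of the resolvents near infinity -/

open LaurentInf

section convergence

/-- The partial sums of a Cauchy product of nonnegative series. -/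
theorem sum_antidiagonal_le_sq {a : ℕ → ℝ} (ha : ∀ n, 0 ≤ a n) (n : ℕ) :
    ∑ m ∈ range n, ∑ y ∈ antidiagonal m, a y.1 * a y.2 ≤ (∑ m ∈ range n, a m) ^ 2 := by
  rw [pow_two, Finset.sum_mul_sum, ← Finset.sum_product', Finset.sum_sigma']
  have hinj : Set.InjOn (fun y : (_ : ℕ) × (ℕ × ℕ) => y.2)
      ((range n).sigma fun m => antidiagonal m) := by
    rintro ⟨m, y⟩ hy ⟨m', y'⟩ hy' (rfl : y = y')
    have h1 := Finset.HasAntidiagonal.mem_antidiagonal.1 (Finset.mem_sigma.1 hy).2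
    have h2 := Finset.HasAntidiagonal.mem_antidiagonal.1 (Finset.mem_sigma.1 hy').2
    obtain rfl : m = m' := h1.symm.trans h2
    rfl
  rw [← Finset.sum_image (f := fun y : ℕ × ℕ => a y.1 * a y.2) hinj]
  refine Finset.sum_le_sum_of_subset_of_nonneg ?_ fun y _ _ => mul_nonneg (ha _) (ha _)
  intro y hy
  obtain ⟨z, hz, rfl⟩ := Finset.mem_image.1 hy
  have h1 := Finset.mem_range.1 (Finset.mem_sigma.1 hz).1
  have h2 := Finset.HasAntidiagonal.mem_antidiagonal.1 (Finset.mem_sigma.1 hz).2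
  rw [Finset.mem_product, Finset.mem_range, Finset.mem_range]
  omega

/-- The solution of a quadratic equation converges near infinity. -/
theorem mem_convergentAt_of_quadratic {f : PowerSeries ℂ} {c u : ℂ}
    (hf : PowerSeries.X ^ 2 * f ^ 2 = PowerSeries.C c * (f - 1)) (hc : c ≠ 0)
    (hu : 4 * ‖u‖ ^ 2 ≤ ‖c‖) :
    f ∈ convergentAt u ∧ ∑' n, ‖PowerSeries.coeff n f * u ^ n‖ ≤ 2 := by
  set a : ℕ → ℝ := fun n => ‖PowerSeries.coeff n f * u ^ n‖ with ha
  have ha0 : ∀ n, 0 ≤ a n := fun n => norm_nonneg _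
  have hc0 : 0 < ‖c‖ := norm_pos_iff.2 hc
  have hf0 : PowerSeries.coeff 0 f = 1 := by
    have := congrArg (PowerSeries.coeff 0) hf
    rw [PowerSeries.coeff_C_mul, PowerSeries.coeff_X_pow_mul', if_neg (by norm_num),
      map_sub] at this
    have h := (mul_eq_zero.1 this.symm).resolve_left hc
    rw [sub_eq_zero] at h
    simpa using h
  have hf1 : PowerSeries.coeff 1 f = 0 := by
    have := congrArg (PowerSeries.coeff 1) hf
    rw [PowerSeries.coeff_C_mul, PowerSeries.coeff_X_pow_mul', if_neg (by norm_num), map_sub,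
      PowerSeries.coeff_one, if_neg (by norm_num), sub_zero] at this
    exact (mul_eq_zero.1 this.symm).resolve_left hc
  have hstep : ∀ n, a (n + 2) ≤ 1 / 4 * ∑ y ∈ antidiagonal n, a y.1 * a y.2 := by
    intro n
    have := congrArg (PowerSeries.coeff (n + 2)) hf
    rw [PowerSeries.coeff_C_mul, PowerSeries.coeff_X_pow_mul', if_pos (by omega), map_sub,
      PowerSeries.coeff_one, if_neg (by omega), sub_zero, Nat.add_sub_cancel, pow_two,
      PowerSeries.coeff_mul] at this
    have h1 : c * (PowerSeries.coeff (n + 2) f * u ^ (n + 2)) = u ^ 2 * ∑ y ∈ antidiagonal n,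
        (PowerSeries.coeff y.1 f * u ^ y.1) * (PowerSeries.coeff y.2 f * u ^ y.2) := by
      rw [← mul_assoc, ← this, Finset.sum_mul, Finset.mul_sum]
      refine Finset.sum_congr rfl fun y hy => ?_
      rw [← (Finset.HasAntidiagonal.mem_antidiagonal.1 hy)]
      ring
    have h2 := congrArg norm h1
    rw [norm_mul, norm_mul (u ^ 2), norm_pow] at h2
    have h3 : ‖∑ y ∈ antidiagonal n, (PowerSeries.coeff y.1 f * u ^ y.1) *
        (PowerSeries.coeff y.2 f * u ^ y.2)‖ ≤ ∑ y ∈ antidiagonal n, a y.1 * a y.2 :=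
      (norm_sum_le _ _).trans (Finset.sum_le_sum fun y _ => (norm_mul _ _).le)
    have h4 : 0 ≤ ∑ y ∈ antidiagonal n, a y.1 * a y.2 :=
      Finset.sum_nonneg fun y _ => mul_nonneg (ha0 _) (ha0 _)
    have h5 : ‖c‖ * a (n + 2) ≤ ‖c‖ * (1 / 4 * ∑ y ∈ antidiagonal n, a y.1 * a y.2) := by
      calc ‖c‖ * a (n + 2) = _ := h2
        _ ≤ ‖u‖ ^ 2 * ∑ y ∈ antidiagonal n, a y.1 * a y.2 := by gcongr
        _ ≤ (‖c‖ / 4) * ∑ y ∈ antidiagonal n, a y.1 * a y.2 := by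
            gcongr; linarith
        _ = _ := by ring
    exact le_of_mul_le_mul_left h5 hc0
  have hS : ∀ n, ∑ m ∈ range n, a m ≤ 2 := by
    have h0 : a 0 = 1 := by simp [ha, hf0]
    have h1 : a 1 = 0 := by simp [ha, hf1]
    intro n
    induction n using Nat.twoStepInduction with
    | zero => simp
    | one => simp [h0]
    | more n ih _ =>
      rw [Finset.sum_range_succ', Finset.sum_range_succ', h0, zero_add, h1, add_zero]
      have h2 : ∑ k ∈ range n, a (k + 1 + 1) ≤ 1 / 4 * (∑ m ∈ range n, a m) ^ 2 := by
        refine (Finset.sum_le_sum fun k _ => hstep k).trans ?_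
        rw [← Finset.mul_sum]
        exact mul_le_mul_of_nonneg_left (sum_antidiagonal_le_sq ha0 n) (by norm_num)
      have h3 : 0 ≤ ∑ m ∈ range n, a m := Finset.sum_nonneg fun m _ => ha0 m
      -- a partial sum is at most `1 + S ^ 2 / 4`, where `S` is the previous one; so the bound `2`
      -- persists
      nlinarith
  exact ⟨summable_of_sum_range_le ha0 hS, Real.tsum_le_of_sum_range_le ha0 hS⟩

theorem X_pow_mul_mem_convergentAt {u : ℂ} (hu : u ≠ 0) {n : ℕ} {f : PowerSeries ℂ} :
    PowerSeries.X ^ n * f ∈ convergentAt u ↔ f ∈ convergentAt u := by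
  refine ⟨fun h => ?_, fun h => mul_mem (pow_mem (X_mem_convergentAt u) n) h⟩
  have h1 := (summable_nat_add_iff n).2 (mem_convergentAt.1 h)
  refine mem_convergentAt.2 ((h1.mul_left ‖u ^ n‖⁻¹).congr fun k => ?_)
  have : ‖u ^ n‖ ≠ 0 := by simp [hu]
  rw [add_comm k n, PowerSeries.coeff_X_pow_mul', if_pos (by omega), Nat.add_sub_cancel_left,
    pow_add, mul_left_comm, norm_mul, inv_mul_cancel_left₀ this]

theorem evalAt_X (u : ℂ) (h : (PowerSeries.X : PowerSeries ℂ) ∈ convergentAt u) :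
    evalAt u ⟨PowerSeries.X, h⟩ = u := by
  rw [evalAt_apply, tsum_eq_single 1]
  · simp
  · intro n hn
    rw [PowerSeries.coeff_X, if_neg hn, zero_mul]

end convergence

/-- `v` is the value at `x = 1 / u` of the Laurent series `f`, which converges there. -/
def HasValue (u : ℂ) (f : LaurentInf) (v : ℂ) : Prop :=
  ∃ (N : ℕ) (h : convergentAt u), f = var ^ N * ofPowerSeries h ∧ v = (u⁻¹) ^ N * evalAt u h

namespace HasValue

variable {u : ℂ}

/-- Raising the order of the pole in the representation of a Laurent series. -/
theorem raise (hu : u ≠ 0) (h : convergentAt u) (N k : ℕ) : ∃ h' : convergentAt u,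
    (h' : PowerSeries ℂ) = PowerSeries.X ^ k * (h : PowerSeries ℂ) ∧
    LaurentInf.var ^ N * LaurentInf.ofPowerSeries h =
      LaurentInf.var ^ (N + k) * LaurentInf.ofPowerSeries h' ∧
    (u⁻¹) ^ N * evalAt u h = (u⁻¹) ^ (N + k) * evalAt u h' := by
  refine ⟨⟨PowerSeries.X, X_mem_convergentAt u⟩ ^ k * h, by simp, ?_, ?_⟩
  · rw [MulMemClass.coe_mul, SubmonoidClass.coe_pow, pow_add, mul_assoc, var_pow_mul_ofPowerSeries]
  · rw [map_mul, map_pow, evalAt_X, pow_add, mul_assoc, inv_pow u k,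
      inv_mul_cancel_left₀ (pow_ne_zero k hu)]

theorem add (hu : u ≠ 0) {f g : LaurentInf} {v w : ℂ} (hf : HasValue u f v) (hg : HasValue u g w) :
    HasValue u (f + g) (v + w) := by
  obtain ⟨N, h, rfl, rfl⟩ := hf
  obtain ⟨M, k, rfl, rfl⟩ := hg
  obtain ⟨h', _, h1, h2⟩ := raise hu h N M
  obtain ⟨k', _, k1, k2⟩ := raise hu k M N
  refine ⟨N + M, h' + k', ?_, ?_⟩
  · rw [h1, k1, add_comm M N, AddMemClass.coe_add, map_add, mul_add]
  · rw [h2, k2, add_comm M N, map_add, mul_add]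

theorem mul {f g : LaurentInf} {v w : ℂ} (hf : HasValue u f v) (hg : HasValue u g w) :
    HasValue u (f * g) (v * w) := by
  obtain ⟨N, h, rfl, rfl⟩ := hf
  obtain ⟨M, k, rfl, rfl⟩ := hg
  refine ⟨N + M, h * k, ?_, ?_⟩
  · rw [MulMemClass.coe_mul, map_mul, pow_add]; ring
  · rw [map_mul, pow_add]; ring

theorem ofPowerSeries (h : convergentAt u) :
    HasValue u (LaurentInf.ofPowerSeries h) (evalAt u h) :=
  ⟨0, h, by simp, by simp⟩

theorem const (a : ℂ) : HasValue u (algebraMap ℂ LaurentInf a) a :=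
  ⟨0, algebraMap ℂ _ a, by
    rw [pow_zero, one_mul, ← ofPowerSeries_C]; rfl, by
    rw [pow_zero, one_mul, AlgHom.commutes]; rfl⟩

theorem var : HasValue u LaurentInf.var u⁻¹ := ⟨1, 1, by simp, by simp⟩

theorem pow {f : LaurentInf} {v : ℂ} (hf : HasValue u f v) (n : ℕ) :
    HasValue u (f ^ n) (v ^ n) := by
  induction n with
  | zero => simpa using const (u := u) 1
  | succ n ih => rw [pow_succ, pow_succ]; exact ih.mul hf

theorem aeval_var (hu : u ≠ 0) (P : Polynomial ℂ) :
    HasValue u (Polynomial.aeval LaurentInf.var P) (P.eval u⁻¹) := by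
  induction P using Polynomial.induction_on' with
  | add P Q hP hQ => rw [map_add, Polynomial.eval_add]; exact hP.add hu hQ
  | monomial n a =>
    rw [Polynomial.aeval_monomial, Polynomial.eval_monomial]
    exact (const a).mul (var.pow n)

theorem exists_eq_var_pow (f : LaurentInf) :
    ∃ (N : ℕ) (h : PowerSeries ℂ), f = LaurentInf.var ^ N * LaurentInf.ofPowerSeries h := by
  obtain ⟨P, hP⟩ := exists_aeval_eq' (sub_ofTail_mem_polys f)
  have key : ∀ P : Polynomial ℂ, ∃ (N : ℕ) (h : PowerSeries ℂ), Polynomial.aeval LaurentInf.var P =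
      LaurentInf.var ^ N * LaurentInf.ofPowerSeries h := by
    intro P
    obtain ⟨N, h, hh, -⟩ := aeval_var (u := 1) one_ne_zero P
    exact ⟨N, h, hh⟩
  obtain ⟨N, h, hh⟩ := key P
  refine ⟨N, h + PowerSeries.X ^ N * (PowerSeries.X * PowerSeries.mk (tail f)), ?_⟩
  rw [map_add, mul_add, ← hh, var_pow_mul_ofPowerSeries, ← ofTail_apply, hP, sub_add_cancel]

theorem var_ne_zero : LaurentInf.var ≠ 0 := by
  intro h
  have h1 := var_mul_ofPowerSeries_X_mul 1
  rw [h, zero_mul, map_one] at h1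
  exact zero_ne_one h1

theorem ofPowerSeries_injective : Function.Injective LaurentInf.ofPowerSeries := by
  intro f g h
  refine PowerSeries.ext fun n => ?_
  rw [← coeff_ofPowerSeries, ← coeff_ofPowerSeries, h]

/-- A power series with a value at `1 / u` converges there. -/
theorem of_ofPowerSeries (hu : u ≠ 0) {h : PowerSeries ℂ} {v : ℂ} {N : ℕ}
    (hv : HasValue u (LaurentInf.var ^ N * LaurentInf.ofPowerSeries h) v) :
    ∃ hh : h ∈ convergentAt u, v = (u⁻¹) ^ N * evalAt u ⟨h, hh⟩ := by
  obtain ⟨M, k, h1, rfl⟩ := hv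
  obtain ⟨k', hk', k1, k2⟩ := raise hu k M N
  have h2 : PowerSeries.X ^ M * h = PowerSeries.X ^ N * (k : PowerSeries ℂ) := by
    refine ofPowerSeries_injective (mul_left_cancel₀ (pow_ne_zero (M + N) var_ne_zero) ?_)
    rw [← hk', ← k1, ← h1, add_comm, pow_add, mul_assoc, var_pow_mul_ofPowerSeries]
  have hh : h ∈ convergentAt u := by
    rw [← X_pow_mul_mem_convergentAt hu (n := M), h2]
    exact mul_mem (pow_mem (X_mem_convergentAt u) N) k.2
  refine ⟨hh, ?_⟩
  obtain ⟨h', hh', _, h4⟩ := raise hu ⟨h, hh⟩ N M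
  have : h' = k' := Subtype.ext (by rw [hh', hk', h2])
  rw [k2, h4, this, add_comm]

end HasValue

end QuarticTensor

namespace QuarticTensor

/-! ### Uniformization of the hyperelliptic curve -/

open Egf LaurentInf

variable {α : Fin 6 → ℂ} {F : Egf (Fin 6 × ℕ) (PowerSeries ℂ)}

theorem root_sq (α : Fin 6 → ℂ) (i : Fin 6) : root α i ^ 2 = 1 - α i ^ 2 := by
  rw [root, ← Complex.cpow_nat_mul]
  norm_num

theorem root_ne_zero {i : Fin 6} (hi : α i ^ 2 ≠ 1) : root α i ≠ 0 := by
  intro h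
  have := root_sq α i
  rw [h, zero_pow two_ne_zero] at this
  exact hi (sub_eq_zero.1 this.symm).symm

/-- The square root `y` of `Δ` in the Joukowsky coordinate. -/
def branchFun (α : Fin 6 → ℂ) (i : Fin 6) (z : ℂ) : ℂ := -(root α i * (z - z⁻¹))

theorem two_lt_norm_add_inv {z : ℂ} (hz : 3 < ‖z‖) : 2 < ‖z + z⁻¹‖ := by
  have h1 : ‖z⁻¹‖ < 1 := by
    rw [norm_inv]
    exact inv_lt_one_of_one_lt₀ (by linarith)
  have h2 := norm_sub_norm_le z (-z⁻¹)
  rw [norm_neg, sub_neg_eq_add] at h2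
  linarith

theorem ne_zero_of_three_lt {z : ℂ} (hz : 3 < ‖z‖) : z ≠ 0 := by
  rintro rfl; simp at hz; linarith

theorem x_ne_zero {i : Fin 6} (hi : α i ^ 2 ≠ 1) {z : ℂ} (hz : 3 < ‖z‖) : x α (i, z) ≠ 0 := by
  have h := two_lt_norm_add_inv hz
  exact div_ne_zero (fun h0 => by rw [h0, norm_zero] at h; linarith) (root_ne_zero hi)

/-- Near infinity, the branch of the square root is the one with `y ∼ -z`. -/
theorem IsSolution.hasValue_branch (hF : IsSolution α F) (hα : ∑ c, α c ^ 2 ≠ 1) {i : Fin 6}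
    (hi : α i ^ 2 ≠ 1) {z : ℂ} (hz : 3 < ‖z‖) :
    HasValue (x α (i, z))⁻¹ (branch α F i) (branchFun α i z) := by
  have hZ := two_lt_norm_add_inv hz
  have hz0 := ne_zero_of_three_lt hz
  have hρ := root_ne_zero hi
  have hρ2 := root_sq α i
  have hZ0 : z + z⁻¹ ≠ 0 := fun h => by rw [h, norm_zero] at hZ; linarith
  have hz2 : z ^ 2 + 1 ≠ 0 := fun h => hZ0 (by field_simp; rw [h, mul_zero])
  set u := (x α (i, z))⁻¹ with hu
  have hu' : u = root α i / (z + z⁻¹) := by rw [hu, x, inv_div]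
  have hnu : 4 * ‖u‖ ^ 2 ≤ ‖1 - α i ^ 2‖ := by
    rw [hu', ← hρ2, norm_div, norm_pow, div_pow, mul_div_assoc', div_le_iff₀ (by positivity),
      mul_comm]
    gcongr
    nlinarith
  have hρ0 : 1 - α i ^ 2 ≠ 0 := hρ2 ▸ pow_ne_zero 2 hρ
  obtain ⟨hv, hv2⟩ := mem_convergentAt_of_quadratic (hF.onePoint_eq hα i) hρ0 hnu
  set X' : convergentAt u := ⟨PowerSeries.X, X_mem_convergentAt u⟩ with hX'
  set v : convergentAt u := ⟨onePoint F i, hv⟩ with hvdef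
  set V := evalAt u v with hV
  have hVn : ‖V‖ ≤ 2 := by
    rw [hV, evalAt_apply]
    exact (norm_tsum_le_tsum_norm hv).trans hv2
  have hq : u ^ 2 * V ^ 2 = (1 - α i ^ 2) * (V - 1) := by
    have h1 : X' ^ 2 * v ^ 2 = algebraMap ℂ _ (1 - α i ^ 2) * (v - 1) :=
      Subtype.ext (hF.onePoint_eq hα i)
    have h2 := congrArg (evalAt u) h1
    rw [map_mul, map_mul, map_pow, map_pow, (evalAt u).commutes (1 - α i ^ 2),
      map_sub (evalAt u) v, map_one, evalAt_X] at h2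
    exact h2
  -- of the two solutions of the quadratic equation, the bound `‖V‖ ≤ 2` excludes `1 + z ^ 2`
  have hV1 : V = 1 + (z⁻¹) ^ 2 := by
    rw [hu', ← hρ2] at hq
    have h1 : (V - 1 - (z⁻¹) ^ 2) * (V - 1 - z ^ 2) = 0 := by
      field_simp at hq ⊢
      linear_combination hq
    rcases mul_eq_zero.1 h1 with h | h
    · linear_combination h
    · exfalso
      have h2 : z ^ 2 = V - 1 := by linear_combination -h
      have h3 := congrArg norm h2
      rw [norm_pow] at h3
      have h4 := norm_sub_le V 1
      rw [norm_one] at h4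
      nlinarith
  have h1 : HasValue u (ofPowerSeries (PowerSeries.X * onePoint F i)) (u * V) := by
    have := HasValue.ofPowerSeries (X' * v)
    rwa [map_mul, evalAt_X] at this
  have hu0 : u ≠ 0 := inv_ne_zero (x_ne_zero hi hz)
  have h2 := ((HasValue.const 2).mul h1).add hu0 ((HasValue.const (-(1 - α i ^ 2))).mul
      HasValue.var)
  rw [branch_eq]
  convert h2 using 1
  · rw [map_neg, map_ofNat, neg_mul, sub_eq_add_neg]
  · rw [hV1, branchFun, hu', ← hρ2]
    field_simp
    ring

/-- Division by the discriminant preserves convergence at points closer to zero than its roots, by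
two geometric series. -/
theorem mem_convergentAt_of_discriminant_mul {u ρ : ℂ} (hρ : ρ ≠ 0) (hu : ‖2 / ρ * u‖ < 1)
    {f : PowerSeries ℂ} (hf : (PowerSeries.C ((ρ ^ 2) ^ 2) -
      PowerSeries.X ^ 2 * PowerSeries.C (4 * ρ ^ 2)) * f ∈ convergentAt u) :
    f ∈ convergentAt u := by
  have hu' : ‖-(2 / ρ) * u‖ < 1 := by rwa [neg_mul, norm_neg]
  refine mem_convergentAt_of_one_sub_mul hu (mem_convergentAt_of_one_sub_mul hu' ?_)
  have := (convergentAt u).smul_mem hf ((ρ ^ 2) ^ 2)⁻¹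
  convert this using 1
  rw [PowerSeries.smul_eq_C_mul, ← mul_assoc, ← mul_assoc]
  congr 1
  have h1 : PowerSeries.C ((ρ ^ 2) ^ 2)⁻¹ * PowerSeries.C ((ρ ^ 2) ^ 2) = 1 := by
    rw [← map_mul, inv_mul_cancel₀ (pow_ne_zero 2 (pow_ne_zero 2 hρ)), map_one]
  have h2 : PowerSeries.C ((ρ ^ 2) ^ 2)⁻¹ * PowerSeries.C (4 * ρ ^ 2) =
      PowerSeries.C (2 / ρ) * PowerSeries.C (2 / ρ) := by
    rw [← map_mul, ← map_mul]
    congr 1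
    field_simp
    norm_num
  rw [map_neg]
  linear_combination PowerSeries.X ^ 2 * h2 - h1

theorem hasValue_unique {u : ℂ} (hu : u ≠ 0) {f : LaurentInf} {v w : ℂ} (hv : HasValue u f v)
    (hw : HasValue u f w) : v = w := by
  obtain ⟨N, h, rfl⟩ := HasValue.exists_eq_var_pow f
  obtain ⟨_, h1⟩ := HasValue.of_ofPowerSeries hu hv
  obtain ⟨_, h2⟩ := HasValue.of_ofPowerSeries hu hw
  rw [h1, h2]

/-- The elements of `oddSpace` converge near infinity. -/
theorem IsSolution.hasValue_of_mem_oddSpace (hF : IsSolution α F) (hα : ∑ c, α c ^ 2 ≠ 1)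
    {i : Fin 6} (hi : α i ^ 2 ≠ 1) {m : ℕ} {f : LaurentInf} {P : Polynomial ℂ}
    (hP : Polynomial.aeval var P = (branch α F i ^ 2) ^ m * branch α F i * f) {z : ℂ}
    (hz : 3 < ‖z‖) :
    HasValue (x α (i, z))⁻¹ f (P.eval (x α (i, z)) / branchFun α i z ^ (2 * m + 1)) := by
  have hx0 := x_ne_zero hi hz
  have hu0 := inv_ne_zero hx0
  have hρ := root_ne_zero hi
  have hz0 := ne_zero_of_three_lt hz
  have hZ := two_lt_norm_add_inv hz
  have hρ2 := root_sq α i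
  set u := (x α (i, z))⁻¹ with hu
  have hy := hF.hasValue_branch hα hi hz
  have hY0 : branchFun α i z ≠ 0 := by
    refine neg_ne_zero.2 (mul_ne_zero hρ fun h => ?_)
    have h1 : z = z⁻¹ := sub_eq_zero.1 h
    have h2 : ‖z⁻¹‖ < 1 := by
      rw [norm_inv]; exact inv_lt_one_of_one_lt₀ (by linarith)
    rw [← h1] at h2
    linarith
  set y := branch α F i with hydef
  have hval : HasValue u ((y ^ 2) ^ (m + 1) * f) (P.eval (x α (i, z)) * branchFun α i z) := by
    have := (HasValue.aeval_var hu0 P).mul hy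
    rw [hP, hu, inv_inv] at this
    convert this using 1
    rw [pow_succ]; ring
  obtain ⟨v, hv⟩ : ∃ v, HasValue u f v := by
    obtain ⟨N, h, rfl⟩ := HasValue.exists_eq_var_pow f
    have hy2 : y ^ 2 = var ^ 2 * ofPowerSeries (PowerSeries.C ((root α i ^ 2) ^ 2) -
        PowerSeries.X ^ 2 * PowerSeries.C (4 * root α i ^ 2)) := by
      rw [hydef, branch, mul_pow, ← map_pow, hF.branchSeries_sq hα, hρ2, map_pow, map_mul,
        show (PowerSeries.C 4 : PowerSeries ℂ) = 4 from map_ofNat _ 4]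
      congr 2
      ring
    rw [hy2, mul_pow, ← pow_mul, ← map_pow, mul_mul_mul_comm, ← pow_add, ← map_mul] at hval
    obtain ⟨h1, -⟩ := HasValue.of_ofPowerSeries hu0 hval
    have hnu : ‖2 / root α i * u‖ < 1 := by
      have : 2 / root α i * u = 2 / (z + z⁻¹) := by
        rw [hu, x, inv_div]
        field_simp
      rw [this, norm_div, Complex.norm_ofNat, div_lt_one (by linarith)]
      exact hZ
    have h2 : ∀ k, (PowerSeries.C ((root α i ^ 2) ^ 2) -
        PowerSeries.X ^ 2 * PowerSeries.C (4 * root α i ^ 2)) ^ k * h ∈ convergentAt u →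
        h ∈ convergentAt u := by
      intro k
      induction k with
      | zero => rw [pow_zero, one_mul]; exact id
      | succ k ih =>
        intro h3
        rw [pow_succ', mul_assoc] at h3
        exact ih (mem_convergentAt_of_discriminant_mul hρ hnu h3)
    exact ⟨_, N, ⟨h, h2 _ h1⟩, rfl, rfl⟩
  have h3 := hasValue_unique hu0 hval (((hy.pow 2).pow (m + 1)).mul hv)
  have h4 : v = P.eval (x α (i, z)) / branchFun α i z ^ (2 * m + 1) := by
    rw [eq_div_iff (pow_ne_zero _ hY0)]
    refine mul_right_cancel₀ hY0 ?_
    rw [h3]; ring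
  rwa [← h4]

theorem inv_mem_regular {z : ℂ} (hz : z ∈ regular) : z⁻¹ ∈ regular := by
  obtain ⟨h0, h1, h2⟩ := hz
  refine ⟨inv_ne_zero h0, fun h => h1 (inv_eq_one.1 h), fun h => h2 ?_⟩
  rw [← inv_inv z, h]; norm_num

theorem x_inv (i : Fin 6) (z : ℂ) : x α (i, z⁻¹) = x α (i, z) := by
  rw [x, x, inv_inv, add_comm]

theorem analyticOnNhd_x (α : Fin 6 → ℂ) (i : Fin 6) :
    AnalyticOnNhd ℂ (fun z => x α (i, z)) {0}ᶜ := by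
  intro z hz
  have h : AnalyticAt ℂ (fun z : ℂ => (z + z⁻¹) * (root α i)⁻¹) z :=
    (analyticAt_id.add (analyticAt_id.inv hz)).mul analyticAt_const
  simpa only [x, div_eq_mul_inv] using h

theorem analyticOnNhd_dx (α : Fin 6 → ℂ) (i : Fin 6) :
    AnalyticOnNhd ℂ (fun z => dx α (i, z)) {0}ᶜ := by
  intro z hz
  have h : AnalyticAt ℂ (fun z : ℂ => (1 - (z ^ 2)⁻¹) * (root α i)⁻¹) z :=
    (analyticAt_const.sub ((analyticAt_id.pow 2).inv (pow_ne_zero 2 hz))).mul analyticAt_const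
  simpa only [dx, div_eq_mul_inv] using h

theorem regular_subset : regular ⊆ {0}ᶜ := fun _ h => h.1

/-- The elements of `oddSpace` are the expansions near infinity of functions on the spectral curve
that change sign under `z ↦ 1 / z`. -/
theorem IsSolution.exists_odd_function (hF : IsSolution α F) (hα : ∑ c, α c ^ 2 ≠ 1)
    {i : Fin 6} (hi : α i ^ 2 ≠ 1) {m : ℕ} {f : LaurentInf}
    (hf : f ∈ oddSpace (branch α F i) m) :
    ∃ (E : ℂ → ℂ) (Q : Polynomial ℂ), AnalyticOnNhd ℂ E regular ∧ (∀ z, E z⁻¹ = -E z) ∧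
      f = ofTail (tail f) + Polynomial.aeval var Q ∧
      ∀ z, 3 < ‖z‖ → HasSum (fun p => tail f p * (x α (i, z) ^ (p + 1))⁻¹)
        (E z - Q.eval (x α (i, z))) := by
  obtain ⟨P, hP⟩ := exists_aeval_eq' (mem_oddSpace.1 hf)
  obtain ⟨Q, hQ⟩ := exists_aeval_eq' (sub_ofTail_mem_polys f)
  refine ⟨fun z => P.eval (x α (i, z)) / branchFun α i z ^ (2 * m + 1), Q, ?_, ?_, ?_, ?_⟩
  · intro z hz
    have h1 : AnalyticAt ℂ (fun z => branchFun α i z) z :=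
      (analyticAt_const.mul (analyticAt_id.sub (analyticAt_id.inv hz.1))).neg
    have h2 : AnalyticAt ℂ (fun z => P.eval (x α (i, z))) z :=
      (AnalyticOnNhd.eval_polynomial (𝕜 := ℂ) P _ (Set.mem_univ _)).comp
        (analyticOnNhd_x α i z hz.1)
    refine h2.div (h1.pow _) (pow_ne_zero _ (neg_ne_zero.2 (mul_ne_zero (root_ne_zero hi) ?_)))
    intro h
    have h3 : z ^ 2 = 1 := by
      have h4 : z = z⁻¹ := sub_eq_zero.1 h
      rw [pow_two]
      nth_rewrite 2 [h4]
      exact mul_inv_cancel₀ hz.1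
    rcases mul_eq_zero.1 (show (z - 1) * (z + 1) = 0 by linear_combination h3) with h | h
    · exact hz.2.1 (sub_eq_zero.1 h)
    · exact hz.2.2 (eq_neg_of_add_eq_zero_left h)
  · intro z
    have h1 : branchFun α i z⁻¹ = -branchFun α i z := by
      rw [branchFun, branchFun, inv_inv]; ring
    dsimp only
    rw [x_inv, h1, Odd.neg_pow ⟨m, rfl⟩, div_neg]
  · rw [hQ]; ring
  · intro z hz
    have hu0 := inv_ne_zero (x_ne_zero hi hz)
    have h1 := (hF.hasValue_of_mem_oddSpace hα hi hP hz).add hu0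
      ((HasValue.const (-1)).mul (HasValue.aeval_var hu0 Q))
    have h2 : f + algebraMap ℂ LaurentInf (-1) * Polynomial.aeval var Q =
        var ^ 0 * ofPowerSeries (PowerSeries.X * PowerSeries.mk (tail f)) := by
      rw [← ofTail_apply, hQ, map_neg, map_one]; ring
    rw [h2, inv_inv] at h1
    obtain ⟨h3, h4⟩ := HasValue.of_ofPowerSeries hu0 h1
    have h5 := (hasSum_nat_add_iff' 1).2 (hasSum_evalAt ⟨_, h3⟩)
    rw [pow_zero, one_mul] at h4
    simp only [Finset.sum_range_one, PowerSeries.coeff_succ_X_mul, PowerSeries.coeff_mk,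
      PowerSeries.coeff_zero_X_mul, zero_mul, sub_zero, inv_pow, ← h4] at h5
    rw [neg_one_mul, ← sub_eq_add_neg] at h5
    exact h5

end QuarticTensor

namespace QuarticTensor

/-! ### Functions of several variables -/

theorem hasSum_prod_pi_fin {n : ℕ} {X : Fin n → Type} {f : ∀ i, X i → ℂ} {a : Fin n → ℂ}
    (h : ∀ i, HasSum (f i) (a i)) : HasSum (fun x : ∀ i, X i => ∏ i, f i (x i)) (∏ i, a i) := by
  induction n with
  | zero => simp
  | succ n ih =>
    have h1 := ih (X := fun i => X i.succ) (f := fun i => f i.succ) fun i => h i.succ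
    have h2 : Summable fun x : X 0 × (∀ i : Fin n, X i.succ) =>
        f 0 x.1 * ∏ i : Fin n, f i.succ (x.2 i) := by
      apply summable_mul_of_summable_norm (h 0).summable.norm h1.summable.norm
    rw [Fin.prod_univ_succ, ← (Fin.consEquiv X).hasSum_iff]
    refine ((h 0).mul h1 h2).congr_fun fun x => ?_
    rw [Function.comp_apply, Fin.prod_univ_succ]
    rfl

/-- Products of absolutely convergent series in independent indices. -/
theorem hasSum_prod_pi {ι : Type} [Fintype ι] {X : ι → Type} {f : ∀ i, X i → ℂ} {a : ι → ℂ}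
    (h : ∀ i, HasSum (f i) (a i)) : HasSum (fun x : ∀ i, X i => ∏ i, f i (x i)) (∏ i, a i) := by
  let e := (Fintype.equivFin ι).symm
  have h1 := hasSum_prod_pi_fin fun i => h (e i)
  rw [Equiv.prod_comp e a] at h1
  rw [← (Equiv.piCongrLeft X e).hasSum_iff]
  refine h1.congr_fun fun x => ?_
  rw [Function.comp_apply, ← Equiv.prod_comp e]
  exact Finset.prod_congr rfl fun i _ => by rw [Equiv.piCongrLeft_apply_apply]

theorem eq_sum_prod_pi_fin {k : ℕ} (n : Fin k → ℕ) (ε : Fin k → ℕ → ℕ → ℂ) (G : (Fin k → ℕ) → ℂ)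
    (h : ∀ p j, G p = ∑ r : Fin (n j), ε j r (p j) * G (Function.update p j r)) (p : Fin k → ℕ) :
    G p = ∑ r : ∀ j, Fin (n j), (∏ j, ε j (r j) (p j)) * G fun j => r j := by
  induction k with
  | zero =>
    rw [Fintype.sum_unique]
    simp only [Finset.univ_eq_empty, Finset.prod_empty, one_mul]
    exact congrArg G (funext fun i => i.elim0)
  | succ k ih =>
    rw [h p 0, ← (Fin.consEquiv fun i => Fin (n i)).sum_comp, Fintype.sum_prod_type]
    refine Finset.sum_congr rfl fun r₀ _ => ?_
    have h1 := ih (fun i => n i.succ) (fun i => ε i.succ)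
      (fun q => G (Fin.cons (α := fun _ => ℕ) (r₀ : ℕ) q))
      (fun q j => by
        rw [h _ j.succ]
        simp only [Fin.cons_succ, Fin.cons_update]) (Fin.tail p)
    have h2 : Function.update p 0 (r₀ : ℕ) = Fin.cons (α := fun _ => ℕ) (r₀ : ℕ) (Fin.tail p) := by
      conv_lhs => rw [← Fin.cons_self_tail p, Fin.update_cons_zero]
    rw [h2, h1, Finset.mul_sum]
    refine Finset.sum_congr rfl fun r _ => ?_
    rw [Fin.prod_univ_succ, mul_assoc]
    refine congrArg₂ (· * ·) rfl (congrArg₂ (· * ·) rfl (congrArg G (funext fun o => ?_)))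
    cases o using Fin.cases <;> rfl

/-- A function of several indices that depends linearly, in each index, on finitely many of its
values is a finite sum of products of functions of one index. -/
theorem eq_sum_prod_pi {ι : Type} [Fintype ι] [DecidableEq ι] (n : ι → ℕ) (ε : ι → ℕ → ℕ → ℂ)
    (G : (ι → ℕ) → ℂ)
    (h : ∀ p j, G p = ∑ r : Fin (n j), ε j r (p j) * G (Function.update p j r)) (p : ι → ℕ) :
    G p = ∑ r : ∀ j, Fin (n j), (∏ j, ε j (r j) (p j)) * G fun j => r j := by
  let e := (Fintype.equivFin ι).symm
  have h1 := eq_sum_prod_pi_fin (fun i => n (e i)) (fun i => ε (e i)) (fun q => G (q ∘ e.symm))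
    (fun q j => by
      rw [h _ (e j)]
      refine Finset.sum_congr rfl fun r _ => ?_
      rw [Function.comp_apply, e.symm_apply_apply, Function.update_comp_equiv, e.symm_symm]) (p ∘ e)
  have h2 : (p ∘ e) ∘ e.symm = p := by funext i; simp
  rw [h2] at h1
  rw [h1, ← (Equiv.piCongrLeft (fun i => Fin (n i)) e).sum_comp]
  refine Finset.sum_congr rfl fun r _ => ?_
  rw [← Equiv.prod_comp e]
  refine congrArg₂ (· * ·) (Finset.prod_congr rfl fun i _ => ?_) (congrArg G ?_)
  · rw [Equiv.piCongrLeft_apply_apply]; rfl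
  · funext i
    obtain ⟨i, rfl⟩ := e.surjective i
    rw [Equiv.piCongrLeft_apply_apply, Function.comp_apply, e.symm_apply_apply]

section regular

/-- The points all of whose coordinates are regular. -/
def regularPi (ι : Type) : Set (ι → ℂ) := {z | ∀ j, z j ∈ regular}

theorem regularPi_eq (ι : Type) : regularPi ι = Set.univ.pi fun _ => regular := by
  ext z; simp [regularPi]

theorem isPreconnected_regularPi (ι : Type) : IsPreconnected (regularPi ι) := by
  rw [regularPi_eq]
  refine isPreconnected_univ_pi fun _ => ?_
  have h1 : regular = ({0, 1, -1} : Set ℂ)ᶜ := by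
    ext z; simp [regular]
  rw [h1]
  refine (Set.Countable.isConnected_compl_of_one_lt_rank ?_ (Set.Finite.countable (by simp))).2
  rw [Complex.rank_real_complex]
  norm_num

variable {ι : Type} [Fintype ι]

theorem mem_regular_of_lt {R : ℝ} {z : ℂ} (hz : max R 3 < ‖z‖) : z ∈ regular := by
  have h3 : 3 < ‖z‖ := (le_max_right _ _).trans_lt hz
  refine ⟨?_, ?_, ?_⟩ <;> (rintro rfl; norm_num at h3)

/-- Analytic functions on the regular part that agree near infinity are equal. -/
theorem eqOn_regularPi {f g : (ι → ℂ) → ℂ} (hf : AnalyticOnNhd ℂ f (regularPi ι))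
    (hg : AnalyticOnNhd ℂ g (regularPi ι)) {R : ℝ}
    (h : ∀ z : ι → ℂ, (∀ j, R < ‖z j‖) → f z = g z) : Set.EqOn f g (regularPi ι) := by
  set z₀ : ι → ℂ := fun _ => ((max R 3 + 1 : ℝ) : ℂ) with hz₀
  have hn : ∀ j, max R 3 < ‖z₀ j‖ := fun j => by
    have h3 := le_max_right R 3
    rw [hz₀, Complex.norm_real, Real.norm_eq_abs, abs_of_pos (by linarith)]
    linarith
  refine hf.eqOn_of_preconnected_of_eventuallyEq hg (isPreconnected_regularPi ι) (z₀ := z₀)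
    (fun j => mem_regular_of_lt (hn j)) ?_
  have hopen : IsOpen {z : ι → ℂ | ∀ j, max R 3 < ‖z j‖} := by
    rw [Set.ofPred_forall]
    exact isOpen_iInter_of_finite fun j => isOpen_lt continuous_const
      (continuous_apply j).norm
  filter_upwards [hopen.mem_nhds hn] with z hz
  exact h z fun j => (le_max_left _ _).trans_lt (hz j)

theorem analyticOnNhd_comp_apply {ϕ : ℂ → ℂ} (hϕ : AnalyticOnNhd ℂ ϕ regular) (j : ι) :
    AnalyticOnNhd ℂ (fun z : ι → ℂ => ϕ (z j)) (regularPi ι) := fun z hz =>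
  AnalyticAt.comp (f := fun z : ι → ℂ => z j) (hϕ _ (hz j))
    ((ContinuousLinearMap.proj j : (ι → ℂ) →L[ℂ] ℂ).analyticAt z)

end regular

section continuation

variable {α : Fin 6 → ℂ} {g : ℕ} {κ ι : Type} [Fintype κ] [DecidableEq κ] [Fintype ι]
  [DecidableEq ι] {b : κ → Fin 6} {a : κ → ℕ} {c : ι → Fin 6}

theorem IsContinuation.eqOn {f f' : (ι → ℂ) → ℂ} (h : IsContinuation α g b a c f)
    (h' : IsContinuation α g b a c f') : Set.EqOn f f' (regularPi ι) := by
  obtain ⟨R, hR⟩ := h.2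
  obtain ⟨R', hR'⟩ := h'.2
  exact eqOn_regularPi h.1 h'.1 (R := max R R') fun z hz =>
    (hR z fun j => (le_max_left _ _).trans_lt (hz j)).unique
      (hR' z fun j => (le_max_right _ _).trans_lt (hz j))

theorem isContinuation_mixed {f : (ι → ℂ) → ℂ} (h : IsContinuation α g b a c f) :
    IsContinuation α g b a c (mixed α g b a c) := by
  have h' : ∃ f, IsContinuation α g b a c f := ⟨f, h⟩
  rw [mixed, dif_pos h']
  exact h'.choose_spec

theorem mixed_eqOn {f : (ι → ℂ) → ℂ} (h : IsContinuation α g b a c f) :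
    Set.EqOn (mixed α g b a c) f (regularPi ι) := (isContinuation_mixed h).eqOn h

/-- The analytic continuation in several variables, from functions of one variable. -/
theorem isContinuation_sum_prod (n : ι → ℕ) (ε : ι → ℕ → ℕ → ℂ) (ϕ : ι → ℕ → ℂ → ℂ)
    (hϕ : ∀ j r, AnalyticOnNhd ℂ (ϕ j r) regular) {R : ℝ}
    (hsum : ∀ j r z, R < ‖z‖ → HasSum (fun p => ε j r p * ((x α (c j, z) ^ (p + 1))⁻¹ *
      dx α (c j, z))) (ϕ j r z))
    (h : ∀ p j, w α g (Sum.elim b c) (Sum.elim a p) = ∑ r : Fin (n j),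
      ε j r (p j) * w α g (Sum.elim b c) (Sum.elim a (Function.update p j r))) :
    IsContinuation α g b a c fun z => ∑ r : ∀ j, Fin (n j),
      (∏ j, ϕ j (r j) (z j)) * w α g (Sum.elim b c) (Sum.elim a fun j => r j) := by
  refine ⟨?_, R, fun z hz => ?_⟩
  · refine Finset.analyticOnNhd_fun_sum _ fun r _ => AnalyticOnNhd.mul ?_ analyticOnNhd_const
    exact Finset.analyticOnNhd_fun_prod _ fun j _ => analyticOnNhd_comp_apply (hϕ j (r j)) j
  · have h1 : ∀ r : ∀ j, Fin (n j), HasSum (fun p : ι → ℕ =>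
        (∏ j, ε j (r j) (p j) * ((x α (c j, z j) ^ (p j + 1))⁻¹ * dx α (c j, z j))) *
          w α g (Sum.elim b c) (Sum.elim a fun j => r j))
        ((∏ j, ϕ j (r j) (z j)) * w α g (Sum.elim b c) (Sum.elim a fun j => r j)) := fun r =>
      (hasSum_prod_pi fun j => hsum j (r j) (z j) (hz j)).mul_right _
    refine (hasSum_sum fun r (_ : r ∈ univ) => h1 r).congr_fun ?_
    intro p
    rw [eq_sum_prod_pi n ε (fun p => w α g (Sum.elim b c) (Sum.elim a p)) h p, Finset.sum_mul]
    refine Finset.sum_congr rfl fun r _ => ?_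
    simp only [Finset.prod_mul_distrib]
    ring

end continuation

end QuarticTensor

namespace QuarticTensor

/-! ### Analytic continuation of the correlations -/

open Egf LaurentInf

section basis

variable {α : Fin 6 → ℂ} {F : Egf (Fin 6 × ℕ) (PowerSeries ℂ)}

/-- The correlations of given genus of a resolvent of the color `i` and of a bounded number of
traces are linear combinations of finitely many one-forms `ϕ r` on the spectral curve. The
symmetrization of these one-forms gives the coefficients of the effective potential. -/
theorem IsSolution.exists_forms (hF : IsSolution α F) (hα : ∑ c, α c ^ 2 ≠ 1) {i : Fin 6}
    (hi : α i ^ 2 ≠ 1) (g N : ℕ) :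
    ∃ (n : ℕ) (ε : ℕ → ℕ → ℂ) (ϕ : ℕ → ℂ → ℂ) (Q : ℕ → Polynomial ℂ),
      (∀ r, AnalyticOnNhd ℂ (ϕ r) regular) ∧
      (∀ r z, 3 < ‖z‖ → HasSum (fun p => ε r p * ((x α (i, z) ^ (p + 1))⁻¹ * dx α (i, z)))
        (ϕ r z)) ∧
      (∀ r z, z ≠ 0 → ϕ r z - (z ^ 2)⁻¹ * ϕ r z⁻¹ =
        -(2 * (Q r).eval (x α (i, z)) * dx α (i, z))) ∧
      ∀ s, s.card ≤ N → ¬ (g = 0 ∧ ∃ q, s = {(i, q)}) → ¬ (g = 0 ∧ s = 0) →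
        (∀ p, PowerSeries.coeff g (F ((i, p) ::ₘ s)) =
          ∑ r : Fin n, ε r p * PowerSeries.coeff g (F ((i, (r : ℕ)) ::ₘ s))) ∧
        ∀ ξ : ℂ, ∑ t ∈ vertices (g + 1), PowerSeries.coeff g (vertexCorr α F i t s) * ξ ^ t.2 i =
          2 * ∑ r : Fin n, (Q r).eval ξ * PowerSeries.coeff g (F ((i, (r : ℕ)) ::ₘ s)) := by
  obtain ⟨m, n, e, he, h⟩ := hF.exists_decomposition hα i hi g N
  choose E Q hE hodd hQ hsum using fun r => hF.exists_odd_function hα hi (he r)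
  -- `e r` is the sum of its tail, the expansion of the one-form `ϕ r` divided by `dx`, and of a
  -- polynomial `Q r`; the function `E r` represents `e r` and is odd, so that `ϕ r` symmetrizes to
  -- `-2 (Q r) dx`
  refine ⟨n, fun r => tail (e r), fun r z => (E r z - (Q r).eval (x α (i, z))) * dx α (i, z), Q,
    fun r => ?_, fun r z hz => ?_, fun r z hz => ?_, fun s hs h1 h2 => ?_⟩
  · exact ((hE r).sub ((AnalyticOnNhd.eval_polynomial (𝕜 := ℂ) (Q r)).comp
      ((analyticOnNhd_x α i).mono regular_subset) fun _ _ => Set.mem_univ _)).mul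
      ((analyticOnNhd_dx α i).mono regular_subset)
  · refine ((hsum r z hz).mul_right (dx α (i, z))).congr_fun fun p => ?_
    ring
  · have h3 : dx α (i, z⁻¹) = -(z ^ 2 * dx α (i, z)) := by
      simp only [dx]
      field_simp
      ring
    dsimp only
    rw [x_inv, hodd, h3]
    have : (z ^ 2)⁻¹ * z ^ 2 = 1 := inv_mul_cancel₀ (pow_ne_zero 2 hz)
    linear_combination (-(E r z + (Q r).eval (x α (i, z))) * dx α (i, z)) * this
  · have h3 := h s hs h1 h2
    have hpot : PowerSeries.coeff g (potential α F i (g + 1) s) ∈ polys :=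
      mem_polySubring.1 (potential_mem_polySubring α F i _) g s
    have h4 : ∀ p, PowerSeries.coeff g (F ((i, p) ::ₘ s)) =
        ∑ r ∈ range n, PowerSeries.coeff g (F ((i, r) ::ₘ s)) * tail (e r) p := by
      intro p
      have := congrFun (congrArg tail h3) p
      rw [map_add, map_smul, mem_polys_iff.1 hpot, smul_zero, add_zero, tail_ofTail, map_sum,
        Finset.sum_apply] at this
      simpa only [map_smul, Pi.smul_apply, smul_eq_mul] using this
    refine ⟨fun p => ?_, fun ξ => ?_⟩
    · rw [h4, Finset.sum_range]
      exact Finset.sum_congr rfl fun r _ => mul_comm _ _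
    · have h5 : ofTail (fun p => PowerSeries.coeff g (F ((i, p) ::ₘ s))) =
          ∑ r ∈ range n, PowerSeries.coeff g (F ((i, r) ::ₘ s)) • ofTail (tail (e r)) := by
        simp only [← map_smul, ← map_sum]
        congr 1
        funext p
        simp only [map_sum, map_smul, Finset.sum_apply, Pi.smul_apply, smul_eq_mul]
        exact h4 p
      -- comparison of the polynomial parts in the decomposition of the resolvent
      have h6 : (1 / 2 : ℂ) • PowerSeries.coeff g (potential α F i (g + 1) s) =
          ∑ r ∈ range n, PowerSeries.coeff g (F ((i, r) ::ₘ s)) • Polynomial.aeval var (Q r) := by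
        have h7 : ∑ r ∈ range n, PowerSeries.coeff g (F ((i, r) ::ₘ s)) • e r =
            ∑ r ∈ range n, PowerSeries.coeff g (F ((i, r) ::ₘ s)) • ofTail (tail (e r)) +
            ∑ r ∈ range n, PowerSeries.coeff g (F ((i, r) ::ₘ s)) • Polynomial.aeval var (Q r) := by
          rw [← Finset.sum_add_distrib]
          exact Finset.sum_congr rfl fun r _ => by rw [← smul_add, ← hQ]
        rw [h5, h7] at h3
        exact add_left_cancel h3
      have h7 : (1 / 2 : ℂ) • ∑ t ∈ vertices (g + 1),
          PowerSeries.coeff g (vertexCorr α F i t s) • (Polynomial.X ^ t.2 i : Polynomial ℂ) =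
          ∑ r ∈ range n, PowerSeries.coeff g (F ((i, r) ::ₘ s)) • Q r := by
        refine aeval_var_injective ?_
        rw [coeff_potential] at h6
        simpa only [map_smul, map_sum, map_pow, Polynomial.aeval_X] using h6
      have h8 := congrArg (Polynomial.eval ξ) h7
      simp only [Polynomial.eval_smul, Polynomial.eval_finsetSum, Polynomial.eval_pow,
        Polynomial.eval_X, smul_eq_mul] at h8
      rw [Finset.sum_range] at h8
      simp only [mul_comm ((Q _).eval ξ)]
      rw [← h8]
      ring

/-- The correlations of one resolvent and of arbitrary traces. -/
theorem IsSolution.exists_form (hF : IsSolution α F) (hα : ∑ c, α c ^ 2 ≠ 1) {i : Fin 6}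
    (hi : α i ^ 2 ≠ 1) (g : ℕ) (s : Multiset (Fin 6 × ℕ)) :
    ∃ ϕ : ℂ → ℂ, AnalyticOnNhd ℂ ϕ regular ∧ ∀ z, 3 < ‖z‖ →
      HasSum (fun p => PowerSeries.coeff g (F ((i, p) ::ₘ s)) *
        ((x α (i, z) ^ (p + 1))⁻¹ * dx α (i, z))) (ϕ z) := by
  obtain ⟨m, -, h⟩ := hF.exists_shiftedResolvent_mem hα i hi (g + 1) (2 * g + s.card)
  obtain ⟨E, Q, hE, -, -, hsum⟩ := hF.exists_odd_function hα hi (h g s (Nat.lt_succ_self g) le_rfl)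
  refine ⟨fun z => (1 / 2) * ((E z - Q.eval (x α (i, z))) * dx α (i, z)), ?_, fun z hz => ?_⟩
  · exact analyticOnNhd_const.mul ((hE.sub ((AnalyticOnNhd.eval_polynomial (𝕜 := ℂ) Q).comp
      ((analyticOnNhd_x α i).mono regular_subset) fun _ _ => Set.mem_univ _)).mul
      ((analyticOnNhd_dx α i).mono regular_subset))
  · refine (((hsum z hz).mul_right (dx α (i, z))).mul_left (1 / 2)).congr_fun fun p => ?_
    rw [tail_shiftedResolvent]
    ring

end basis

section labels

variable {κ ι : Type} [Fintype κ] [Fintype ι]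

/-- The labels of the traces `tr M_{c j} ^ {p j}`. -/
def labels (c : ι → Fin 6) (p : ι → ℕ) : Multiset (Fin 6 × ℕ) := univ.val.map fun j => (c j, p j)

theorem card_labels (c : ι → Fin 6) (p : ι → ℕ) : (labels c p).card = Fintype.card ι := by
  rw [labels, Multiset.card_map]; rfl

theorem labels_sum_elim (b : κ → Fin 6) (a : κ → ℕ) (c : ι → Fin 6) (p : ι → ℕ) :
    labels (Sum.elim b c) (Sum.elim a p) = labels b a + labels c p := by
  rw [labels, ← Finset.univ_disjSum_univ, Finset.val_disjSum, Multiset.disjSum, Multiset.map_add,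
    Multiset.map_map, Multiset.map_map]
  rfl

theorem labels_update [DecidableEq ι] (c : ι → Fin 6) (p : ι → ℕ) (j : ι) (r : ℕ) :
    labels c (Function.update p j r) =
      (c j, r) ::ₘ (univ.erase j).val.map fun k => (c k, p k) := by
  rw [labels, ← Finset.insert_erase (mem_univ j), Finset.insert_val_of_notMem
    (Finset.notMem_erase _ _), Multiset.map_cons, Function.update_self,
      Finset.insert_erase (mem_univ j)]
  refine congrArg _ (Multiset.map_congr rfl fun k hk => ?_)
  have hk' : k ∈ univ.erase j := hk
  rw [Function.update_of_ne (Finset.ne_of_mem_erase hk')]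

theorem labels_eq_cons [DecidableEq ι] (c : ι → Fin 6) (p : ι → ℕ) (j : ι) :
    labels c p = (c j, p j) ::ₘ (univ.erase j).val.map fun k => (c k, p k) := by
  conv_lhs => rw [← Function.update_eq_self j p, labels_update]

theorem labels_of_isEmpty [IsEmpty κ] (b : κ → Fin 6) (a : κ → ℕ) : labels b a = 0 := by
  rw [labels, Finset.univ_eq_empty]; rfl

/-- The correlations as coefficients of the free energy. -/
theorem w_eq_labels [DecidableEq κ] [DecidableEq ι] (α : Fin 6 → ℂ) (g : ℕ) [Nonempty (κ ⊕ ι)]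
    (b : κ → Fin 6)
    (a : κ → ℕ) (c : ι → Fin 6) (p : ι → ℕ) :
    w α g (Sum.elim b c) (Sum.elim a p) =
      PowerSeries.coeff g (energy α (labels b a + labels c p)) := by
  rw [w_eq, ← labels_sum_elim]
  rfl

end labels

section existence

variable {α : Fin 6 → ℂ}

theorem isSolution_energy (hα : ∀ c, ‖α c‖ < 1) (hα2 : ‖∑ c, α c ^ 2‖ < 1) :
    IsSolution α (energy α) :=
  ⟨D_zero_energy hα hα2, fun i p _ _ s hK => loopEq_energy hα hα2 i p hK s⟩

theorem sum_sq_ne_one (hα2 : ‖∑ c, α c ^ 2‖ < 1) : ∑ c, α c ^ 2 ≠ 1 := by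
  intro h
  rw [h, norm_one] at hα2
  exact lt_irrefl _ hα2

theorem sq_ne_one (hα : ∀ c, ‖α c‖ < 1) (i : Fin 6) : α i ^ 2 ≠ 1 := by
  intro h
  have h1 := congrArg norm h
  rw [norm_pow, norm_one] at h1
  have := pow_lt_one₀ (norm_nonneg _) (hα i) two_ne_zero
  linarith

variable {κ ι : Type} [Fintype κ] [DecidableEq κ] [Fintype ι] [DecidableEq ι]

/-- All correlations of resolvents and traces extend to the spectral curve, with the exception of
the genus zero correlation of two resolvents of the same color. -/
theorem exists_isContinuation (hα : ∀ c, ‖α c‖ < 1) (hα2 : ‖∑ c, α c ^ 2‖ < 1) (g : ℕ)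
    (b : κ → Fin 6) (a : κ → ℕ) (c : ι → Fin 6)
    (h : ¬ (g = 0 ∧ Fintype.card κ = 0 ∧ Fintype.card ι = 2 ∧ ∀ j k, c j = c k)) :
    ∃ f, IsContinuation α g b a c f := by
  have hF := isSolution_energy hα hα2
  have hs := sum_sq_ne_one hα2
  rcases Nat.eq_zero_or_pos (Fintype.card ι) with h0 | h0
  · have := Fintype.card_eq_zero_iff.1 h0
    set G : (ι → ℕ) → ℂ := fun p => w α g (Sum.elim b c) (Sum.elim a p) with hG
    refine ⟨fun _ => G fun _ => 0, analyticOnNhd_const, 0, fun z _ => ?_⟩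
    have h1 : HasSum G (G fun _ => 0) :=
      hasSum_single _ fun p hp => absurd (Subsingleton.elim _ _) hp
    refine h1.congr_fun fun p => ?_
    rw [Fintype.prod_empty, mul_one]
  rcases Nat.lt_or_ge 1 (Fintype.card ι) with h1 | h1
  swap
  · obtain ⟨_⟩ := Fintype.card_eq_one_iff_nonempty_unique.1 (le_antisymm h1 h0)
    obtain ⟨ϕ, hϕ, hsum⟩ := hF.exists_form hs (sq_ne_one hα (c default)) g (labels b a)
    refine ⟨fun z => ϕ (z default), analyticOnNhd_comp_apply hϕ default, 3, fun z hz => ?_⟩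
    have h2 := (Equiv.funUnique ι ℕ).hasSum_iff.2 (hsum (z default) (hz default))
    refine h2.congr_fun fun p => ?_
    have : Nonempty (κ ⊕ ι) := ⟨Sum.inr default⟩
    rw [w_eq_labels, Fintype.prod_unique, labels_eq_cons c p default, Multiset.add_cons]
    have h3 : (univ.erase (default : ι)) = ∅ := by
      rw [Finset.univ_unique, Finset.erase_singleton]
    rw [h3]
    simp
  · choose n ε ϕ Q hϕ hsum _ hlin using fun j : ι =>
      hF.exists_forms hs (sq_ne_one hα (c j)) g (Fintype.card κ + Fintype.card ι)
    refine ⟨_, isContinuation_sum_prod n ε ϕ hϕ hsum fun p j => ?_⟩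
    have : Nonempty (κ ⊕ ι) := ⟨Sum.inr j⟩
    have hcard : ((univ.erase j).val.map fun k => (c k, p k)).card = Fintype.card ι - 1 := by
      rw [Multiset.card_map]
      exact Finset.card_erase_of_mem (mem_univ j)
    have h2 := (hlin j (labels b a + (univ.erase j).val.map fun k => (c k, p k)) ?_ ?_ ?_).1 (p j)
    · simp only [w_eq_labels, labels_update, Multiset.add_cons]
      rw [labels_eq_cons c p j, Multiset.add_cons, h2]
    · rw [Multiset.card_add, card_labels, hcard]; omega
    · rintro ⟨hg, q, hq⟩
      have h3 := congrArg Multiset.card hq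
      rw [Multiset.card_add, card_labels, hcard, Multiset.card_singleton] at h3
      refine h ⟨hg, by omega, by omega, ?_⟩
      have h4 : ∀ k, c k = c j := by
        intro k
        by_cases hk : k = j
        · rw [hk]
        · have hk' : k ∈ (univ.erase j).val := Finset.mem_erase.2 ⟨hk, mem_univ k⟩
          have h5 : (c k, p k) ∈ labels b a + (univ.erase j).val.map fun k => (c k, p k) :=
            Multiset.mem_add.2 (Or.inr (Multiset.mem_map_of_mem _ hk'))
          rw [hq, Multiset.mem_singleton] at h5
          exact congrArg Prod.fst h5
      intro k k'
      rw [h4 k, h4 k']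
    · rintro ⟨-, hq⟩
      have h3 := congrArg Multiset.card hq
      rw [Multiset.card_add, hcard, Multiset.card_zero] at h3
      omega

end existence

end QuarticTensor

namespace QuarticTensor

/-! ### The effective potential as a sum over partitions -/

open Egf

section products

variable {β R T : Type*} [CommRing R] [DecidableEq T]

theorem D_prod (b : β) (f : T → Egf β R) (s : Finset T) :
    D b (∏ t ∈ s, f t) = ∑ t ∈ s, ∏ t' ∈ s, Function.update f t (D b (f t)) t' := by
  induction s using Finset.induction with
  | empty => simp [D_one]
  | insert a s ha ih =>
    rw [Finset.prod_insert ha, D_mul, ih, Finset.sum_insert ha, Finset.prod_insert ha,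
      Function.update_self, Finset.mul_sum]
    refine congrArg₂ (· + ·) (congrArg _ (Finset.prod_congr rfl fun t ht => ?_))
      (Finset.sum_congr rfl fun t ht => ?_)
    · rw [Function.update_of_ne (ne_of_mem_of_not_mem ht ha)]
    · rw [Finset.prod_insert ha, Function.update_of_ne (ne_of_mem_of_not_mem ht ha).symm]

theorem prod_apply_zero (f : T → Egf β R) (s : Finset T) :
    (∏ t ∈ s, f t) 0 = ∏ t ∈ s, f t 0 := by
  induction s using Finset.induction with
  | empty => rw [Finset.prod_empty, Finset.prod_empty, one_apply, if_pos Multiset.card_zero]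
  | insert a s ha ih => rw [Finset.prod_insert ha, Finset.prod_insert ha, mul_apply_zero, ih]

/-- The coefficients of a product, as a sum over the distributions of the labels. -/
theorem prod_apply_sum_singleton [Fintype T] {n : ℕ} (X : Fin n → β) (f : T → Egf β R) :
    (∏ t, f t) (∑ j, {X j}) =
      ∑ J : Fin n → T, ∏ t, f t (∑ j, if J j = t then {X j} else 0) := by
  induction n generalizing f with
  | zero =>
    rw [Fintype.sum_subsingleton _ (finZeroElim : Fin 0 → T)]
    simp only [Finset.univ_eq_empty, Finset.sum_empty]
    exact prod_apply_zero f univ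
  | succ n ih =>
    rw [Fin.sum_univ_succ, Multiset.singleton_add,
      ← D_apply (X 0) (∏ t, f t) (∑ j : Fin n, {X j.succ}), D_prod, Egf.sum_apply,
      ← (Fin.consEquiv fun _ => T).sum_comp, Fintype.sum_prod_type]
    refine Finset.sum_congr rfl fun t₀ _ => ?_
    rw [ih]
    refine Finset.sum_congr rfl fun J _ => Finset.prod_congr rfl fun t _ => ?_
    rw [Fin.sum_univ_succ]
    change _ = f t ((if t₀ = t then {X 0} else 0) + ∑ j : Fin n, if J j = t then {X j.succ} else 0)
    by_cases h : t = t₀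
    · subst h
      rw [Function.update_self, if_pos rfl, Multiset.singleton_add, D_apply]
    · rw [Function.update_of_ne h, if_neg (Ne.symm h), zero_add]

/-- The coefficients of a product, as a sum over the distributions of the degree. -/
theorem coeff_X_pow_mul_prod [Fintype T] (P : T → PowerSeries R) (k : ℕ) {g M : ℕ} (hM : g < M) :
    PowerSeries.coeff g (PowerSeries.X ^ k * ∏ t, P t) =
      ∑ h ∈ (Fintype.piFinset fun _ => range M).filter (fun h : T → ℕ => ∑ t, h t + k = g),
        ∏ t, PowerSeries.coeff (h t) (P t) := by
  rw [PowerSeries.coeff_X_pow_mul']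
  split_ifs with hk
  · rw [PowerSeries.coeff_prod]
    refine Finset.sum_bij' (fun l _ => ⇑l) (fun h _ =>
      Finsupp.equivFunOnFinite.symm h) ?_ ?_ ?_ ?_ ?_
    · intro l hl
      have h1 : ∑ t, l t = g - k := (Finset.mem_finsuppAntidiag.1 hl).1
      rw [Finset.mem_filter, Fintype.mem_piFinset]
      refine ⟨fun t => Finset.mem_range.2 ?_, by omega⟩
      have := Finset.single_le_sum (f := l) (fun _ _ => Nat.zero_le _) (mem_univ t)
      omega
    · intro h hh
      rw [Finset.mem_finsuppAntidiag]
      have h1 := (Finset.mem_filter.1 hh).2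
      refine ⟨?_, Finset.subset_univ _⟩
      change ∑ t, h t = g - k
      omega
    · intro l _; ext t; simp
    · intro h _; funext t; simp
    · intro l _; rfl
  · rw [Finset.sum_eq_zero]
    intro h hh
    have h1 := (Finset.mem_filter.1 hh).2
    omega

end products

section labels

variable {ι : Type} [Fintype ι]

theorem labels_eq_sum (c : ι → Fin 6) (p : ι → ℕ) : labels c p = ∑ j, {(c j, p j)} := by
  rw [labels, Finset.sum_eq_multiset_sum]
  exact (Multiset.sum_map_singleton _).symm.trans (by rw [Multiset.map_map]; rfl)

theorem labels_subtype (c : ι → Fin 6) (p : ι → ℕ) (q : ι → Prop) [DecidablePred q] :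
    labels (fun j : {j // q j} => c j) (fun j => p j) =
      ∑ j, if q j then {(c j, p j)} else 0 := by
  rw [labels_eq_sum, ← Finset.sum_filter]
  exact (Finset.sum_subtype _ (fun j => by simp) fun j => {(c j, p j)}).symm

end labels

/-- The genera of the blocks of a partition in a term with `j + 1` traces. -/
def blockGenera (g j : ℕ) {i : Fin 6} (π : ColorPartition i) : Finset (π.parts → ℕ) :=
  (Fintype.piFinset fun _ => range (g + 3)).filter fun h => ∑ B, h B + j + 5 = g + π.parts.card

theorem card_parts_le {i : Fin 6} (π : ColorPartition i) : π.parts.card ≤ 5 := by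
  refine π.card_parts_le_card.trans ?_
  rw [Finset.card_erase_of_mem (mem_univ i)]
  rfl

/-- The correlation attributed to the block `B`: traces of the colors in the block, and
resolvents. -/
def blockCorr (F : Egf (Fin 6 × ℕ) (PowerSeries ℂ)) {n : ℕ} (c : Fin n → Fin 6) (p : Fin n → ℕ)
    {i : Fin 6} {π : ColorPartition i} (J : Fin n → π.parts) (a : Fin 6 → ℕ) (B : π.parts) :
    PowerSeries ℂ :=
  F (labels (fun e : {e : Fin 6 // e ∈ B.1} => e.1) (fun e => a e.1) +
    labels (fun j : {j // J j = B} => c j.1) (fun j => p j.1))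

/-- A coefficient of the effective potential: the correlator of the five other traces is a sum over
partitions into cumulants, and the labels and the genus are distributed over the blocks. -/
theorem coeff_vertexCorr_labels (α : Fin 6 → ℂ) (F : Egf (Fin 6 × ℕ) (PowerSeries ℂ)) (i : Fin 6)
    (g : ℕ) (t : Σ _ : ℕ, Fin 6 → ℕ) {n : ℕ} (c : Fin n → Fin 6) (p : Fin n → ℕ) :
    PowerSeries.coeff g (vertexCorr α F i t (labels c p)) = vert α i t.2 *
      ∑ π : ColorPartition i, ∑ J : Fin n → π.parts, ∑ h ∈ blockGenera g t.1 π,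
        ∏ B, PowerSeries.coeff (h B) (blockCorr F c p J t.2 B) := by
  have hcard : ((univ : Finset (Fin 6)).erase i).card = 5 := by
    rw [Finset.card_erase_of_mem (mem_univ i)]; rfl
  rw [vertexCorr, Egf.smul_apply, mul_assoc, PowerSeries.coeff_C_mul, rest, corr_map_eq,
    Egf.sum_apply, Finset.mul_sum, map_sum]
  refine congrArg _ (Finset.sum_congr rfl fun π _ => ?_)
  have hπ := card_parts_le π
  rw [Egf.smul_apply, hcard, ← mul_assoc, ← pow_add, ← Finset.prod_coe_sort, labels_eq_sum,
    prod_apply_sum_singleton, Finset.mul_sum, map_sum]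
  refine Finset.sum_congr rfl fun J _ => ?_
  rw [coeff_X_pow_mul_prod _ _ (show g < g + 3 by omega)]
  refine Finset.sum_congr (Finset.filter_congr fun h _ => by omega) fun h _ =>
    Finset.prod_congr rfl fun B _ => ?_
  rw [blockCorr, Dm_apply, labels_subtype]
  congr 3
  rw [labels, Finset.univ_eq_attach, Finset.attach_val,
    ← Multiset.attach_map_val' B.1.val fun c => (c, t.2 c)]
  rfl

/-- The terms of the form `l`, relabelled by the exponents `b = a - e_i` that remain after
differentiation with respect to `M_i`. -/
theorem sum_loopIndex (α : Fin 6 → ℂ) (g : ℕ) {i : Fin 6} (π : ColorPartition i)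
    (Φ : (Fin 6 → ℕ) → (π.parts → ℕ) → ℂ) :
    ∑ s ∈ loopIndex g π, (s.1 i : ℂ) * tTilde α s.1 * Φ s.1 s.2 =
      -∑ t ∈ vertices (g + 1), vert α i t.2 *
        ∑ h ∈ blockGenera g t.1 π, Φ (t.2 + Pi.single i 1) h := by
  have hπ := card_parts_le π
  simp only [Finset.mul_sum]
  rw [Finset.sum_sigma', ← Finset.sum_neg_distrib]
  symm
  refine Finset.sum_bij' (fun t _ => (t.1.2 + Pi.single i 1, t.2))
    (fun s _ => ⟨⟨∑ c, s.1 c - 2, s.1 - Pi.single i 1⟩, s.2⟩) ?_ ?_ ?_ ?_ ?_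
  · rintro ⟨⟨j, b⟩, h⟩ ht
    rw [Finset.mem_sigma, vertices, Finset.mem_sigma, Finset.mem_range, Finset.mem_piAntidiag,
      blockGenera, Finset.mem_filter] at ht
    obtain ⟨⟨hj, hb, -⟩, hh, hsum⟩ := ht
    dsimp only at hj hb hh hsum ⊢
    have h1 : ∑ c, (b + Pi.single i 1 : Fin 6 → ℕ) c = j + 2 := by
      simp only [Pi.add_apply, Finset.sum_add_distrib, hb, Finset.sum_pi_single', Finset.mem_univ,
        if_true]
    rw [loopIndex, Finset.mem_filter, Finset.mem_product]
    refine ⟨⟨Fintype.mem_piFinset.2 fun c => Finset.mem_range.2 ?_, hh⟩, ?_, ?_, ?_⟩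
    · have := Finset.single_le_sum (f := (b + Pi.single i 1 : Fin 6 → ℕ))
        (fun _ _ => Nat.zero_le _) (mem_univ c)
      rw [h1] at this
      dsimp only
      omega
    · simp
    · rw [h1]; omega
    · dsimp only; rw [h1]; omega
  · rintro ⟨a, h⟩ hs
    rw [loopIndex, Finset.mem_filter, Finset.mem_product] at hs
    obtain ⟨⟨ha, hh⟩, hi, h2, hsum⟩ := hs
    dsimp only at ha hh hi h2 hsum ⊢
    have h1 : univ.sum (a - Pi.single i 1 : Fin 6 → ℕ) + 1 = ∑ c, a c := by
      change ∑ c, (a - Pi.single i 1 : Fin 6 → ℕ) c + 1 = ∑ c, a c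
      have h3 : ∀ c, (a - Pi.single i 1 : Fin 6 → ℕ) c + (Pi.single i 1 : Fin 6 → ℕ) c = a c := by
        intro c
        by_cases hc : c = i
        · subst hc; simp; omega
        · simp [hc]
      rw [← Finset.sum_congr rfl fun c _ => h3 c, Finset.sum_add_distrib]
      simp
    rw [Finset.mem_sigma, vertices, Finset.mem_sigma, Finset.mem_range, Finset.mem_piAntidiag,
      blockGenera, Finset.mem_filter]
    dsimp only
    exact ⟨⟨by omega, by omega, by simp⟩, hh, by omega⟩
  · rintro ⟨⟨j, b⟩, h⟩ ht
    rw [Finset.mem_sigma, vertices, Finset.mem_sigma, Finset.mem_piAntidiag] at ht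
    have hb : ∑ c, b c = j + 1 := ht.1.2.1
    have h1 : ∑ c, (b + Pi.single i 1 : Fin 6 → ℕ) c = j + 2 := by
      simp only [Pi.add_apply, Finset.sum_add_distrib, hb, Finset.sum_pi_single', Finset.mem_univ,
        if_true]
    dsimp only
    rw [h1, Nat.add_sub_cancel]
    congr 2
    funext c
    simp
  · rintro ⟨a, h⟩ hs
    rw [loopIndex, Finset.mem_filter] at hs
    have hi : 1 ≤ a i := hs.2.1
    dsimp only
    congr 1
    funext c
    by_cases hc : c = i
    · subst hc; simp; omega
    · simp [hc]
  · rintro ⟨⟨j, b⟩, h⟩ _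
    dsimp only
    rw [← tTilde_add_single]
    ring

/-- The effective potential in terms of the couplings and of the partitions of the other colors. -/
theorem sum_vertexCorr_eq (α : Fin 6 → ℂ) (F : Egf (Fin 6 × ℕ) (PowerSeries ℂ)) (i : Fin 6)
    (g : ℕ) {n : ℕ} (c : Fin n → Fin 6) (p : Fin n → ℕ) (ξ : ℂ) :
    ∑ t ∈ vertices (g + 1), PowerSeries.coeff g (vertexCorr α F i t (labels c p)) * ξ ^ t.2 i =
      -∑ π : ColorPartition i, ∑ J : Fin n → π.parts, ∑ s ∈ loopIndex g π,
        (s.1 i : ℂ) * tTilde α s.1 * (ξ ^ (s.1 i - 1) *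
          ∏ B, PowerSeries.coeff (s.2 B) (blockCorr F c p J s.1 B)) := by
  have h1 : ∀ (π : ColorPartition i) (J : Fin n → π.parts) (b : Fin 6 → ℕ) (B : π.parts),
      blockCorr F c p J (b + Pi.single i 1) B = blockCorr F c p J b B := by
    intro π J b B
    have h2 : (fun e : {e : Fin 6 // e ∈ B.1} => (b + Pi.single i 1 : Fin 6 → ℕ) e.1) =
        fun e => b e.1 := by
      funext e
      have he := π.le B.2 e.2
      rw [Pi.add_apply, Pi.single_eq_of_ne (Finset.ne_of_mem_erase he), add_zero]
    rw [blockCorr, blockCorr, h2]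
  simp only [coeff_vertexCorr_labels]
  have h2 : ∀ (π : ColorPartition i) (J : Fin n → π.parts), ∑ s ∈ loopIndex g π,
      (s.1 i : ℂ) * tTilde α s.1 * (ξ ^ (s.1 i - 1) *
        ∏ B, PowerSeries.coeff (s.2 B) (blockCorr F c p J s.1 B)) =
      -∑ t ∈ vertices (g + 1), vert α i t.2 * ∑ h ∈ blockGenera g t.1 π,
        ξ ^ t.2 i * ∏ B, PowerSeries.coeff (h B) (blockCorr F c p J t.2 B) := by
    intro π J
    rw [sum_loopIndex α g π fun a h => ξ ^ (a i - 1) *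
        ∏ B, PowerSeries.coeff (h B) (blockCorr F c p J a B)]
    simp only [h1, Pi.add_apply, Pi.single_eq_same, Nat.add_sub_cancel]
  simp only [h2, Finset.sum_neg_distrib, neg_neg]
  simp only [Finset.mul_sum, Finset.sum_mul]
  rw [Finset.sum_comm]
  refine Finset.sum_congr rfl fun π _ => ?_
  rw [Finset.sum_comm]
  refine Finset.sum_congr rfl fun J _ => Finset.sum_congr rfl fun t _ =>
    Finset.sum_congr rfl fun h _ => ?_
  ring

end QuarticTensor

namespace QuarticTensor

/-! ### The explicit loop equations -/

open Filter

section ell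

variable {α : Fin 6 → ℂ}

/-- The correlation form attributed to the block `B` in a term of the form `l`. -/
def blockForm (α : Fin 6 → ℂ) {n : ℕ} (c : Fin n → Fin 6) {i : Fin 6} {π : ColorPartition i}
    (J : Fin n → π.parts) (s : (Fin 6 → ℕ) × (π.parts → ℕ)) (B : π.parts) :
    ({j : Fin n // J j = B} → ℂ) → ℂ :=
  mixed α (s.2 B) (κ := {c : Fin 6 // c ∈ B.1}) (ι := {j : Fin n // J j = B})
    (fun e => e.1) (fun e => s.1 e.1) (fun j => c j.1)

theorem loopTerm_eq {n : ℕ} (c : Fin n → Fin 6) {i : Fin 6} (z₀ : ℂ) {π : ColorPartition i}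
    (J : Fin n → π.parts) (s : (Fin 6 → ℕ) × (π.parts → ℕ)) (z : Fin n → ℂ) :
    loopTerm α (i, z₀) (fun j => (c j, z j)) π J s =
      (s.1 i : ℂ) * tTilde α s.1 * x α (i, z₀) ^ (s.1 i - 1) *
        ∏ B, blockForm α c J s B fun j => z j.1 := rfl

/-- The correlation of the traces of a block and of resolvents extends to the spectral curve: the
exceptional correlation has no traces. -/
theorem isContinuation_block (hα : ∀ c, ‖α c‖ < 1) (hα2 : ‖∑ c, α c ^ 2‖ < 1) {n : ℕ}
    (c : Fin n → Fin 6) {i : Fin 6} {π : ColorPartition i} (J : Fin n → π.parts)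
    (s : (Fin 6 → ℕ) × (π.parts → ℕ)) (B : π.parts) :
    IsContinuation α (s.2 B) (κ := {c : Fin 6 // c ∈ B.1}) (ι := {j : Fin n // J j = B})
      (fun e => e.1) (fun e => s.1 e.1) (fun j => c j.1) (blockForm α c J s B) := by
  have hκ : Fintype.card {c : Fin 6 // c ∈ B.1} ≠ 0 := by
    obtain ⟨e, he⟩ := π.nonempty_of_mem_parts B.2
    exact fun h => (Fintype.card_eq_zero_iff.1 h).false ⟨e, he⟩
  obtain ⟨f, hf⟩ := exists_isContinuation hα hα2 (s.2 B) (κ := {c : Fin 6 // c ∈ B.1})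
    (ι := {j : Fin n // J j = B}) (fun e => e.1) (fun e => s.1 e.1) (fun j => c j.1)
    fun h => hκ h.2.1
  exact isContinuation_mixed hf

theorem analyticOnNhd_ell (hα : ∀ c, ‖α c‖ < 1) (hα2 : ‖∑ c, α c ^ 2‖ < 1) (g : ℕ) {n : ℕ}
    (c : Fin n → Fin 6) (i : Fin 6) (z₀ : ℂ) :
    AnalyticOnNhd ℂ (fun z : Fin n → ℂ => ell α g (i, z₀) fun j => (c j, z j))
      (regularPi (Fin n)) := by
  refine AnalyticOnNhd.mul (AnalyticOnNhd.neg (Finset.analyticOnNhd_fun_sum _ fun π _ =>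
    Finset.analyticOnNhd_fun_sum _ fun J _ => Finset.analyticOnNhd_fun_sum _ fun s _ => ?_))
      analyticOnNhd_const
  simp only [loopTerm_eq]
  refine analyticOnNhd_const.mul (Finset.analyticOnNhd_fun_prod _ fun B _ => ?_)
  intro z hz
  have h1 := (isContinuation_block hα hα2 c J s B).1 (fun j => z j.1) fun j => hz j.1
  exact AnalyticAt.comp (f := fun (z : Fin n → ℂ) (j : {j // J j = B}) => z j.1) h1
    ((ContinuousLinearMap.pi fun j : {j // J j = B} =>
      (ContinuousLinearMap.proj j.1 : (Fin n → ℂ) →L[ℂ] ℂ)).analyticAt z)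

/-- The expansion near infinity of a term of the form `l`: the product of the expansions of the
factors. -/
theorem hasSum_loopTerm {n : ℕ} (c : Fin n → Fin 6) {i : Fin 6} (z₀ : ℂ) {π : ColorPartition i}
    (J : Fin n → π.parts) (s : (Fin 6 → ℕ) × (π.parts → ℕ)) (z : Fin n → ℂ)
    (h : ∀ B : π.parts, HasSum (fun p : {j : Fin n // J j = B} → ℕ =>
      w α (s.2 B) (Sum.elim (fun e : {c : Fin 6 // c ∈ B.1} => e.1) fun j => c j.1)
          (Sum.elim (fun e => s.1 e.1) p) *
        ∏ j, (x α (c j.1, z j.1) ^ (p j + 1))⁻¹ * dx α (c j.1, z j.1))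
      (blockForm α c J s B fun j => z j.1)) :
    HasSum (fun p : Fin n → ℕ => (s.1 i : ℂ) * tTilde α s.1 * (x α (i, z₀) ^ (s.1 i - 1) *
        ∏ B, PowerSeries.coeff (s.2 B) (blockCorr (energy α) c p J s.1 B)) *
        ∏ j, (x α (c j, z j) ^ (p j + 1))⁻¹ * dx α (c j, z j))
      (loopTerm α (i, z₀) (fun j => (c j, z j)) π J s) := by
  -- the exponents of all the points are the exponents of the points of each block
  let e : (Fin n → ℕ) ≃ ∀ B : π.parts, ({j : Fin n // J j = B} → ℕ) :=
    ⟨fun p B j => p j.1, fun q j => q (J j) ⟨j, rfl⟩, fun p => rfl, fun q => by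
      funext B ⟨j, hj⟩
      subst hj
      rfl⟩
  have h1 := (e.hasSum_iff.2 (hasSum_prod_pi h)).mul_left
    ((s.1 i : ℂ) * tTilde α s.1 * x α (i, z₀) ^ (s.1 i - 1))
  refine h1.congr_fun fun p => ?_
  rw [Function.comp_apply]
  have h2 : ∏ B : π.parts, ∏ j : {j : Fin n // J j = B},
      (x α (c j.1, z j.1) ^ (p j.1 + 1))⁻¹ * dx α (c j.1, z j.1) =
      ∏ j, (x α (c j, z j) ^ (p j + 1))⁻¹ * dx α (c j, z j) :=
    Fintype.prod_fiberwise J fun j => (x α (c j, z j) ^ (p j + 1))⁻¹ * dx α (c j, z j)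
  have h3 : ∏ B : π.parts, w α (s.2 B)
      (Sum.elim (fun e : {c : Fin 6 // c ∈ B.1} => e.1) fun j : {j : Fin n // J j = B} => c j.1)
      (Sum.elim (fun e => s.1 e.1) fun j => p j.1) =
      ∏ B, PowerSeries.coeff (s.2 B) (blockCorr (energy α) c p J s.1 B) := by
    refine Finset.prod_congr rfl fun B _ => ?_
    obtain ⟨e, he⟩ := π.nonempty_of_mem_parts B.2
    have : Nonempty ({c : Fin 6 // c ∈ B.1} ⊕ {j : Fin n // J j = B}) := ⟨Sum.inl ⟨e, he⟩⟩
    rw [w_eq_labels]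
    rfl
  rw [← h2, ← h3, ← mul_assoc, mul_assoc, ← Finset.prod_mul_distrib]
  rfl

/-- The expansion of the form `l` near infinity. -/
theorem eventually_hasSum_ell (hα : ∀ c, ‖α c‖ < 1) (hα2 : ‖∑ c, α c ^ 2‖ < 1) (g : ℕ) {n : ℕ}
    (c : Fin n → Fin 6) (i : Fin 6) (z₀ : ℂ) :
    ∀ᶠ R : ℝ in atTop, ∀ z : Fin n → ℂ, (∀ j, R < ‖z j‖) →
      HasSum (fun p : Fin n → ℕ => (∑ t ∈ vertices (g + 1),
          PowerSeries.coeff g (vertexCorr α (energy α) i t (labels c p)) *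
            x α (i, z₀) ^ t.2 i) * dx α (i, z₀) *
          ∏ j, (x α (c j, z j) ^ (p j + 1))⁻¹ * dx α (c j, z j))
        (ell α g (i, z₀) fun j => (c j, z j)) := by
  have h1 : ∀ᶠ R : ℝ in atTop, ∀ (π : ColorPartition i) (J : Fin n → π.parts),
      ∀ s ∈ loopIndex g π, ∀ (B : π.parts) (z : Fin n → ℂ), (∀ j, R < ‖z j‖) →
      HasSum (fun p : {j : Fin n // J j = B} → ℕ =>
      w α (s.2 B) (Sum.elim (fun e : {c : Fin 6 // c ∈ B.1} => e.1) fun j => c j.1)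
          (Sum.elim (fun e => s.1 e.1) p) *
        ∏ j, (x α (c j.1, z j.1) ^ (p j + 1))⁻¹ * dx α (c j.1, z j.1))
      (blockForm α c J s B fun j => z j.1) := by
    rw [eventually_all]
    intro π
    rw [eventually_all]
    intro J
    rw [eventually_all_finset]
    intro s _
    rw [eventually_all]
    intro B
    obtain ⟨R, hR⟩ := (isContinuation_block hα hα2 c J s B).2
    filter_upwards [eventually_ge_atTop R] with R' hR' z hz
    exact hR _ fun j => hR'.trans_lt (hz j.1)
  filter_upwards [h1] with R hR z hz
  have h2 := ((hasSum_sum fun (π : ColorPartition i) (_ : π ∈ univ) =>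
    hasSum_sum fun (J : Fin n → π.parts) (_ : J ∈ univ) =>
    hasSum_sum fun s (hs : s ∈ loopIndex g π) =>
      hasSum_loopTerm c z₀ J s z fun B => hR π J s hs B z hz).neg).mul_right (dx α (i, z₀))
  refine h2.congr_fun fun p => ?_
  rw [sum_vertexCorr_eq]
  simp only [← Finset.sum_mul]
  ring

end ell

section omega

variable {α : Fin 6 → ℂ}

theorem labels_cons {n : ℕ} (i : Fin 6) (c : Fin n → Fin 6) (p : Fin (n + 1) → ℕ) :
    labels (Fin.cons i c : Fin (n + 1) → Fin 6) p = (i, p 0) ::ₘ labels c (Fin.tail p) := by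
  rw [labels_eq_sum, labels_eq_sum, Fin.sum_univ_succ, Multiset.singleton_add]
  rfl

/-- The correlation forms in terms of a basis for the dependence on the first variable. -/
theorem exists_omega_cons (hα : ∀ c, ‖α c‖ < 1) (hα2 : ‖∑ c, α c ^ 2‖ < 1) (g : ℕ) {n : ℕ}
    (c : Fin n → Fin 6) (i : Fin 6) (h0 : ¬ (g = 0 ∧ n = 0))
    (h1 : ¬ (g = 0 ∧ n = 1 ∧ ∀ j, c j = i)) :
    ∃ (m : ℕ) (ε : ℕ → ℕ → ℂ) (ϕ : ℕ → ℂ → ℂ) (Q : ℕ → Polynomial ℂ),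
      (∀ r, AnalyticOnNhd ℂ (ϕ r) regular) ∧
      (∀ r z, 3 < ‖z‖ → HasSum (fun p => ε r p * ((x α (i, z) ^ (p + 1))⁻¹ * dx α (i, z)))
        (ϕ r z)) ∧
      (∀ r z, z ≠ 0 → ϕ r z - (z ^ 2)⁻¹ * ϕ r z⁻¹ =
        -(2 * (Q r).eval (x α (i, z)) * dx α (i, z))) ∧
      (∀ z₀ ∈ regular, ∀ z ∈ regularPi (Fin n),
        omega α g (Fin.cons (i, z₀) (fun j => (c j, z j)) : Fin (n + 1) → Curve) =
          ∑ r : Fin m, ϕ r z₀ * mixed α g (fun _ : Unit => i) (fun _ => (r : ℕ)) c z) ∧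
      (∀ p, ∀ z ∈ regularPi (Fin n), mixed α g (fun _ : Unit => i) (fun _ => p) c z =
          ∑ r : Fin m, ε r p * mixed α g (fun _ : Unit => i) (fun _ => (r : ℕ)) c z) ∧
      ∀ z₀, ∀ z ∈ regularPi (Fin n), ell α g (i, z₀) (fun j => (c j, z j)) =
          2 * (∑ r : Fin m, (Q r).eval (x α (i, z₀)) *
            mixed α g (fun _ : Unit => i) (fun _ => (r : ℕ)) c z) * dx α (i, z₀) := by
  obtain ⟨m, ε, ϕ, Q, hϕ, hsum, hS, hlin⟩ :=
    (isSolution_energy hα hα2).exists_forms (sum_sq_ne_one hα2) (sq_ne_one hα i) g n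
  have hM : ∀ p : ℕ, IsContinuation α g (fun _ : Unit => i) (fun _ => p) c
      (mixed α g (fun _ : Unit => i) (fun _ => p) c) := fun p => by
    obtain ⟨f, hf⟩ := exists_isContinuation hα hα2 g (fun _ : Unit => i) (fun _ => p) c
      (by simp)
    exact isContinuation_mixed hf
  have hw : ∀ (p₀ : ℕ) (p : Fin n → ℕ),
      w α g (Sum.elim (fun _ : Unit => i) c) (Sum.elim (fun _ => p₀) p) =
        PowerSeries.coeff g (energy α ((i, p₀) ::ₘ labels c p)) := by
    intro p₀ p
    rw [w_eq_labels]
    rfl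
  have hev : ∀ p : ℕ, ∀ᶠ R : ℝ in atTop, ∀ z : Fin n → ℂ, (∀ j, R < ‖z j‖) →
      HasSum (fun q : Fin n → ℕ => PowerSeries.coeff g (energy α ((i, p) ::ₘ labels c q)) *
        ∏ j, (x α (c j, z j) ^ (q j + 1))⁻¹ * dx α (c j, z j))
        (mixed α g (fun _ : Unit => i) (fun _ => p) c z) := by
    intro p
    obtain ⟨R, hR⟩ := (hM p).2
    filter_upwards [eventually_ge_atTop R] with R' hR' z hz
    simpa only [hw] using hR z fun j => hR'.trans_lt (hz j)
  have hlin' : ∀ q : Fin n → ℕ, _ := fun q => hlin (labels c q)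
    (by rw [card_labels, Fintype.card_fin])
    (by
      rintro ⟨hg, l, hl⟩
      have h2 := congrArg Multiset.card hl
      rw [card_labels, Fintype.card_fin, Multiset.card_singleton] at h2
      refine h1 ⟨hg, h2, fun j => ?_⟩
      have h3 : (c j, q j) ∈ labels c q := Multiset.mem_map_of_mem _ (Finset.mem_univ j)
      rw [hl, Multiset.mem_singleton] at h3
      exact congrArg Prod.fst h3)
    (by
      rintro ⟨hg, hl⟩
      have h2 := congrArg Multiset.card hl
      rw [card_labels, Fintype.card_fin, Multiset.card_zero] at h2
      exact h0 ⟨hg, h2⟩)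
  -- in all three cases, both sides are analytic on the regular part, and the expansions near
  -- infinity agree by `hlin'`
  refine ⟨m, ε, ϕ, Q, hϕ, hsum, hS, ?_, ?_, ?_⟩
  · have hC : IsContinuation α g (κ := Empty) Empty.elim Empty.elim
        (Fin.cons i c : Fin (n + 1) → Fin 6) (fun z => ∑ r : Fin m, ϕ r (z 0) *
          mixed α g (fun _ : Unit => i) (fun _ => (r : ℕ)) c (Fin.tail z)) := by
      refine ⟨Finset.analyticOnNhd_fun_sum _ fun r _ =>
        (analyticOnNhd_comp_apply (hϕ r) 0).mul fun z hz => ?_, ?_⟩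
      · exact AnalyticAt.comp (f := fun (z : Fin (n + 1) → ℂ) (j : Fin n) => z j.succ)
          ((hM r).1 _ fun j => hz j.succ)
          ((ContinuousLinearMap.pi fun j : Fin n =>
            (ContinuousLinearMap.proj j.succ : (Fin (n + 1) → ℂ) →L[ℂ] ℂ)).analyticAt z)
      · obtain ⟨R, hR, hR3⟩ := ((eventually_all.2 fun r : Fin m => hev r).and
          (eventually_ge_atTop 3)).exists
        refine ⟨R, fun z hz => ?_⟩
        rw [← (Fin.consEquiv fun _ : Fin (n + 1) => ℕ).hasSum_iff]
        have h3 : ∀ r : Fin m, _ := fun r => by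
          have h4 := hsum r (z 0) (hR3.trans_lt (hz 0))
          have h5 := hR r (Fin.tail z) fun j => hz j.succ
          have h6 : Summable fun q : ℕ × (Fin n → ℕ) =>
              (ε r q.1 * ((x α (i, z 0) ^ (q.1 + 1))⁻¹ * dx α (i, z 0))) *
              (PowerSeries.coeff g (energy α ((i, (r : ℕ)) ::ₘ labels c q.2)) *
                ∏ j, (x α (c j, Fin.tail z j) ^ (q.2 j + 1))⁻¹ * dx α (c j, Fin.tail z j)) := by
            apply summable_mul_of_summable_norm h4.summable.norm h5.summable.norm
          exact h4.mul h5 h6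
        refine (hasSum_sum fun r (_ : r ∈ univ) => h3 r).congr_fun fun q => ?_
        have h4 : w α g (Sum.elim Empty.elim (Fin.cons i c : Fin (n + 1) → Fin 6))
            (Sum.elim Empty.elim (Fin.cons q.1 q.2 : Fin (n + 1) → ℕ)) =
            PowerSeries.coeff g (energy α ((i, q.1) ::ₘ labels c q.2)) := by
          rw [w_eq_labels, labels_of_isEmpty, zero_add, labels_cons]
          rfl
        rw [Function.comp_apply]
        change w α g (Sum.elim Empty.elim (Fin.cons i c : Fin (n + 1) → Fin 6))
            (Sum.elim Empty.elim (Fin.cons q.1 q.2 : Fin (n + 1) → ℕ)) * _ = _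
        rw [h4, (hlin' q.2).1, Fin.prod_univ_succ, Finset.sum_mul]
        refine Finset.sum_congr rfl fun r _ => ?_
        simp only [Fin.consEquiv_apply, Fin.cons_zero, Fin.cons_succ, Fin.tail]
        ring
    intro z₀ hz₀ z hz
    have h2 := mixed_eqOn hC (x := Fin.cons z₀ z) fun j => by
      cases j using Fin.cases with
      | zero => exact hz₀
      | succ j => exact hz j
    simp only [Fin.cons_zero, Fin.tail_cons] at h2
    rw [← h2, omega]
    have h3 : (fun j => ((Fin.cons (i, z₀) (fun j => (c j, z j)) : Fin (n + 1) → Curve) j).1) =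
        (Fin.cons i c : Fin (n + 1) → Fin 6) := by
      funext j; cases j using Fin.cases <;> rfl
    have h4 : (fun j => ((Fin.cons (i, z₀) (fun j => (c j, z j)) : Fin (n + 1) → Curve) j).2) =
        (Fin.cons z₀ z : Fin (n + 1) → ℂ) := by
      funext j; cases j using Fin.cases <;> rfl
    rw [h3, h4]
  · intro p
    obtain ⟨R, hR, hR'⟩ := ((eventually_all.2 fun r : Fin m => hev r).and (hev p)).exists
    refine eqOn_regularPi (R := R) (hM p).1 (Finset.analyticOnNhd_fun_sum _ fun r _ =>
      analyticOnNhd_const.mul (hM r).1) fun z hz => ?_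
    refine (hR' z hz).unique ((hasSum_sum fun r (_ : r ∈ univ) =>
      (hR r z hz).mul_left (ε r p)).congr_fun fun q => ?_)
    rw [(hlin' q).1, Finset.sum_mul]
    exact Finset.sum_congr rfl fun r _ => by ring
  · intro z₀
    obtain ⟨R, hR, hR'⟩ := ((eventually_all.2 fun r : Fin m => hev r).and
      (eventually_hasSum_ell hα hα2 g c i z₀)).exists
    have h2 : AnalyticOnNhd ℂ (fun z => 2 * (∑ r : Fin m, (Q r).eval (x α (i, z₀)) *
        mixed α g (fun _ : Unit => i) (fun _ => (r : ℕ)) c z) * dx α (i, z₀))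
        (regularPi (Fin n)) := by
      have h3 : AnalyticOnNhd ℂ (fun z => ∑ r : Fin m, (Q r).eval (x α (i, z₀)) *
          mixed α g (fun _ : Unit => i) (fun _ => (r : ℕ)) c z) (regularPi (Fin n)) :=
        Finset.analyticOnNhd_fun_sum _ fun r _ => analyticOnNhd_const.mul (hM r).1
      exact (analyticOnNhd_const.mul h3).mul analyticOnNhd_const
    refine eqOn_regularPi (R := R) (analyticOnNhd_ell hα hα2 g c i z₀) h2 fun z hz => ?_
    have h3 := ((hasSum_sum fun r (_ : r ∈ univ) =>
      (hR r z hz).mul_left ((Q r).eval (x α (i, z₀)))).mul_left 2).mul_right (dx α (i, z₀))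
    have h4 := hR' z hz
    refine h4.unique (h3.congr_fun fun q => ?_)
    have h5 := (hlin' q).2 (x α (i, z₀))
    rw [h5]
    simp only [Finset.mul_sum, Finset.sum_mul]
    exact Finset.sum_congr rfl fun r _ => by ring

/-- The explicit linear loop equations. -/
theorem opS_omega_add_ell (hα : ∀ c, ‖α c‖ < 1) (hα2 : ‖∑ c, α c ^ 2‖ < 1) (g : ℕ) {n : ℕ}
    (Q : Curve) (P : Fin n → Curve) (h0 : ¬ (g = 0 ∧ n = 0))
    (h1 : ¬ (g = 0 ∧ n = 1 ∧ ∀ j, (P j).1 = Q.1)) (hQ : Q.2 ∈ regular)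
    (hP : ∀ j, (P j).2 ∈ regular) :
    opS (fun Q => omega α g (Fin.cons Q P : Fin (n + 1) → Curve)) Q + ell α g Q P = 0 := by
  obtain ⟨i, z₀⟩ := Q
  obtain ⟨m, ε, ϕ, Q, -, -, hS, hω, -, hell⟩ :=
    exists_omega_cons hα hα2 g (fun j => (P j).1) i h0 h1
  have h2 := hω z₀ hQ (fun j => (P j).2) hP
  have h3 := hω z₀⁻¹ (inv_mem_regular hQ) (fun j => (P j).2) hP
  have h4 := hell z₀ (fun j => (P j).2) hP
  rw [opS, h2, h3, h4, Finset.mul_sum, ← Finset.sum_sub_distrib, Finset.mul_sum, Finset.sum_mul,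
    ← Finset.sum_add_distrib]
  refine Finset.sum_eq_zero fun r _ => ?_
  linear_combination (mixed α g (fun _ : Unit => i) (fun _ => (r : ℕ)) (fun j => (P j).1)
    fun j => (P j).2) * hS r z₀ hQ.1

end omega

end QuarticTensor

namespace QuarticTensor

/-! ### Contour integrals -/

open Filter

section contour

variable {α : Fin 6 → ℂ}

theorem hasDerivAt_x (α : Fin 6 → ℂ) (i : Fin 6) {z : ℂ} (hz : z ≠ 0) :
    HasDerivAt (fun z => x α (i, z)) (dx α (i, z)) z := by
  have h := ((hasDerivAt_id z).add (hasDerivAt_inv hz)).mul_const (root α i)⁻¹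
  simp only [x, dx, div_eq_mul_inv, sub_eq_add_neg]
  exact h

/-- The function `x` has two zeros and one pole inside the circle. -/
theorem integral_dlog_x {i : Fin 6} (hi : α i ^ 2 ≠ 1) :
    ∮ y in C(0, 4), (x α (i, y))⁻¹ * dx α (i, y) = 2 * Real.pi * Complex.I := by
  have hI : ∀ w : ℂ, ‖w‖ < 4 → CircleIntegrable (fun y => (y - w)⁻¹) 0 4 := fun w hw => by
    rw [circleIntegrable_sub_inv_iff]
    right
    rw [abs_of_pos (by norm_num), mem_sphere_zero_iff_norm]
    exact hw.ne
  have hw : ∀ w : ℂ, ‖w‖ < 4 → ∮ y in C(0, 4), (y - w)⁻¹ = 2 * Real.pi * Complex.I := fun w hw =>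
    circleIntegral.integral_sub_inv_of_mem_ball (by rwa [mem_ball_zero_iff])
  have hnI : ‖Complex.I‖ < 4 := by rw [Complex.norm_I]; norm_num
  have hnI' : ‖-Complex.I‖ < 4 := by rw [norm_neg]; exact hnI
  have hn0 : ‖(0 : ℂ)‖ < 4 := by rw [norm_zero]; norm_num
  -- partial fractions: the zeros of `x` are `±i`, its pole is `0`
  have h1 : Set.EqOn (fun y => (x α (i, y))⁻¹ * dx α (i, y))
      (fun y => (y - Complex.I)⁻¹ + (y - -Complex.I)⁻¹ - (y - 0)⁻¹) (Metric.sphere 0 4) := by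
    intro y hy
    rw [mem_sphere_zero_iff_norm] at hy
    have h3 : 3 < ‖y‖ := by rw [hy]; norm_num
    have hy0 := ne_zero_of_three_lt h3
    have hρ := root_ne_zero hi
    have hne : ∀ w : ℂ, ‖w‖ < 4 → y - w ≠ 0 := fun w hw h => by
      rw [sub_eq_zero.1 h] at hy
      linarith
    have h4 := hne _ hnI
    have h5 := hne _ hnI'
    have h6 : (y - Complex.I) * (y - -Complex.I) = y ^ 2 + 1 := by
      ring_nf
      rw [Complex.I_sq]
      ring
    have h7 : y ^ 2 + 1 ≠ 0 := h6 ▸ mul_ne_zero h4 h5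
    have h8 : (y - Complex.I)⁻¹ + (y - -Complex.I)⁻¹ = 2 * y / (y ^ 2 + 1) := by
      rw [← h6, inv_add_inv h4 h5]
      ring
    dsimp only
    rw [h8, x, dx, sub_zero]
    field_simp
    ring
  have h2 : CircleIntegrable (fun y => (y - Complex.I)⁻¹ + (y - -Complex.I)⁻¹) 0 4 :=
    (hI _ hnI).add (hI _ hnI')
  rw [circleIntegral.integral_congr (by norm_num) h1, circleIntegral.integral_sub h2 (hI _ hn0),
    circleIntegral.integral_add (hI _ hnI) (hI _ hnI'), hw _ hnI, hw _ hnI', hw _ hn0]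
  ring

/-- For `p ≠ 1` the form has a primitive, a power of `x`. -/
theorem integral_pow_dx {i : Fin 6} (hi : α i ^ 2 ≠ 1) (p : ℕ) :
    ∮ y in C(0, 4), (x α (i, y) ^ p)⁻¹ * dx α (i, y) =
      if p = 1 then 2 * Real.pi * Complex.I else 0 := by
  split_ifs with h
  · rw [h]
    simpa only [pow_one] using integral_dlog_x hi
  · refine circleIntegral.integral_eq_zero_of_hasDerivWithinAt
      (f := fun y => x α (i, y) ^ (1 - p : ℤ) * (1 - p : ℂ)⁻¹) (by norm_num) fun y hy => ?_
    rw [mem_sphere_zero_iff_norm] at hy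
    have h3 : 3 < ‖y‖ := by rw [hy]; norm_num
    have hx := x_ne_zero hi h3
    have hp : (1 - p : ℂ) ≠ 0 := by
      rw [sub_ne_zero]
      exact_mod_cast Ne.symm h
    have h4 := (((hasDerivAt_zpow (1 - p : ℤ) _ (Or.inl hx)).comp y
      (hasDerivAt_x α i (ne_zero_of_three_lt h3))).mul_const (1 - p : ℂ)⁻¹).hasDerivWithinAt
      (s := Metric.sphere 0 4)
    refine HasDerivWithinAt.congr_deriv h4 ?_
    rw [show (1 - p : ℤ) - 1 = -(p : ℤ) by ring, zpow_neg, zpow_natCast]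
    push_cast
    field_simp

/-- The integral of a form around the cut is its residue at infinity. -/
theorem integral_x_mul {i : Fin 6} (hi : α i ^ 2 ≠ 1) {ϕ : ℂ → ℂ} (hϕ : AnalyticOnNhd ℂ ϕ regular)
    {ε : ℕ → ℂ} (hsum : ∀ z, 3 < ‖z‖ →
      HasSum (fun p => ε p * ((x α (i, z) ^ (p + 1))⁻¹ * dx α (i, z))) (ϕ z)) {R : ℝ} (hR : 1 < R) :
    (2 * (Real.pi : ℂ) * Complex.I)⁻¹ * ∮ y in C(0, R), x α (i, y) * ϕ y = ε 1 := by
  have hreg : ∀ y : ℂ, 1 < ‖y‖ → y ∈ regular := fun y hy => by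
    refine ⟨?_, ?_, ?_⟩ <;> (rintro rfl; norm_num at hy)
  have hd : ∀ y : ℂ, 1 < ‖y‖ → DifferentiableAt ℂ (fun y => x α (i, y) * ϕ y) y := fun y hy =>
    ((hasDerivAt_x α i (hreg y hy).1).differentiableAt).mul (hϕ y (hreg y hy)).differentiableAt
  -- the singularities are at `0` and `±1`, so the radius may be changed to `4`, where the expansion
  -- at infinity converges
  have hann : ∀ r r' : ℝ, 1 < r → r ≤ r' →
      ∮ y in C(0, r'), x α (i, y) * ϕ y = ∮ y in C(0, r), x α (i, y) * ϕ y := by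
    intro r r' hr hrr'
    refine Complex.circleIntegral_eq_of_differentiable_on_annulus_off_countable (by linarith) hrr'
      Set.countable_empty (fun y hy => (hd y ?_).continuousAt.continuousWithinAt)
      fun y hy => hd y ?_
    · have := hy.2
      rw [mem_ball_zero_iff, not_lt] at this
      linarith
    · have := hy.1.2
      rw [mem_closedBall_zero_iff, not_le] at this
      linarith
  have h4 : ∮ y in C(0, R), x α (i, y) * ϕ y = ∮ y in C(0, 4), x α (i, y) * ϕ y := by
    rcases le_total R 4 with h | h
    · exact (hann R 4 hR h).symm
    · exact hann 4 R (by norm_num) h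
  rw [h4]
  set f : ℕ → ℂ → ℂ := fun p y => ε p * ((x α (i, y) ^ p)⁻¹ * dx α (i, y)) with hf
  have hρ := root_ne_zero hi
  have hmem : ∀ y ∈ Metric.sphere (0 : ℂ) 4, 3 < ‖y‖ := fun y hy => by
    rw [mem_sphere_zero_iff_norm] at hy
    rw [hy]; norm_num
  have hfsum : ∀ y, 3 < ‖y‖ → HasSum (fun p => f p y) (x α (i, y) * ϕ y) := fun y hy => by
    refine ((hsum y hy).mul_left (x α (i, y))).congr_fun fun p => ?_
    have := x_ne_zero hi hy
    rw [hf, pow_succ]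
    field_simp
  have hcont : ∀ p, ContinuousOn (f p) (Metric.sphere 0 4) := fun p y hy => by
    have h3 := hmem y hy
    have hy0 := ne_zero_of_three_lt h3
    have h5 := ((analyticOnNhd_x α i) y hy0).continuousAt
    exact (continuousAt_const.mul (((h5.pow p).inv₀ (pow_ne_zero p (x_ne_zero hi h3))).mul
      ((analyticOnNhd_dx α i) y hy0).continuousAt)).continuousWithinAt
  -- on the circle, `|x|` is minimal at `4 i`
  set y₀ : ℂ := 4 * Complex.I with hy₀
  have hn₀ : ‖y₀‖ = 4 := by simp [hy₀]
  have h3₀ : 3 < ‖y₀‖ := by rw [hn₀]; norm_num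
  have hx₀ : ‖x α (i, y₀)‖ = (15 / 4) / ‖root α i‖ := by
    have h5 : y₀ + y₀⁻¹ = (15 / 4 : ℝ) * Complex.I := by
      rw [hy₀, mul_inv, Complex.inv_I]
      push_cast
      ring
    rw [x, norm_div, h5, norm_mul, Complex.norm_I, Complex.norm_real]
    norm_num
  have hdx₀ : ‖dx α (i, y₀)‖ = (17 / 16) / ‖root α i‖ := by
    have h5 : 1 - (y₀ ^ 2)⁻¹ = ((17 / 16 : ℝ) : ℂ) := by
      rw [hy₀, mul_pow, Complex.I_sq]
      push_cast
      norm_num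
    rw [dx, norm_div, h5, Complex.norm_real]
    norm_num
  have hbound : ∀ p y, y ∈ Metric.sphere (0 : ℂ) 4 → ‖f p y‖ ≤ ‖f p y₀‖ := by
    intro p y hy
    have h3 := hmem y hy
    rw [mem_sphere_zero_iff_norm] at hy
    have hy' : ‖y⁻¹‖ = 1 / 4 := by rw [norm_inv, hy]; norm_num
    have h5 : ‖x α (i, y₀)‖ ≤ ‖x α (i, y)‖ := by
      rw [hx₀, x, norm_div]
      refine div_le_div_of_nonneg_right ?_ (norm_nonneg _)
      have := norm_sub_norm_le y (-y⁻¹)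
      rw [norm_neg, sub_neg_eq_add, hy, hy'] at this
      linarith
    have h6 : ‖dx α (i, y)‖ ≤ ‖dx α (i, y₀)‖ := by
      rw [hdx₀, dx, norm_div]
      refine div_le_div_of_nonneg_right ((norm_sub_le _ _).trans ?_) (norm_nonneg _)
      rw [norm_one, norm_inv, norm_pow, hy]
      norm_num
    have h7 : 0 < ‖x α (i, y₀)‖ := norm_pos_iff.2 (x_ne_zero hi h3₀)
    simp only [hf, norm_mul, norm_inv, norm_pow]
    gcongr
  have hunif := tendstoUniformlyOn_tsum_nat (hfsum y₀ h3₀).summable.norm hbound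
  have hlim := hunif.tendsto_circleIntegral_of_continuousOn (by norm_num)
    (Eventually.of_forall fun N => continuousOn_finsetSum _ fun p _ => hcont p)
  have hval : ∀ N, 2 ≤ N → ∮ y in C(0, 4), ∑ p ∈ range N, f p y =
      ε 1 * (2 * Real.pi * Complex.I) := by
    intro N hN
    rw [circleIntegral.integral_fun_sum fun p _ => (hcont p).circleIntegrable (by norm_num)]
    simp only [hf, circleIntegral.integral_const_mul, integral_pow_dx hi]
    rw [Finset.sum_eq_single 1, if_pos rfl]
    · intro p _ hp
      rw [if_neg hp, mul_zero]
    · intro h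
      exact absurd (Finset.mem_range.2 hN) h
  have hlim' : Tendsto (fun N => ∮ y in C(0, 4), ∑ p ∈ range N, f p y) atTop
      (nhds (ε 1 * (2 * Real.pi * Complex.I))) :=
    tendsto_const_nhds.congr' ((eventually_ge_atTop 2).mono fun N hN => (hval N hN).symm)
  have h5 : ∮ y in C(0, 4), ∑' p, f p y = ∮ y in C(0, 4), x α (i, y) * ϕ y :=
    circleIntegral.integral_congr (by norm_num) fun y hy => (hfsum y (hmem y hy)).tsum_eq
  rw [← h5, tendsto_nhds_unique hlim hlim']
  field_simp [Complex.I_ne_zero, Real.pi_ne_zero]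

end contour

/-- The operator `𝒪` acts on the correlation forms by insertion of traces. -/
theorem opO_omega {α : Fin 6 → ℂ} (hα : ∀ c, ‖α c‖ < 1) (hα2 : ‖∑ c, α c ^ 2‖ < 1) (g : ℕ) {n : ℕ}
    (P : Fin n → Curve) (h : 2 < 2 * g + (n + 1)) (hP : ∀ j, (P j).2 ∈ regular) {R : ℝ} (hR : 1 < R)
    {Q : Curve} (hQ : Q.2 ≠ 0) :
    opO α R (fun Q => omega α g (Fin.cons Q P : Fin (n + 1) → Curve)) Q =
      (∑ c ∈ univ.erase Q.1, α Q.1 * α c * mixed α g (fun _ : Unit => c) (fun _ => 1)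
        (fun j => (P j).1) (fun j => (P j).2)) * dx α Q := by
  obtain ⟨i, z₀⟩ := Q
  have hR0 : 0 ≤ R := by linarith
  have h1 : ∀ c : Fin 6, (2 * (Real.pi : ℂ) * Complex.I)⁻¹ *
      ∮ y in C(0, R), x α (c, y) * omega α g (Fin.cons (c, y) P : Fin (n + 1) → Curve) =
      mixed α g (fun _ : Unit => c) (fun _ => 1) (fun j => (P j).1) (fun j => (P j).2) := by
    intro c
    obtain ⟨m, ε, ϕ, -, hϕ, hsum, -, hω, hε, -⟩ :=
      exists_omega_cons hα hα2 g (fun j => (P j).1) c (by omega) (by omega)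
    set M : ℕ → ℂ := fun r => mixed α g (fun _ : Unit => c) (fun _ => r)
      (fun j => (P j).1) (fun j => (P j).2) with hM
    have h2 : Set.EqOn (fun y => x α (c, y) * omega α g (Fin.cons (c, y) P : Fin (n + 1) → Curve))
        (fun y => ∑ r : Fin m, M r * (x α (c, y) * ϕ r y)) (Metric.sphere 0 R) := by
      intro y hy
      rw [mem_sphere_zero_iff_norm] at hy
      have hreg : y ∈ regular := by
        refine ⟨?_, ?_, ?_⟩ <;> (rintro rfl; norm_num at hy; linarith)
      have h3 : omega α g (Fin.cons (c, y) P : Fin (n + 1) → Curve) = ∑ r : Fin m, ϕ r y * M r :=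
        hω y hreg (fun j => (P j).2) hP
      dsimp only
      rw [h3, Finset.mul_sum]
      exact Finset.sum_congr rfl fun r _ => by ring
    have hint : ∀ r : Fin m, CircleIntegrable (fun y => M r * (x α (c, y) * ϕ r y)) 0 R := by
      intro r
      refine ContinuousOn.circleIntegrable hR0 fun y hy => ?_
      rw [mem_sphere_zero_iff_norm] at hy
      have hreg : y ∈ regular := by
        refine ⟨?_, ?_, ?_⟩ <;> (rintro rfl; norm_num at hy; linarith)
      exact (continuousAt_const.mul ((hasDerivAt_x α c hreg.1).continuousAt.mul
        (hϕ r y hreg).continuousAt)).continuousWithinAt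
    rw [circleIntegral.integral_congr hR0 h2, circleIntegral.integral_fun_sum fun r _ => hint r,
      Finset.mul_sum]
    refine Eq.trans (Finset.sum_congr rfl fun r _ => ?_) (hε 1 (fun j => (P j).2) hP).symm
    rw [circleIntegral.integral_const_mul, ← integral_x_mul (sq_ne_one hα c) (hϕ r) (hsum r) hR]
    ring
  have h0 : ∮ _ in C(0, R), (0 : ℂ) = 0 := by simp [circleIntegral]
  rw [opO, ← Finset.add_sum_erase univ _ (mem_univ i), Finset.sum_mul]
  have h2 : ∀ y, (fun z => q α (i, z) (i, y)) = fun _ => 0 := fun y => by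
    funext z; rw [q, if_pos rfl]
  simp only [h2, deriv_const, zero_mul, h0, mul_zero, zero_add]
  refine Finset.sum_congr rfl fun c hc => ?_
  have hc' : i ≠ c := (Finset.ne_of_mem_erase hc).symm
  have h3 : ∀ y, deriv (fun z => q α (i, z) (c, y)) z₀ = α i * α c * dx α (i, z₀) * x α (c, y) := by
    intro y
    have h4 : (fun z => q α (i, z) (c, y)) = fun z => x α (i, z) * (α i * α c * x α (c, y)) := by
      funext z
      rw [q, if_neg hc']
      ring
    rw [h4, ((hasDerivAt_x α i hQ).mul_const _).deriv]
    ring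
  simp only [h3, mul_assoc]
  rw [circleIntegral.integral_const_mul, circleIntegral.integral_const_mul,
    circleIntegral.integral_const_mul, ← h1 c]
  ring

end QuarticTensor

namespace QuarticTensor

/-! ### The leading terms of the effective potential -/

section singleton

variable {α : Fin 6 → ℂ} {n : ℕ} {c : Fin n → Fin 6} {i e : Fin 6} {π : ColorPartition i}
  {J : Fin n → π.parts} {s : (Fin 6 → ℕ) × (π.parts → ℕ)} {B : π.parts}

theorem labels_block (hB : B.1 = {e}) :
    labels (fun e : {c : Fin 6 // c ∈ B.1} => e.1) (fun e => s.1 e.1) = {(e, s.1 e)} := by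
  rw [labels, Finset.univ_eq_attach, Finset.attach_val]
  refine (Multiset.attach_map_val' B.1.val fun c => (c, s.1 c)).trans ?_
  rw [hB]
  rfl

theorem w_block (hB : B.1 = {e}) (p : {j : Fin n // J j = B} → ℕ) :
    w α (s.2 B) (Sum.elim (fun e : {c : Fin 6 // c ∈ B.1} => e.1) fun j => c j.1)
      (Sum.elim (fun e => s.1 e.1) p) =
      PowerSeries.coeff (s.2 B) (energy α ((e, s.1 e) ::ₘ
        labels (fun j : {j : Fin n // J j = B} => c j.1) p)) := by
  have : Nonempty ({c : Fin 6 // c ∈ B.1} ⊕ {j : Fin n // J j = B}) :=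
    ⟨Sum.inl ⟨e, hB ▸ Finset.mem_singleton_self e⟩⟩
  rw [w_eq_labels, labels_block hB, Multiset.singleton_add]

theorem coeff_energy_zero_cons (hα : ∀ c, ‖α c‖ < 1) (hα2 : ‖∑ c, α c ^ 2‖ < 1) (e : Fin 6) (g : ℕ)
    (l : Multiset (Fin 6 × ℕ)) : PowerSeries.coeff g (energy α ((e, 0) ::ₘ l)) =
      if g = 0 ∧ l = 0 then 1 else 0 := by
  rw [← Egf.D_apply (e, 0) (energy α) l, D_zero_energy hα hα2, Egf.one_apply]
  by_cases hl : l = 0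
  · simp [hl, PowerSeries.coeff_one]
  · simp [hl]

/-- A trace `tr 1` has no correlations. -/
theorem blockForm_eq_zero (hα : ∀ c, ‖α c‖ < 1) (hα2 : ‖∑ c, α c ^ 2‖ < 1) (hB : B.1 = {e})
    (he : s.1 e = 0) (h : s.2 B ≠ 0 ∨ Nonempty {j : Fin n // J j = B})
    {z : {j : Fin n // J j = B} → ℂ} (hz : ∀ j, z j ∈ regular) : blockForm α c J s B z = 0 := by
  refine mixed_eqOn (f := fun _ => 0) ⟨analyticOnNhd_const, 0, fun z _ => ?_⟩ hz
  refine hasSum_zero.congr_fun fun p => ?_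
  rw [w_block hB, he, coeff_energy_zero_cons hα hα2, if_neg, zero_mul]
  rintro ⟨h1, h2⟩
  rcases h with h | ⟨⟨j⟩⟩
  · exact h h1
  · rw [labels_eq_cons _ _ j] at h2
    exact Multiset.cons_ne_zero h2

theorem blockForm_eq_one (hα : ∀ c, ‖α c‖ < 1) (hα2 : ‖∑ c, α c ^ 2‖ < 1) (hB : B.1 = {e})
    (he : s.1 e = 0) (h : s.2 B = 0) (hJ : ∀ j, J j ≠ B)
    (z : {j : Fin n // J j = B} → ℂ) : blockForm α c J s B z = 1 := by
  have : IsEmpty {j : Fin n // J j = B} := ⟨fun j => hJ j.1 j.2⟩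
  refine mixed_eqOn (f := fun _ => 1) ⟨analyticOnNhd_const, 0, fun z _ => ?_⟩ fun j => isEmptyElim j
  have h1 : HasSum (fun _ : {j : Fin n // J j = B} → ℕ => (1 : ℂ)) 1 :=
    hasSum_unique _
  refine h1.congr_fun fun p => ?_
  rw [w_block hB, he, coeff_energy_zero_cons hα hα2, labels_of_isEmpty, if_pos ⟨h, rfl⟩,
    Fintype.prod_empty, mul_one]

/-- If all the points are attributed to a block with one color. -/
theorem blockForm_eq_mixed (hα : ∀ c, ‖α c‖ < 1) (hα2 : ‖∑ c, α c ^ 2‖ < 1) (hB : B.1 = {e})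
    (hJ : ∀ j, J j = B) {z : Fin n → ℂ} (hz : ∀ j, z j ∈ regular) :
    blockForm α c J s B (fun j => z j.1) =
      mixed α (s.2 B) (fun _ : Unit => e) (fun _ => s.1 e) c z := by
  obtain ⟨f, hf⟩ := exists_isContinuation hα hα2 (s.2 B) (fun _ : Unit => e) (fun _ => s.1 e) c
    (by simp)
  have hm := isContinuation_mixed hf
  let E : {j : Fin n // J j = B} ≃ Fin n := Equiv.subtypeUnivEquiv hJ
  refine mixed_eqOn (f := fun y => mixed α (s.2 B) (fun _ : Unit => e) (fun _ => s.1 e) c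
    fun j => y (E.symm j)) ⟨fun y hy => ?_, ?_⟩ fun j => hz j.1
  · exact AnalyticAt.comp (f := fun (y : {j : Fin n // J j = B} → ℂ) (j : Fin n) => y (E.symm j))
      (hm.1 _ fun j => hy (E.symm j))
      ((ContinuousLinearMap.pi fun j : Fin n =>
        (ContinuousLinearMap.proj (E.symm j) : ({j : Fin n // J j = B} → ℂ) →L[ℂ] ℂ)).analyticAt y)
  · obtain ⟨R, hR⟩ := hm.2
    refine ⟨R, fun y hy => ?_⟩
    have h1 := (E.arrowCongr (Equiv.refl ℕ)).hasSum_iff.2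
      (hR (fun j => y (E.symm j)) fun j => hy (E.symm j))
    refine h1.congr_fun fun p => ?_
    rw [w_block hB, Function.comp_apply, w_eq_labels]
    have h2 : labels c (E.arrowCongr (Equiv.refl ℕ) p) =
        labels (fun j : {j : Fin n // J j = B} => c j.1) p := by
      rw [labels_eq_sum, labels_eq_sum, ← E.sum_comp]
      refine Finset.sum_congr rfl fun j _ => ?_
      simp [Equiv.arrowCongr, E]
    have h3 : ∏ j, (x α (c j, y (E.symm j)) ^ ((E.arrowCongr (Equiv.refl ℕ)) p j + 1))⁻¹ *
        dx α (c j, y (E.symm j)) = ∏ j : {j : Fin n // J j = B},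
          (x α (c j.1, y j) ^ (p j + 1))⁻¹ * dx α (c j.1, y j) := by
      rw [← E.prod_comp]
      refine Finset.prod_congr rfl fun j _ => ?_
      simp [Equiv.arrowCongr, E]
    rw [h3, h2]
    rfl

end singleton

section top

variable {α : Fin 6 → ℂ} {n g : ℕ} {i : Fin 6}

theorem mem_loopIndex {π : ColorPartition i} {s : (Fin 6 → ℕ) × (π.parts → ℕ)}
    (h : s ∈ loopIndex g π) : 1 ≤ s.1 i ∧ 2 ≤ ∑ c, s.1 c ∧
      ∑ B, s.2 B + ∑ c, s.1 c + 3 = g + π.parts.card :=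
  (Finset.mem_filter.1 h).2

theorem sum_card_block (π : ColorPartition i) : ∑ B : π.parts, B.1.card = 5 := by
  rw [Finset.sum_coe_sort π.parts Finset.card, π.sum_card_parts,
    Finset.card_erase_of_mem (mem_univ i)]
  rfl

theorem sum_card_fiber {π : ColorPartition i} (J : Fin n → π.parts) :
    ∑ B : π.parts, Fintype.card {j : Fin n // J j = B} = n := by
  have := Fintype.sum_fiberwise J fun _ => 1
  simpa using this

/-- In a term with a correlation of maximal level, all the other factors are trivial. -/
theorem IsTopTerm.exists_block {π : ColorPartition i} {J : Fin n → π.parts}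
    {s : (Fin 6 → ℕ) × (π.parts → ℕ)} (h : IsTopTerm g π J s) (hs : s ∈ loopIndex g π) :
    (∀ B : π.parts, B.1.card = 1) ∧ ∑ c, s.1 c = 2 ∧
      ∃ B : π.parts, (∀ j, J j = B) ∧ s.2 = Pi.single B g := by
  obtain ⟨hi, h2, hsum⟩ := mem_loopIndex hs
  obtain ⟨B, hB⟩ := h
  have hπ := card_parts_le π
  have h1 : ∀ B : π.parts, 1 ≤ B.1.card := fun B =>
    Finset.card_pos.2 (π.nonempty_of_mem_parts B.2)
  have e1 := sum_card_block π
  have e2 := sum_card_fiber J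
  have hcard : (univ.erase B).card + 1 = π.parts.card := by
    rw [Finset.card_erase_add_one (mem_univ B), Finset.card_univ, Fintype.card_coe]
  rw [← Finset.add_sum_erase _ _ (mem_univ B)] at e1 e2 hsum
  have h3 : (univ.erase B).card ≤ ∑ B' ∈ univ.erase B, B'.1.card := by
    simpa using Finset.card_nsmul_le_sum (univ.erase B) (fun B' : π.parts => B'.1.card) 1
      fun B' _ => h1 B'
  have hBc := h1 B
  -- Summed over all the blocks, `2 h_B + |B| + |J⁻¹ B|` is `2 g + n + 1 + 2 (|π| - 1 - ∑_c a_c)`,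
  -- so the blocks other than `B` contribute `2 (|π| - 1 - ∑_c a_c)`. As they contribute at least
  -- `|π| - 1`, it follows that `|π| - 1 ≥ 2 ∑_c a_c ≥ 4`. Since `|π| ≤ 5`, all of these are
  -- equalities.
  have f1 : ∑ B' ∈ univ.erase B, s.2 B' = 0 := by omega
  have f2 : ∑ B' ∈ univ.erase B, Fintype.card {j : Fin n // J j = B'} = 0 := by omega
  have f3 : π.parts.card = 5 := by omega
  have f4 : s.2 B = g := by omega
  refine ⟨?_, by omega, B, fun j => ?_, ?_⟩
  · have h4 : ∑ B' : π.parts, 1 = ∑ B' : π.parts, B'.1.card := by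
      rw [sum_card_block, Finset.sum_const, Finset.card_univ, Fintype.card_coe, f3]
      rfl
    have h5 := (Finset.sum_eq_sum_iff_of_le fun B' _ => h1 B').1 h4
    exact fun B' => (h5 B' (mem_univ _)).symm
  · by_contra hj
    have h4 := Finset.sum_eq_zero_iff.1 f2 (J j) (Finset.mem_erase.2 ⟨hj, mem_univ _⟩)
    exact (Fintype.card_eq_zero_iff.1 h4).false ⟨j, rfl⟩
  · funext B'
    by_cases hB' : B' = B
    · rw [hB', Pi.single_eq_same, f4]
    · rw [Pi.single_eq_of_ne hB', Finset.sum_eq_zero_iff.1 f1 B'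
        (Finset.mem_erase.2 ⟨hB', mem_univ _⟩)]

/-- The block of the color `c` in the partition into singletons. -/
def singletonBlock {i c : Fin 6} (hc : c ∈ univ.erase i) : (⊥ : ColorPartition i).parts :=
  ⟨{c}, Finpartition.mem_bot_iff.2 ⟨c, hc, rfl⟩⟩

theorem exists_singletonBlock (B : (⊥ : ColorPartition i).parts) :
    ∃ (c : Fin 6) (hc : c ∈ univ.erase i), B = singletonBlock hc := by
  obtain ⟨c, hc, h⟩ := Finpartition.mem_bot_iff.1 B.2
  exact ⟨c, hc, Subtype.ext h.symm⟩

theorem eq_bot_of_card_eq_one {π : ColorPartition i} (h : ∀ B : π.parts, B.1.card = 1) : π = ⊥ := by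
  refine le_antisymm (fun B hB => ?_) bot_le
  obtain ⟨c, hc⟩ := Finset.card_eq_one.1 (h ⟨B, hB⟩)
  have hc' : c ∈ univ.erase i := π.le hB (by
    rw [show B = {c} from hc]
    exact Finset.mem_singleton_self c)
  exact ⟨{c}, Finpartition.mem_bot_iff.2 ⟨c, hc', rfl⟩, hc.le⟩

theorem sum_single_add_single {c : Fin 6} :
    ∑ d, (Pi.single c 1 + Pi.single i 1 : Fin 6 → ℕ) d = 2 := by
  simp [Finset.sum_add_distrib]

theorem eq_single_add_single {a : Fin 6 → ℕ} {c : Fin 6} (hc : c ≠ i) (h : ∑ d, a d = 2)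
    (hi : 1 ≤ a i) (hac : a c ≠ 0) : a = Pi.single c 1 + Pi.single i 1 := by
  have hle : ∀ d, (Pi.single c 1 + Pi.single i 1 : Fin 6 → ℕ) d ≤ a d := by
    intro d
    by_cases h1 : d = c
    · subst h1
      simp [hc]
      omega
    · by_cases h2 : d = i
      · subst h2
        simp [h1, hi]
      · simp [h1, h2]
  funext d
  exact ((Finset.sum_eq_sum_iff_of_le fun d _ => hle d).1
    (sum_single_add_single.trans h.symm) d (mem_univ d)).symm

open Classical in
/-- The terms with a correlation of maximal level are bilinear in the couplings: one factor is the
correlation with one inserted trace, the others are `tr 1`. -/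
theorem sum_topTerm (hα : ∀ c, ‖α c‖ < 1) (hα2 : ‖∑ c, α c ^ 2‖ < 1) (h : 2 < 2 * g + (n + 1))
    (i : Fin 6) (z₀ : ℂ) (c : Fin n → Fin 6) {z : Fin n → ℂ} (hz : ∀ j, z j ∈ regular) :
    ∑ π : ColorPartition i, ∑ J : Fin n → π.parts,
      ∑ s ∈ (loopIndex g π).filter (fun s => IsTopTerm g π J s),
        loopTerm α (i, z₀) (fun j => (c j, z j)) π J s =
      -∑ e ∈ univ.erase i, α i * α e * mixed α g (fun _ : Unit => e) (fun _ => 1) c z := by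
  rw [Finset.sum_eq_single (⊥ : ColorPartition i)]
  rotate_left
  · intro π _ hπ
    refine Finset.sum_eq_zero fun J _ => Finset.sum_eq_zero fun s hs => ?_
    obtain ⟨hs1, hs2⟩ := Finset.mem_filter.1 hs
    exact absurd (eq_bot_of_card_eq_one (hs2.exists_block hs1).1) hπ
  · exact fun h => absurd (mem_univ _) h
  rw [Finset.sum_sigma', ← Finset.sum_neg_distrib, ← Finset.sum_coe_sort (univ.erase i)]
  symm
  refine Finset.sum_of_injOn (fun e : {e // e ∈ univ.erase i} =>
    ⟨fun _ => singletonBlock e.2, (Pi.single e.1 1 + Pi.single i 1,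
      Pi.single (singletonBlock e.2) g)⟩) ?_ ?_ ?_ ?_
  · intro e _ e' _ hee
    have h1 := congrArg (fun t : Σ _ : Fin n → (⊥ : ColorPartition i).parts,
      (Fin 6 → ℕ) × ((⊥ : ColorPartition i).parts → ℕ) => t.2.1 e.1) hee
    have h2 : e.1 ≠ i := Finset.ne_of_mem_erase e.2
    by_contra hne
    have h3 : e.1 ≠ e'.1 := fun h => hne (Subtype.ext h)
    simp [h2, h3] at h1
  · intro e _
    have h2 : e.1 ≠ i := Finset.ne_of_mem_erase e.2
    have hs2 :
        ∑ B, (Pi.single (singletonBlock e.2) g : (⊥ : ColorPartition i).parts → ℕ) B = g := by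
      simp
    have hcard : (⊥ : ColorPartition i).parts.card = 5 := by
      rw [Finpartition.parts_bot, Finset.card_map, Finset.card_erase_of_mem (mem_univ i)]
      rfl
    rw [Finset.mem_coe, Finset.mem_sigma, Finset.mem_filter, loopIndex, Finset.mem_filter,
      Finset.mem_product, Fintype.mem_piFinset, Fintype.mem_piFinset]
    dsimp only
    refine ⟨mem_univ _, ⟨⟨fun d => Finset.mem_range.2 ?_, fun B => Finset.mem_range.2 ?_⟩, ?_, ?_,
      ?_⟩,
      singletonBlock e.2, ?_⟩
    · have := Finset.single_le_sum (f := (Pi.single e.1 1 + Pi.single i 1 : Fin 6 → ℕ))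
        (fun _ _ => Nat.zero_le _) (mem_univ d)
      have h3 := sum_single_add_single (i := i) (c := e.1)
      omega
    · have := Finset.single_le_sum (f := (Pi.single (singletonBlock e.2) g :
        (⊥ : ColorPartition i).parts → ℕ)) (fun _ _ => Nat.zero_le _) (mem_univ B)
      omega
    · simp
    · rw [sum_single_add_single]
    · rw [sum_single_add_single, hs2, hcard]
    · have h3 : (singletonBlock e.2).1.card = 1 := Finset.card_singleton _
      simp [h3]
      omega
  · rintro ⟨J, s⟩ hs hns
    obtain ⟨hs1, hs2⟩ := Finset.mem_filter.1 (Finset.mem_sigma.1 hs).2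
    obtain ⟨-, ha, B, hJ, hsB⟩ := hs2.exists_block hs1
    obtain ⟨e, he, rfl⟩ := exists_singletonBlock B
    dsimp only at ha hJ hsB ⊢
    -- a top term not in the image has `tr 1` in the block that carries the points, and vanishes
    have hae : s.1 e = 0 := by
      by_contra hae
      refine hns ⟨⟨e, he⟩, mem_univ _, ?_⟩
      have h1 := eq_single_add_single (Finset.ne_of_mem_erase he) ha (mem_loopIndex hs1).1 hae
      have h2 : J = fun _ => singletonBlock he := funext hJ
      subst h2
      dsimp only
      rw [← h1, ← hsB]
    rw [loopTerm_eq]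
    refine mul_eq_zero_of_right _ (Finset.prod_eq_zero (mem_univ (singletonBlock he)) ?_)
    refine blockForm_eq_zero hα hα2 rfl hae ?_ fun j => hz j.1
    rw [hsB, Pi.single_eq_same]
    rcases Nat.eq_zero_or_pos g with hg | hg
    · exact Or.inr ⟨⟨⟨0, by omega⟩, hJ _⟩⟩
    · exact Or.inl hg.ne'
  · intro e _
    have h2 : e.1 ≠ i := Finset.ne_of_mem_erase e.2
    set s : (Fin 6 → ℕ) × ((⊥ : ColorPartition i).parts → ℕ) :=
      (Pi.single e.1 1 + Pi.single i 1, Pi.single (singletonBlock e.2) g) with hs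
    have he : s.1 e.1 = 1 := by simp [hs, h2]
    have hi : s.1 i = 1 := by simp [hs, h2.symm]
    have ht : (s.1 i : ℂ) * tTilde α s.1 = -(α i * α e.1) := by
      rw [← vert_single, ← tTilde_add_single]
      ring
    have hg : s.2 (singletonBlock e.2) = g := Pi.single_eq_same _ _
    change _ = loopTerm α (i, z₀) (fun j => (c j, z j)) ⊥ (fun _ => singletonBlock e.2) s
    rw [loopTerm_eq, ht, hi, Nat.sub_self, pow_zero, mul_one,
      Finset.prod_eq_single (singletonBlock e.2), blockForm_eq_mixed hα hα2 rfl (fun _ => rfl) hz,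
        he,
      hg, neg_mul]
    · intro B _ hB
      obtain ⟨d, hd, rfl⟩ := exists_singletonBlock B
      have hde : d ≠ e.1 := fun h => hB (Subtype.ext (congrArg singleton h))
      refine blockForm_eq_one hα hα2 rfl ?_ ?_ (fun j => hB.symm) _
      · simp [hs, hde, Finset.ne_of_mem_erase hd]
      · rw [hs]
        exact Pi.single_eq_of_ne hB _
    · exact fun h => absurd (mem_univ _) h

theorem ell_eq (hα : ∀ c, ‖α c‖ < 1) (hα2 : ‖∑ c, α c ^ 2‖ < 1) (h : 2 < 2 * g + (n + 1))
    (Q : Curve) {P : Fin n → Curve} (hP : ∀ j, (P j).2 ∈ regular) :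
    ell α g Q P = ellPrime α g Q P + (∑ e ∈ univ.erase Q.1, α Q.1 * α e *
      mixed α g (fun _ : Unit => e) (fun _ => 1) (fun j => (P j).1) (fun j => (P j).2)) *
        dx α Q := by
  classical
  have h1 := sum_topTerm hα hα2 h Q.1 Q.2 (fun j => (P j).1) hP
  have h2 : ∑ π : ColorPartition Q.1, ∑ J : Fin n → π.parts, ∑ s ∈ loopIndex g π,
      loopTerm α Q P π J s =
      ∑ π : ColorPartition Q.1, ∑ J : Fin n → π.parts,
        ∑ s ∈ (loopIndex g π).filter (fun s => IsTopTerm g π J s), loopTerm α Q P π J s +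
      ∑ π : ColorPartition Q.1, ∑ J : Fin n → π.parts,
        ∑ s ∈ (loopIndex g π).filter (fun s => ¬ IsTopTerm g π J s), loopTerm α Q P π J s := by
    simp only [← Finset.sum_add_distrib, Finset.sum_filter_add_sum_filter_not]
  have h3 : ∑ π : ColorPartition Q.1, ∑ J : Fin n → π.parts,
      ∑ s ∈ (loopIndex g π).filter (fun s => IsTopTerm g π J s), loopTerm α Q P π J s = _ := h1
  rw [ell, h2, h3, ellPrime]
  ring

end top

end QuarticTensor

namespace QuarticTensor

/-! ### The global loop equations and holomorphy -/

section global

variable {α : Fin 6 → ℂ} {n g : ℕ} {P : Fin n → Curve}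

/-- The global linear loop equations: the operator `𝒪` accounts for the terms with a correlation of
maximal level. -/
theorem opS_omega_add_opO_omega_add_ellPrime (hα : ∀ c, ‖α c‖ < 1) (hα2 : ‖∑ c, α c ^ 2‖ < 1)
    (h : 2 < 2 * g + (n + 1)) (hP : ∀ j, (P j).2 ∈ regular) {R : ℝ} (hR : 1 < R) {Q : Curve}
    (hQ : Q.2 ∈ regular) :
    opS (fun Q => omega α g (Fin.cons Q P : Fin (n + 1) → Curve)) Q +
      opO α R (fun Q => omega α g (Fin.cons Q P : Fin (n + 1) → Curve)) Q +
        ellPrime α g Q P = 0 := by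
  have h1 := opS_omega_add_ell hα hα2 g Q P (by omega) (by omega) hQ hP
  rw [ell_eq hα hα2 h Q hP] at h1
  rw [opO_omega hα hα2 g P h hP hR hQ.1]
  linear_combination h1

theorem analyticOnNhd_loopTerm (α : Fin 6 → ℂ) (P : Fin n → Curve) {i : Fin 6}
    (π : ColorPartition i) (J : Fin n → π.parts) (s : (Fin 6 → ℕ) × (π.parts → ℕ)) :
    AnalyticOnNhd ℂ (fun z => loopTerm α (i, z) P π J s) {0}ᶜ := by
  have h : (fun z => loopTerm α (i, z) P π J s) = fun z =>
      (s.1 i : ℂ) * tTilde α s.1 * x α (i, z) ^ (s.1 i - 1) *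
        ∏ B, blockForm α (fun j => (P j).1) J s B fun j => (P j.1).2 :=
    funext fun z => loopTerm_eq (fun j => (P j).1) z J s fun j => (P j).2
  have h2 : AnalyticOnNhd ℂ (fun z => x α (i, z) ^ (s.1 i - 1)) {0}ᶜ :=
    (analyticOnNhd_x α i).fun_pow _
  rw [h]
  exact (analyticOnNhd_const.mul h2).mul analyticOnNhd_const

theorem analyticOnNhd_sum_loopTerm (α : Fin 6 → ℂ) (P : Fin n → Curve) (i : Fin 6)
    (I : ∀ π : ColorPartition i, (Fin n → π.parts) → Finset ((Fin 6 → ℕ) × (π.parts → ℕ))) :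
    AnalyticOnNhd ℂ (fun z => -(∑ π : ColorPartition i, ∑ J : Fin n → π.parts, ∑ s ∈ I π J,
      loopTerm α (i, z) P π J s) * dx α (i, z)) {0}ᶜ :=
  (AnalyticOnNhd.neg (Finset.analyticOnNhd_fun_sum _ fun π _ =>
    Finset.analyticOnNhd_fun_sum _ fun J _ => Finset.analyticOnNhd_fun_sum _ fun s _ =>
      analyticOnNhd_loopTerm α P π J s)).mul (analyticOnNhd_dx α i)

theorem analyticOnNhd_ell_left (α : Fin 6 → ℂ) (g : ℕ) (P : Fin n → Curve) (i : Fin 6) :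
    AnalyticOnNhd ℂ (fun z => ell α g (i, z) P) {0}ᶜ :=
  analyticOnNhd_sum_loopTerm α P i fun π _ => loopIndex g π

open Classical in
theorem analyticOnNhd_ellPrime_left (α : Fin 6 → ℂ) (g : ℕ) (P : Fin n → Curve) (i : Fin 6) :
    AnalyticOnNhd ℂ (fun z => ellPrime α g (i, z) P) {0}ᶜ :=
  analyticOnNhd_sum_loopTerm α P i fun π J => (loopIndex g π).filter fun s => ¬ IsTopTerm g π J s

/-- The form `l` vanishes at the zeros of `dx`. -/
theorem ell_eq_zero (α : Fin 6 → ℂ) (g : ℕ) (P : Fin n → Curve) (i : Fin 6) {z : ℂ}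
    (hz : z ^ 2 = 1) : ell α g (i, z) P = 0 := by
  have h : dx α (i, z) = 0 := by rw [dx, hz, inv_one, sub_self, zero_div]
  rw [ell, h, mul_zero]

end global

end QuarticTensor

end

theorem mainTheorem3 (α : Fin 6 → ℂ) (hα : ∀ c, ‖α c‖ < 1) (hα2 : ‖∑ c, α c ^ 2‖ < 1) :
    -- the topological expansion exists in each degree in `α`, and each genus sums up
    (∀ (n : ℕ) (c : Fin (n + 1) → Fin 6) (p : Fin (n + 1) → ℕ),
      (∀ k, ∃ u, IsTopExpansion (n + 1) (fun N => PowerSeries.coeff k (cumulant N α c p)) u) ∧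
      ∀ g, Summable (wCoeff α g c p)) ∧
    -- the correlations extend analytically to the spectral curve
    (∀ (g m n : ℕ) (b : Fin m → Fin 6) (a : Fin m → ℕ) (c : Fin n → Fin 6),
      ¬ (g = 0 ∧ m = 0 ∧ n = 2 ∧ ∀ j k, c j = c k) →
      IsContinuation α g b a c (mixed α g b a c)) ∧
    (∀ (g n : ℕ) (c : Fin n → Fin 6), ¬ (g = 0 ∧ n = 2 ∧ ∀ j k, c j = c k) →
      IsContinuation α g (κ := Empty) Empty.elim Empty.elim c
        (fun z => omega α g (fun j => (c j, z j)))) ∧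
    -- the explicit linear loop equations, for every color of every variable
    (∀ (g n : ℕ) (Q : Curve) (P : Fin n → Curve),
      ¬ (g = 0 ∧ n = 0) → ¬ (g = 0 ∧ n = 1 ∧ ∀ j, (P j).1 = Q.1) →
      Q.2 ∈ regular → (∀ j, (P j).2 ∈ regular) →
      opS (fun Q => omega α g (Fin.cons Q P : Fin (n + 1) → Curve)) Q + ell α g Q P = 0) ∧
    -- the global linear loop equations, and the behaviour of `l'` and of `S ω`
    (∀ (g n : ℕ) (P : Fin n → Curve), 2 < 2 * g + (n + 1) → (∀ j, (P j).2 ∈ regular) →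
      (∀ (R : ℝ) (Q : Curve), 1 < R → Q.2 ∈ regular →
        opS (fun Q => omega α g (Fin.cons Q P : Fin (n + 1) → Curve)) Q +
          opO α R (fun Q => omega α g (Fin.cons Q P : Fin (n + 1) → Curve)) Q +
          ellPrime α g Q P = 0) ∧
      (∀ i : Fin 6, AnalyticOnNhd ℂ (fun z => ellPrime α g (i, z) P) {0}ᶜ) ∧
      (∀ i : Fin 6, ∃ F : ℂ → ℂ, AnalyticOnNhd ℂ F {0}ᶜ ∧
        (∀ z ∈ regular,
          opS (fun Q => omega α g (Fin.cons Q P : Fin (n + 1) → Curve)) (i, z) = F z) ∧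
        F 1 = 0 ∧ F (-1) = 0)) := by
  refine ⟨fun n c p => ⟨fun k => by
    simpa only [Fintype.card_fin] using exists_isTopExpansion α c p k, fun g =>
    summable_wCoeff hα hα2 g c p⟩, fun g m n b a c h => ?_, fun g n c h => ?_,
    fun g n Q P h0 h1 hQ hP => opS_omega_add_ell hα hα2 g Q P h0 h1 hQ hP, fun g n P h hP =>
    ⟨fun R Q hR hQ => opS_omega_add_opO_omega_add_ellPrime hα hα2 h hP hR hQ,
      analyticOnNhd_ellPrime_left α g P, fun i => ⟨fun z => -ell α g (i, z) P,
        (analyticOnNhd_ell_left α g P i).neg, fun z hz => ?_, ?_, ?_⟩⟩⟩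
  · obtain ⟨f, hf⟩ := exists_isContinuation hα hα2 g b a c
      (by simpa only [Fintype.card_fin] using h)
    exact isContinuation_mixed hf
  · obtain ⟨f, hf⟩ := exists_isContinuation hα hα2 g (κ := Empty) Empty.elim Empty.elim c
      (by simpa only [Fintype.card_fin, Fintype.card_empty, true_and] using h)
    exact isContinuation_mixed hf
  · exact eq_neg_of_add_eq_zero_left
      (opS_omega_add_ell hα hα2 g (i, z) P (by omega) (by omega) hz hP)
  · exact neg_eq_zero.2 (ell_eq_zero α g P i (one_pow 2))
  · exact neg_eq_zero.2 (ell_eq_zero α g P i (by norm_num))
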